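/- Identify Pauli operators on $n$ qubits, up to phase, with vectors over $\mathbb F_4$ via $X^{\mathbf v}Z^{\mathbf u}\mapsto\mathbf u+\omega\mathbf v$. A $[[n,k]]$ stabilizer code is given by a parity check matrix $H$ whose $n-k$ rows (the stabilizer generators) are linearly independent over $\mathbb F_2$ and pairwise commuting; its distance $d$ is the least weight of a Pauli operator that commutes with all generators and does not belong (up to phase) to the stabilizer. Let $H_4(x)=x\log_4 3-x\log_4x-(1-x)\log_4(1-x)$. **Proposition (punctured bipartition technique).** There is one deterministic algorithm (a random access machine program with logarithmic cost, whose input is $n$, $n-k$ and $H$) with the following properties for every $R\in(0,1)$, every sequence $k_n$ with $k_n/n\to R$, and every $\varepsilon>0$. Let $F_{Dq}(R,\delta)=\frac{2(1+R)}{3+R}H_4(\delta)$. 1. For a uniformly random $[[n,k_n]]$ stabilizer code, given by uniformly random generators, with distance $d=\delta n$ ($\delta$ depending on the code), the algorithm outputs $d$ at cost at most $2^{(F_{Dq}(R,\delta)+\varepsilon)n}$ with probability tending to $1$ as $n\to\infty$. 2. The same holds for random codes of any prescribed relative distance below the quantum Gilbert–Varshamov (GV) bound: if $0<\delta\le1$,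 $R<1-2H_4(\delta)$ and $d_n/n\to\delta$, then for a uniformly random $[[n,k_n]]$ stabilizer code of distance exactly $d_n$ the algorithm outputs $d_n$ at cost at most $2^{(F_{Dq}(R,\delta)+\varepsilon)n}$ with probability tending to $1$. 3. On the quantum GV bound, that is, for $0<\delta\le 1$ with $R=1-2H_4(\delta)$, the exponent becomes $F_{Dq}^*=\frac{1-R^2}{3+R}$: with probability tending to $1$, a uniformly random $[[n,k_n]]$ stabilizer code has $|d/n-\delta|\le\varepsilon$, and the algorithm outputs $d$ at cost at most $2^{(F_{Dq}^*+\varepsilon)n}$. -/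

import Mathlib

open Filter Topology

namespace QDist

/-! ## Stabilizer codes in the quaternary (symplectic) representation -/

/-- A Pauli operator on `n` qubits up to a phase. The entry `(u, v)` at a position stands for the
quaternary symbol `u + ω v`, that is, for the single-qubit operator `X ^ v Z ^ u`. -/
abbrev PauliVec (n : ℕ) : Type := Fin n → ZMod 2 × ZMod 2

/-- The trace inner product `e ∗ f`; two Pauli operators commute iff it vanishes. -/
def traceInner {n : ℕ} (e f : PauliVec n) : ZMod 2 :=
  ∑ i, ((e i).1 * (f i).2 + (e i).2 * (f i).1)

/-- `r` stabilizer generators on `n` qubits, written as the rows of a parity check matrix. -/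
abbrev CheckMatrix (r n : ℕ) : Type := Fin r → PauliVec n

/-- The parity check matrices of the `[[n, k]]` stabilizer codes: `n - k` independent, pairwise
commuting generators. Every code has the same number of such matrices, so a uniformly random
matrix of this set is a uniformly random code with a uniformly random choice of generators. -/
def stabilizerCodes (n k : ℕ) : Set (CheckMatrix (n - k) n) :=
  {H | LinearIndependent (ZMod 2) H ∧ ∀ i j, traceInner (H i) (H j) = 0}

/-- The code distance: the least weight (number of affected qubits) of an operator which commutes
with all stabilizer generators and is not in the stabilizer group. -/
noncomputable def distance {r n : ℕ} (H : CheckMatrix r n) : ℕ :=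
  sInf {w | ∃ e : PauliVec n, (∀ i, traceInner (H i) e = 0) ∧
    e ∉ Submodule.span (ZMod 2) (Set.range H) ∧ hammingNorm e = w}

/-! ## Random access machines with logarithmic cost -/

/-- Arithmetic operations of the machine (natural numbers; truncated subtraction; integer
division, with value `0` for division by `0`). -/
inductive Op
  | add | sub | mul | div

/-- The value of an arithmetic operation. -/
def Op.eval : Op → ℕ → ℕ → ℕ
  | .add, a, b => a + b
  | .sub, a, b => a - b
  | .mul, a, b => a * b
  | .div, a, b => a / b

/-- Structured programs of a random access machine with registers and an addressable memory. -/
inductive Prog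
  /-- no operation -/
  | skip
  /-- `reg[x] := c` -/
  | const (x c : ℕ)
  /-- `reg[x] := reg[a] o reg[b]` -/
  | arith (o : Op) (x a b : ℕ)
  /-- `reg[x] := mem[reg[a]]` -/
  | load (x a : ℕ)
  /-- `mem[reg[a]] := reg[b]` -/
  | store (a b : ℕ)
  /-- sequential composition -/
  | seq (p q : Prog)
  /-- if `reg[a] ≠ 0` then `p` else `q` -/
  | ite (a : ℕ) (p q : Prog)
  /-- while `reg[a] ≠ 0` do `p` -/
  | loop (a : ℕ) (p : Prog)

/-- The contents of the registers and of the memory. -/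
structure State where
  reg : ℕ → ℕ
  mem : ℕ → ℕ

/-- `Exec p s t s'`: started in state `s`, the program `p` halts in state `s'` at the total cost
`t`. Every instruction and every test costs `1` plus the bit lengths of the numbers (operands and
memory addresses) that it handles. -/
inductive Exec : Prog → State → ℕ → State → Prop
  | skip (s : State) : Exec .skip s 1 s
  | const (s : State) (x c : ℕ) :
      Exec (.const x c) s (1 + c.size) ⟨Function.update s.reg x c, s.mem⟩
  | arith (s : State) (o : Op) (x a b : ℕ) :
      Exec (.arith o x a b) s (1 + (s.reg a).size + (s.reg b).size)
        ⟨Function.update s.reg x (o.eval (s.reg a) (s.reg b)), s.mem⟩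
  | load (s : State) (x a : ℕ) :
      Exec (.load x a) s (1 + (s.reg a).size + (s.mem (s.reg a)).size)
        ⟨Function.update s.reg x (s.mem (s.reg a)), s.mem⟩
  | store (s : State) (a b : ℕ) :
      Exec (.store a b) s (1 + (s.reg a).size + (s.reg b).size)
        ⟨s.reg, Function.update s.mem (s.reg a) (s.reg b)⟩
  | seq {p q : Prog} {s s₁ s₂ : State} {t₁ t₂ : ℕ} :
      Exec p s t₁ s₁ → Exec q s₁ t₂ s₂ → Exec (.seq p q) s (t₁ + t₂) s₂
  | iteTrue {a : ℕ} {p q : Prog} {s s₁ : State} {t : ℕ} :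
      s.reg a ≠ 0 → Exec p s t s₁ → Exec (.ite a p q) s (1 + (s.reg a).size + t) s₁
  | iteFalse {a : ℕ} {p q : Prog} {s s₁ : State} {t : ℕ} :
      s.reg a = 0 → Exec q s t s₁ → Exec (.ite a p q) s (1 + (s.reg a).size + t) s₁
  | loopTrue {a : ℕ} {p : Prog} {s s₁ s₂ : State} {t₁ t₂ : ℕ} :
      s.reg a ≠ 0 → Exec p s t₁ s₁ → Exec (.loop a p) s₁ t₂ s₂ →
        Exec (.loop a p) s (1 + (s.reg a).size + t₁ + t₂) s₂
  | loopFalse {a : ℕ} {p : Prog} {s : State} :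
      s.reg a = 0 → Exec (.loop a p) s (1 + (s.reg a).size) s

/-- The initial state on input `H`: register `0` holds `n`, register `1` holds the number `r` of
rows, memory cell `i * n + j` holds the symbol of `H` in row `i` and column `j`, encoded as
`u + 2 v`, and everything else is `0`. -/
def initState {r n : ℕ} (H : CheckMatrix r n) : State where
  reg x := if x = 0 then n else if x = 1 then r else 0
  mem a := if h : a / n < r ∧ a % n < n then
      (H ⟨a / n, h.1⟩ ⟨a % n, h.2⟩).1.val + 2 * (H ⟨a / n, h.1⟩ ⟨a % n, h.2⟩).2.val
    else 0

/-- On input `H`, the program halts at a cost of at most `T` with the code distance in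
register `0`. -/
def FindsDistance (p : Prog) {r n : ℕ} (H : CheckMatrix r n) (T : ℝ) : Prop :=
  ∃ (t : ℕ) (s : State), Exec p (initState H) t s ∧ (t : ℝ) ≤ T ∧ s.reg 0 = distance H

/-! ## Entropy, exponents, probabilities -/

/-- The quaternary entropy `H₄(x) = x log₄ 3 - x log₄ x - (1 - x) log₄ (1 - x)`. -/
noncomputable def entropy4 (x : ℝ) : ℝ := Real.qaryEntropy 4 x / Real.log 4

/-- The binary complexity exponent `2 (1 + R) / (3 + R) · H₄(δ)`. -/
noncomputable def exponentD (R δ : ℝ) : ℝ := 2 * (1 + R) / (3 + R) * entropy4 δ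

/-- The probability that a uniformly random element of the finite set `E` has the property `A`. -/
noncomputable def prob {α : Type*} (E : Set α) (A : α → Prop) : ℝ :=
  ({x | x ∈ E ∧ A x}.ncard : ℝ) / (E.ncard : ℝ)

end QDist

/-!
The program tries the target distances `d = 1, 2, …` in turn. Fix `d`, let `r = n - k` and `w =
halfWindow n r ≈ (1 + R) / (3 + R) * n`, and consider the cyclic windows of `2 * w` positions, each
cut into two halves in all rotated ways. Averaging over the windows and a discrete intermediate
value argument show that every operator of weight at most `d` has weight at most `t = d * w / n +
1` on both halves for some choice (`exists_window`). In a round, the syndromes of the single-qubit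
operators outside the window are eliminated; the lists of all operators of weight at most `t` on
the two halves are matched by their reduced syndromes; and every match is completed by all
relations among the columns outside the window. This meet in the middle lists, each once, exactly
the operators that commute with all generators and have weight at most `t` on both halves
(`foldl_extV_matchV`, `round_spec`). Each candidate is tested for having weight at most `d` and
lying outside the stabilizer. Hence the program always outputs the distance, at a cost that is
polynomial in `n` times the length of the longest list (`exec_distP_distance`). To verify the
program, it is written in a small language with arrays that compiles to the machine, together with
a calculus of preconditions (`WP`) that keeps track of the number of instructions; all numbers have
`O(n)` bits.

The half-window lists have a length bounded by the volume of a ball, hence by `4 ^ (w * H₄(d / n))`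
up to subexponential factors, and this is the claimed exponent. It remains to bound the number of
candidates for most codes. The commuting independent generators are counted by adjoining them one
after the other (`ncard_good`). This shows that a fixed nonzero operator commutes with all
generators with probability about `2 ^ (-r)`, and also that this stays true for any other nonzero
operator under the condition that one given operator is logical (`Small.ncard_commutes_le`,
`ncard_good_span`). By Markov's inequality a round then has hardly ever more than about `|ball| ^ 2
* 4 ^ (n - 2 * w) / 2 ^ r` candidates (`ncard_many_cand_le`), where `|ball|` bounds the length of
the half-window lists. At the Gilbert-Varshamov distance the choice of `w` makes this equal to
`|ball|` up to subexponential factors, and below this distance there are even fewer candidates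
(`ncard_slow_le`).

A first moment bound (`ncard_distance_le`) and a second moment bound (`ncard_no_logical_le`) put
the distance of a random code at the Gilbert-Varshamov distance, which settles the codes on the
bound (`tendsto_prob_gv`) and, by continuity of the exponent, the codes in terms of their own
distance. Below the bound, codes of a prescribed distance are exponentially rare. But the expected
number of further logical operators of that weight, given one of them, is small as well, so that
counting pairs of a code and a logical operator of weight `d` loses at most a constant factor
(`ncard_distance_eq_le`). The bound on the candidates conditional on one logical operator therefore
carries over to these codes (`tendsto_prob_distance`).
-/

namespace QDist

/-! ### A small imperative language on top of the machine -/

/-- Execution with every instruction charged the same amount `1 + 2 * B`, which bounds its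
logarithmic cost as long as all numbers stay below `2 ^ B`. -/
def Go (B : ℕ) (p : Prog) (s : State) (n : ℕ) (s' : State) : Prop :=
  ∃ t, Exec p s t s' ∧ t ≤ n * (1 + 2 * B)

/-- All registers and memory cells hold numbers below `2 ^ B`. -/
def Bnd (B : ℕ) (s : State) : Prop := (∀ x, s.reg x < 2 ^ B) ∧ ∀ a, s.mem a < 2 ^ B

theorem Go.seq {B p q s n s₁ m s₂} (h₁ : Go B p s n s₁) (h₂ : Go B q s₁ m s₂) :
    Go B (.seq p q) s (n + m) s₂ := by
  obtain ⟨t₁, e₁, l₁⟩ := h₁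
  obtain ⟨t₂, e₂, l₂⟩ := h₂
  exact ⟨t₁ + t₂, .seq e₁ e₂, by rw [add_mul]; omega⟩

theorem Go.mono {B p s n m s'} (h : Go B p s n s') (hm : n ≤ m) : Go B p s m s' := by
  obtain ⟨t, e, l⟩ := h
  exact ⟨t, e, l.trans (Nat.mul_le_mul_right _ hm)⟩

theorem Go.const {B : ℕ} (s : State) (x c : ℕ) (hc : c < 2 ^ B) :
    Go B (.const x c) s 1 ⟨Function.update s.reg x c, s.mem⟩ :=
  ⟨_, .const s x c, by have := Nat.size_le.2 hc; omega⟩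

theorem Go.arith {B : ℕ} {s : State} (hs : Bnd B s) (o : Op) (x a b : ℕ) :
    Go B (.arith o x a b) s 1 ⟨Function.update s.reg x (o.eval (s.reg a) (s.reg b)), s.mem⟩ :=
  ⟨_, .arith s o x a b, by
    have := Nat.size_le.2 (hs.1 a)
    have := Nat.size_le.2 (hs.1 b)
    omega⟩

theorem Go.load {B : ℕ} {s : State} (hs : Bnd B s) (x a : ℕ) :
    Go B (.load x a) s 1 ⟨Function.update s.reg x (s.mem (s.reg a)), s.mem⟩ :=
  ⟨_, .load s x a, by
    have := Nat.size_le.2 (hs.1 a)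
    have := Nat.size_le.2 (hs.2 (s.reg a))
    omega⟩

theorem Go.store {B : ℕ} {s : State} (hs : Bnd B s) (a b : ℕ) :
    Go B (.store a b) s 1 ⟨s.reg, Function.update s.mem (s.reg a) (s.reg b)⟩ :=
  ⟨_, .store s a b, by
    have := Nat.size_le.2 (hs.1 a)
    have := Nat.size_le.2 (hs.1 b)
    omega⟩

theorem Bnd.reg {B : ℕ} {s : State} (hs : Bnd B s) (x : ℕ) {v : ℕ} (hv : v < 2 ^ B) :
    Bnd B ⟨Function.update s.reg x v, s.mem⟩ := by
  refine ⟨fun y => ?_, hs.2⟩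
  by_cases h : y = x
  · subst h; simpa
  · simpa [Function.update_of_ne h] using hs.1 y

theorem Bnd.mem {B : ℕ} {s : State} (hs : Bnd B s) (x : ℕ) {v : ℕ} (hv : v < 2 ^ B) :
    Bnd B ⟨s.reg, Function.update s.mem x v⟩ := by
  refine ⟨hs.1, fun y => ?_⟩
  by_cases h : y = x
  · subst h; simpa
  · simpa [Function.update_of_ne h] using hs.2 y

theorem ne_scratch {y k m : ℕ} (hy : y < 2 * k + 3 ∨ Even y) (hm : 2 * k + 3 ≤ m)
    (hodd : m % 2 = 1) : y ≠ m := by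
  rcases hy with hy | hy
  · omega
  · rw [Nat.even_iff] at hy
    omega

/-- Expressions over variables, growing arrays (addressed by a number), and the input. -/
inductive Expr
  /-- a variable -/
  | var (x : ℕ)
  /-- a literal -/
  | lit (c : ℕ)
  /-- an arithmetic operation -/
  | bin (o : Op) (a b : Expr)
  /-- the length of array number `a` -/
  | len (a : Expr)
  /-- entry `i` of array number `a`, with value `0` beyond its end -/
  | get (a i : Expr)
  /-- cell `a` of the input -/
  | inp (a : Expr)

instance : Add Expr := ⟨.bin .add⟩
instance : Sub Expr := ⟨.bin .sub⟩
instance : Mul Expr := ⟨.bin .mul⟩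
instance : Div Expr := ⟨.bin .div⟩
instance (n : ℕ) : OfNat Expr n := ⟨.lit n⟩

/-- The abstract state of a program: variables, arrays, and a clock that counts machine
instructions. -/
structure VState where
  var : ℕ → ℕ
  arr : ℕ → List ℕ
  clk : ℕ

/-- What stays fixed during a run: the bit length `B` that bounds all numbers, the bound `c ^ 2`
on the addresses of input cells, and the input. -/
structure Env where
  B : ℕ
  c : ℕ
  inp : ℕ → ℕ

/-- The memory address of cell `i` of array number `id`. Cell `0` holds the length. Since
`id ≤ id + i + c`, this is an injective pairing with values at least `c ^ 2`. -/
def addr (c id i : ℕ) : ℕ := (id + i + c) * (id + i + c) + id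

theorem addr_inj {c id i id' i' : ℕ} (h : addr c id i = addr c id' i') : id = id' ∧ i = i' := by
  unfold addr at h
  have key : id + i + c = id' + i' + c := by
    rcases lt_trichotomy (id + i + c) (id' + i' + c) with hl | hl | hl
    · nlinarith
    · exact hl
    · nlinarith
  rw [key] at h
  omega

theorem le_addr (c id i : ℕ) : c * c ≤ addr c id i := by
  unfold addr
  nlinarith

/-- The value of an expression. -/
def Expr.eval (E : Env) (h : VState) : Expr → ℕ
  | .var x => h.var x
  | .lit c => c
  | .bin o a b => o.eval (a.eval E h) (b.eval E h)
  | .len a => (h.arr (a.eval E h)).length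
  | .get a i => (h.arr (a.eval E h)).getD (i.eval E h) 0
  | .inp a => E.inp (a.eval E h)

/-- All numbers that occur in the evaluation of an expression are below `2 ^ B`. -/
def Expr.Bdd (E : Env) (h : VState) : Expr → Prop
  | .var _ => True
  | .lit c => c < 2 ^ E.B
  | .bin o a b => a.Bdd E h ∧ b.Bdd E h ∧ o.eval (a.eval E h) (b.eval E h) < 2 ^ E.B
  | .len a => a.Bdd E h ∧ addr E.c (a.eval E h) 0 < 2 ^ E.B
  | .get a i => a.Bdd E h ∧ i.Bdd E h ∧ addr E.c (a.eval E h) (i.eval E h + 1) < 2 ^ E.B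
  | .inp a => a.Bdd E h ∧ a.eval E h < E.c * E.c

/-- The number of machine instructions that evaluate an expression. -/
def Expr.ops : Expr → ℕ
  | .var _ => 2
  | .lit _ => 1
  | .bin _ a b => a.ops + b.ops + 1
  | .len a => a.ops + 4
  | .get a i => a.ops + i.ops + 7
  | .inp a => a.ops + 1

/-- Code that puts the value of an expression into register `2 * k + 3`. Variable `x` lives in
register `2 * x`, register `1` holds the number `c`, and the other odd registers from `2 * k + 3`
on are scratch space. -/
def Expr.compile : Expr → ℕ → Prog
  | .var x, k => .seq (.const (2 * k + 3) 0) (.arith .add (2 * k + 3) (2 * k + 3) (2 * x))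
  | .lit c, k => .const (2 * k + 3) c
  | .bin o a b, k => .seq (a.compile k) (.seq (b.compile (k + 1))
      (.arith o (2 * k + 3) (2 * k + 3) (2 * k + 5)))
  | .len a, k => .seq (a.compile k) (.seq (.arith .add (2 * k + 5) (2 * k + 3) 1)
      (.seq (.arith .mul (2 * k + 5) (2 * k + 5) (2 * k + 5))
      (.seq (.arith .add (2 * k + 5) (2 * k + 5) (2 * k + 3)) (.load (2 * k + 3) (2 * k + 5)))))
  | .get a i, k => .seq (a.compile k) (.seq (i.compile (k + 1))
      (.seq (.const (2 * k + 7) 1)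
      (.seq (.arith .add (2 * k + 5) (2 * k + 5) (2 * k + 7))
      (.seq (.arith .add (2 * k + 5) (2 * k + 3) (2 * k + 5))
      (.seq (.arith .add (2 * k + 5) (2 * k + 5) 1)
      (.seq (.arith .mul (2 * k + 5) (2 * k + 5) (2 * k + 5))
      (.seq (.arith .add (2 * k + 5) (2 * k + 5) (2 * k + 3))
        (.load (2 * k + 3) (2 * k + 5)))))))))
  | .inp a, k => .seq (a.compile k) (.load (2 * k + 3) (2 * k + 3))

/-- The machine state `s` represents the abstract state `h`. -/
structure Rep (E : Env) (h : VState) (s : State) : Prop where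
  var : ∀ x, s.reg (2 * x) = h.var x
  base : s.reg 1 = E.c
  bnd : Bnd E.B s
  inp : ∀ a < E.c * E.c, s.mem a = E.inp a
  len : ∀ id, s.mem (addr E.c id 0) = (h.arr id).length
  get : ∀ id i, s.mem (addr E.c id (i + 1)) = (h.arr id).getD i 0

theorem Rep.of_scratch {E : Env} {h : VState} {s s' : State} (hr : Rep E h s) (hb : Bnd E.B s')
    (hm : s'.mem = s.mem) {k : ℕ}
    (hk : ∀ x, x < 2 * k + 3 ∨ Even x → s'.reg x = s.reg x) : Rep E h s' where
  var x := by rw [hk _ (.inr (by simp)), hr.var]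
  base := by rw [hk _ (.inl (by omega)), hr.base]
  bnd := hb
  inp := by simpa [hm] using hr.inp
  len := by simpa [hm] using hr.len
  get := by simpa [hm] using hr.get

/-- Compiled expressions put the value into the target register, and touch only scratch
registers above it. -/
theorem compile_spec {E : Env} {h : VState} (e : Expr) : ∀ (k : ℕ) (s : State), Rep E h s →
    e.Bdd E h → ∃ s', Go E.B (e.compile k) s e.ops s' ∧ Bnd E.B s' ∧ s'.mem = s.mem ∧
      (∀ x, x < 2 * k + 3 ∨ Even x → s'.reg x = s.reg x) ∧ s'.reg (2 * k + 3) = e.eval E h := by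
  induction e with
  | var x =>
    intro k s hr _
    have hb := hr.bnd
    have b1 := hb.reg (2 * k + 3) (v := 0) (by positivity)
    refine ⟨_, (Go.const s _ 0 (by positivity)).seq (Go.arith b1 _ _ _ _), b1.reg _ ?_, rfl,
      ?_, ?_⟩
    · have : 2 * x ≠ 2 * k + 3 := by omega
      simpa [Op.eval, Function.update_of_ne this] using hb.1 _
    · intro y hy
      have : y ≠ 2 * k + 3 := ne_scratch hy (by omega) (by omega)
      simp [Function.update_of_ne this]
    · have : 2 * x ≠ 2 * k + 3 := by omega
      simp [Op.eval, Function.update_of_ne this, Expr.eval, hr.var]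
  | lit c =>
    intro k s hr hc
    refine ⟨_, Go.const s _ c hc, hr.bnd.reg _ hc, rfl, ?_, ?_⟩
    · intro y hy
      have : y ≠ 2 * k + 3 := ne_scratch hy (by omega) (by omega)
      simp [Function.update_of_ne this]
    · simp [Expr.eval]
  | bin o a b iha ihb =>
    intro k s hr hc
    obtain ⟨ha, hb, hv⟩ := hc
    obtain ⟨s₁, g₁, b₁, m₁, f₁, v₁⟩ := iha k s hr ha
    have r₁ := hr.of_scratch b₁ m₁ f₁
    obtain ⟨s₂, g₂, b₂, m₂, f₂, v₂⟩ := ihb (k + 1) s₁ r₁ hb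
    have v₂' : s₂.reg (2 * k + 5) = b.eval E h := v₂
    have v₁' : s₂.reg (2 * k + 3) = a.eval E h := by rw [f₂ _ (.inl (by omega)), v₁]
    refine ⟨_, (g₁.seq (g₂.seq (Go.arith b₂ o _ _ _))).mono (by simp only [Expr.ops]; omega),
      b₂.reg _ (by rw [v₁', v₂']; exact hv), by simp [m₁, m₂], ?_, ?_⟩
    · intro y hy
      have : y ≠ 2 * k + 3 := ne_scratch hy (by omega) (by omega)
      simp only [Function.update_of_ne this]
      rw [f₂ y (hy.imp_left (by omega)), f₁ y hy]
    · simp [Expr.eval, v₁', v₂']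
  | len a iha =>
    intro k s hr hc
    obtain ⟨ha, hv⟩ := hc
    obtain ⟨s₁, g₁, b₁, m₁, f₁, v₁⟩ := iha k s hr ha
    have r₁ := hr.of_scratch b₁ m₁ f₁
    unfold addr at hv
    simp only [add_zero] at hv
    have i1 : a.eval E h + E.c < 2 ^ E.B := by nlinarith
    have i2 : (a.eval E h + E.c) * (a.eval E h + E.c) < 2 ^ E.B := by omega
    have c2 := b₁.reg (2 * k + 5) (v := a.eval E h + E.c) i1
    have c3 := c2.reg (2 * k + 5) (v := (a.eval E h + E.c) * (a.eval E h + E.c)) i2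
    have c4 := c3.reg (2 * k + 5) (v := (a.eval E h + E.c) * (a.eval E h + E.c) + a.eval E h) hv
    have hG1 := Go.arith b₁ .add (2 * k + 5) (2 * k + 3) 1
    rw [v₁, r₁.base] at hG1
    have hG2 := Go.arith c2 .mul (2 * k + 5) (2 * k + 5) (2 * k + 5)
    have hG3 := Go.arith c3 .add (2 * k + 5) (2 * k + 5) (2 * k + 3)
    have hG4 := Go.load c4 (2 * k + 3) (2 * k + 5)
    have c5 := c4.reg (2 * k + 3)
      (b₁.2 ((a.eval E h + E.c) * (a.eval E h + E.c) + a.eval E h))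
    simp [Op.eval, v₁] at hG1 hG2 hG3 hG4 c5
    refine ⟨_, (g₁.seq (hG1.seq (hG2.seq (hG3.seq hG4)))).mono (by simp only [Expr.ops]; omega),
      c5, by simp [m₁], ?_, ?_⟩
    · intro y hy
      have h3 : y ≠ 2 * k + 3 := ne_scratch hy (by omega) (by omega)
      have h5 : y ≠ 2 * k + 5 := ne_scratch hy (by omega) (by omega)
      simp [Function.update_of_ne h3, Function.update_of_ne h5, f₁ y hy]
    · have := r₁.len (a.eval E h)
      simp only [addr, add_zero] at this
      simpa [Expr.eval] using this
  | get a i iha ihi =>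
    intro k s hr hc
    obtain ⟨ha, hi, hv⟩ := hc
    obtain ⟨s₁, g₁, b₁, m₁, f₁, v₁⟩ := iha k s hr ha
    have r₁ := hr.of_scratch b₁ m₁ f₁
    obtain ⟨s₂, g₂, b₂, m₂, f₂, v₂⟩ := ihi (k + 1) s₁ r₁ hi
    have r₂ := r₁.of_scratch b₂ m₂ f₂
    have v₂' : s₂.reg (2 * k + 5) = i.eval E h := v₂
    have v₁' : s₂.reg (2 * k + 3) = a.eval E h := by rw [f₂ _ (.inl (by omega)), v₁]
    have gl := r₂.get (a.eval E h) (i.eval E h)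
    have hba := r₂.base
    generalize hA : a.eval E h = A at *
    generalize hI : i.eval E h = I at *
    unfold addr at hv gl
    have i1 : A + (I + 1) + E.c < 2 ^ E.B := by nlinarith
    have i2 : (A + (I + 1) + E.c) * (A + (I + 1) + E.c) < 2 ^ E.B := by omega
    have c1 := b₂.reg (2 * k + 7) (v := 1) (by omega)
    have c2 := c1.reg (2 * k + 5) (v := I + 1) (by omega)
    have c3 := c2.reg (2 * k + 5) (v := A + (I + 1)) (by omega)
    have c4 := c3.reg (2 * k + 5) (v := A + (I + 1) + E.c) (by omega)
    have c5 := c4.reg (2 * k + 5) (v := (A + (I + 1) + E.c) * (A + (I + 1) + E.c)) (by omega)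
    have c6 := c5.reg (2 * k + 5) (v := (A + (I + 1) + E.c) * (A + (I + 1) + E.c) + A) (by omega)
    have hG0 := Go.const s₂ (2 * k + 7) 1 (B := E.B) (by omega)
    have hG1 := Go.arith c1 .add (2 * k + 5) (2 * k + 5) (2 * k + 7)
    have hG2 := Go.arith c2 .add (2 * k + 5) (2 * k + 3) (2 * k + 5)
    have hG3 := Go.arith c3 .add (2 * k + 5) (2 * k + 5) 1
    have hG4 := Go.arith c4 .mul (2 * k + 5) (2 * k + 5) (2 * k + 5)
    have hG5 := Go.arith c5 .add (2 * k + 5) (2 * k + 5) (2 * k + 3)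
    have hG6 := Go.load c6 (2 * k + 3) (2 * k + 5)
    have c7 := c6.reg (2 * k + 3)
      (b₂.2 ((A + (I + 1) + E.c) * (A + (I + 1) + E.c) + A))
    simp [Op.eval, v₁', v₂', hba, Function.update_of_ne] at hG1 hG2 hG3 hG4 hG5 hG6 c7
    refine ⟨_, (g₁.seq (g₂.seq (hG0.seq (hG1.seq (hG2.seq (hG3.seq (hG4.seq
      (hG5.seq hG6)))))))).mono (by simp only [Expr.ops]; omega),
      c7, by simp [m₁, m₂], ?_, ?_⟩
    · intro y hy
      have h3 : y ≠ 2 * k + 3 := ne_scratch hy (by omega) (by omega)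
      have h5 : y ≠ 2 * k + 5 := ne_scratch hy (by omega) (by omega)
      have h7 : y ≠ 2 * k + 7 := ne_scratch hy (by omega) (by omega)
      simp [Function.update_of_ne h3, Function.update_of_ne h5, Function.update_of_ne h7]
      rw [f₂ y (hy.imp_left (by omega)), f₁ y hy]
    · simpa [Expr.eval, hA, hI] using gl
  | inp a iha =>
    intro k s hr hc
    obtain ⟨ha, hv⟩ := hc
    obtain ⟨s₁, g₁, b₁, m₁, f₁, v₁⟩ := iha k s hr ha
    have r₁ := hr.of_scratch b₁ m₁ f₁
    refine ⟨_, g₁.seq (Go.load b₁ _ _), b₁.reg _ (b₁.2 _), by simp [m₁], ?_, ?_⟩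
    · intro y hy
      have h3 : y ≠ 2 * k + 3 := ne_scratch hy (by omega) (by omega)
      simp [Function.update_of_ne h3, f₁ y hy]
    · simp [Expr.eval, v₁, r₁.inp _ hv]

section

infixr:60 " ;; " => Prog.seq

/-! ### Rules for verifying programs -/

/-- `WP E p Q h`: from every machine state that represents `h`, the program `p` halts, within the
number of instructions by which the clock advances, in a state that represents some abstract state
with property `Q`. -/
def WP (E : Env) (p : Prog) (Q : VState → Prop) (h : VState) : Prop :=
  ∀ s, Rep E h s → ∃ n s' h', Go E.B p s n s' ∧ Rep E h' s' ∧ h.clk + n ≤ h'.clk ∧ Q h'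

/-- Let the clock advance by `k`. -/
def VState.tick (h : VState) (k : ℕ) : VState := ⟨h.var, h.arr, h.clk + k⟩

/-- Give the variable `x` the value `v`, and let the clock advance by `k`. -/
def VState.set (h : VState) (x v k : ℕ) : VState := ⟨Function.update h.var x v, h.arr, h.clk + k⟩

/-- Append `v` to array number `a`, and let the clock advance by `k`. -/
def VState.app (h : VState) (a v k : ℕ) : VState :=
  ⟨h.var, Function.update h.arr a (h.arr a ++ [v]), h.clk + k⟩

@[simp] theorem VState.tick_var (h : VState) (k : ℕ) : (h.tick k).var = h.var := rfl
@[simp] theorem VState.tick_arr (h : VState) (k : ℕ) : (h.tick k).arr = h.arr := rfl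
@[simp] theorem VState.tick_clk (h : VState) (k : ℕ) : (h.tick k).clk = h.clk + k := rfl
@[simp] theorem VState.set_var (h : VState) (x v k y : ℕ) :
    (h.set x v k).var y = if y = x then v else h.var y := by
  simp [VState.set, Function.update_apply]
@[simp] theorem VState.set_arr (h : VState) (x v k : ℕ) : (h.set x v k).arr = h.arr := rfl
@[simp] theorem VState.set_clk (h : VState) (x v k : ℕ) : (h.set x v k).clk = h.clk + k := rfl
@[simp] theorem VState.app_var (h : VState) (a v k : ℕ) : (h.app a v k).var = h.var := rfl
@[simp] theorem VState.app_arr (h : VState) (a v k : ℕ) :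
    (h.app a v k).arr = Function.update h.arr a (h.arr a ++ [v]) := rfl
@[simp] theorem VState.app_clk (h : VState) (a v k : ℕ) : (h.app a v k).clk = h.clk + k := rfl

section evalSimp
variable (E : Env) (h : VState) (a b : Expr) (x : ℕ)
@[simp] theorem eval_var : (Expr.var x).eval E h = h.var x := rfl
@[simp] theorem eval_ofNat (n : ℕ) : (no_index (OfNat.ofNat n) : Expr).eval E h = OfNat.ofNat n := rfl
@[simp] theorem eval_add : (a + b).eval E h = a.eval E h + b.eval E h := rfl
@[simp] theorem eval_sub : (a - b).eval E h = a.eval E h - b.eval E h := rfl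
@[simp] theorem eval_mul : (a * b).eval E h = a.eval E h * b.eval E h := rfl
@[simp] theorem eval_div : (a / b).eval E h = a.eval E h / b.eval E h := rfl
@[simp] theorem eval_len : (Expr.len a).eval E h = (h.arr (a.eval E h)).length := rfl
@[simp] theorem eval_get : (Expr.get a b).eval E h = (h.arr (a.eval E h)).getD (b.eval E h) 0 := rfl
@[simp] theorem eval_inp : (Expr.inp a).eval E h = E.inp (a.eval E h) := rfl
@[simp] theorem bdd_var : (Expr.var x).Bdd E h ↔ True := Iff.rfl
@[simp] theorem bdd_ofNat (n : ℕ) :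
    (no_index (OfNat.ofNat n) : Expr).Bdd E h ↔ (OfNat.ofNat n : ℕ) < 2 ^ E.B := Iff.rfl
@[simp] theorem bdd_add : (a + b).Bdd E h ↔
    a.Bdd E h ∧ b.Bdd E h ∧ a.eval E h + b.eval E h < 2 ^ E.B := Iff.rfl
@[simp] theorem bdd_sub : (a - b).Bdd E h ↔
    a.Bdd E h ∧ b.Bdd E h ∧ a.eval E h - b.eval E h < 2 ^ E.B := Iff.rfl
@[simp] theorem bdd_mul : (a * b).Bdd E h ↔
    a.Bdd E h ∧ b.Bdd E h ∧ a.eval E h * b.eval E h < 2 ^ E.B := Iff.rfl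
@[simp] theorem bdd_div : (a / b).Bdd E h ↔
    a.Bdd E h ∧ b.Bdd E h ∧ a.eval E h / b.eval E h < 2 ^ E.B := Iff.rfl
@[simp] theorem bdd_len : (Expr.len a).Bdd E h ↔
    a.Bdd E h ∧ addr E.c (a.eval E h) 0 < 2 ^ E.B := Iff.rfl
@[simp] theorem bdd_get : (Expr.get a b).Bdd E h ↔
    a.Bdd E h ∧ b.Bdd E h ∧ addr E.c (a.eval E h) (b.eval E h + 1) < 2 ^ E.B := Iff.rfl
@[simp] theorem bdd_inp : (Expr.inp a).Bdd E h ↔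
    a.Bdd E h ∧ a.eval E h < E.c * E.c := Iff.rfl
@[simp] theorem ops_var : (Expr.var x).ops = 2 := rfl
@[simp] theorem ops_ofNat (n : ℕ) : (no_index (OfNat.ofNat n) : Expr).ops = 1 := rfl
@[simp] theorem ops_add : (a + b).ops = a.ops + b.ops + 1 := rfl
@[simp] theorem ops_sub : (a - b).ops = a.ops + b.ops + 1 := rfl
@[simp] theorem ops_mul : (a * b).ops = a.ops + b.ops + 1 := rfl
@[simp] theorem ops_div : (a / b).ops = a.ops + b.ops + 1 := rfl
@[simp] theorem ops_len : (Expr.len a).ops = a.ops + 4 := rfl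
@[simp] theorem ops_get : (Expr.get a b).ops = a.ops + b.ops + 7 := rfl
@[simp] theorem ops_inp : (Expr.inp a).ops = a.ops + 1 := rfl
end evalSimp

variable {E : Env} {Q : VState → Prop} {h : VState}

theorem WP.mono {p : Prog} {Q' : VState → Prop} (hw : WP E p Q h) (hQ : ∀ h', Q h' → Q' h') :
    WP E p Q' h := by
  intro s hs
  obtain ⟨n, s', h', g, r, c, q⟩ := hw s hs
  exact ⟨n, s', h', g, r, c, hQ _ q⟩

theorem wp_seq {p q : Prog} (hw : WP E p (WP E q Q) h) : WP E (p ;; q) Q h := by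
  intro s hs
  obtain ⟨n, s', h', g, r, c, w⟩ := hw s hs
  obtain ⟨n', s'', h'', g', r', c', q'⟩ := w s' r
  exact ⟨n + n', s'', h'', g.seq g', r', by omega, q'⟩

/-- The assignment of the value of an expression to a variable. -/
def assign (x : ℕ) (e : Expr) : Prog :=
  e.compile 0 ;; .const (2 * x) 0 ;; .arith .add (2 * x) (2 * x) 3

theorem wp_assign {x : ℕ} {e : Expr} (hb : e.Bdd E h)
    (hQ : Q (h.set x (e.eval E h) (e.ops + 2))) : WP E (assign x e) Q h := by
  intro s hs
  obtain ⟨s₁, g₁, b₁, m₁, f₁, v₁⟩ := compile_spec e 0 s hs hb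
  have v₁' : s₁.reg 3 = e.eval E h := v₁
  have r₁ := hs.of_scratch b₁ m₁ f₁
  have b₂ := b₁.reg (2 * x) (v := 0) (by positivity)
  have b₃ := b₂.reg (2 * x) (v := e.eval E h) (by rw [← v₁']; exact b₁.1 3)
  have hG1 := Go.arith b₂ .add (2 * x) (2 * x) 3
  have hne : 3 ≠ 2 * x := by omega
  simp [Op.eval, Function.update_of_ne hne, v₁'] at hG1 b₃
  refine ⟨_, _, _, g₁.seq ((Go.const s₁ (2 * x) 0 (by positivity)).seq hG1), ?_, le_rfl, hQ⟩
  · refine ⟨fun y => ?_, ?_, b₃, r₁.inp, r₁.len, r₁.get⟩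
    · by_cases hy : y = x
      · subst hy; simp
      · have : 2 * y ≠ 2 * x := by omega
        simp [hy, r₁.var]
    · have : 1 ≠ 2 * x := by omega
      simp [Function.update_of_ne this, r₁.base]

/-- Append the value of `v` to array number `a`. -/
def push (a v : Expr) : Prog :=
  a.compile 0 ;; v.compile 1 ;; .arith .add 7 3 1 ;; .arith .mul 7 7 7 ;; .arith .add 7 7 3 ;;
  .load 9 7 ;; .const 11 1 ;; .arith .add 11 9 11 ;; .store 7 11 ;; .arith .add 7 3 11 ;;
  .arith .add 7 7 1 ;; .arith .mul 7 7 7 ;; .arith .add 7 7 3 ;; .store 7 5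

theorem wp_push {a v : Expr} (ha : a.Bdd E h) (hv : v.Bdd E h)
    (hl : addr E.c (a.eval E h) ((h.arr (a.eval E h)).length + 1) < 2 ^ E.B)
    (hQ : Q (h.app (a.eval E h) (v.eval E h) (a.ops + v.ops + 12))) : WP E (push a v) Q h := by
  intro s hs
  obtain ⟨s₁, g₁, b₁, m₁, f₁, v₁⟩ := compile_spec a 0 s hs ha
  have r₁ := hs.of_scratch b₁ m₁ f₁
  obtain ⟨s₂, g₂, b₂, m₂, f₂, v₂⟩ := compile_spec v 1 s₁ r₁ hv
  have r₂ := r₁.of_scratch b₂ m₂ f₂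
  have v₂' : s₂.reg 5 = v.eval E h := v₂
  have v₁' : s₂.reg 3 = a.eval E h := by rw [f₂ _ (.inl (by omega))]; exact v₁
  have hbv : v.eval E h < 2 ^ E.B := by rw [← v₂']; exact b₂.1 5
  have hba := r₂.base
  have hlen := r₂.len (a.eval E h)
  generalize hA : a.eval E h = A at *
  generalize hV : v.eval E h = V at *
  generalize hN : (h.arr A).length = N at *
  have hl' := hl
  unfold addr at hl hlen
  simp only [add_zero] at hlen
  have i1 : A + (N + 1) + E.c < 2 ^ E.B := by nlinarith
  have i2 : (A + (N + 1) + E.c) * (A + (N + 1) + E.c) < 2 ^ E.B := by omega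
  have i3 : (A + E.c) * (A + E.c) ≤ (A + (N + 1) + E.c) * (A + (N + 1) + E.c) :=
    Nat.mul_le_mul (by omega) (by omega)
  have c1 := b₂.reg 7 (v := A + E.c) (by omega)
  have c2 := c1.reg 7 (v := (A + E.c) * (A + E.c)) (by omega)
  have c3 := c2.reg 7 (v := (A + E.c) * (A + E.c) + A) (by omega)
  have c4 := c3.reg 9 (v := N) (by omega)
  have c5 := c4.reg 11 (v := 1) (by omega)
  have c6 := c5.reg 11 (v := N + 1) (by omega)
  have c7 := c6.mem ((A + E.c) * (A + E.c) + A) (v := N + 1) (by omega)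
  have c8 := c7.reg 7 (v := A + (N + 1)) (by omega)
  have c9 := c8.reg 7 (v := A + (N + 1) + E.c) (by omega)
  have c10 := c9.reg 7 (v := (A + (N + 1) + E.c) * (A + (N + 1) + E.c)) (by omega)
  have c11 := c10.reg 7 (v := (A + (N + 1) + E.c) * (A + (N + 1) + E.c) + A) (by omega)
  have c12 := c11.mem ((A + (N + 1) + E.c) * (A + (N + 1) + E.c) + A) (v := V) hbv
  have hG1 := Go.arith b₂ .add 7 3 1
  have hG2 := Go.arith c1 .mul 7 7 7
  have hG3 := Go.arith c2 .add 7 7 3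
  have hG4 := Go.load c3 9 7
  have hG5 := Go.const ⟨Function.update (Function.update s₂.reg 7 ((A + E.c) * (A + E.c) + A)) 9 N,
    s₂.mem⟩ 11 1 (B := E.B) (by omega)
  have hG6 := Go.arith c5 .add 11 9 11
  have hG7 := Go.store c6 7 11
  have hG8 := Go.arith c7 .add 7 3 11
  have hG9 := Go.arith c8 .add 7 7 1
  have hG10 := Go.arith c9 .mul 7 7 7
  have hG11 := Go.arith c10 .add 7 7 3
  have hG12 := Go.store c11 7 5
  simp [Op.eval, v₁', v₂', hba, hlen, Function.update_of_ne] at hG1 hG2 hG3 hG4 hG6 hG7 hG8 hG9 hG10 hG11 hG12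
  refine ⟨_, _, _, g₁.seq (g₂.seq (hG1.seq (hG2.seq (hG3.seq (hG4.seq (hG5.seq (hG6.seq (hG7.seq
    (hG8.seq (hG9.seq (hG10.seq (hG11.seq hG12)))))))))))), ?_, ?_, hQ⟩
  · clear hG1 hG2 hG3 hG4 hG5 hG6 hG7 hG8 hG9 hG10 hG11 hG12
    have e1 : (A + E.c) * (A + E.c) + A = addr E.c A 0 := by simp [addr]
    have e2 : (A + (N + 1) + E.c) * (A + (N + 1) + E.c) + A = addr E.c A (N + 1) := rfl
    simp only [e1, e2] at c12 ⊢
    refine ⟨fun y => ?_, ?_, ?_, ?_, ?_, ?_⟩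
    · have h7 : 2 * y ≠ 7 := by omega
      have h9 : 2 * y ≠ 9 := by omega
      have h11 : 2 * y ≠ 11 := by omega
      simp [h7, h9, h11, r₂.var]
    · simp [hba]
    · refine ⟨fun y => ?_, c12.2⟩
      have := c12.1 y
      simp only [Function.update_apply] at this ⊢
      split_ifs at * <;> assumption
    · intro y hy
      have n1 := le_addr E.c A 0
      have n2 := le_addr E.c A (N + 1)
      simp only [Function.update_apply]
      rw [if_neg (by omega), if_neg (by omega), r₂.inp _ hy]
    · intro id
      simp only [VState.app_arr, Function.update_apply]
      rw [if_neg (fun hh => by have := (addr_inj hh).2; omega)]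
      by_cases hid : id = A
      · subst hid; simp [hN]
      · rw [if_neg (fun hh => hid (addr_inj hh).1), if_neg hid, r₂.len]
    · intro id i
      simp only [VState.app_arr, Function.update_apply]
      by_cases hid : id = A
      · subst hid
        by_cases hi : i = N
        · subst hi; simp [hN, List.getD]
        · rw [if_neg (fun hh => hi (by have := (addr_inj hh).2; omega)),
            if_neg (fun hh => by have := (addr_inj hh).2; omega), r₂.get]
          simp only [if_true, List.getD]
          rcases lt_or_ge i N with hlt | hge
          · rw [List.getElem?_append_left (by omega)]
          · rw [List.getElem?_eq_none (by omega), List.getElem?_eq_none (by simp; omega)]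
      · rw [if_neg (fun hh => hid (addr_inj hh).1), if_neg (fun hh => hid (addr_inj hh).1),
          if_neg hid, r₂.get]
  · simp; omega

theorem wp_ite {x : ℕ} {p q : Prog} (hp : h.var x ≠ 0 → WP E p Q (h.tick 1))
    (hq : h.var x = 0 → WP E q Q (h.tick 1)) : WP E (.ite (2 * x) p q) Q h := by
  intro s hs
  have hx := hs.var x
  have hr : Rep E (h.tick 1) s := ⟨hs.var, hs.base, hs.bnd, hs.inp, hs.len, hs.get⟩
  have hsz := Nat.size_le.2 (hs.bnd.1 (2 * x))
  by_cases h0 : h.var x = 0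
  · obtain ⟨n, s', h', ⟨t, e, l⟩, r, c, q⟩ := hq h0 s hr
    exact ⟨n + 1, s', h', ⟨_, .iteFalse (by rw [hx, h0]) e, by rw [add_mul]; omega⟩, r,
      by simp at c; omega, q⟩
  · obtain ⟨n, s', h', ⟨t, e, l⟩, r, c, q⟩ := hp h0 s hr
    exact ⟨n + 1, s', h', ⟨_, .iteTrue (by rw [hx]; exact h0) e, by rw [add_mul]; omega⟩, r,
      by simp at c; omega, q⟩

theorem wp_skip (hQ : Q (h.tick 1)) : WP E .skip Q h := by
  intro s hs
  exact ⟨1, s, h.tick 1, ⟨_, .skip s, by omega⟩,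
    ⟨hs.var, hs.base, hs.bnd, hs.inp, hs.len, hs.get⟩, le_rfl, hQ⟩

/-- The rule for loops, with an invariant indexed by a decreasing measure. -/
theorem wp_while {x : ℕ} {p : Prog} (Inv : ℕ → VState → Prop)
    (step : ∀ m h, Inv m h → h.var x ≠ 0 → WP E p (fun h' => ∃ m' < m, Inv m' h') (h.tick 1))
    (exit : ∀ m h, Inv m h → h.var x = 0 → Q (h.tick 1)) :
    ∀ m h, Inv m h → WP E (.loop (2 * x) p) Q h := by
  intro m
  induction m using Nat.strong_induction_on with
  | _ m ih =>
  intro h hI s hs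
  have hx := hs.var x
  have hr : Rep E (h.tick 1) s := ⟨hs.var, hs.base, hs.bnd, hs.inp, hs.len, hs.get⟩
  have hsz := Nat.size_le.2 (hs.bnd.1 (2 * x))
  by_cases h0 : h.var x = 0
  · exact ⟨1, s, _, ⟨_, .loopFalse (by rw [hx, h0]), by omega⟩, hr, le_rfl, exit m h hI h0⟩
  · obtain ⟨n, s', h', ⟨t, e, l⟩, r, c, m', hm', hI'⟩ := step m h hI h0 s hr
    obtain ⟨n', s'', h'', ⟨t', e', l'⟩, r', c', q⟩ := ih m' hm' h' hI' s' r
    simp only [VState.tick_clk] at c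
    refine ⟨n + n' + 1, s'', h'', ⟨_, .loopTrue (by rw [hx]; exact h0) e e', ?_⟩, r', by omega, q⟩
    rw [add_mul, add_mul]
    omega

/-- Repeat `p`, counting the variable `x` down to zero. -/
def forLoop (x : ℕ) (p : Prog) : Prog := .loop (2 * x) (p ;; assign x (.var x - 1))

/-- The rule for counting loops; `Inv i` holds after `i` rounds, with `k - i` left in `x`. -/
theorem wp_for {x : ℕ} {p : Prog} (Inv : ℕ → VState → Prop) (hB : 0 < E.B) {k : ℕ}
    (hk : h.var x = k) (h0 : Inv 0 h)
    (step : ∀ i < k, ∀ h, Inv i h → h.var x = k - i → h.var x < 2 ^ E.B →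
      WP E p (fun h' => h'.var x = k - i ∧ Inv (i + 1) (h'.set x (k - i - 1) 6)) (h.tick 1))
    (exit : ∀ h, Inv k h → h.var x = 0 → Q (h.tick 1)) : WP E (forLoop x p) Q h := by
  have hB1 : 1 < 2 ^ E.B := Nat.one_lt_two_pow (by omega)
  refine wp_while (fun m h => m ≤ k ∧ h.var x = m ∧ Inv (k - m) h) ?_ ?_ k h
    ⟨le_rfl, hk, by simpa using h0⟩
  · rintro m h ⟨hm, hx, hI⟩ hne
    intro s hs
    have hlt : h.var x < 2 ^ E.B := by
      have h1 := hs.bnd.1 (2 * x)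
      rw [hs.var x] at h1
      exact h1
    refine wp_seq ((step (k - m) (by omega) h hI (by omega) hlt).mono ?_) s hs
    rintro h' ⟨hx', hI'⟩
    refine wp_assign ?_ ⟨m - 1, by omega, by omega, ?_, ?_⟩
    · simp; omega
    · simp; omega
    · convert hI' using 1
      · omega
      · simp [hx']
  · rintro m h ⟨hm, hx, hI⟩ h0
    have : m = 0 := by omega
    subst this
    exact exit h (by simpa using hI) h0

end

section

variable {E : Env} {Q : VState → Prop} {h : VState}

/-! ### Programs for the elementary steps -/

theorem xor_eq_div_two (a b : ℕ) : a ^^^ b = (a + b) % 2 + 2 * ((a / 2) ^^^ (b / 2)) := by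
  have h1 := Nat.xor_mod_two_eq (m := a) (n := b)
  have h2 := Nat.xor_div_two (a := a) (b := b)
  omega

/-- Variable `42` receives the bitwise exclusive or of variables `40` and `41`. -/
def xorP : Prog :=
  assign 42 0 ;; assign 43 1 ;; assign 44 (.var 40 + .var 41) ;;
  .loop (2 * 44)
    (assign 42 (.var 42 + .var 43 * (.var 44 - .var 44 / 2 * 2)) ;;
     assign 40 (.var 40 / 2) ;; assign 41 (.var 41 / 2) ;; assign 43 (.var 43 * 2) ;;
     assign 44 (.var 40 + .var 41))

theorem wp_xor {M : ℕ} (hM : M + 2 ≤ E.B) (ha : h.var 40 < 2 ^ M) (hb : h.var 41 < 2 ^ M)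
    (hQ : ∀ h' : VState, h'.arr = h.arr → (∀ y < 40, h'.var y = h.var y) →
      h'.var 42 = h.var 40 ^^^ h.var 41 → h'.clk ≤ h.clk + 60 * (M + 1) → Q h') :
    WP E xorP Q h := by
  have hB : 4 * 2 ^ M ≤ 2 ^ E.B :=
    calc 4 * 2 ^ M = 2 ^ (M + 2) := by ring
      _ ≤ _ := Nat.pow_le_pow_right (by omega) hM
  have hp : 0 < 2 ^ M := by positivity
  unfold xorP
  refine wp_seq (wp_assign (by simp) (wp_seq (wp_assign (by simp; omega) (wp_seq
    (wp_assign (by simp; omega) ?_)))))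
  refine wp_while (fun m h' => h'.arr = h.arr ∧ (∀ y < 40, h'.var y = h.var y) ∧
    h'.var 40 < 2 ^ m ∧ h'.var 41 < 2 ^ m ∧ h'.var 44 = h'.var 40 + h'.var 41 ∧
    h'.var 42 + h'.var 43 * (h'.var 40 ^^^ h'.var 41) = h.var 40 ^^^ h.var 41 ∧
    h'.var 43 * 2 ^ m = 2 ^ M ∧ h'.var 42 < h'.var 43 ∧
    h'.clk + 50 * m ≤ h.clk + 50 * M + 20) ?_ ?_ M _ ?_
  · rintro m g ⟨e1, e2, e3, e4, e5, e6, e7, e8, e9⟩ hne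
    obtain ⟨m, rfl⟩ : ∃ k, m = k + 1 := by
      rcases m with _ | k
      · simp at e3 e4; omega
      · exact ⟨k, rfl⟩
    rw [pow_succ] at e3 e4
    have p1 : g.var 43 ≤ 2 ^ M := by rw [← e7]; exact Nat.le_mul_of_pos_right _ (by positivity)
    have p2 : g.var 43 * 2 ≤ 2 ^ M := by
      rw [← e7, pow_succ, mul_comm (2 ^ m) 2, ← mul_assoc]
      exact Nat.le_mul_of_pos_right _ (by positivity)
    have hm2 : 2 ^ m ≤ 2 ^ M := by
      rw [← e7, pow_succ]; nlinarith [Nat.one_le_two_pow (n := m)]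
    have hmod : g.var 44 - g.var 44 / 2 * 2 = g.var 44 % 2 := by omega
    have hbit : g.var 43 * (g.var 44 % 2) ≤ g.var 43 := by
      have := Nat.mod_lt (g.var 44) (y := 2) (by omega)
      calc _ ≤ g.var 43 * 1 := Nat.mul_le_mul_left _ (by omega)
        _ = _ := mul_one _
    refine wp_seq (wp_assign (by simp [hmod]; omega) (wp_seq (wp_assign (by simp; omega)
      (wp_seq (wp_assign (by simp; omega) (wp_seq (wp_assign (by simp; omega)
      (wp_assign (by simp; omega) ⟨m, by omega, ?_⟩))))))))
    simp [hmod]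
    refine ⟨e1, ?_, by omega, by omega, ?_, ?_, by omega, by omega⟩
    · intro y hy
      rw [if_neg (by omega), if_neg (by omega), if_neg (by omega), if_neg (by omega),
        if_neg (by omega), e2 y hy]
    · rw [← e6, xor_eq_div_two (g.var 40), e5]; ring
    · rw [← e7]; ring
  · rintro m g ⟨e1, e2, e3, e4, e5, e6, e7, e8, e9⟩ h0
    refine hQ _ e1 e2 ?_ ?_
    · have h1 : g.var 40 = 0 := by omega
      have h2 : g.var 41 = 0 := by omega
      simpa [h1, h2] using e6
    · simp; omega
  · simp
    refine ⟨fun y hy => ?_, ha, hb, by omega⟩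
    rw [if_neg (by omega), if_neg (by omega), if_neg (by omega)]

/-- The number of non-zero digits in base four. -/
def wt4 (x : ℕ) : ℕ := if h : x = 0 then 0 else (if x % 4 = 0 then 0 else 1) + wt4 (x / 4)
decreasing_by omega

theorem wt4_zero : wt4 0 = 0 := by rw [wt4]; simp

theorem wt4_eq (x : ℕ) : wt4 x = (if x % 4 = 0 then 0 else 1) + wt4 (x / 4) := by
  by_cases h : x = 0
  · subst h; simp [wt4_zero]
  · rw [wt4, dif_neg h]

/-- Variable `51` receives the number of non-zero base four digits of variable `50`. -/
def wtP : Prog :=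
  assign 51 0 ;; .loop (2 * 50)
    (assign 51 (.var 51 + (1 - (1 - (.var 50 - .var 50 / 4 * 4)))) ;; assign 50 (.var 50 / 4))

theorem wp_wt {M : ℕ} (hM : M + 2 ≤ E.B) (hx : h.var 50 < 2 ^ M)
    (hQ : ∀ h' : VState, h'.arr = h.arr → (∀ y < 50, h'.var y = h.var y) →
      h'.var 51 = wt4 (h.var 50) → h'.clk ≤ h.clk + 60 * (M + 1) → Q h') :
    WP E wtP Q h := by
  have hB : 4 * 2 ^ M ≤ 2 ^ E.B :=
    calc 4 * 2 ^ M = 2 ^ (M + 2) := by ring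
      _ ≤ _ := Nat.pow_le_pow_right (by omega) hM
  have hp : M < 2 ^ M := Nat.lt_two_pow_self
  unfold wtP
  refine wp_seq (wp_assign (by simp) ?_)
  refine wp_while (fun m h' => h'.arr = h.arr ∧ (∀ y < 50, h'.var y = h.var y) ∧
    h'.var 50 < 2 ^ m ∧ h'.var 51 + m ≤ M ∧
    h'.var 51 + wt4 (h'.var 50) = wt4 (h.var 50) ∧
    h'.clk + 50 * m ≤ h.clk + 50 * M + 20) ?_ ?_ M _ ?_
  · rintro m g ⟨e1, e2, e3, e4, e5, e6⟩ hne
    obtain ⟨m, rfl⟩ : ∃ k, m = k + 1 := by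
      rcases m with _ | k
      · simp at e3; omega
      · exact ⟨k, rfl⟩
    rw [pow_succ] at e3
    have hm2 : 2 ^ (m + 1) ≤ 2 ^ M := Nat.pow_le_pow_right (by omega) (by omega)
    rw [pow_succ] at hm2
    have hmod : 1 - (1 - (g.var 50 - g.var 50 / 4 * 4)) = if g.var 50 % 4 = 0 then 0 else 1 := by
      split_ifs <;> omega
    have hmod' : (if g.var 50 % 4 = 0 then 0 else 1) ≤ 1 := by split_ifs <;> omega
    refine wp_seq (wp_assign ?_ (wp_assign (by simp; omega) ⟨m, by omega, ?_⟩))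
    · simp [-tsub_le_iff_right]; omega
    simp [hmod]
    refine ⟨e1, ?_, by omega, by omega, ?_, by omega⟩
    · intro y hy
      rw [if_neg (by omega), if_neg (by omega), e2 y hy]
    · rw [← e5, wt4_eq (g.var 50)]; ring
  · rintro m g ⟨e1, e2, e3, e4, e5, e6⟩ h0
    refine hQ _ e1 e2 ?_ ?_
    · simpa [h0, wt4_zero] using e5
    · simp; omega
  · simp
    exact ⟨fun y hy h => by omega, hx, by omega⟩

theorem addr_lt {K B c id i : ℕ} (hK : 2 * K + 6 ≤ B) (hc : c < 2 ^ K) (hid : id < 2 ^ K)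
    (hi : i ≤ 2 ^ K) : addr c id i < 2 ^ B := by
  have h1 : 2 ^ (2 * K + 6) ≤ 2 ^ B := Nat.pow_le_pow_right (by omega) hK
  have h2 : 2 ^ (2 * K + 6) = 64 * (2 ^ K * 2 ^ K) := by ring
  unfold addr
  have h3 : (id + i + c) * (id + i + c) ≤ (3 * 2 ^ K) * (3 * 2 ^ K) :=
    Nat.mul_le_mul (by omega) (by omega)
  nlinarith

/-- Reduction of `x` modulo the numbers `bs`, in this order: each of them is added (without
carries) whenever this makes the number smaller. -/
def redN (bs : List ℕ) (x : ℕ) : ℕ := bs.foldl (fun x b => if x ^^^ b < x then x ^^^ b else x) x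

/-- Variable `30` is reduced modulo the array with the number in variable `31`. -/
def redP : Prog :=
  assign 32 (.len (.var 31)) ;; assign 33 0 ;;
  forLoop 32 (assign 40 (.var 30) ;; assign 41 (.get (.var 31) (.var 33)) ;; xorP ;;
    assign 34 (.var 30 - .var 42) ;; .ite (2 * 34) (assign 30 (.var 42)) .skip ;;
    assign 33 (.var 33 + 1))

theorem redN_take_succ (bs : List ℕ) (x i : ℕ) (hi : i < bs.length) :
    redN (bs.take (i + 1)) x =
      if redN (bs.take i) x ^^^ bs.getD i 0 < redN (bs.take i) x
        then redN (bs.take i) x ^^^ bs.getD i 0 else redN (bs.take i) x := by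
  unfold redN
  rw [List.take_add_one, List.foldl_append]
  simp [List.getD, List.getElem?_eq_getElem hi]

theorem redN_le (bs : List ℕ) (x : ℕ) : redN bs x ≤ x := by
  unfold redN
  induction bs generalizing x with
  | nil => simp
  | cons b bs ih =>
    rw [List.foldl_cons]
    refine (ih _).trans ?_
    split_ifs <;> omega

theorem wp_red {K M L : ℕ} (hK : 2 * K + 6 ≤ E.B) (hc : E.c < 2 ^ K) (hMK : M ≤ K) {x id : ℕ}
    (h30 : h.var 30 = x) (h31 : h.var 31 = id)
    (hx : x < 2 ^ M) (hid : id < 2 ^ K) (hbs : ∀ b ∈ h.arr id, b < 2 ^ M)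
    (hL : (h.arr id).length ≤ L) (hLK : L < 2 ^ K)
    (hQ : ∀ h' : VState, h'.arr = h.arr → (∀ y < 30, h'.var y = h.var y) →
      h'.var 30 = redN (h.arr id) x →
      h'.clk ≤ h.clk + (150 * (M + 1)) * (L + 1) → Q h') :
    WP E redP Q h := by
  have hB : 64 * 2 ^ K ≤ 2 ^ E.B :=
    calc 64 * 2 ^ K = 2 ^ (K + 6) := by ring
      _ ≤ _ := Nat.pow_le_pow_right (by omega) (by omega)
  have hMK' : 2 ^ M ≤ 2 ^ K := Nat.pow_le_pow_right (by omega) hMK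
  have hp : 0 < 2 ^ K := by positivity
  unfold redP
  refine wp_seq (wp_assign (by simpa [h31] using addr_lt hK hc hid (by omega)) (wp_seq
    (wp_assign (by simp) ?_)))
  refine wp_for (fun i h' => h'.arr = h.arr ∧ (∀ y < 30, h'.var y = h.var y) ∧
    h'.var 30 = redN ((h.arr id).take i) x ∧ h'.var 31 = id ∧ h'.var 33 = i ∧
    h'.clk ≤ h.clk + 20 + (60 * (M + 1) + 50) * i) (by omega)
    (k := (h.arr id).length) (by simp [h31]) ?_ ?_ ?_
  · simp [redN, h30, h31]
    intro y hy
    rw [if_neg (by omega), if_neg (by omega)]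
  · rintro i hi g ⟨e1, e2, e3, e4, e5, e6⟩ hx' -
    have hg30 : g.var 30 < 2 ^ M := by
      rw [e3]; exact (redN_le _ _).trans_lt hx
    have hgb : (h.arr id).getD i 0 < 2 ^ M := by
      simp only [List.getD, List.getElem?_eq_getElem hi, Option.getD_some]
      exact hbs _ (List.getElem_mem _)
    refine wp_seq (wp_assign (by simp) (wp_seq (wp_assign ?_ (wp_seq (wp_xor (M := M) (by omega)
      (by simpa using hg30) (by simpa [e1, e4, e5] using hgb) ?_)))))
    · simpa [e4, e5] using addr_lt hK hc hid (by omega)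
    intro g' a1 a2 a3 a4
    simp only [VState.set_clk, VState.tick_clk, VState.set_arr, VState.tick_arr] at a1 a4
    simp [e1, e4, e5] at a3
    simp at a4
    have b30 : g'.var 30 = g.var 30 := by rw [a2 _ (by omega)]; simp
    have b31 : g'.var 31 = id := by rw [a2 _ (by omega)]; simpa using e4
    have b32 : g'.var 32 = (h.arr id).length - i := by rw [a2 _ (by omega)]; simpa using hx'
    have b33 : g'.var 33 = i := by rw [a2 _ (by omega)]; simpa using e5
    have blow : ∀ y < 30, g'.var y = h.var y := by
      intro y hy
      rw [a2 _ (by omega)]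
      simp only [VState.set_var, VState.tick_var]
      rw [if_neg (by omega), if_neg (by omega), e2 y hy]
    have hred := redN_take_succ (h.arr id) x i hi
    rw [← e3] at hred
    refine wp_seq (wp_assign (by simp; omega) (wp_seq (wp_ite ?_ ?_)))
    · intro hne
      simp [a3, b30] at hne
      refine wp_assign (by simp) (wp_assign (by simp [b33]; omega) ?_)
      simp [a1, e1, b31, b32, b33]
      refine ⟨?_, ?_, by rw [mul_add]; omega⟩
      · intro y hy
        rw [if_neg (by omega), if_neg (by omega), if_neg (by omega), if_neg (by omega), blow y hy]
      · rw [a3, hred, if_pos (by simp; omega)]; simp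
    · intro hne
      simp [a3, b30] at hne
      refine wp_skip (wp_assign (by simp [b33]; omega) ?_)
      simp [a1, e1, b31, b32, b33]
      refine ⟨?_, ?_, by rw [mul_add]; omega⟩
      · intro y hy
        rw [if_neg (by omega), if_neg (by omega), if_neg (by omega), blow y hy]
      · rw [b30, hred, if_neg (by simp; omega)]
  · rintro g ⟨e1, e2, e3, e4, e5, e6⟩ -
    refine hQ _ e1 e2 (by simpa using e3) ?_
    simp only [VState.tick_clk]
    nlinarith [Nat.mul_le_mul_left (60 * (M + 1) + 50) hL]

end

section

variable {E : Env} {Q : VState → Prop} {h : VState}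

/-! ### Lists of vectors of small weight, and bases -/

/-- The list `A` followed by the sums (without carries) of its members with `v`, as far as their
residue modulo `P` has at most `W` non-zero digits in base four. -/
def extN (P W : ℕ) (A : List ℕ) (v : ℕ) : List ℕ :=
  A ++ (A.map (· ^^^ v)).filter fun y => decide (wt4 (y % P) ≤ W)

/-- The array with the number in variable `20` is extended, see `extN`; variables `8`, `22` and
`21` hold the modulus, the bound and the vector. -/
def extP : Prog :=
  assign 23 (.len (.var 20)) ;; assign 24 0 ;;
  forLoop 23 (assign 40 (.get (.var 20) (.var 24)) ;; assign 41 (.var 21) ;; xorP ;;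
    assign 25 (.var 42) ;; assign 50 (.var 25 - .var 25 / .var 8 * .var 8) ;; wtP ;;
    assign 26 (.var 51 - .var 22) ;; .ite (2 * 26) .skip (push (.var 20) (.var 25)) ;;
    assign 24 (.var 24 + 1))

theorem wt4_le_self (x : ℕ) : wt4 x ≤ x := by
  induction x using Nat.strong_induction_on with
  | _ x ih =>
  rw [wt4_eq]
  by_cases h : x = 0
  · subst h; simp [wt4_zero]
  · have := ih (x / 4) (by omega)
    split_ifs <;> omega

theorem getD_append_of_lt {A B : List ℕ} {i : ℕ} (hi : i < A.length) :
    (A ++ B).getD i 0 = A.getD i 0 := by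
  simp [List.getD, List.getElem?_append_left hi]

theorem getD_mem {A : List ℕ} {i : ℕ} (hi : i < A.length) : A.getD i 0 ∈ A := by
  simp [List.getD, List.getElem?_eq_getElem hi]

theorem extN_take_succ (P W v : ℕ) (A : List ℕ) (i : ℕ) (hi : i < A.length) :
    ((A.take (i + 1)).map (· ^^^ v)).filter (fun y => decide (wt4 (y % P) ≤ W)) =
      ((A.take i).map (· ^^^ v)).filter (fun y => decide (wt4 (y % P) ≤ W)) ++
        if wt4 ((A.getD i 0 ^^^ v) % P) ≤ W then [A.getD i 0 ^^^ v] else [] := by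
  rw [List.take_add_one, List.map_append, List.filter_append]
  simp only [List.getD, List.getElem?_eq_getElem hi, Option.toList_some, List.map_cons,
    List.map_nil, Option.getD_some]
  split_ifs with hw <;> simp [hw]

theorem wp_ext {K M : ℕ} (hK : 2 * K + 6 ≤ E.B) (hc : E.c < 2 ^ K) (hMK : M ≤ K)
    {id v P W : ℕ} {A : List ℕ} (h20 : h.var 20 = id) (h21 : h.var 21 = v) (h22 : h.var 22 = W)
    (h8 : h.var 8 = P) (hA : h.arr id = A)
    (hv : v < 2 ^ M) (hid : id < 2 ^ K) (hAM : ∀ b ∈ A, b < 2 ^ M)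
    (hL : 2 * A.length < 2 ^ K)
    (hQ : ∀ h' : VState, h'.arr = Function.update h.arr id (extN P W A v) →
      (∀ y < 23, h'.var y = h.var y) →
      h'.clk ≤ h.clk + (300 * (M + 1)) * (A.length + 1) → Q h') :
    WP E extP Q h := by
  have hB : 64 * 2 ^ K ≤ 2 ^ E.B :=
    calc 64 * 2 ^ K = 2 ^ (K + 6) := by ring
      _ ≤ _ := Nat.pow_le_pow_right (by omega) (by omega)
  have hMK' : 2 ^ M ≤ 2 ^ K := Nat.pow_le_pow_right (by omega) hMK
  have hp : 0 < 2 ^ K := by positivity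
  unfold extP
  refine wp_seq (wp_assign (by simpa [h20] using addr_lt hK hc hid (by omega)) (wp_seq
    (wp_assign (by simp) ?_)))
  refine wp_for (fun i h' => h'.arr = Function.update h.arr id (A ++
      ((A.take i).map (· ^^^ v)).filter (fun y => decide (wt4 (y % P) ≤ W))) ∧
    (∀ y < 23, h'.var y = h.var y) ∧ h'.var 24 = i ∧
    h'.clk ≤ h.clk + 20 + (120 * (M + 1) + 120) * i) (by omega)
    (k := A.length) (by simp [h20, hA]) ?_ ?_ ?_
  · simp [← hA]
    intro y hy
    rw [if_neg (by omega), if_neg (by omega)]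
  · rintro i hi g ⟨e1, e2, e5, e6⟩ hx' -
    have g20 : g.var 20 = id := by rw [e2 _ (by omega), h20]
    have g21 : g.var 21 = v := by rw [e2 _ (by omega), h21]
    set y := A.getD i 0 with hy
    have hylt : y < 2 ^ M := hAM _ (getD_mem hi)
    have hz : y ^^^ v < 2 ^ M := Nat.xor_lt_two_pow hylt hv
    have hget : (g.arr id).getD i 0 = y := by
      rw [e1]; simp only [Function.update_self]; rw [getD_append_of_lt hi]
    have hlen : (g.arr id).length < 2 ^ K := by
      rw [e1]; simp only [Function.update_self]
      have := List.length_filter_le (fun y => decide (wt4 (y % P) ≤ W))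
        ((A.take i).map (· ^^^ v))
      simp only [List.length_append, List.length_map, List.length_take] at this ⊢
      omega
    refine wp_seq (wp_assign ?_ (wp_seq (wp_assign (by simp) (wp_seq (wp_xor (M := M) (by omega)
      (by simp [g20, e5]; simpa using hget.trans_lt hylt) (by simpa [g21] using hv) ?_)))))
    · simpa [g20, e5] using addr_lt hK hc hid (by omega)
    intro g' a1 a2 a3 a4
    simp only [VState.set_clk, VState.tick_clk, VState.set_arr, VState.tick_arr] at a1 a4
    simp [g20, g21, e5, -List.getD_eq_getElem?_getD] at a3
    rw [hget] at a3
    simp at a4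
    have b23 : g'.var 23 = A.length - i := by rw [a2 _ (by omega)]; simpa using hx'
    have b24 : g'.var 24 = i := by rw [a2 _ (by omega)]; simpa using e5
    have blow : ∀ y < 23, g'.var y = h.var y := by
      intro y hy
      rw [a2 _ (by omega)]
      simp only [VState.set_var, VState.tick_var]
      rw [if_neg (by omega), if_neg (by omega), e2 y hy]
    have b8 : g'.var 8 = P := by rw [blow _ (by omega), h8]
    have hmod : (y ^^^ v) - (y ^^^ v) / P * P = (y ^^^ v) % P := by
      rw [Nat.mod_eq_sub_div_mul]
    have hmodle : (y ^^^ v) % P ≤ y ^^^ v := Nat.mod_le _ _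
    have hdivle : (y ^^^ v) / P ≤ y ^^^ v := Nat.div_le_self _ _
    have hdm : (y ^^^ v) / P * P ≤ y ^^^ v := Nat.div_mul_le_self _ _
    refine wp_seq (wp_assign (by simp) (wp_seq (wp_assign ?_ (wp_seq (wp_wt (M := M) (by omega)
      ?_ ?_)))))
    · simp [a3, b8, hmod, -tsub_le_iff_right]; omega
    · simp [a3, b8, hmod]; omega
    intro g'' c1 c2 c3 c4
    simp only [VState.set_clk, VState.set_arr] at c1 c4
    simp [a3, b8, hmod] at c3 c4
    have d23 : g''.var 23 = A.length - i := by rw [c2 _ (by omega)]; simpa using b23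
    have d24 : g''.var 24 = i := by rw [c2 _ (by omega)]; simpa using b24
    have d25 : g''.var 25 = y ^^^ v := by rw [c2 _ (by omega)]; simpa using a3
    have dlow : ∀ y < 23, g''.var y = h.var y := by
      intro y hy
      rw [c2 _ (by omega)]
      simp only [VState.set_var]
      rw [if_neg (by omega), if_neg (by omega), blow y hy]
    have d20 : g''.var 20 = id := by rw [dlow _ (by omega), h20]
    have d22 : g''.var 22 = W := by rw [dlow _ (by omega), h22]
    have hwle := wt4_le_self ((y ^^^ v) % P)
    refine wp_seq (wp_assign ?_ (wp_seq (wp_ite ?_ ?_)))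
    · simp [c3, d22, -tsub_le_iff_right]; omega
    · intro hne
      simp [c3, d22] at hne
      refine wp_skip (wp_assign (by simp [d24]; omega) ?_)
      simp [c1, a1, d23, d24]
      refine ⟨?_, ?_, by rw [mul_add]; omega⟩
      · rw [← List.map_take, extN_take_succ P W v A i hi, if_neg (by rw [← hy]; omega), List.append_nil, e1]
      · intro y hy
        rw [if_neg (by omega), if_neg (by omega), if_neg (by omega), dlow y hy]
    · intro hne
      simp [c3, d22] at hne
      refine wp_push (by simp) (by simp) ?_ (wp_assign (by simp [d24]; omega) ?_)
      · simpa [d20, c1, a1] using addr_lt hK hc hid hlen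
      simp [c1, a1, d20, d25, d23, d24]
      refine ⟨?_, ?_, by rw [mul_add]; omega⟩
      · rw [← List.map_take, extN_take_succ P W v A i hi, if_pos (by rw [← hy]; omega), e1]
        simp [hy]
      · intro y hy
        rw [if_neg (by omega), if_neg (by omega), if_neg (by omega), dlow y hy]
  · rintro g ⟨e1, e2, e5, e6⟩ -
    refine hQ _ ?_ e2 ?_
    · simpa [extN] using e1
    · simp only [VState.tick_clk]
      nlinarith

/-- Insertion of the vector `v` into a basis: the vector is reduced, and appended to the first or
the second list, according as the quotient by `D` of the result is non-zero or zero. -/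
def insN (D : ℕ) (b : List ℕ × List ℕ) (v : ℕ) : List ℕ × List ℕ :=
  if redN b.1 v / D = 0 then (b.1, b.2 ++ [redN b.1 v]) else (b.1 ++ [redN b.1 v], b.2)

/-- The vector in variable `20` is inserted, see `insN`, into the arrays with the numbers `b` and
`b + 1`, where `b` is held by variable `21` and the divisor by variable `22`. -/
def insP : Prog :=
  assign 30 (.var 20) ;; assign 31 (.var 21) ;; redP ;; assign 23 (.var 30 / .var 22) ;;
  .ite (2 * 23) (push (.var 21) (.var 30)) (push (.var 21 + 1) (.var 30))

theorem wp_ins {K M L : ℕ} (hK : 2 * K + 6 ≤ E.B) (hc : E.c < 2 ^ K) (hMK : M ≤ K)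
    {id v D : ℕ} (h20 : h.var 20 = v) (h21 : h.var 21 = id) (h22 : h.var 22 = D)
    {b : List ℕ × List ℕ} (hb1 : h.arr id = b.1) (hb2 : h.arr (id + 1) = b.2)
    (hv : v < 2 ^ M) (hid : id + 1 < 2 ^ K) (hAM : ∀ y ∈ b.1, y < 2 ^ M)
    (hL : b.1.length ≤ L) (hL' : b.2.length ≤ L) (hLK : L < 2 ^ K)
    (hQ : ∀ h' : VState, h'.arr = Function.update (Function.update h.arr id (insN D b v).1)
        (id + 1) (insN D b v).2 → (∀ y < 23, h'.var y = h.var y) →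
      h'.clk ≤ h.clk + (250 * (M + 1)) * (L + 1) → Q h') :
    WP E insP Q h := by
  have hB : 64 * 2 ^ K ≤ 2 ^ E.B :=
    calc 64 * 2 ^ K = 2 ^ (K + 6) := by ring
      _ ≤ _ := Nat.pow_le_pow_right (by omega) (by omega)
  have hMK' : 2 ^ M ≤ 2 ^ K := Nat.pow_le_pow_right (by omega) hMK
  have hT : 100 ≤ 100 * (M + 1) * (L + 1) := by nlinarith [Nat.zero_le (M * L)]
  have hT' : 250 * (M + 1) * (L + 1) = 150 * (M + 1) * (L + 1) + 100 * (M + 1) * (L + 1) := by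
    ring
  unfold insP
  refine wp_seq (wp_assign (by simp) (wp_seq (wp_assign (by simp) (wp_seq (wp_red hK hc hMK
    (L := L) (x := v) (id := id) (by simpa using h20) (by simpa using h21) hv (by omega)
    (by simpa [hb1] using hAM) (by simpa [hb1] using hL) hLK ?_)))))
  intro g a1 a2 a3 a4
  simp at a1 a4
  simp [hb1] at a3
  have glow : ∀ y < 30, g.var y = h.var y := by
    intro y hy
    rw [a2 _ (by omega)]
    simp only [VState.set_var]
    rw [if_neg (by omega), if_neg (by omega)]
  have hle := redN_le b.1 v
  have hdle := Nat.div_le_self (redN b.1 v) D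
  refine wp_seq (wp_assign ?_ (wp_ite ?_ ?_))
  · simp [a3, glow, h22]; omega
  · intro hne
    have hne' : redN b.1 v / D ≠ 0 := by simpa [a3, glow, h22] using hne
    refine wp_push (by simp) (by simp) ?_ (hQ _ ?_ ?_ ?_)
    · simpa [glow, h21, a1, hb1] using addr_lt hK hc (by omega) (by omega)
    · simp [glow, h21, a1, a3, insN, hne', hb1]
      exact hb2
    · intro y hy
      simp
      rw [if_neg (by omega), glow y (by omega)]
    · simp; omega
  · intro hne
    have hne' : redN b.1 v / D = 0 := by simpa [a3, glow, h22] using hne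
    refine wp_push (by simp [glow, h21]; omega) (by simp) ?_ (hQ _ ?_ ?_ ?_)
    · simpa [glow, h21, a1, hb2] using addr_lt hK hc (by omega) (by omega)
    · simp [glow, h21, a1, a3, insN, hne', hb2]
      rw [← hb1, Function.update_eq_self]
    · intro y hy
      simp
      rw [if_neg (by omega), glow y (by omega)]
    · simp; omega

end

section

variable {E : Env} {Q : VState → Prop} {h : VState}

/-! ### The parameters of a round, and the columns outside its window -/

/-- The parameters of one round of the search: length `n`, target distance `d`, start `a` of the
window, rotation `x` of the window, half `w` of the window length, first free array number `top`,
modulus `P` that separates errors from syndromes, weight bound `t`, number `S` of syndromes. -/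
structure Params where
  (n d a x w top P t S : ℕ)

/-- The variables in which the programs below expect the parameters. Variable `7` is reserved for
the success of a round, variable `11` for the loop over the target distances; variables from `12`
on are local to the individual programs. -/
structure Par (p : Params) (h : VState) : Prop where
  n : h.var 0 = p.n
  d : h.var 2 = p.d
  a : h.var 3 = p.a
  x : h.var 4 = p.x
  w : h.var 5 = p.w
  top : h.var 6 = p.top
  P : h.var 8 = p.P
  t : h.var 9 = p.t
  S : h.var 10 = p.S

theorem Par.congr {p : Params} {h h' : VState} (hp : Par p h)
    (hl : ∀ y < 12, h'.var y = h.var y) : Par p h' := by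
  constructor
  · rw [hl _ (by omega), hp.n]
  · rw [hl _ (by omega), hp.d]
  · rw [hl _ (by omega), hp.a]
  · rw [hl _ (by omega), hp.x]
  · rw [hl _ (by omega), hp.w]
  · rw [hl _ (by omega), hp.top]
  · rw [hl _ (by omega), hp.P]
  · rw [hl _ (by omega), hp.t]
  · rw [hl _ (by omega), hp.S]

/-- The numbers that occur in a round fit into the machine words: vectors have at most `M` bits,
lists have at most `X` entries, and array numbers and lengths have at most `K` bits. -/
structure Fits (E : Env) (p : Params) (K M X : ℕ) : Prop where
  hK : 2 * K + 6 ≤ E.B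
  hc : E.c < 2 ^ K
  hM : M ≤ K
  hn : 8 * p.n + 8 < 2 ^ K
  hX : 4 * X + 8 < 2 ^ K
  hn0 : 0 < p.n
  ha : p.a ≤ p.n
  hx : p.x ≤ 2 * p.w
  hw : 2 * p.w ≤ p.n
  hP : 0 < p.P
  hPS : p.P * p.S = 2 ^ M
  htop : p.top + p.S + 8 < 2 ^ K
  ht : p.t ≤ p.n

theorem Fits.hB {p : Params} {K M X : ℕ} (f : Fits E p K M X) : 64 * 2 ^ K ≤ 2 ^ E.B :=
  calc 64 * 2 ^ K = 2 ^ (K + 6) := by ring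
    _ ≤ _ := Nat.pow_le_pow_right (by omega) (by have := f.hK; omega)

theorem Fits.hMK {p : Params} {K M X : ℕ} (f : Fits E p K M X) : 2 ^ M ≤ 2 ^ K :=
  Nat.pow_le_pow_right (by omega) f.hM

/-- The columns with the numbers `2 * q` and `2 * q + 1` for the positions `q` of a list. -/
def colsN (G : List ℕ) (qs : List ℕ) : List ℕ :=
  qs.flatMap fun q => [G.getD (2 * q) 0, G.getD (2 * q + 1) 0]

theorem colsN_range_succ (G : List ℕ) (q : ℕ → ℕ) (i : ℕ) :
    colsN G ((List.range (i + 1)).map q) =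
      colsN G ((List.range i).map q) ++ [G.getD (2 * q i) 0, G.getD (2 * q i + 1) 0] := by
  simp [colsN, List.range_succ]

theorem colsN_length (G qs : List ℕ) : (colsN G qs).length = 2 * qs.length := by
  induction qs with
  | nil => rfl
  | cons q qs ih => simp only [colsN, List.flatMap_cons, List.length_append] at ih ⊢
                    simp; omega

theorem getD_lt {G : List ℕ} {b : ℕ} (hb : 0 < b) (hG : ∀ g ∈ G, g < b) (i : ℕ) :
    G.getD i 0 < b := by
  rcases lt_or_ge i G.length with hi | hi
  · exact hG _ (getD_mem hi)
  · simpa [List.getD, List.getElem?_eq_none hi] using hb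

theorem colsN_lt {G : List ℕ} {b : ℕ} (hb : 0 < b) (hG : ∀ g ∈ G, g < b) (qs : List ℕ) :
    ∀ v ∈ colsN G qs, v < b := by
  intro v hv
  simp only [colsN, List.mem_flatMap, List.mem_cons, List.not_mem_nil, or_false] at hv
  obtain ⟨q, -, rfl | rfl⟩ := hv <;> exact getD_lt hb hG _

theorem foldl_insN_length (D : ℕ) (vs : List ℕ) (b : List ℕ × List ℕ) :
    (vs.foldl (insN D) b).1.length ≤ b.1.length + vs.length ∧
      (vs.foldl (insN D) b).2.length ≤ b.2.length + vs.length := by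
  induction vs generalizing b with
  | nil => simp
  | cons v vs ih =>
    have := ih (insN D b v)
    simp only [List.foldl_cons, List.length_cons]
    have h1 : (insN D b v).1.length ≤ b.1.length + 1 := by unfold insN; split_ifs <;> simp
    have h2 : (insN D b v).2.length ≤ b.2.length + 1 := by unfold insN; split_ifs <;> simp
    omega

theorem foldl_insN_lt {D c : ℕ} (vs : List ℕ) (hvs : ∀ v ∈ vs, v < c) (b : List ℕ × List ℕ)
    (hb : ∀ v ∈ b.1, v < c) (hb2 : ∀ v ∈ b.2, v < c) :
    (∀ v ∈ (vs.foldl (insN D) b).1, v < c) ∧ ∀ v ∈ (vs.foldl (insN D) b).2, v < c := by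
  induction vs generalizing b with
  | nil => exact ⟨hb, hb2⟩
  | cons v vs ih =>
    rw [List.foldl_cons]
    have hv := (redN_le b.1 v).trans_lt (hvs v (by simp))
    refine ih (fun v hv => hvs v (by simp [hv])) _ ?_ ?_
    · intro y hy
      unfold insN at hy
      split_ifs at hy
      · exact hb y hy
      · simp at hy
        rcases hy with hy | rfl
        · exact hb y hy
        · exact hv
    · intro y hy
      unfold insN at hy
      split_ifs at hy
      · simp at hy
        rcases hy with hy | rfl
        · exact hb2 y hy
        · exact hv
      · exact hb2 y hy

/-- The position with number `i` outside the window. -/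
def Params.out (p : Params) (i : ℕ) : ℕ := (p.a + (2 * p.w + i)) % p.n

/-- The position with number `i` in the rotated window. -/
def Params.pos (p : Params) (i : ℕ) : ℕ := (p.a + (p.x + i) % (2 * p.w)) % p.n

/-- Insertion of all columns outside the window into the arrays `top` and `top + 1`. -/
def colsP : Prog :=
  assign 12 (.var 0 - 2 * .var 5) ;; assign 13 (2 * .var 5) ;;
  forLoop 12 (assign 14 (.var 3 + .var 13) ;; assign 14 (.var 14 - .var 14 / .var 0 * .var 0) ;;
    assign 20 (.get 0 (2 * .var 14)) ;; assign 21 (.var 6) ;; assign 22 (.var 8) ;; insP ;;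
    assign 20 (.get 0 (2 * .var 14 + 1)) ;; insP ;; assign 13 (.var 13 + 1))

theorem wp_cols {p : Params} {K M X : ℕ} (f : Fits E p K M X) (hp : Par p h) {G : List ℕ}
    (hG : ∀ g ∈ G, g < 2 ^ M) (h0 : h.arr 0 = G) (ht : 0 < p.top)
    (h1 : h.arr p.top = []) (h2 : h.arr (p.top + 1) = [])
    (hQ : ∀ h' : VState, (∀ y < 12, h'.var y = h.var y) →
      h'.arr = Function.update (Function.update h.arr p.top
        ((colsN G ((List.range (p.n - 2 * p.w)).map p.out)).foldl (insN p.P) ([], [])).1)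
        (p.top + 1) ((colsN G ((List.range (p.n - 2 * p.w)).map p.out)).foldl
          (insN p.P) ([], [])).2 →
      h'.clk ≤ h.clk + 1000 * (M + 1) * (2 * p.n + 1) * (p.n + 1) → Q h') :
    WP E colsP Q h := by
  have hB := f.hB
  have hMK := f.hMK
  have hn := f.hn
  have hw := f.hw
  have ha := f.ha
  have hn0 := f.hn0
  have htop := f.htop
  have hM0 : 0 < 2 ^ M := by positivity
  have hE0 : E.B ≠ 0 := by have := f.hK; omega
  have hPM : p.P ≤ 2 ^ M := by
    have := f.hPS
    rcases Nat.eq_zero_or_pos p.S with h | h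
    · rw [h] at this; omega
    · rw [← this]; exact Nat.le_mul_of_pos_right _ h
  unfold colsP
  refine wp_seq (wp_assign (by simp [hp.n, hp.w, -tsub_le_iff_right]; omega) (wp_seq
    (wp_assign (by simp [hp.w]; omega) ?_)))
  set bb : ℕ → List ℕ × List ℕ := fun i =>
    (colsN G ((List.range i).map p.out)).foldl (insN p.P) ([], []) with hbb
  refine wp_for (fun i h' => h'.arr = Function.update (Function.update h.arr p.top (bb i).1)
      (p.top + 1) (bb i).2 ∧ (∀ y < 12, h'.var y = h.var y) ∧ h'.var 13 = 2 * p.w + i ∧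
    h'.clk ≤ h.clk + 40 + (500 * (M + 1) * (2 * p.n + 1) + 100) * i) (by have := f.hK; omega)
    (k := p.n - 2 * p.w) (by simp [hp.n, hp.w]) ?_ ?_ ?_
  · simp [hbb, colsN, hp.w]
    constructor
    · ext1 id
      simp only [Function.update_apply]
      split_ifs with i1 i2
      · rw [i1, h2]
      · rw [i2, h1]
      · rfl
    · intro y hy
      rw [if_neg (by omega), if_neg (by omega)]
  · rintro i hi g ⟨e1, e2, e3, e4⟩ hx' -
    have gp := hp.congr e2
    have g0 : g.arr 0 = G := by
      rw [e1, Function.update_of_ne (by omega), Function.update_of_ne (by omega), h0]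
    have hq : p.a + (2 * p.w + i) - (p.a + (2 * p.w + i)) / p.n * p.n = p.out i := by
      rw [Params.out, Nat.mod_eq_sub_div_mul]
    have hqn : p.out i < p.n := Nat.mod_lt _ (by omega)
    have hdm := Nat.div_mul_le_self (p.a + (2 * p.w + i)) p.n
    have hdl := Nat.div_le_self (p.a + (2 * p.w + i)) p.n
    have hbl := foldl_insN_length p.P (colsN G ((List.range i).map p.out)) ([], [])
    rw [colsN_length] at hbl
    simp only [List.length_nil, List.length_map, List.length_range, zero_add] at hbl
    change (bb i).1.length ≤ _ ∧ (bb i).2.length ≤ _ at hbl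
    have hblt := (foldl_insN_lt (D := p.P) _ (colsN_lt hM0 hG ((List.range i).map p.out)) ([], [])
      (by simp) (by simp)).1
    change ∀ v ∈ (bb i).1, v < 2 ^ M at hblt
    have hv1 := getD_lt hM0 hG (2 * p.out i)
    have hv2 := getD_lt hM0 hG (2 * p.out i + 1)
    set v1 := G.getD (2 * p.out i) 0 with hv1e
    set v2 := G.getD (2 * p.out i + 1) 0 with hv2e
    have hbs : bb (i + 1) = insN p.P (insN p.P (bb i) v1) v2 := by
      simp only [hbb, colsN_range_succ, List.foldl_append, List.foldl_cons, List.foldl_nil]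
      rfl
    have hb2 := foldl_insN_length p.P [v1] (bb i)
    have hb3 := (foldl_insN_lt (D := p.P) [v1] (by simpa using hv1) (bb i) hblt
      (foldl_insN_lt (D := p.P) _ (colsN_lt hM0 hG ((List.range i).map p.out)) ([], [])
      (by simp) (by simp)).2).1
    simp only [List.foldl_cons, List.foldl_nil, List.length_cons, List.length_nil] at hb2 hb3
    refine wp_seq (wp_assign (by simp [gp.a, e3]; omega) (wp_seq (wp_assign ?_ (wp_seq
      (wp_assign ?_ (wp_seq (wp_assign (by simp) (wp_seq (wp_assign (by simp) (wp_seq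
      (wp_ins f.hK f.hc f.hM (L := 2 * p.n) (id := p.top) (v := v1) (D := p.P) (b := bb i)
        ?_ ?_ ?_ ?_ ?_ hv1 ?_ hblt ?_ ?_ ?_ ?_)))))))))))
    · simp [gp.a, gp.n, e3, hq, -tsub_le_iff_right]; omega
    · simp [gp.a, gp.n, e3, hq]
      constructorm* _ ∧ _ <;> first | omega | exact addr_lt f.hK f.hc (by positivity) (by omega)
    · simp [gp.a, gp.n, e3, hq, g0, hv1e]
    · simp [gp.top]
    · simp [gp.P]
    · simp [e1]
    · simp [e1]
    · omega
    · omega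
    · omega
    · omega
    intro g' a1 a2 a3
    simp at a3
    simp only [VState.set_arr, VState.tick_arr] at a1
    have bl : ∀ y < 12, g'.var y = h.var y := by
      intro y hy
      rw [a2 _ (by omega)]
      simp only [VState.set_var, VState.tick_var]
      rw [if_neg (by omega), if_neg (by omega), if_neg (by omega), if_neg (by omega),
        if_neg (by omega), e2 y hy]
    have gp' := hp.congr bl
    have b12 : g'.var 12 = p.n - 2 * p.w - i := by rw [a2 _ (by omega)]; simpa using hx'
    have b13 : g'.var 13 = 2 * p.w + i := by rw [a2 _ (by omega)]; simpa using e3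
    have b14 : g'.var 14 = p.out i := by
      rw [a2 _ (by omega)]; simp [gp.a, gp.n, e3, hq]
    have b21 : g'.var 21 = p.top := by rw [a2 _ (by omega)]; simp [gp.top]
    have b22 : g'.var 22 = p.P := by rw [a2 _ (by omega)]; simp [gp.P]
    have g0' : g'.arr 0 = G := by
      rw [a1, Function.update_of_ne (by omega), Function.update_of_ne (by omega), g0]
    refine wp_seq (wp_assign ?_ (wp_seq
      (wp_ins f.hK f.hc f.hM (L := 2 * p.n) (id := p.top) (v := v2) (D := p.P)
        (b := insN p.P (bb i) v1) ?_ ?_ ?_ ?_ ?_ hv2 ?_ hb3 ?_ ?_ ?_ ?_)))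
    · simp [b14]
      constructorm* _ ∧ _ <;> first | omega | exact addr_lt f.hK f.hc (by positivity) (by omega)
    · simp [b14, g0', hv2e]
    · simp [b21]
    · simp [b22]
    · simp [a1]
    · simp [a1]
    · omega
    · omega
    · omega
    · omega
    intro g'' c1 c2 c3
    simp at c3
    simp only [VState.set_arr] at c1
    have cl : ∀ y < 12, g''.var y = h.var y := by
      intro y hy
      rw [c2 _ (by omega)]
      simp only [VState.set_var]
      rw [if_neg (by omega), bl y hy]
    have c12 : g''.var 12 = p.n - 2 * p.w - i := by rw [c2 _ (by omega)]; simpa using b12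
    have c13 : g''.var 13 = 2 * p.w + i := by rw [c2 _ (by omega)]; simpa using b13
    refine wp_assign (by simp [c13]; omega) ?_
    simp [c12, c13]
    refine ⟨?_, ?_, by omega, ?_⟩
    · rw [c1, a1, e1, hbs]
      ext1 id
      simp only [Function.update_apply]
      split_ifs <;> rfl
    · intro y hy
      rw [if_neg (by omega), if_neg (by omega), cl y hy]
    · rw [mul_add (500 * (M + 1) * (2 * p.n + 1) + 100)]
      have : 500 * (M + 1) * (2 * p.n + 1) = 250 * (M + 1) * (2 * p.n + 1) +
        250 * (M + 1) * (2 * p.n + 1) := by ring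
      omega
  · rintro g ⟨e1, e2, e3, e4⟩ -
    refine hQ _ e2 (by simpa using e1) ?_
    simp only [VState.tick_clk]
    have h1 : (500 * (M + 1) * (2 * p.n + 1) + 100) * (p.n - 2 * p.w) ≤
      (500 * (M + 1) * (2 * p.n + 1) + 100) * p.n := Nat.mul_le_mul_left _ (by omega)
    nlinarith [Nat.zero_le (M * p.n), Nat.zero_le (M * p.n * p.n), Nat.zero_le (p.n * p.n)]

end

section

variable {E : Env} {Q : VState → Prop} {h : VState}

/-! ### Half windows and buckets -/

theorem length_extN (P W : ℕ) (A : List ℕ) (v : ℕ) :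
    A.length ≤ (extN P W A v).length ∧ (extN P W A v).length ≤ 2 * A.length := by
  have := List.length_filter_le (fun y => decide (wt4 (y % P) ≤ W)) (A.map (· ^^^ v))
  simp only [extN, List.length_append, List.length_map] at this ⊢
  omega

theorem le_length_foldl_extN (P W : ℕ) (vs A : List ℕ) :
    A.length ≤ (vs.foldl (extN P W) A).length := by
  induction vs generalizing A with
  | nil => simp
  | cons v vs ih => exact (length_extN P W A v).1.trans (ih _)

theorem extN_lt {M P W : ℕ} {A : List ℕ} {v : ℕ} (hA : ∀ y ∈ A, y < 2 ^ M) (hv : v < 2 ^ M) :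
    ∀ y ∈ extN P W A v, y < 2 ^ M := by
  intro y hy
  simp only [extN, List.mem_append, List.mem_filter, List.mem_map] at hy
  rcases hy with hy | ⟨⟨z, hz, rfl⟩, -⟩
  · exact hA y hy
  · exact Nat.xor_lt_two_pow (hA z hz) hv

theorem foldl_extN_lt {M P W : ℕ} (vs : List ℕ) (hvs : ∀ v ∈ vs, v < 2 ^ M) (A : List ℕ)
    (hA : ∀ y ∈ A, y < 2 ^ M) : ∀ y ∈ vs.foldl (extN P W) A, y < 2 ^ M := by
  induction vs generalizing A with
  | nil => exact hA
  | cons v vs ih =>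
    exact ih (fun v hv => hvs v (by simp [hv])) _ (extN_lt hA (hvs v (by simp)))

/-- The list of all vectors of weight at most `t` that are supported on the `m` window positions
from number `s` on. -/
def sideN (p : Params) (G : List ℕ) (s m : ℕ) : List ℕ :=
  (colsN G ((List.range m).map fun i => p.pos (s + i))).foldl (extN p.P p.t) [0]

theorem sideN_succ (p : Params) (G : List ℕ) (s i : ℕ) :
    sideN p G s (i + 1) = extN p.P p.t (extN p.P p.t (sideN p G s i)
      (G.getD (2 * p.pos (s + i)) 0)) (G.getD (2 * p.pos (s + i) + 1) 0) := by
  simp only [sideN, colsN_range_succ, List.foldl_append, List.foldl_cons, List.foldl_nil]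

theorem sideN_mono (p : Params) (G : List ℕ) (s : ℕ) {i m : ℕ} (hi : i ≤ m) :
    (sideN p G s i).length ≤ (sideN p G s m).length := by
  induction m, hi using Nat.le_induction with
  | base => exact le_rfl
  | succ m _ ih =>
    rw [sideN_succ]
    exact ih.trans ((length_extN _ _ _ _).1.trans (length_extN _ _ _ _).1)

/-- The list of the vectors of small weight on one half of the window is built in the array with
the number in variable `16`; variable `15` holds the number of the first position. -/
def sideP : Prog :=
  push (.var 16) 0 ;; assign 12 (.var 5) ;; assign 13 (.var 15) ;;
  forLoop 12 (assign 14 (.var 4 + .var 13) ;;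
    assign 14 (.var 14 - .var 14 / (2 * .var 5) * (2 * .var 5)) ;;
    assign 14 (.var 3 + .var 14) ;; assign 14 (.var 14 - .var 14 / .var 0 * .var 0) ;;
    assign 20 (.var 16) ;; assign 22 (.var 9) ;;
    assign 21 (.get 0 (2 * .var 14)) ;; extP ;;
    assign 21 (.get 0 (2 * .var 14 + 1)) ;; extP ;; assign 13 (.var 13 + 1))

theorem wp_side {p : Params} {K M X : ℕ} (f : Fits E p K M X) (hp : Par p h) {G : List ℕ}
    (hG : ∀ g ∈ G, g < 2 ^ M) (h0 : h.arr 0 = G) {s id : ℕ} (hs : s + p.w ≤ 2 * p.w)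
    (h15 : h.var 15 = s) (h16 : h.var 16 = id) (hid0 : 0 < id) (hid : id < 2 ^ K)
    (h1 : h.arr id = []) (hX : (sideN p G s p.w).length ≤ X)
    (hQ : ∀ h' : VState, (∀ y < 12, h'.var y = h.var y) →
      h'.arr = Function.update h.arr id (sideN p G s p.w) →
      h'.clk ≤ h.clk + 1000 * (M + 1) * (X + 1) * (p.n + 1) → Q h') :
    WP E sideP Q h := by
  have hB := f.hB
  have hMK := f.hMK
  have hn := f.hn
  have hw := f.hw
  have ha := f.ha
  have hn0 := f.hn0
  have hx := f.hx
  have htop := f.htop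
  have hXK := f.hX
  have htn := f.ht
  have hM0 : 0 < 2 ^ M := by positivity
  have hE0 : E.B ≠ 0 := by have := f.hK; omega
  unfold sideP
  refine wp_seq (wp_push (by simp) (by simp) (by simpa [h16, h1] using addr_lt f.hK f.hc hid (by omega))
    (wp_seq (wp_assign (by simp) (wp_seq (wp_assign (by simp) ?_)))))
  refine wp_for (fun i h' => h'.arr = Function.update h.arr id (sideN p G s i) ∧
      (∀ y < 12, h'.var y = h.var y) ∧ h'.var 13 = s + i ∧ h'.var 16 = id ∧
    h'.clk ≤ h.clk + 40 + (600 * (M + 1) * (X + 1) + 150) * i) (by omega)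
    (k := p.w) (by simp [hp.w]) ?_ ?_ ?_
  · simp [h16, h1, h15, sideN, colsN]
    intro y hy
    rw [if_neg (by omega), if_neg (by omega)]
  · rintro i hi g ⟨e1, e2, e3, e16, e4⟩ hx' -
    have gp := hp.congr e2
    have g0 : g.arr 0 = G := by rw [e1, Function.update_of_ne (by omega), h0]
    set z := (p.x + (s + i)) % (2 * p.w) with hz
    have hq1 : p.x + (s + i) - (p.x + (s + i)) / (2 * p.w) * (2 * p.w) = z := by
      rw [hz, Nat.mod_eq_sub_div_mul]
    have hq : p.a + z - (p.a + z) / p.n * p.n = p.pos (s + i) := by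
      rw [Params.pos, Nat.mod_eq_sub_div_mul]
    have hzn : z < 2 * p.w := Nat.mod_lt _ (by omega)
    have hqn : p.pos (s + i) < p.n := Nat.mod_lt _ (by omega)
    have hdm := Nat.div_mul_le_self (p.a + z) p.n
    have hdl := Nat.div_le_self (p.a + z) p.n
    have hdm' := Nat.div_mul_le_self (p.x + (s + i)) (2 * p.w)
    have hdl' := Nat.div_le_self (p.x + (s + i)) (2 * p.w)
    have hv1 := getD_lt hM0 hG (2 * p.pos (s + i))
    have hv2 := getD_lt hM0 hG (2 * p.pos (s + i) + 1)
    have hS := sideN_succ p G s i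
    have hlt : ∀ y ∈ sideN p G s i, y < 2 ^ M :=
      foldl_extN_lt _ (colsN_lt hM0 hG _) _ (by simp)
    set v1 := G.getD (2 * p.pos (s + i)) 0 with hv1e
    set v2 := G.getD (2 * p.pos (s + i) + 1) 0 with hv2e
    have hlt2 := extN_lt (P := p.P) (W := p.t) hlt hv1
    have l1 := sideN_mono p G s (i := i + 1) (m := p.w) (by omega)
    rw [hS] at l1
    have l2 := length_extN p.P p.t (extN p.P p.t (sideN p G s i) v1) v2
    have l3 := length_extN p.P p.t (sideN p G s i) v1
    refine wp_seq (wp_assign (by simp [gp.x, e3]; omega) (wp_seq (wp_assign ?_ (wp_seq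
      (wp_assign ?_ (wp_seq (wp_assign ?_ (wp_seq (wp_assign (by simp) (wp_seq
      (wp_assign (by simp) (wp_seq (wp_assign ?_ (wp_seq
      (wp_ext f.hK f.hc f.hM (id := id) (v := v1) (P := p.P) (W := p.t) (A := sideN p G s i)
        ?_ ?_ ?_ ?_ ?_ hv1 hid hlt ?_ ?_)))))))))))))))
    · simp [gp.x, gp.w, e3, hq1, -tsub_le_iff_right]; omega
    · simp [gp.x, gp.w, gp.a, e3, hq1]; omega
    · simp [gp.x, gp.w, gp.a, gp.n, e3, hq1, hq, -tsub_le_iff_right]; omega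
    · simp [gp.x, gp.w, gp.a, gp.n, e3, hq1, hq]
      constructorm* _ ∧ _ <;> first | omega | exact addr_lt f.hK f.hc (by positivity) (by omega)
    · simp [e16]
    · simp [gp.x, gp.w, gp.a, gp.n, e3, hq1, hq, g0, hv1e]
    · simp [gp.t]
    · simp [gp.P]
    · simp [e1]
    · omega
    intro g' a1 a2 a3
    simp at a3
    simp only [VState.set_arr, VState.tick_arr] at a1
    have bl : ∀ y < 12, g'.var y = h.var y := by
      intro y hy
      rw [a2 _ (by omega)]
      simp only [VState.set_var, VState.tick_var]
      rw [if_neg (by omega), if_neg (by omega), if_neg (by omega), if_neg (by omega),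
        if_neg (by omega), if_neg (by omega), if_neg (by omega), e2 y hy]
    have gp' := hp.congr bl
    have b12 : g'.var 12 = p.w - i := by rw [a2 _ (by omega)]; simpa using hx'
    have b13 : g'.var 13 = s + i := by rw [a2 _ (by omega)]; simpa using e3
    have b14 : g'.var 14 = p.pos (s + i) := by
      rw [a2 _ (by omega)]; simp [gp.x, gp.w, gp.a, gp.n, e3, hq1, hq]
    have b16 : g'.var 16 = id := by rw [a2 _ (by omega)]; simpa using e16
    have b20 : g'.var 20 = id := by rw [a2 _ (by omega)]; simp [e16]
    have b22 : g'.var 22 = p.t := by rw [a2 _ (by omega)]; simp [gp.t]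
    have g0' : g'.arr 0 = G := by rw [a1, Function.update_of_ne (by omega), g0]
    refine wp_seq (wp_assign ?_ (wp_seq
      (wp_ext f.hK f.hc f.hM (id := id) (v := v2) (P := p.P) (W := p.t)
        (A := extN p.P p.t (sideN p G s i) v1) ?_ ?_ ?_ ?_ ?_ hv2 hid hlt2 ?_ ?_)))
    · simp [b14]
      constructorm* _ ∧ _ <;> first | omega | exact addr_lt f.hK f.hc (by positivity) (by omega)
    · simp [b20]
    · simp [b14, g0', hv2e]
    · simp [b22]
    · simp [gp'.P]
    · simp [a1]
    · omega
    intro g'' c1 c2 c3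
    simp at c3
    simp only [VState.set_arr] at c1
    have cl : ∀ y < 12, g''.var y = h.var y := by
      intro y hy
      rw [c2 _ (by omega)]
      simp only [VState.set_var]
      rw [if_neg (by omega), bl y hy]
    have c12 : g''.var 12 = p.w - i := by rw [c2 _ (by omega)]; simpa using b12
    have c13 : g''.var 13 = s + i := by rw [c2 _ (by omega)]; simpa using b13
    have c16 : g''.var 16 = id := by rw [c2 _ (by omega)]; simpa using b16
    refine wp_assign (by simp [c13]; omega) ?_
    simp [c12, c13, c16]
    refine ⟨?_, ?_, by omega, ?_⟩
    · rw [c1, a1, e1, hS]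
      simp
    · intro y hy
      rw [if_neg (by omega), if_neg (by omega), cl y hy]
    · rw [mul_add (600 * (M + 1) * (X + 1) + 150)]
      have : 600 * (M + 1) * (X + 1) = 300 * (M + 1) * (X + 1) +
        300 * (M + 1) * (X + 1) := by ring
      have u1 : 300 * (M + 1) * ((sideN p G s i).length + 1) ≤ 300 * (M + 1) * (X + 1) :=
        Nat.mul_le_mul_left _ (by omega)
      have u2 : 300 * (M + 1) * ((extN p.P p.t (sideN p G s i) v1).length + 1) ≤
        300 * (M + 1) * (X + 1) := Nat.mul_le_mul_left _ (by omega)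
      omega
  · rintro g ⟨e1, e2, e3, e16, e4⟩ -
    refine hQ _ e2 (by simpa using e1) ?_
    simp only [VState.tick_clk]
    have h1 : (600 * (M + 1) * (X + 1) + 150) * p.w ≤
      (600 * (M + 1) * (X + 1) + 150) * p.n := Nat.mul_le_mul_left _ (by omega)
    nlinarith [Nat.zero_le (M * p.n), Nat.zero_le (M * p.n * X), Nat.zero_le (p.n * X),
      Nat.zero_le (M * X)]

/-- The contents of the bucket with number `k` when the vectors of `A` are reduced modulo `bs` and
distributed by their syndromes. -/
def bucketN (P : ℕ) (bs A : List ℕ) (k : ℕ) : List ℕ :=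
  (A.map (redN bs)).filter fun z => decide (z / P = k)

/-- The vectors in array `top + 2` are reduced modulo array `top`, and distributed over the arrays
from number `top + 5` on. -/
def bucketP : Prog :=
  assign 12 (.len (.var 6 + 2)) ;; assign 13 0 ;;
  forLoop 12 (assign 30 (.get (.var 6 + 2) (.var 13)) ;; assign 31 (.var 6) ;; redP ;;
    push (.var 6 + 5 + .var 30 / .var 8) (.var 30) ;; assign 13 (.var 13 + 1))

theorem bucketN_take_succ (P : ℕ) (bs A : List ℕ) (k i : ℕ) (hi : i < A.length) :
    bucketN P bs (A.take (i + 1)) k = bucketN P bs (A.take i) k ++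
      if redN bs (A.getD i 0) / P = k then [redN bs (A.getD i 0)] else [] := by
  unfold bucketN
  rw [List.take_add_one, List.map_append, List.filter_append]
  simp only [List.getD, List.getElem?_eq_getElem hi, Option.toList_some, List.map_cons,
    List.map_nil, Option.getD_some]
  split_ifs with hw <;> simp [hw]

theorem bucketN_length_le (P : ℕ) (bs A : List ℕ) (k : ℕ) :
    (bucketN P bs A k).length ≤ A.length := by
  simpa [bucketN] using List.length_filter_le (fun z => decide (z / P = k)) (A.map (redN bs))

theorem wp_bucket {p : Params} {K M X : ℕ} (f : Fits E p K M X) (hp : Par p h)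
    {bs A : List ℕ} (hbs : h.arr p.top = bs) (hA : h.arr (p.top + 2) = A)
    (hbl : bs.length ≤ 2 * p.n) (hbM : ∀ b ∈ bs, b < 2 ^ M) (hAM : ∀ b ∈ A, b < 2 ^ M)
    (hX : A.length ≤ X) (hemp : ∀ id, p.top + 5 ≤ id → h.arr id = [])
    (hQ : ∀ h' : VState, (∀ y < 12, h'.var y = h.var y) →
      (∀ id < p.top + 5, h'.arr id = h.arr id) →
      (∀ k, h'.arr (p.top + 5 + k) = bucketN p.P bs A k) →
      h'.clk ≤ h.clk + 300 * (M + 1) * (X + 1) * (2 * p.n + 1) → Q h') :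
    WP E bucketP Q h := by
  have hB := f.hB
  have hMK := f.hMK
  have hn := f.hn
  have htop := f.htop
  have hXK := f.hX
  have hM0 : 0 < 2 ^ M := by positivity
  have hE0 : E.B ≠ 0 := by have := f.hK; omega
  unfold bucketP
  refine wp_seq (wp_assign ?_ (wp_seq (wp_assign (by simp) ?_)))
  · simp [hp.top]
    constructorm* _ ∧ _ <;> first | omega | exact addr_lt f.hK f.hc (by omega) (by omega)
  refine wp_for (fun i h' => (∀ y < 12, h'.var y = h.var y) ∧
      (∀ id < p.top + 5, h'.arr id = h.arr id) ∧
      (∀ k, h'.arr (p.top + 5 + k) = bucketN p.P bs (A.take i) k) ∧ h'.var 13 = i ∧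
    h'.clk ≤ h.clk + 40 + (150 * (M + 1) * (2 * p.n + 1) + 100) * i) (by omega)
    (k := A.length) (by simp [hp.top, hA]) ?_ ?_ ?_
  · simp [bucketN]
    refine ⟨?_, fun k => hemp _ (by omega)⟩
    intro y hy
    rw [if_neg (by omega), if_neg (by omega)]
  · rintro i hi g ⟨e1, e2, e3, e4, e5⟩ hx' -
    have gp := hp.congr e1
    have gA : g.arr (p.top + 2) = A := by rw [e2 _ (by omega), hA]
    have gb : g.arr p.top = bs := by rw [e2 _ (by omega), hbs]
    have hy : A.getD i 0 < 2 ^ M := hAM _ (getD_mem hi)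
    have hr := (redN_le bs (A.getD i 0)).trans_lt hy
    set z := redN bs (A.getD i 0) with hz
    have hzk : z / p.P < p.S := by
      rw [Nat.div_lt_iff_lt_mul f.hP, mul_comm, f.hPS]; exact hr
    refine wp_seq (wp_assign ?_ (wp_seq (wp_assign (by simp) (wp_seq
      (wp_red f.hK f.hc f.hM (L := 2 * p.n) (x := A.getD i 0) (id := p.top) ?_ ?_ hy (by omega)
        (by simpa [gb] using hbM) (by simpa [gb] using hbl) (by omega) ?_)))))
    · simp [gp.top, e4]
      constructorm* _ ∧ _ <;> first | omega | exact addr_lt f.hK f.hc (by omega) (by omega)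
    · simp [gp.top, e4, gA]
    · simp [gp.top]
    intro g' a1 a2 a3 a4
    simp at a1 a4
    simp only [VState.set_arr, VState.tick_arr, gb, ← hz] at a3
    have bl : ∀ y < 12, g'.var y = h.var y := by
      intro y hy
      rw [a2 _ (by omega)]
      simp only [VState.set_var, VState.tick_var]
      rw [if_neg (by omega), if_neg (by omega), e1 y hy]
    have gp' := hp.congr bl
    have b12 : g'.var 12 = A.length - i := by rw [a2 _ (by omega)]; simpa using hx'
    have b13 : g'.var 13 = i := by rw [a2 _ (by omega)]; simpa using e4
    have hlen : (g'.arr (p.top + 5 + z / p.P)).length ≤ A.length := by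
      rw [a1, e3]
      refine (bucketN_length_le _ _ _ _).trans (by simp)
    refine wp_seq (wp_push ?_ (by simp) ?_ (wp_assign (by simp [b13]; omega) ?_))
    · simp [gp'.top, gp'.P, a3]
      constructorm* _ ∧ _ <;> omega
    · simp only [eval_add, eval_var, eval_ofNat, eval_div, gp'.top, gp'.P, a3]
      exact addr_lt f.hK f.hc (by omega) (by omega)
    · simp [gp'.top, gp'.P, a3, b12, b13]
      refine ⟨?_, ?_, ?_, by rw [mul_add (150 * (M + 1) * (2 * p.n + 1) + 100)]; omega⟩
      · intro y hy
        rw [if_neg (by omega), if_neg (by omega), bl y hy]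
      · intro id hid
        have := Nat.zero_le (z / p.P)
        rw [Function.update_of_ne (by omega), a1, e2 _ hid]
      · intro k
        rw [bucketN_take_succ _ _ _ _ _ hi, ← hz]
        by_cases hk : k = z / p.P
        · subst hk
          simp [a1, e3]
        · rw [Function.update_of_ne (by omega), if_neg (fun hh => hk hh.symm), a1, e3]
          simp
  · rintro g ⟨e1, e2, e3, e4, e5⟩ -
    refine hQ _ e1 e2 (by simpa using e3) ?_
    simp only [VState.tick_clk]
    have h1 : (150 * (M + 1) * (2 * p.n + 1) + 100) * A.length ≤
      (150 * (M + 1) * (2 * p.n + 1) + 100) * X := Nat.mul_le_mul_left _ (by omega)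
    nlinarith [Nat.zero_le (M * p.n), Nat.zero_le (M * p.n * X), Nat.zero_le (p.n * X),
      Nat.zero_le (M * X)]

end

section

variable {E : Env} {Q : VState → Prop} {h : VState}

/-! ### Matching, and the test of the candidates -/

/-- The sums of the pairs from `A` and `B` whose reductions modulo `bs` have the same syndrome. -/
def matchN (P : ℕ) (bs A B : List ℕ) : List ℕ :=
  B.flatMap fun y => (bucketN P bs A (redN bs y / P)).map (· ^^^ redN bs y)

theorem matchN_take_succ (P : ℕ) (bs A B : List ℕ) (i : ℕ) (hi : i < B.length) :
    matchN P bs A (B.take (i + 1)) = matchN P bs A (B.take i) ++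
      (bucketN P bs A (redN bs (B.getD i 0) / P)).map (· ^^^ redN bs (B.getD i 0)) := by
  unfold matchN
  rw [List.take_add_one, List.flatMap_append]
  simp [List.getD, List.getElem?_eq_getElem hi]

theorem matchN_length_mono (P : ℕ) (bs A B : List ℕ) (i : ℕ) :
    (matchN P bs A (B.take i)).length ≤ (matchN P bs A B).length := by
  conv_rhs => rw [← List.take_append_drop i B]
  simp only [matchN, List.flatMap_append, List.length_append]
  omega

theorem bucketN_lt {M P : ℕ} {bs A : List ℕ} (hA : ∀ y ∈ A, y < 2 ^ M) (k : ℕ) :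
    ∀ y ∈ bucketN P bs A k, y < 2 ^ M := by
  intro y hy
  simp only [bucketN, List.mem_filter, List.mem_map] at hy
  obtain ⟨⟨z, hz, rfl⟩, -⟩ := hy
  exact (redN_le _ _).trans_lt (hA z hz)

theorem matchN_lt {M P : ℕ} {bs A B : List ℕ} (hA : ∀ y ∈ A, y < 2 ^ M)
    (hB : ∀ y ∈ B, y < 2 ^ M) : ∀ y ∈ matchN P bs A B, y < 2 ^ M := by
  intro y hy
  simp only [matchN, List.mem_flatMap, List.mem_map] at hy
  obtain ⟨z, hz, u, hu, rfl⟩ := hy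
  exact Nat.xor_lt_two_pow (bucketN_lt hA _ u hu) ((redN_le _ _).trans_lt (hB z hz))

/-- The vectors in array `top + 3` are reduced modulo array `top` and matched with the contents of
the buckets; the sums are collected in array `top + 4`. -/
def matchP : Prog :=
  assign 12 (.len (.var 6 + 3)) ;; assign 13 0 ;;
  forLoop 12 (assign 30 (.get (.var 6 + 3) (.var 13)) ;; assign 31 (.var 6) ;; redP ;;
    assign 14 (.var 30) ;; assign 15 (.var 6 + 5 + .var 30 / .var 8) ;;
    assign 16 (.len (.var 15)) ;; assign 17 0 ;;
    forLoop 16 (assign 40 (.get (.var 15) (.var 17)) ;; assign 41 (.var 14) ;; xorP ;;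
      push (.var 6 + 4) (.var 42) ;; assign 17 (.var 17 + 1)) ;;
    assign 13 (.var 13 + 1))

theorem wp_match {p : Params} {K M X : ℕ} (f : Fits E p K M X) (hp : Par p h)
    {bs A B : List ℕ} (hbs : h.arr p.top = bs) (hB3 : h.arr (p.top + 3) = B)
    (hk : ∀ k, h.arr (p.top + 5 + k) = bucketN p.P bs A k)
    (hbl : bs.length ≤ 2 * p.n) (hbM : ∀ b ∈ bs, b < 2 ^ M) (hAM : ∀ b ∈ A, b < 2 ^ M)
    (hBM : ∀ b ∈ B, b < 2 ^ M) (hXA : A.length ≤ X)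
    (hX : B.length ≤ X) (hXm : (matchN p.P bs A B).length ≤ X) (hemp : h.arr (p.top + 4) = [])
    (hQ : ∀ h' : VState, (∀ y < 12, h'.var y = h.var y) →
      h'.arr = Function.update h.arr (p.top + 4) (matchN p.P bs A B) →
      h'.clk ≤ h.clk + 600 * (M + 1) * (X + 1) * (2 * p.n + 1) → Q h') :
    WP E matchP Q h := by
  have hB := f.hB
  have hMK := f.hMK
  have hn := f.hn
  have htop := f.htop
  have hXK := f.hX
  have hKE := f.hK
  have hME := f.hM
  have hM0 : 0 < 2 ^ M := by positivity
  have hE0 : E.B ≠ 0 := by omega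
  unfold matchP
  refine wp_seq (wp_assign ?_ (wp_seq (wp_assign (by simp) ?_)))
  · simp [hp.top]
    constructorm* _ ∧ _ <;> first | omega | exact addr_lt f.hK f.hc (by omega) (by omega)
  refine wp_for (fun i h' => (∀ y < 12, h'.var y = h.var y) ∧
      h'.arr = Function.update h.arr (p.top + 4) (matchN p.P bs A (B.take i)) ∧ h'.var 13 = i ∧
      h'.clk ≤ h.clk + 40 + (150 * (M + 1) * (2 * p.n + 1) + 150) * i +
        (60 * (M + 1) + 150) * (matchN p.P bs A (B.take i)).length) (by omega)
    (k := B.length) (by simp [hp.top, hB3]) ?_ ?_ ?_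
  · refine ⟨fun y hy => ?_, ?_, by simp, by simp [matchN]⟩
    · simp only [VState.set_var]
      rw [if_neg (by omega), if_neg (by omega)]
    · simp [matchN, hemp]
  · rintro i hi g ⟨e1, e2, e4, e5⟩ hx' -
    have gp := hp.congr e1
    have gB : g.arr (p.top + 3) = B := by rw [e2, Function.update_of_ne (by omega), hB3]
    have gb : g.arr p.top = bs := by rw [e2, Function.update_of_ne (by omega), hbs]
    have hy : B.getD i 0 < 2 ^ M := hBM _ (getD_mem hi)
    have hr := (redN_le bs (B.getD i 0)).trans_lt hy
    have hms := matchN_take_succ p.P bs A B i hi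
    have hml := matchN_length_mono p.P bs A B (i + 1)
    rw [hms] at hml
    set z := redN bs (B.getD i 0) with hz
    have hzk : z / p.P < p.S := by
      rw [Nat.div_lt_iff_lt_mul f.hP, mul_comm, f.hPS]; exact hr
    have hz0 := Nat.zero_le (z / p.P)
    have gk : g.arr (p.top + 5 + z / p.P) = bucketN p.P bs A (z / p.P) := by
      rw [e2, Function.update_of_ne (by omega), hk]
    set bk := bucketN p.P bs A (z / p.P) with hbk
    have hbkM : ∀ y ∈ bk, y < 2 ^ M := bucketN_lt hAM _
    have hbkl : bk.length ≤ A.length := bucketN_length_le _ _ _ _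
    set old := matchN p.P bs A (B.take i) with hold
    simp only [List.length_append, List.length_map] at hml
    refine wp_seq (wp_assign ?_ (wp_seq (wp_assign (by simp) (wp_seq
      (wp_red f.hK f.hc f.hM (L := 2 * p.n) (x := B.getD i 0) (id := p.top) ?_ ?_ hy (by omega)
        (by simpa [gb] using hbM) (by simpa [gb] using hbl) (by omega) ?_)))))
    · simp [gp.top, e4]
      constructorm* _ ∧ _ <;> first | omega | exact addr_lt f.hK f.hc (by omega) (by omega)
    · simp [gp.top, e4, gB]
    · simp [gp.top]
    intro g' a1 a2 a3 a4
    simp at a1 a4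
    simp only [VState.set_arr, VState.tick_arr, gb, ← hz] at a3
    have bl : ∀ y < 12, g'.var y = h.var y := by
      intro y hy
      rw [a2 _ (by omega)]
      simp only [VState.set_var, VState.tick_var]
      rw [if_neg (by omega), if_neg (by omega), e1 y hy]
    have gp' := hp.congr bl
    have b12 : g'.var 12 = B.length - i := by rw [a2 _ (by omega)]; simpa using hx'
    have b13 : g'.var 13 = i := by rw [a2 _ (by omega)]; simpa using e4
    refine wp_seq (wp_assign (by simp) (wp_seq (wp_assign ?_ (wp_seq (wp_assign ?_ (wp_seq
      (wp_assign (by simp) (wp_seq ?_))))))))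
    · simp [gp'.top, gp'.P, a3]
      constructorm* _ ∧ _ <;> omega
    · simp [gp'.top, gp'.P, a3]
      exact addr_lt f.hK f.hc (by omega) (by omega)
    refine wp_for (fun j h' => (∀ y < 12, h'.var y = h.var y) ∧ h'.var 12 = B.length - i ∧
      h'.var 13 = i ∧ h'.var 14 = z ∧ h'.var 15 = p.top + 5 + z / p.P ∧ h'.var 17 = j ∧
      h'.arr = Function.update h.arr (p.top + 4) (old ++ (bk.take j).map (· ^^^ z)) ∧
      h'.clk ≤ g'.clk + 40 + (60 * (M + 1) + 100) * j) (by omega)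
      (k := bk.length) (by simp [gp'.top, gp'.P, a3, a1, gk]) ?_ ?_ ?_
    · simp [gp'.top, gp'.P, a3, a1, b12, b13, e2]
      intro y hy
      rw [if_neg (by omega), if_neg (by omega), if_neg (by omega), if_neg (by omega), bl y hy]
    · rintro j hj u ⟨c1, c12, c13, c14, c15, c17, c2, c3⟩ hu -
      have up := hp.congr c1
      have uk : u.arr (p.top + 5 + z / p.P) = bk := by
        rw [c2, Function.update_of_ne (by omega), hk]
      have hv : bk.getD j 0 < 2 ^ M := hbkM _ (getD_mem hj)
      refine wp_seq (wp_assign ?_ (wp_seq (wp_assign (by simp) (wp_seq (wp_xor (M := M) (by omega)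
        ?_ (by simpa [c14] using hr) ?_)))))
      · simp [c15, c17]
        exact addr_lt f.hK f.hc (by omega) (by omega)
      · simpa [c15, c17, uk] using hv
      intro u' d1 d2 d3 d4
      simp [c14, c15, c17, uk] at d3
      simp at d4
      simp only [VState.set_arr, VState.tick_arr] at d1
      have dl : ∀ y < 12, u'.var y = h.var y := by
        intro y hy
        rw [d2 _ (by omega)]
        simp only [VState.set_var, VState.tick_var]
        rw [if_neg (by omega), if_neg (by omega), c1 y hy]
      have up' := hp.congr dl
      have d12 : u'.var 12 = B.length - i := by rw [d2 _ (by omega)]; simpa using c12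
      have d13 : u'.var 13 = i := by rw [d2 _ (by omega)]; simpa using c13
      have d14 : u'.var 14 = z := by rw [d2 _ (by omega)]; simpa using c14
      have d15 : u'.var 15 = p.top + 5 + z / p.P := by rw [d2 _ (by omega)]; simpa using c15
      have d16 : u'.var 16 = bk.length - j := by rw [d2 _ (by omega)]; simpa using hu
      have d17 : u'.var 17 = j := by rw [d2 _ (by omega)]; simpa using c17
      refine wp_seq (wp_push ?_ (by simp) ?_ (wp_assign (by simp [d17]; omega) ?_))
      · simp [up'.top]; omega
      · simp only [eval_add, eval_var, eval_ofNat, up'.top, d1, c2, Function.update_self]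
        refine addr_lt f.hK f.hc (by omega) ?_
        simp only [List.length_append, List.length_map, List.length_take]
        omega
      · simp [up'.top, d12, d13, d14, d15, d16, d17, d3, d1, c2]
        refine ⟨?_, ?_, by rw [mul_add (60 * (M + 1) + 100)]; omega⟩
        · intro y hy
          rw [if_neg (by omega), if_neg (by omega), dl y hy]
        · rw [List.take_add_one]
          simp [List.getElem?_eq_getElem hj]
    · rintro u ⟨c1, c12, c13, c14, c15, c17, c2, c3⟩ hu
      refine wp_assign (by simp [c13]; omega) ?_
      simp [c12, c13]
      refine ⟨?_, ?_, ?_⟩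
      · intro y hy
        rw [if_neg (by omega), if_neg (by omega), c1 y hy]
      · rw [c2, hms]; simp
      · rw [hms, List.length_append, List.length_map]
        have s1 : (60 * (M + 1) + 150) * (old.length + bk.length) = (60 * (M + 1) + 150) * old.length
          + (60 * (M + 1) + 100) * bk.length + 50 * bk.length := by ring
        rw [mul_add (150 * (M + 1) * (2 * p.n + 1) + 150), s1]
        omega
  · rintro g ⟨e1, e2, e4, e5⟩ -
    refine hQ _ e1 (by simpa using e2) ?_
    simp only [VState.tick_clk, List.take_length] at e5 ⊢
    have h1 : (150 * (M + 1) * (2 * p.n + 1) + 150) * B.length ≤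
      (150 * (M + 1) * (2 * p.n + 1) + 150) * X := Nat.mul_le_mul_left _ (by omega)
    have h2 : (60 * (M + 1) + 150) * (matchN p.P bs A B).length ≤
      (60 * (M + 1) + 150) * X := Nat.mul_le_mul_left _ (by omega)
    nlinarith [Nat.zero_le (M * p.n), Nat.zero_le (M * p.n * X), Nat.zero_le (p.n * X),
      Nat.zero_le (M * X)]

/-- Array `top + 4` is extended by all vectors in array `top + 1`. -/
def kerP : Prog :=
  assign 12 (.len (.var 6 + 1)) ;; assign 13 0 ;;
  forLoop 12 (assign 20 (.var 6 + 4) ;; assign 21 (.get (.var 6 + 1) (.var 13)) ;;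
    assign 22 (.var 0) ;; extP ;; assign 13 (.var 13 + 1))

theorem wp_ker {p : Params} {K M X : ℕ} (f : Fits E p K M X) (hp : Par p h)
    {ks C : List ℕ} (hks : h.arr (p.top + 1) = ks) (hC : h.arr (p.top + 4) = C)
    (hkl : ks.length ≤ 2 * p.n) (hkM : ∀ b ∈ ks, b < 2 ^ M) (hCM : ∀ b ∈ C, b < 2 ^ M)
    (hX : (ks.foldl (extN p.P p.n) C).length ≤ X)
    (hQ : ∀ h' : VState, (∀ y < 12, h'.var y = h.var y) →
      h'.arr = Function.update h.arr (p.top + 4) (ks.foldl (extN p.P p.n) C) →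
      h'.clk ≤ h.clk + 500 * (M + 1) * (X + 1) * (2 * p.n + 1) → Q h') :
    WP E kerP Q h := by
  have hB := f.hB
  have hMK := f.hMK
  have hn := f.hn
  have htop := f.htop
  have hXK := f.hX
  have hKE := f.hK
  have hME := f.hM
  have hM0 : 0 < 2 ^ M := by positivity
  have hE0 : E.B ≠ 0 := by omega
  unfold kerP
  refine wp_seq (wp_assign ?_ (wp_seq (wp_assign (by simp) ?_)))
  · simp [hp.top]
    constructorm* _ ∧ _ <;> first | omega | exact addr_lt f.hK f.hc (by omega) (by omega)
  refine wp_for (fun i h' => (∀ y < 12, h'.var y = h.var y) ∧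
      h'.arr = Function.update h.arr (p.top + 4) ((ks.take i).foldl (extN p.P p.n) C) ∧
      h'.var 13 = i ∧ h'.clk ≤ h.clk + 40 + (300 * (M + 1) * (X + 1) + 100) * i) (by omega)
    (k := ks.length) (by simp [hp.top, hks]) ?_ ?_ ?_
  · simp [← hC]
    intro y hy
    rw [if_neg (by omega), if_neg (by omega)]
  · rintro i hi g ⟨e1, e2, e4, e5⟩ hx' -
    have gp := hp.congr e1
    have gk : g.arr (p.top + 1) = ks := by rw [e2, Function.update_of_ne (by omega), hks]
    have hv : ks.getD i 0 < 2 ^ M := hkM _ (getD_mem hi)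
    have hlen : ((ks.take i).foldl (extN p.P p.n) C).length ≤ X := by
      refine le_trans ?_ hX
      conv_rhs => rw [← List.take_append_drop i ks, List.foldl_append]
      exact le_length_foldl_extN _ _ _ _
    have hlt := foldl_extN_lt (P := p.P) (W := p.n) (ks.take i)
      (fun v hv => hkM v (List.mem_of_mem_take hv)) C hCM
    refine wp_seq (wp_assign ?_ (wp_seq (wp_assign ?_ (wp_seq (wp_assign (by simp) (wp_seq
      (wp_ext f.hK f.hc f.hM (id := p.top + 4) (v := ks.getD i 0) (P := p.P) (W := p.n)
        (A := (ks.take i).foldl (extN p.P p.n) C)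
        ?_ ?_ ?_ ?_ ?_ hv (by omega) hlt (by omega) ?_)))))))
    · simp [gp.top]; omega
    · simp [gp.top, e4]
      constructorm* _ ∧ _ <;> first | omega | exact addr_lt f.hK f.hc (by omega) (by omega)
    · simp [gp.top]
    · simp [gp.top, e4, gk]
    · simp [gp.n]
    · simp [gp.P]
    · simp [e2]
    intro g' a1 a2 a3
    simp at a3
    simp only [VState.set_arr, VState.tick_arr] at a1
    have bl : ∀ y < 12, g'.var y = h.var y := by
      intro y hy
      rw [a2 _ (by omega)]
      simp only [VState.set_var, VState.tick_var]
      rw [if_neg (by omega), if_neg (by omega), if_neg (by omega), e1 y hy]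
    have b12 : g'.var 12 = ks.length - i := by rw [a2 _ (by omega)]; simpa using hx'
    have b13 : g'.var 13 = i := by rw [a2 _ (by omega)]; simpa using e4
    refine wp_assign (by simp [b13]; omega) ?_
    simp [b12, b13]
    refine ⟨?_, ?_, ?_⟩
    · intro y hy
      rw [if_neg (by omega), if_neg (by omega), bl y hy]
    · have htk : ks.take (i + 1) = ks.take i ++ [ks.getD i 0] := by
        rw [List.take_add_one]
        simp [List.getD, List.getElem?_eq_getElem hi]
      rw [a1, e2, htk, List.foldl_append]
      simp
    · have := Nat.mul_le_mul_left (300 * (M + 1)) (Nat.add_le_add_right hlen 1)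
      rw [mul_add (300 * (M + 1) * (X + 1) + 100)]
      omega
  · rintro g ⟨e1, e2, e4, e5⟩ -
    refine hQ _ e1 (by simpa using e2) ?_
    simp only [VState.tick_clk] at e5 ⊢
    have h1 : (300 * (M + 1) * (X + 1) + 100) * ks.length ≤
      (300 * (M + 1) * (X + 1) + 100) * (2 * p.n) := Nat.mul_le_mul_left _ (by omega)
    nlinarith [Nat.zero_le (M * p.n), Nat.zero_le (M * p.n * X), Nat.zero_le (p.n * X),
      Nat.zero_le (M * X)]

/-- The test whether `e` is an error of weight at most `d` that is not reduced to zero modulo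
`R`. -/
def goodN (P d : ℕ) (R : List ℕ) (e : ℕ) : Bool :=
  decide (wt4 (e % P) ≤ d) && decide (redN R e ≠ 0)

/-- Variable `7` is set to `1` if some vector in array `top + 4` passes the test `goodN`. -/
def testP : Prog :=
  assign 12 (.len (.var 6 + 4)) ;; assign 13 0 ;;
  forLoop 12 (assign 14 (.get (.var 6 + 4) (.var 13)) ;;
    assign 50 (.var 14 - .var 14 / .var 8 * .var 8) ;; wtP ;; assign 15 (.var 51 - .var 2) ;;
    assign 30 (.var 14) ;; assign 31 1 ;; redP ;;
    .ite (2 * 15) .skip (.ite (2 * 30) (assign 7 1) .skip) ;;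
    assign 13 (.var 13 + 1))

theorem Par.congr_ne {p : Params} {h h' : VState} (hp : Par p h)
    (hl : ∀ y < 12, y ≠ 7 → h'.var y = h.var y) : Par p h' := by
  constructor
  · rw [hl _ (by omega) (by omega), hp.n]
  · rw [hl _ (by omega) (by omega), hp.d]
  · rw [hl _ (by omega) (by omega), hp.a]
  · rw [hl _ (by omega) (by omega), hp.x]
  · rw [hl _ (by omega) (by omega), hp.w]
  · rw [hl _ (by omega) (by omega), hp.top]
  · rw [hl _ (by omega) (by omega), hp.P]
  · rw [hl _ (by omega) (by omega), hp.t]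
  · rw [hl _ (by omega) (by omega), hp.S]

theorem wp_test {p : Params} {K M X : ℕ} (f : Fits E p K M X) (hp : Par p h)
    {R C : List ℕ} (hR : h.arr 1 = R) (hC : h.arr (p.top + 4) = C)
    (hRl : R.length ≤ 2 * p.n) (hRM : ∀ b ∈ R, b < 2 ^ M) (hCM : ∀ b ∈ C, b < 2 ^ M)
    (hX : C.length ≤ X)
    (hQ : ∀ h' : VState, (∀ y < 12, y ≠ 7 → h'.var y = h.var y) → h'.arr = h.arr →
      h'.var 7 = (if C.any (goodN p.P p.d R) then 1 else h.var 7) →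
      h'.clk ≤ h.clk + 600 * (M + 1) * (X + 1) * (2 * p.n + 1) → Q h') :
    WP E testP Q h := by
  have hB := f.hB
  have hMK := f.hMK
  have hn := f.hn
  have htop := f.htop
  have hXK := f.hX
  have hKE := f.hK
  have hME := f.hM
  have hM0 : 0 < 2 ^ M := by positivity
  have hE0 : E.B ≠ 0 := by omega
  unfold testP
  refine wp_seq (wp_assign ?_ (wp_seq (wp_assign (by simp) ?_)))
  · simp [hp.top]
    constructorm* _ ∧ _ <;> first | omega | exact addr_lt f.hK f.hc (by omega) (by omega)
  refine wp_for (fun i h' => (∀ y < 12, y ≠ 7 → h'.var y = h.var y) ∧ h'.arr = h.arr ∧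
      h'.var 13 = i ∧ h'.var 7 = (if (C.take i).any (goodN p.P p.d R) then 1 else h.var 7) ∧
      h'.clk ≤ h.clk + 40 + (60 * (M + 1) + 150 * (M + 1) * (2 * p.n + 1) + 150) * i) (by omega)
    (k := C.length) (by simp [hp.top, hC]) ?_ ?_ ?_
  · simp
    intro y hy _
    rw [if_neg (by omega), if_neg (by omega)]
  · rintro i hi g ⟨e1, e2, e4, e7, e5⟩ hx' -
    have gp := hp.congr_ne e1
    have gC : g.arr (p.top + 4) = C := by rw [e2, hC]
    have hv : C.getD i 0 < 2 ^ M := hCM _ (getD_mem hi)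
    have htake : (C.take (i + 1)).any (goodN p.P p.d R) =
        ((C.take i).any (goodN p.P p.d R) || goodN p.P p.d R (C.getD i 0)) := by
      rw [List.take_add_one, List.any_append]
      simp [List.getD, List.getElem?_eq_getElem hi]
    set v := C.getD i 0 with hve
    have hmod : v - v / p.P * p.P = v % p.P := by rw [Nat.mod_eq_sub_div_mul]
    have hmodle : v % p.P ≤ v := Nat.mod_le _ _
    have hdivle : v / p.P ≤ v := Nat.div_le_self _ _
    have hdm : v / p.P * p.P ≤ v := Nat.div_mul_le_self _ _
    have gget : (g.arr (p.top + 4)).getD i 0 = v := by rw [gC]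
    refine wp_seq (wp_assign ?_ (wp_seq (wp_assign ?_ (wp_seq (wp_wt (M := M) (by omega)
      ?_ ?_)))))
    · simp [gp.top, e4]
      constructorm* _ ∧ _ <;> first | omega | exact addr_lt f.hK f.hc (by omega) (by omega)
    · simp [gp.top, e4, gget, gp.P, hmod, -tsub_le_iff_right, -List.getD_eq_getElem?_getD]; omega
    · simp [gp.top, e4, gget, gp.P, hmod, -List.getD_eq_getElem?_getD]; omega
    intro g' a1 a2 a3 a4
    simp at a4
    simp only [VState.set_arr, VState.tick_arr] at a1
    simp [gp.top, e4, gget, gp.P, hmod, -List.getD_eq_getElem?_getD] at a3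
    have bl : ∀ y < 12, g'.var y = g.var y := by
      intro y hy
      rw [a2 _ (by omega)]
      simp only [VState.set_var, VState.tick_var]
      rw [if_neg (by omega), if_neg (by omega)]
    have gp' := gp.congr bl
    have b12 : g'.var 12 = C.length - i := by rw [a2 _ (by omega)]; simpa using hx'
    have b13 : g'.var 13 = i := by rw [a2 _ (by omega)]; simpa using e4
    have b14 : g'.var 14 = v := by
      rw [a2 _ (by omega)]; simp [gp.top, e4, gget, -List.getD_eq_getElem?_getD]
    have hwle := wt4_le_self (v % p.P)
    refine wp_seq (wp_assign ?_ (wp_seq (wp_assign (by simp) (wp_seq (wp_assign (by simp [hE0]) (wp_seq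
      (wp_red f.hK f.hc f.hM (L := 2 * p.n) (x := v) (id := 1) ?_ ?_ hv (by omega)
        (by simpa [a1, e2, hR] using hRM) (by simpa [a1, e2, hR] using hRl) (by omega) ?_)))))))
    · simp [a3, gp'.d, -tsub_le_iff_right]; omega
    · simp [b14]
    · simp
    intro g'' c1 c2 c3 c4
    simp at c4
    simp only [VState.set_arr] at c1 c3
    rw [a1, e2, hR] at c3
    have cl : ∀ y < 12, g''.var y = g.var y := by
      intro y hy
      rw [c2 _ (by omega)]
      simp only [VState.set_var]
      rw [if_neg (by omega), if_neg (by omega), if_neg (by omega), bl y hy]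
    have c12 : g''.var 12 = C.length - i := by rw [c2 _ (by omega)]; simpa using b12
    have c13 : g''.var 13 = i := by rw [c2 _ (by omega)]; simpa using b13
    have c15 : g''.var 15 = wt4 (v % p.P) - p.d := by
      rw [c2 _ (by omega)]; simp [a3, gp'.d]
    have c7 := cl 7 (by omega)
    rw [e7] at c7
    have harr : g''.arr = h.arr := by rw [c1, a1, e2]
    have hlow : ∀ y < 12, y ≠ 7 → g''.var y = h.var y := by
      intro y hy h7
      rw [cl y hy, e1 y hy h7]
    refine wp_seq (wp_ite ?_ ?_)
    · intro hne
      rw [c15] at hne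
      refine wp_skip (wp_assign (by simp [c13]; omega) ?_)
      refine ⟨by simp [c12], fun y hy h7 => ?_, by simp [harr], by simp [c13], ?_, ?_⟩
      · simp only [VState.set_var, VState.tick_var]
        rw [if_neg (by omega), if_neg (by omega), hlow y hy h7]
      · have : goodN p.P p.d R v = false := by
          simp only [goodN, Bool.and_eq_false_iff, decide_eq_false_iff_not]
          left; omega
        rw [htake, this, Bool.or_false]; simpa using c7
      · simp only [VState.set_clk, VState.tick_clk, ops_add, ops_var, ops_ofNat]
        rw [mul_add (60 * (M + 1) + 150 * (M + 1) * (2 * p.n + 1) + 150)]; omega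
    · intro hne
      rw [c15] at hne
      refine wp_ite ?_ ?_
      · intro h30
        simp only [VState.tick_var] at h30
        rw [c3] at h30
        refine wp_assign (by simp; omega) (wp_assign (by simp [c13]; omega) ?_)
        refine ⟨by simp [c12], fun y hy h7 => ?_, by simp [harr], by simp [c13], ?_, ?_⟩
        · simp only [VState.set_var, VState.tick_var]
          rw [if_neg (by omega), if_neg (by omega), if_neg (by omega), hlow y hy h7]
        · have : goodN p.P p.d R v = true := by
            simp only [goodN, Bool.and_eq_true, decide_eq_true_eq]
            exact ⟨by omega, h30⟩
          rw [htake, this, Bool.or_true, if_pos rfl]; simp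
        · simp only [VState.set_clk, VState.tick_clk, ops_add, ops_var, ops_ofNat]
          rw [mul_add (60 * (M + 1) + 150 * (M + 1) * (2 * p.n + 1) + 150)]; omega
      · intro h30
        simp only [VState.tick_var] at h30
        rw [c3] at h30
        refine wp_skip (wp_assign (by simp [c13]; omega) ?_)
        refine ⟨by simp [c12], fun y hy h7 => ?_, by simp [harr], by simp [c13], ?_, ?_⟩
        · simp only [VState.set_var, VState.tick_var]
          rw [if_neg (by omega), if_neg (by omega), hlow y hy h7]
        · have : goodN p.P p.d R v = false := by
            simp only [goodN, Bool.and_eq_false_iff, decide_eq_false_iff_not]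
            right; simpa using h30
          rw [htake, this, Bool.or_false]; simpa using c7
        · simp only [VState.set_clk, VState.tick_clk, ops_add, ops_var, ops_ofNat]
          rw [mul_add (60 * (M + 1) + 150 * (M + 1) * (2 * p.n + 1) + 150)]; omega
  · rintro g ⟨e1, e2, e4, e7, e5⟩ -
    refine hQ _ e1 (by simpa using e2) (by simpa using e7) ?_
    simp only [VState.tick_clk] at e5 ⊢
    have h1 : (60 * (M + 1) + 150 * (M + 1) * (2 * p.n + 1) + 150) * C.length ≤
      (60 * (M + 1) + 150 * (M + 1) * (2 * p.n + 1) + 150) * X := Nat.mul_le_mul_left _ (by omega)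
    nlinarith [Nat.zero_le (M * p.n), Nat.zero_le (M * p.n * X), Nat.zero_le (p.n * X),
      Nat.zero_le (M * X)]

end

section

variable {E : Env} {Q : VState → Prop} {h : VState}

/-! ### One round -/

/-- The basis of the columns outside the window, and the relations among these columns. -/
def baseN (p : Params) (G : List ℕ) : List ℕ × List ℕ :=
  (colsN G ((List.range (p.n - 2 * p.w)).map p.out)).foldl (insN p.P) ([], [])

/-- The candidates that are examined in one round. -/
def candN (p : Params) (G : List ℕ) : List ℕ :=
  (baseN p G).2.foldl (extN p.P p.n)
    (matchN p.P (baseN p G).1 (sideN p G 0 p.w) (sideN p G p.w p.w))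

/-- One round of the search. It uses the empty arrays from `top` on: `top` and `top + 1` for the
basis and the relations of the columns outside the window, `top + 2` and `top + 3` for the lists of
the two halves, `top + 4` for the candidates, and the following `S` arrays as buckets. Afterwards
`top` moves on, so that the next round finds empty arrays again. -/
def roundP : Prog :=
  colsP ;; assign 15 0 ;; assign 16 (.var 6 + 2) ;; sideP ;; assign 15 (.var 5) ;;
  assign 16 (.var 6 + 3) ;; sideP ;; bucketP ;; matchP ;; kerP ;; testP ;;
  assign 6 (.var 6 + 5 + .var 10)

theorem bucketN_eq_nil {p : Params} {M : ℕ} (hP : 0 < p.P) (hPS : p.P * p.S = 2 ^ M)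
    {bs A : List ℕ} (hA : ∀ y ∈ A, y < 2 ^ M) {k : ℕ} (hk : p.S ≤ k) :
    bucketN p.P bs A k = [] := by
  rw [List.eq_nil_iff_forall_not_mem]
  intro z hz
  simp only [bucketN, List.mem_filter, List.mem_map, decide_eq_true_eq] at hz
  obtain ⟨⟨y, hy, rfl⟩, hk'⟩ := hz
  have : redN bs y / p.P < p.S := by
    rw [Nat.div_lt_iff_lt_mul hP, mul_comm, hPS]
    exact (redN_le _ _).trans_lt (hA y hy)
  omega

theorem wp_round {p : Params} {K M X : ℕ} (f : Fits E p K M X) (hp : Par p h)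
    {G R : List ℕ} (hG : ∀ g ∈ G, g < 2 ^ M) (hRM : ∀ b ∈ R, b < 2 ^ M)
    (hRl : R.length ≤ 2 * p.n) (h0 : h.arr 0 = G) (h1 : h.arr 1 = R) (ht : 3 ≤ p.top)
    (hemp : ∀ id, p.top ≤ id → h.arr id = [])
    (hX1 : (sideN p G 0 p.w).length ≤ X) (hX2 : (sideN p G p.w p.w).length ≤ X)
    (hX3 : (candN p G).length ≤ X)
    (hQ : ∀ h' : VState, (∀ y < 12, y ≠ 6 → y ≠ 7 → h'.var y = h.var y) →
      h'.var 6 = p.top + 5 + p.S →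
      h'.var 7 = (if (candN p G).any (goodN p.P p.d R) then 1 else h.var 7) →
      h'.arr 0 = G → h'.arr 1 = R → (∀ id, p.top + 5 + p.S ≤ id → h'.arr id = []) →
      h'.clk ≤ h.clk + 6000 * ((M + 1) * (X + 1) * (2 * p.n + 1) * (p.n + 1)) → Q h') :
    WP E roundP Q h := by
  have hB := f.hB
  have hMK := f.hMK
  have htop := f.htop
  have hM0 : 0 < 2 ^ M := by positivity
  have hX : 1 ≤ X := by
    refine le_trans ?_ hX1
    exact le_length_foldl_extN p.P p.t _ [0]
  have hbl := foldl_insN_length p.P (colsN G ((List.range (p.n - 2 * p.w)).map p.out)) ([], [])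
  have hbM := foldl_insN_lt (D := p.P) _ (colsN_lt hM0 hG ((List.range (p.n - 2 * p.w)).map p.out))
    ([], []) (by simp) (by simp)
  rw [colsN_length] at hbl
  simp only [List.length_nil, List.length_map, List.length_range, zero_add] at hbl
  change (baseN p G).1.length ≤ _ ∧ (baseN p G).2.length ≤ _ at hbl
  change (∀ v ∈ (baseN p G).1, _) ∧ (∀ v ∈ (baseN p G).2, _) at hbM
  have hA : ∀ y ∈ sideN p G 0 p.w, y < 2 ^ M := foldl_extN_lt _ (colsN_lt hM0 hG _) _ (by simp)
  have hA' : ∀ y ∈ sideN p G p.w p.w, y < 2 ^ M :=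
    foldl_extN_lt _ (colsN_lt hM0 hG _) _ (by simp)
  have hmM := matchN_lt (P := p.P) (bs := (baseN p G).1) hA hA'
  have hcM : ∀ y ∈ candN p G, y < 2 ^ M := foldl_extN_lt _ hbM.2 _ hmM
  have hml := (le_length_foldl_extN p.P p.n (baseN p G).2
    (matchN p.P (baseN p G).1 (sideN p G 0 p.w) (sideN p G p.w p.w))).trans hX3
  unfold roundP
  refine wp_seq (wp_cols f hp hG h0 (by omega) (hemp _ le_rfl) (hemp _ (by omega)) ?_)
  intro g₁ l₁ a₁ c₁
  have p₁ := hp.congr l₁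
  change g₁.arr = Function.update (Function.update h.arr p.top (baseN p G).1) (p.top + 1)
    (baseN p G).2 at a₁
  refine wp_seq (wp_assign (by simp) (wp_seq (wp_assign (by simp [p₁.top]; omega) (wp_seq ?_))))
  refine wp_side f (p := p) (G := G) (s := 0) (id := p.top + 2) (X := X)
    (p₁.congr fun y hy => ?_) hG ?_ (by omega) (by simp) (by simp [p₁.top]) (by omega) (by omega)
    ?_ hX1 ?_
  · simp only [VState.set_var]; rw [if_neg (by omega), if_neg (by omega)]
  · simp only [VState.set_arr, a₁]
    rw [Function.update_of_ne (by omega), Function.update_of_ne (by omega), h0]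
  · simp only [VState.set_arr, a₁]
    rw [Function.update_of_ne (by omega), Function.update_of_ne (by omega), hemp _ (by omega)]
  intro g₂ l₂ a₂ c₂
  simp only [VState.set_arr] at a₂
  simp only [VState.set_clk, ops_add, ops_var, ops_ofNat] at c₂
  replace l₂ : ∀ y < 12, g₂.var y = h.var y := by
    intro y hy
    rw [l₂ y hy]; simp only [VState.set_var]; rw [if_neg (by omega), if_neg (by omega), l₁ y hy]
  have p₂ := hp.congr l₂
  refine wp_seq (wp_assign (by simp) (wp_seq (wp_assign (by simp [p₂.top]; omega) (wp_seq ?_))))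
  refine wp_side f (p := p) (G := G) (s := p.w) (id := p.top + 3) (X := X)
    (p₂.congr fun y hy => ?_) hG ?_ (by omega) (by simp [p₂.w]) (by simp [p₂.top]) (by omega)
    (by omega) ?_ hX2 ?_
  · simp only [VState.set_var]; rw [if_neg (by omega), if_neg (by omega)]
  · simp only [VState.set_arr, a₂, a₁]
    rw [Function.update_of_ne (by omega), Function.update_of_ne (by omega),
      Function.update_of_ne (by omega), h0]
  · simp only [VState.set_arr, a₂, a₁]
    rw [Function.update_of_ne (by omega), Function.update_of_ne (by omega),
      Function.update_of_ne (by omega), hemp _ (by omega)]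
  intro g₃ l₃ a₃ c₃
  simp only [VState.set_arr] at a₃
  simp only [VState.set_clk, ops_add, ops_var, ops_ofNat] at c₃
  replace l₃ : ∀ y < 12, g₃.var y = h.var y := by
    intro y hy
    rw [l₃ y hy]; simp only [VState.set_var]; rw [if_neg (by omega), if_neg (by omega), l₂ y hy]
  have p₃ := hp.congr l₃
  rw [a₂, a₁] at a₃
  have t0 : g₃.arr p.top = (baseN p G).1 := by
    rw [a₃, Function.update_of_ne (by omega), Function.update_of_ne (by omega),
      Function.update_of_ne (by omega), Function.update_self]
  have t1 : g₃.arr (p.top + 1) = (baseN p G).2 := by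
    rw [a₃, Function.update_of_ne (by omega), Function.update_of_ne (by omega),
      Function.update_self]
  have t2 : g₃.arr (p.top + 2) = sideN p G 0 p.w := by
    rw [a₃, Function.update_of_ne (by omega), Function.update_self]
  have t3 : g₃.arr (p.top + 3) = sideN p G p.w p.w := by
    rw [a₃, Function.update_self]
  have t4 : ∀ id, p.top + 4 ≤ id → g₃.arr id = [] := by
    intro id hid
    rw [a₃, Function.update_of_ne (by omega), Function.update_of_ne (by omega),
      Function.update_of_ne (by omega), Function.update_of_ne (by omega), hemp _ (by omega)]
  have t5 : ∀ id < p.top, g₃.arr id = h.arr id := by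
    intro id hid
    rw [a₃, Function.update_of_ne (by omega), Function.update_of_ne (by omega),
      Function.update_of_ne (by omega), Function.update_of_ne (by omega)]
  refine wp_seq (wp_bucket f p₃ t0 t2 (by omega) hbM.1 hA hX1 (fun id hid => t4 id (by omega)) ?_)
  intro g₄ l₄ a₄ k₄ c₄
  replace l₄ : ∀ y < 12, g₄.var y = h.var y := fun y hy => by rw [l₄ y hy, l₃ y hy]
  refine wp_seq (wp_match f (hp.congr l₄) (by rw [a₄ _ (by omega), t0])
    (by rw [a₄ _ (by omega), t3]) k₄ (by omega) hbM.1 hA hA' hX1 hX2 hml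
    (by rw [a₄ _ (by omega), t4 _ le_rfl]) ?_)
  intro g₅ l₅ a₅ c₅
  replace l₅ : ∀ y < 12, g₅.var y = h.var y := fun y hy => by rw [l₅ y hy, l₄ y hy]
  refine wp_seq (wp_ker f (X := X) (hp.congr l₅) (ks := (baseN p G).2)
    (by rw [a₅, Function.update_of_ne (by omega), a₄ _ (by omega), t1])
    (by rw [a₅, Function.update_self]) (by omega) hbM.2 hmM hX3 ?_)
  intro g₆ l₆ a₆ c₆
  change g₆.arr = Function.update g₅.arr (p.top + 4) (candN p G) at a₆
  replace l₆ : ∀ y < 12, g₆.var y = h.var y := fun y hy => by rw [l₆ y hy, l₅ y hy]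
  rw [a₅] at a₆
  refine wp_seq (wp_test f (X := X) (hp.congr l₆) (R := R) (C := candN p G)
    (by rw [a₆, Function.update_of_ne (by omega), Function.update_of_ne (by omega),
      a₄ _ (by omega), t5 _ (by omega), h1])
    (by rw [a₆, Function.update_self]) hRl hRM hcM hX3 ?_)
  intro g₇ l₇ a₇ v₇ c₇
  replace l₇ : ∀ y < 12, y ≠ 7 → g₇.var y = h.var y := fun y hy h7 => by rw [l₇ y hy h7, l₆ y hy]
  have p₇ := hp.congr_ne l₇
  refine wp_assign (by simp [p₇.top, p₇.S]; omega) (hQ _ ?_ ?_ ?_ ?_ ?_ ?_ ?_)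
  · intro y hy h6 h7
    simp only [VState.set_var]
    rw [if_neg h6, l₇ y hy h7]
  · simp [p₇.top, p₇.S]
  · rw [l₆ 7 (by omega)] at v₇
    simpa using v₇
  · simp only [VState.set_arr]
    rw [a₇, a₆, Function.update_of_ne (by omega), Function.update_of_ne (by omega),
      a₄ _ (by omega), t5 _ (by omega), h0]
  · simp only [VState.set_arr]
    rw [a₇, a₆, Function.update_of_ne (by omega), Function.update_of_ne (by omega),
      a₄ _ (by omega), t5 _ (by omega), h1]
  · intro id hid
    simp only [VState.set_arr]
    rw [a₇, a₆, Function.update_of_ne (by omega), Function.update_of_ne (by omega)]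
    obtain ⟨k, rfl⟩ : ∃ k, id = p.top + 5 + k := ⟨id - (p.top + 5), by omega⟩
    rw [k₄, bucketN_eq_nil f.hP f.hPS hA (by omega)]
  · simp only [VState.set_clk, ops_add, ops_var, ops_ofNat]
    have b1 : (M + 1) * (2 * p.n + 1) * (p.n + 1) * 2 ≤
        (M + 1) * (2 * p.n + 1) * (p.n + 1) * (X + 1) := Nat.mul_le_mul_left _ (by omega)
    have b2 : (M + 1) * (X + 1) * (p.n + 1) * 1 ≤
        (M + 1) * (X + 1) * (p.n + 1) * (2 * p.n + 1) := Nat.mul_le_mul_left _ (by omega)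
    have b3 : (M + 1) * (X + 1) * (2 * p.n + 1) * 1 ≤
        (M + 1) * (X + 1) * (2 * p.n + 1) * (p.n + 1) := Nat.mul_le_mul_left _ (by omega)
    have e1 : 1000 * (M + 1) * (2 * p.n + 1) * (p.n + 1) =
      1000 * ((M + 1) * (2 * p.n + 1) * (p.n + 1)) := by ring
    have e2 : 1000 * (M + 1) * (X + 1) * (p.n + 1) =
      1000 * ((M + 1) * (X + 1) * (p.n + 1)) := by ring
    have e3 : ∀ c, c * (M + 1) * (X + 1) * (2 * p.n + 1) =
      c * ((M + 1) * (X + 1) * (2 * p.n + 1)) := by intro c; ring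
    have e4 : (M + 1) * (2 * p.n + 1) * (p.n + 1) * (X + 1) =
      (M + 1) * (X + 1) * (2 * p.n + 1) * (p.n + 1) := by ring
    have e5 : (M + 1) * (X + 1) * (p.n + 1) * (2 * p.n + 1) =
      (M + 1) * (X + 1) * (2 * p.n + 1) * (p.n + 1) := by ring
    have e6 : 0 < (M + 1) * (X + 1) * (2 * p.n + 1) * (p.n + 1) := by positivity
    rw [e3] at c₄ c₅ c₆ c₇
    rw [e1] at c₁
    rw [e2] at c₂ c₃
    generalize (M + 1) * (X + 1) * (2 * p.n + 1) * (p.n + 1) = Z at *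
    omega

end

section

variable {E : Env} {Q : VState → Prop} {h : VState}

/-! ### The loops over windows and target distances -/

open Classical in
/-- The number `1` or `0`, according as the proposition holds or not. -/
noncomputable def ind (Φ : Prop) : ℕ := if Φ then 1 else 0

theorem ite_ind {b : Bool} {Φ Ψ : Prop} (h : Ψ ↔ Φ ∨ b = true) :
    (if b = true then 1 else ind Φ) = ind Ψ := by
  classical
  unfold ind
  by_cases hb : b = true <;> by_cases hΦ : Φ <;> simp [h, hb, hΦ]

/-- The parameters of the round with window start `a`, rotation `x` and target distance `d`. Each
half of the window may carry slightly more than its share `d * w / n` of the weight. -/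
def prm (n w P S d a x top : ℕ) : Params := ⟨n, d, a, x, w, top, P, d * w / n + 1, S⟩

/-- All rounds for a given target distance: all starts and all rotations of the window. -/
def roundsP : Prog := assign 3 (.var 0) ;; forLoop 3 (assign 4 (2 * .var 5) ;; forLoop 4 roundP)

/-- The data that all rounds share, and their sizes. -/
structure Setup (E : Env) (n w P S K M X D : ℕ) (G R : List ℕ) : Prop where
  hK : 2 * K + 6 ≤ E.B
  hc : E.c < 2 ^ K
  hM : M ≤ K
  hn : 8 * n + 8 < 2 ^ K
  hX : 4 * X + 8 < 2 ^ K
  hn0 : 2 ≤ n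
  hw : 2 * w ≤ n
  hP : 0 < P
  hPS : P * S = 2 ^ M
  hDn : D ≤ n
  htop : 3 + n * (n * n * (5 + S)) + S + 8 < 2 ^ K
  hG : ∀ g ∈ G, g < 2 ^ M
  hRM : ∀ b ∈ R, b < 2 ^ M
  hRl : R.length ≤ 2 * n
  hX1 : ∀ d ≤ D, ∀ a x, (sideN (prm n w P S d a x 0) G 0 w).length ≤ X
  hX2 : ∀ d ≤ D, ∀ a x, (sideN (prm n w P S d a x 0) G w w).length ≤ X
  hX3 : ∀ d ≤ D, ∀ a x, (candN (prm n w P S d a x 0) G).length ≤ X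

/-- A round is successful if one of its candidates passes the test. -/
def Succ (n w P S : ℕ) (G R : List ℕ) (d a x : ℕ) : Prop :=
  (candN (prm n w P S d a x 0) G).any (goodN P d R) = true

/-- The state between two rounds: the arrays from `top` on are empty. -/
structure Ready (n w P S d top : ℕ) (G R : List ℕ) (h : VState) : Prop where
  vn : h.var 0 = n
  vd : h.var 2 = d
  vw : h.var 5 = w
  vtop : h.var 6 = top
  vP : h.var 8 = P
  vt : h.var 9 = d * w / n + 1
  vS : h.var 10 = S
  arr0 : h.arr 0 = G
  arr1 : h.arr 1 = R
  emp : ∀ id, top ≤ id → h.arr id = []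

theorem Ready.congr {n w P S d top top' : ℕ} {G R : List ℕ} {h h' : VState}
    (hr : Ready n w P S d top G R h) (hl : ∀ y < 12, y ≠ 3 → y ≠ 4 → y ≠ 6 → y ≠ 7 →
      h'.var y = h.var y) (h6 : h'.var 6 = top') (h0 : h'.arr 0 = G) (h1 : h'.arr 1 = R)
    (he : ∀ id, top' ≤ id → h'.arr id = []) : Ready n w P S d top' G R h' where
  vn := by rw [hl _ (by omega) (by omega) (by omega) (by omega) (by omega), hr.vn]
  vd := by rw [hl _ (by omega) (by omega) (by omega) (by omega) (by omega), hr.vd]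
  vw := by rw [hl _ (by omega) (by omega) (by omega) (by omega) (by omega), hr.vw]
  vtop := h6
  vP := by rw [hl _ (by omega) (by omega) (by omega) (by omega) (by omega), hr.vP]
  vt := by rw [hl _ (by omega) (by omega) (by omega) (by omega) (by omega), hr.vt]
  vS := by rw [hl _ (by omega) (by omega) (by omega) (by omega) (by omega), hr.vS]
  arr0 := h0
  arr1 := h1
  emp := he

theorem wp_rounds {n w P S K M X D d top : ℕ} {G R : List ℕ} {Φ : Prop}
    (f : Setup E n w P S K M X D G R) (hd : d ≤ D) (hr : Ready n w P S d top G R h)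
    (ht : 3 ≤ top) (htop : top + n * n * (5 + S) + S + 8 < 2 ^ K) (h7 : h.var 7 = ind Φ)
    (hQ : ∀ h' : VState, h'.var 11 = h.var 11 →
      Ready n w P S d (top + n * (2 * w * (5 + S))) G R h' →
      h'.var 7 = ind (Φ ∨ ∃ a < n, ∃ x < 2 * w, Succ n w P S G R d (n - a) (2 * w - x)) →
      h'.clk ≤ h.clk + 7000 * ((M + 1) * (X + 1) * (2 * n + 1) * (n + 1)) * (n + 1) * (n + 1) →
      Q h') :
    WP E roundsP Q h := by
  have hB : 64 * 2 ^ K ≤ 2 ^ E.B :=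
    calc 64 * 2 ^ K = 2 ^ (K + 6) := by ring
      _ ≤ _ := Nat.pow_le_pow_right (by omega) (by have := f.hK; omega)
  have hKE := f.hK
  have hE0 : E.B ≠ 0 := by omega
  have hn := f.hn
  have hw := f.hw
  have hn0 := f.hn0
  set Z := (M + 1) * (X + 1) * (2 * n + 1) * (n + 1) with hZ
  have hZ0 : 0 < Z := by positivity
  unfold roundsP
  refine wp_seq (wp_assign (by simp) ?_)
  refine wp_for (fun i h' => h'.var 11 = h.var 11 ∧
      Ready n w P S d (top + i * (2 * w * (5 + S))) G R h' ∧
      h'.var 7 = ind (Φ ∨ ∃ a < i, ∃ x < 2 * w, Succ n w P S G R d (n - a) (2 * w - x)) ∧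
      h'.clk ≤ h.clk + 10 + (6020 * Z * n + 40) * i) (by omega) (k := n) (by simp [hr.vn]) ?_ ?_ ?_
  · refine ⟨by simp, hr.congr ?_ (by simp [hr.vtop]) (by simp [hr.arr0]) (by simp [hr.arr1])
      (by simpa using hr.emp), by simp [h7], by simp⟩
    intro y _ h3 _ _ _
    simp [h3]
  · rintro i hi g ⟨e11, er, e7, ec⟩ h3 -
    refine wp_seq (wp_assign (by simp [er.vw]; omega) ?_)
    have hi1 : i * (2 * w * (5 + S)) + 2 * w * (5 + S) ≤ n * n * (5 + S) := by
      calc i * (2 * w * (5 + S)) + 2 * w * (5 + S) = (i + 1) * (2 * w) * (5 + S) := by ring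
        _ ≤ n * n * (5 + S) := Nat.mul_le_mul_right _ (Nat.mul_le_mul (by omega) hw)
    set top1 := top + i * (2 * w * (5 + S)) with htop1
    refine wp_for (fun j h' => h'.var 11 = h.var 11 ∧ h'.var 3 = n - i ∧
        Ready n w P S d (top1 + j * (5 + S)) G R h' ∧
        h'.var 7 = ind ((Φ ∨ ∃ a < i, ∃ x < 2 * w, Succ n w P S G R d (n - a) (2 * w - x)) ∨
          ∃ x < j, Succ n w P S G R d (n - i) (2 * w - x)) ∧
        h'.clk ≤ g.clk + 10 + (6000 * Z + 10) * j) (by omega) (k := 2 * w) (by simp [er.vw])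
        ?_ ?_ ?_
    · refine ⟨by simp [e11], by simp [h3], er.congr ?_ (by simp [er.vtop]) (by simp [er.arr0])
        (by simp [er.arr1]) (by simpa using er.emp), by simp [e7], by simp⟩
      intro y _ _ h4 _ _
      simp [h4]
    · rintro j hj u ⟨c11, c3, cr, c7, cc⟩ h4 -
      have hj1 : j * (5 + S) + (5 + S) ≤ 2 * w * (5 + S) := by
        calc j * (5 + S) + (5 + S) = (j + 1) * (5 + S) := by ring
          _ ≤ _ := Nat.mul_le_mul_right _ (by omega)
      set p := prm n w P S d (n - i) (2 * w - j) (top1 + j * (5 + S)) with hp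
      have hdw : d * w / n ≤ w := by
        rw [Nat.div_le_iff_le_mul_add_pred (by omega)]
        have := Nat.mul_le_mul_right w (hd.trans f.hDn)
        omega
      have F : Fits E p K M X := by
        refine ⟨f.hK, f.hc, f.hM, f.hn, f.hX, ?_, ?_, ?_, f.hw, f.hP, f.hPS, ?_, ?_⟩
        · change 0 < n; omega
        · change n - i ≤ n; omega
        · change 2 * w - j ≤ 2 * w; omega
        · change top1 + j * (5 + S) + S + 8 < 2 ^ K; omega
        · change d * w / n + 1 ≤ n; omega
      have HP : Par p (u.tick 1) :=
        ⟨cr.vn, cr.vd, c3, h4, cr.vw, cr.vtop, cr.vP, cr.vt, cr.vS⟩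
      refine wp_round F HP f.hG f.hRM f.hRl cr.arr0 cr.arr1 ?_ cr.emp
        (f.hX1 d hd (n - i) (2 * w - j)) (f.hX2 d hd (n - i) (2 * w - j))
        (f.hX3 d hd (n - i) (2 * w - j)) ?_
      · change 3 ≤ top1 + j * (5 + S); omega
      intro u' d1 d6 d7 d0 da de dc
      change u'.var 6 = top1 + j * (5 + S) + 5 + S at d6
      change ∀ id, top1 + j * (5 + S) + 5 + S ≤ id → u'.arr id = [] at de
      change u'.clk ≤ u.clk + 1 + 6000 * Z at dc
      have htt : top1 + j * (5 + S) + 5 + S = top1 + (j + 1) * (5 + S) := by ring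
      rw [htt] at d6 de
      refine ⟨by rw [d1 4 (by omega) (by omega) (by omega)]; exact h4, ?_, ?_, ?_, ?_, ?_⟩
      · simp [d1 11 (by omega) (by omega) (by omega), c11]
      · simp [d1 3 (by omega) (by omega) (by omega), c3]
      · refine cr.congr ?_ (by simpa using d6) (by simpa using d0) (by simpa using da)
          (by simpa using de)
        intro y hy h3 h4 h6 h7
        simp only [VState.set_var]
        rw [if_neg h4, d1 y hy h6 h7]; rfl
      · have : u.var 7 = (u.tick 1).var 7 := rfl
        rw [← this, c7] at d7
        simp only [VState.set_var]
        rw [if_neg (by omega), d7]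
        refine ite_ind ?_
        constructor
        · rintro (hΦ | ⟨x, hx, hs⟩)
          · exact .inl (.inl hΦ)
          · rcases Nat.lt_succ_iff_lt_or_eq.1 hx with hx | rfl
            · exact .inl (.inr ⟨x, hx, hs⟩)
            · exact .inr hs
        · rintro ((hΦ | ⟨x, hx, hs⟩) | hs)
          · exact .inl hΦ
          · exact .inr ⟨x, by omega, hs⟩
          · exact .inr ⟨j, by omega, hs⟩
      · simp only [VState.set_clk]
        rw [mul_add (6000 * Z + 10)]; omega
    · rintro u ⟨c11, c3, cr, c7, cc⟩ -
      have htt : top1 + 2 * w * (5 + S) = top + (i + 1) * (2 * w * (5 + S)) := by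
        rw [htop1]; ring
      rw [htt] at cr
      refine ⟨c3, by simp [c11], cr.congr ?_ (by simp [cr.vtop]) (by simp [cr.arr0])
        (by simp [cr.arr1]) (by simpa using cr.emp), ?_, ?_⟩
      · intro y _ h3 _ _ _
        simp [h3]
      · simp only [VState.set_var, VState.tick_var]
        rw [if_neg (by omega), c7]
        congr 1
        apply propext
        constructor
        · rintro ((hΦ | ⟨a, ha, hs⟩) | hs)
          · exact .inl hΦ
          · exact .inr ⟨a, by omega, hs⟩
          · exact .inr ⟨i, by omega, hs⟩
        · rintro (hΦ | ⟨a, ha, hs⟩)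
          · exact .inl (.inl hΦ)
          · rcases Nat.lt_succ_iff_lt_or_eq.1 ha with ha | rfl
            · exact .inl (.inr ⟨a, ha, hs⟩)
            · exact .inr hs
      · simp only [VState.set_clk, VState.tick_clk]
        have w1 : (6000 * Z + 10) * (2 * w) ≤ (6000 * Z + 10) * n := Nat.mul_le_mul_left _ hw
        have w2 : 1 * n ≤ Z * n := Nat.mul_le_mul_right _ hZ0
        have w3 : (6000 * Z + 10) * n = 6000 * (Z * n) + 10 * n := by ring
        have w4 : (6020 * Z * n + 40) * (i + 1) = (6020 * Z * n + 40) * i + (6020 * (Z * n) + 40) := by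
          ring
        rw [w4]
        clear_value Z
        omega
  · rintro g ⟨e11, er, e7, ec⟩ -
    refine hQ _ (by simpa using e11) ?_ (by simpa using e7) ?_
    · exact ⟨er.vn, er.vd, er.vw, er.vtop, er.vP, er.vt, er.vS, er.arr0, er.arr1, er.emp⟩
    · simp only [VState.tick_clk]
      nlinarith [Nat.zero_le (Z * n * n), Nat.zero_le (Z * n)]

/-- The search: the target distance in variable `2` is increased until a round succeeds. -/
def searchP : Prog :=
  assign 6 3 ;; assign 11 1 ;;
  .loop (2 * 11) (assign 2 (.var 2 + 1) ;; assign 9 (.var 2 * .var 5 / .var 0 + 1) ;; roundsP ;;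
    assign 11 (1 - .var 7)) ;;
  assign 0 (.var 2)

theorem wp_search {n w P S K M X D : ℕ} {G R : List ℕ}
    (f : Setup E n w P S K M X D G R) (v0 : h.var 0 = n) (v2 : h.var 2 = 0) (v5 : h.var 5 = w)
    (v7 : h.var 7 = 0) (v8 : h.var 8 = P) (v10 : h.var 10 = S) (a0 : h.arr 0 = G)
    (a1 : h.arr 1 = R) (ae : ∀ id, 3 ≤ id → h.arr id = [])
    (hD : 0 < D) (hno : ∀ d < D, ∀ a x, ¬ Succ n w P S G R d a x)
    (hyes : ∃ a < n, ∃ x < 2 * w, Succ n w P S G R D (n - a) (2 * w - x))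
    (hQ : ∀ h' : VState, h'.var 0 = D →
      h'.clk ≤ h.clk + 8000 * ((M + 1) * (X + 1) * (2 * n + 1) * (n + 1)) * (n + 1) * (n + 1) *
        (n + 1) → Q h') :
    WP E searchP Q h := by
  have hB : 64 * 2 ^ K ≤ 2 ^ E.B :=
    calc 64 * 2 ^ K = 2 ^ (K + 6) := by ring
      _ ≤ _ := Nat.pow_le_pow_right (by omega) (by have := f.hK; omega)
  have hKE := f.hK
  have hE0 : E.B ≠ 0 := by omega
  have hn := f.hn
  have hw := f.hw
  have hn0 := f.hn0
  have hDn := f.hDn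
  have hT := f.htop
  set Z := (M + 1) * (X + 1) * (2 * n + 1) * (n + 1) with hZ
  have hZ0 : 0 < Z := by positivity
  set C := 7000 * Z * (n + 1) * (n + 1) + 100 with hC
  unfold searchP
  refine wp_seq (wp_assign (by simp; omega) (wp_seq (wp_assign (by simp; omega) (wp_seq ?_))))
  refine wp_while (fun m h' => ∃ d, d + m = D ∧ h'.var 11 = ind (d < D) ∧
    (0 < d → Ready n w P S d (3 + d * (n * (2 * w * (5 + S)))) G R h') ∧
    (d = 0 → Ready n w P S 0 3 G R (h'.set 9 1 0)) ∧ h'.var 2 = d ∧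
    h'.var 7 = ind (d = D) ∧ h'.clk ≤ h.clk + 10 + C * d) ?_ ?_ D _ ?_
  · rintro m g ⟨d, hdm, e11, er, er0, e2, e7, ec⟩ hne
    have hdD : d < D := by
      by_contra hcon
      rw [e11, ind, if_neg hcon] at hne
      exact hne rfl
    have hgr : Ready n w P S d (3 + d * (n * (2 * w * (5 + S)))) G R (g.set 9 (d * w / n + 1) 0) := by
      rcases Nat.eq_zero_or_pos d with rfl | hd0
      · simpa using er0 rfl
      · have := er hd0
        exact ⟨this.vn, this.vd, this.vw, this.vtop, this.vP, by simp, this.vS, this.arr0, this.arr1,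
          this.emp⟩
    have gn : g.var 0 = n := by simpa using hgr.vn
    have gw : g.var 5 = w := by simpa using hgr.vw
    have hdw : (d + 1) * w ≤ n * n := Nat.mul_le_mul (by omega) (by omega)
    have hnn : n * n ≤ n * (n * n * (5 + S)) := by
      have : n * (n * n * (5 + S)) = n * n * (n * (5 + S)) := by ring
      rw [this]; exact Nat.le_mul_of_pos_right _ (by positivity)
    have hdw2 : (d + 1) * w / n ≤ (d + 1) * w := Nat.div_le_self _ _
    have htt : d * (n * (2 * w * (5 + S))) + n * n * (5 + S) ≤ n * (n * n * (5 + S)) := by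
      have h1 : d * (n * (2 * w * (5 + S))) ≤ d * (n * (n * (5 + S))) :=
        Nat.mul_le_mul_left _ (Nat.mul_le_mul_left _ (Nat.mul_le_mul_right _ hw))
      have h2 : d * (n * (n * (5 + S))) + n * n * (5 + S) = (d + 1) * (n * n * (5 + S)) := by ring
      have h3 : (d + 1) * (n * n * (5 + S)) ≤ n * (n * n * (5 + S)) :=
        Nat.mul_le_mul_right _ (by omega)
      omega
    refine wp_seq (wp_assign (by simp [e2]; omega) (wp_seq (wp_assign ?_ (wp_seq ?_))))
    · simp [e2, gn, gw]
      constructorm* _ ∧ _ <;> omega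
    refine wp_rounds (Φ := False) (d := d + 1) (top := 3 + d * (n * (2 * w * (5 + S)))) f (by omega)
      ?_ (by omega) (by omega) ?_ ?_
    · refine ⟨by simp [gn], by simp [e2], by simp [gw], ?_, ?_, by simp [e2, gn, gw], ?_,
        by simpa using hgr.arr0, by simpa using hgr.arr1, by simpa using hgr.emp⟩
      · simpa using hgr.vtop
      · simpa using hgr.vP
      · simpa using hgr.vS
    · simp [e7, ind]; omega
    · intro g' b11 br b7 bc
      simp at bc
      have hto : 3 + d * (n * (2 * w * (5 + S))) + n * (2 * w * (5 + S)) =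
        3 + (d + 1) * (n * (2 * w * (5 + S))) := by ring
      rw [hto] at br
      have b7' : g'.var 7 = ind (d + 1 = D) := by
        rw [b7]
        congr 1
        apply propext
        simp only [false_or]
        constructor
        · rintro ⟨a, _, x, _, hs⟩
          by_contra hcon
          exact hno (d + 1) (by omega) _ _ hs
        · intro hd; rw [hd]; exact hyes
      refine wp_assign (by simp [b7', ind]; omega) ⟨m - 1, by omega, d + 1, by omega, ?_, ?_,
        by omega, ?_, ?_, ?_⟩
      · simp only [VState.set_var, if_true, eval_sub, eval_ofNat, eval_var, b7', ind]
        split_ifs <;> omega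
      · intro _
        exact ⟨by simpa using br.vn, by simpa using br.vd, by simpa using br.vw,
          by simpa using br.vtop, by simpa using br.vP, by simpa using br.vt, by simpa using br.vS,
          br.arr0, br.arr1, br.emp⟩
      · simpa using br.vd
      · simpa using b7'
      · simp
        have w1 : C * (d + 1) = C * d + (7000 * Z * (n + 1) * (n + 1) + 100) := by rw [hC]; ring
        rw [← hZ] at bc
        rw [w1]
        omega
  · rintro m g ⟨d, hdm, e11, er, er0, e2, e7, ec⟩ h0
    have hdD : ¬ d < D := by
      intro hcon
      rw [e11, ind, if_pos hcon] at h0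
      exact absurd h0 one_ne_zero
    have hd : d = D := by omega
    subst hd
    refine wp_assign (by simp) (hQ _ (by simp [e2]) ?_)
    simp
    have h1 : C * d ≤ C * n := Nat.mul_le_mul_left _ hDn
    have h2 : 1 ≤ Z * (n + 1) * (n + 1) := Nat.succ_le_of_lt (by positivity)
    have h3 : C * n = 7000 * (Z * (n + 1) * (n + 1)) * n + 100 * n := by rw [hC]; ring
    have h4 : 8000 * Z * (n + 1) * (n + 1) * (n + 1) = 7000 * (Z * (n + 1) * (n + 1)) * n +
      1000 * (Z * (n + 1) * (n + 1)) * n + 8000 * (Z * (n + 1) * (n + 1)) := by ring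
    have h5 : 1000 * 1 * n ≤ 1000 * (Z * (n + 1) * (n + 1)) * n :=
      Nat.mul_le_mul_right _ (Nat.mul_le_mul_left _ h2)
    linarith
  · refine ⟨0, by omega, by simp [ind, hD], by omega, fun _ => ?_, by simp [v2], ?_, by simp⟩
    · refine ⟨by simp [v0], by simp [v2], by simp [v5], by simp, by simp [v8], by simp,
        by simp [v10], by simp [a0], by simp [a1], by simpa using ae⟩
    · simp [v7, ind]; omega

end

section

variable {E : Env} {Q : VState → Prop} {h : VState}

/-! ### The preparation of the data, and the whole program -/

/-- The number `∑ i < m, b i * q ^ i`. -/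
def digits (q m : ℕ) (b : ℕ → ℕ) : ℕ := ∑ i ∈ Finset.range m, b i * q ^ i

theorem digits_zero (q : ℕ) (b : ℕ → ℕ) : digits q 0 b = 0 := by simp [digits]

theorem digits_succ (q m : ℕ) (b : ℕ → ℕ) : digits q (m + 1) b = digits q m b + b m * q ^ m := by
  simp [digits, Finset.sum_range_succ]

theorem digits_lt {q : ℕ} {b : ℕ → ℕ} (hb : ∀ i, b i < q) (m : ℕ) :
    digits q m b < q ^ m := by
  induction m with
  | zero => simp [digits]
  | succ m ih =>
    rw [digits_succ, pow_succ']
    have := Nat.mul_le_mul_right (q ^ m) (show b m + 1 ≤ q from hb m)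
    rw [add_mul] at this
    omega

/-- The two columns of the parity check matrix at position `j`, each together with the unit vector
that it belongs to: first `Z`, then `X`. -/
def colPair (n r : ℕ) (inp : ℕ → ℕ) (j : ℕ) : List ℕ :=
  [4 ^ j + 4 ^ n * digits 2 r fun i => inp (i * n + j) / 2,
   2 * 4 ^ j + 4 ^ n * digits 2 r fun i => inp (i * n + j) % 2]

/-- The columns of the parity check matrix, see `colPair`. -/
def colTable (n r : ℕ) (inp : ℕ → ℕ) : List ℕ := (List.range n).flatMap (colPair n r inp)

/-- The basis of the stabilizer group that results from the rows of the matrix. -/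
def rowBasis (n r : ℕ) (inp : ℕ → ℕ) : List ℕ × List ℕ :=
  ((List.range r).map fun i => digits 4 n fun j => inp (i * n + j)).foldl (insN 1) ([], [])

/-- Variable `x` receives the product of `x` with the power of `b` whose exponent is in variable
`y`. -/
def powP (x y b : ℕ) : Prog :=
  assign x 1 ;; assign 12 (.var y) ;; forLoop 12 (assign x (.var x * .lit b))

/-- The column table is written into array `0`. -/
def tableP : Prog :=
  assign 13 0 ;; assign 14 1 ;; assign 12 (.var 0) ;;
  forLoop 12 (
    assign 15 0 ;; assign 16 0 ;; assign 17 (.var 8) ;; assign 18 0 ;; assign 19 (.var 1) ;;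
    forLoop 19 (
      assign 20 (.inp (.var 18 * .var 0 + .var 13)) ;;
      assign 15 (.var 15 + .var 17 * (.var 20 / 2)) ;;
      assign 16 (.var 16 + .var 17 * (.var 20 - .var 20 / 2 * 2)) ;;
      assign 17 (.var 17 * 2) ;; assign 18 (.var 18 + 1)) ;;
    push 0 (.var 14 + .var 15) ;; push 0 (2 * .var 14 + .var 16) ;;
    assign 14 (.var 14 * 4) ;; assign 13 (.var 13 + 1))

/-- The basis of the stabilizer group is written into array `1`. -/
def rowsP : Prog :=
  assign 13 0 ;; assign 12 (.var 1) ;;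
  forLoop 12 (
    assign 20 0 ;; assign 14 1 ;; assign 15 0 ;; assign 16 (.var 0) ;;
    forLoop 16 (
      assign 20 (.var 20 + .inp (.var 13 * .var 0 + .var 15) * .var 14) ;;
      assign 14 (.var 14 * 4) ;; assign 15 (.var 15 + 1)) ;;
    assign 21 1 ;; assign 22 1 ;; insP ;; assign 13 (.var 13 + 1))

theorem wp_pow {x y b m : ℕ} (hx : x ≠ 12) (hy : y ≠ x) (hB0 : 1 < 2 ^ E.B)
    (hb : b < 2 ^ E.B)
    (hm : h.var y = m) (hB : b ^ m * b < 2 ^ E.B) (hb0 : 0 < b)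
    (hQ : ∀ h' : VState, h'.arr = h.arr → (∀ z, z ≠ x → z ≠ 12 → h'.var z = h.var z) →
      h'.var x = b ^ m → h'.clk ≤ h.clk + 20 * (m + 1) → Q h') :
    WP E (powP x y b) Q h := by
  have hE0 : E.B ≠ 0 := by rintro h0; simp [h0] at hB0
  unfold powP
  refine wp_seq (wp_assign (by simp; omega) (wp_seq (wp_assign (by simp) ?_)))
  refine wp_for (fun i h' => h'.arr = h.arr ∧ (∀ z, z ≠ x → z ≠ 12 → h'.var z = h.var z) ∧
    h'.var x = b ^ i ∧ h'.clk ≤ h.clk + 10 + 20 * i) (by omega) (k := m) (by simp [hm, hy]) ?_ ?_ ?_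
  · simp [hx]
    intro z h1 h2
    simp [h1, h2]
  · rintro i hi g ⟨e1, e2, e3, e4⟩ hx' -
    have hp : b ^ i * b ≤ b ^ m * b :=
      Nat.mul_le_mul_right _ (Nat.pow_le_pow_right hb0 hi.le)
    have hbd : (Expr.lit b).Bdd E (g.tick 1) := hb
    have hev : (Expr.lit b).eval E (g.tick 1) = b := rfl
    have hop : (Expr.lit b).ops = 1 := rfl
    refine wp_assign ?_ ?_
    · simp [e3, hbd, hev]; omega
    · simp [e1, e3, hev, hop, Ne.symm hx, hx']
      refine ⟨?_, ?_, by omega⟩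
      · intro z h1 h2
        simp [h1, h2, e2]
      · simp [hx, pow_succ]
  · rintro g ⟨e1, e2, e3, e4⟩ -
    exact hQ _ e1 e2 e3 (by simp; omega)

theorem colTable_lt {n r : ℕ} {inp : ℕ → ℕ} (hi : ∀ a, inp a < 4) :
    ∀ g ∈ colTable n r inp, g < 2 ^ (2 * n + r) := by
  have e : 2 ^ (2 * n + r) = 4 ^ n * 2 ^ r := by rw [pow_add, pow_mul]; norm_num
  intro g hg
  simp only [colTable, colPair, List.mem_flatMap, List.mem_range, List.mem_cons, List.not_mem_nil,
    or_false] at hg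
  obtain ⟨j, hj, hg⟩ := hg
  have h4 : 4 * 4 ^ j ≤ 4 ^ n := by
    rw [← pow_succ']; exact Nat.pow_le_pow_right (by omega) hj
  have h1 := digits_lt (q := 2) (b := fun i => inp (i * n + j) / 2)
    (fun i => by have := hi (i * n + j); omega) r
  have h2 := digits_lt (q := 2) (b := fun i => inp (i * n + j) % 2)
    (fun i => by omega) r
  have hp : 0 < 4 ^ j := by positivity
  rw [e]
  have m1 := Nat.mul_le_mul_left (4 ^ n) (Nat.succ_le_of_lt h1)
  have m2 := Nat.mul_le_mul_left (4 ^ n) (Nat.succ_le_of_lt h2)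
  rw [Nat.succ_eq_add_one, mul_add] at m1 m2
  rcases hg with rfl | rfl <;> omega

set_option maxHeartbeats 1000000 in
theorem wp_table {n r K : ℕ} (hK : 2 * K + 6 ≤ E.B) (hc : E.c = n + 1) (hcK : E.c < 2 ^ K)
    (hrn : r ≤ n) (hMK : 2 * n + r ≤ K) (hnK : 8 * n + 8 < 2 ^ K) (hi : ∀ a, E.inp a < 4)
    (v0 : h.var 0 = n) (v1 : h.var 1 = r)
    (v8 : h.var 8 = 4 ^ n) (a0 : h.arr 0 = [])
    (hQ : ∀ h' : VState, h'.arr = Function.update h.arr 0 (colTable n r E.inp) →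
      (∀ y < 12, h'.var y = h.var y) → h'.clk ≤ h.clk + 300 * ((n + 1) * (n + 1)) → Q h') :
    WP E tableP Q h := by
  have hB : 64 * 2 ^ K ≤ 2 ^ E.B :=
    calc 64 * 2 ^ K = 2 ^ (K + 6) := by ring
      _ ≤ _ := Nat.pow_le_pow_right (by omega) (by omega)
  have hE0 : E.B ≠ 0 := by omega
  have hM : 2 ^ (2 * n + r) ≤ 2 ^ K := Nat.pow_le_pow_right (by omega) hMK
  have eM : 2 ^ (2 * n + r) = 4 ^ n * 2 ^ r := by rw [pow_add, pow_mul]; norm_num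
  have h4n : 4 ^ n ≤ 4 ^ n * 2 ^ r := Nat.le_mul_of_pos_right _ (by positivity)
  unfold tableP
  refine wp_seq (wp_assign (by simp) (wp_seq (wp_assign (by simp; omega) (wp_seq
    (wp_assign (by simp) ?_)))))
  refine wp_for (fun j g => g.arr = Function.update h.arr 0 ((List.range j).flatMap
      (colPair n r E.inp)) ∧
    (∀ y < 12, g.var y = h.var y) ∧ g.var 13 = j ∧ g.var 14 = 4 ^ j ∧
    g.clk ≤ h.clk + 20 + (100 * r + 150) * j) (by omega) (k := n) (by simp [v0]) ?_ ?_ ?_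
  · have u0 : Function.update h.arr 0 [] = h.arr := by rw [← a0, Function.update_eq_self]
    simp [u0]
    intro y hy
    rw [if_neg (by omega), if_neg (by omega), if_neg (by omega)]
  · rintro j hj g ⟨e1, e2, e3, e4, e5⟩ h12 -
    have h4 : 4 * 4 ^ j ≤ 4 ^ n := by
      rw [← pow_succ']; exact Nat.pow_le_pow_right (by omega) hj
    have hp : 0 < 4 ^ j := by positivity
    refine wp_seq (wp_assign (by simp) (wp_seq (wp_assign (by simp) (wp_seq
      (wp_assign (by simp) (wp_seq (wp_assign (by simp) (wp_seq (wp_assign (by simp)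
      (wp_seq ?_))))))))))
    refine wp_for (fun i u => u.arr = g.arr ∧ (∀ y < 12, u.var y = h.var y) ∧ u.var 12 = n - j ∧
      u.var 13 = j ∧ u.var 14 = 4 ^ j ∧
      u.var 15 = 4 ^ n * (digits 2 i fun i => E.inp (i * n + j) / 2) ∧
      u.var 16 = 4 ^ n * (digits 2 i fun i => E.inp (i * n + j) % 2) ∧
      u.var 17 = 4 ^ n * 2 ^ i ∧ u.var 18 = i ∧ u.clk ≤ g.clk + 30 + 100 * i)
      (by omega) (k := r) (by simp [e2, v1]) ?_ ?_ ?_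
    · simp [h12, e3, e4, digits_zero, e2, v8]
      intro y hy
      rw [if_neg (by omega), if_neg (by omega), if_neg (by omega), if_neg (by omega),
        if_neg (by omega), e2 y hy]
    · rintro i hir u ⟨f1, f2, f3, f4, f5, f6, f7, f8, f9, f10⟩ h19 -
      have u0 : u.var 0 = n := by rw [f2 _ (by omega), v0]
      have hin : i * n + j < (n + 1) * (n + 1) := by nlinarith
      have hin' : i * n ≤ n * n := Nat.mul_le_mul_right _ (by omega)
      have hnn : (n + 1) * (n + 1) < 2 ^ E.B := by
        have := addr_lt (id := 0) (i := 0) hK hcK (by positivity) (by omega)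
        simpa [addr, hc] using this
      have hnn' : (n + 1) * (n + 1) = n * n + 2 * n + 1 := by ring
      have d1 := digits_lt (q := 2) (b := fun i => E.inp (i * n + j) / 2)
        (fun i => by have := hi (i * n + j); omega) i
      have d2 := digits_lt (q := 2) (b := fun i => E.inp (i * n + j) % 2)
        (fun i => by omega) i
      have m1 := Nat.mul_le_mul_left (4 ^ n) d1.le
      have m2 := Nat.mul_le_mul_left (4 ^ n) d2.le
      have hir2 : 4 ^ n * 2 ^ i * 2 ≤ 4 ^ n * 2 ^ r := by
        rw [mul_assoc, ← pow_succ]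
        exact Nat.mul_le_mul_left _ (Nat.pow_le_pow_right (by omega) hir)
      have hin4 := hi (i * n + j)
      set q := E.inp (i * n + j) with hq
      have hq2 : q - q / 2 * 2 = q % 2 := by omega
      have b1 : 4 ^ n * 2 ^ i * (q / 2) ≤ 4 ^ n * 2 ^ i * 1 := Nat.mul_le_mul_left _ (by omega)
      have b2 : 4 ^ n * 2 ^ i * (q % 2) ≤ 4 ^ n * 2 ^ i * 1 := Nat.mul_le_mul_left _ (by omega)
      refine wp_seq (wp_assign (by simp [f9, f4, u0, hc]; omega) (wp_seq (wp_assign ?_ (wp_seq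
        (wp_assign ?_ (wp_seq (wp_assign (by simp [f8]; omega)
        (wp_assign (by simp [f9]; omega) ?_))))))))
      · simp [f9, f4, u0, f6, f8, ← hq]; omega
      · simp [f9, f4, u0, f6, f7, f8, ← hq, hq2, -tsub_le_iff_right]; omega
      · simp [f9, f4, u0, f6, f7, f8, ← hq, hq2, h19, f1, f3, f5, digits_succ]
        refine ⟨?_, by ring, by ring, by ring, by omega⟩
        intro y hy
        rw [if_neg (by omega), if_neg (by omega), if_neg (by omega), if_neg (by omega),
          if_neg (by omega), if_neg (by omega), f2 y hy]
    · rintro u ⟨f1, f2, f3, f4, f5, f6, f7, f8, f9, f10⟩ -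
      have d1 := digits_lt (q := 2) (b := fun i => E.inp (i * n + j) / 2)
        (fun i => by have := hi (i * n + j); omega) r
      have d2 := digits_lt (q := 2) (b := fun i => E.inp (i * n + j) % 2)
        (fun i => by omega) r
      have m1 := Nat.mul_le_mul_left (4 ^ n) d1.le
      have m2 := Nat.mul_le_mul_left (4 ^ n) d2.le
      have hl : (g.arr 0).length = 2 * j := by
        rw [e1]
        simp [List.length_flatMap, colPair, mul_comm]
      refine wp_seq (wp_push (by simp) (by simp [f5, f6]; omega) ?_ (wp_seq (wp_push (by simp)
        (by simp [f5, f7]; omega) ?_ (wp_seq (wp_assign (by simp [f5]; omega)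
        (wp_assign (by simp [f4]; omega) ?_))))))
      · simpa [f1, hl] using addr_lt hK hcK (by positivity) (by omega)
      · simpa [f1, hl] using addr_lt hK hcK (by positivity) (by omega)
      · simp only [VState.set_var, VState.app_var, VState.tick_var, VState.set_arr, VState.app_arr,
          VState.tick_arr, VState.set_clk, VState.app_clk, VState.tick_clk, eval_add, eval_mul,
          eval_var, eval_ofNat, ops_add, ops_mul, ops_var, ops_ofNat, f1, f3, f4, f5, f6, f7]
        refine ⟨by simp, ?_, ?_, by simp, by simp [pow_succ], ?_⟩
        · rw [e1, List.range_succ, List.flatMap_append]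
          simp [colPair]
        · intro y hy
          rw [if_neg (by omega), if_neg (by omega), if_neg (by omega), f2 y hy]
        · rw [mul_add]; omega
  · rintro g ⟨e1, e2, e3, e4, e5⟩ -
    refine hQ _ e1 e2 ?_
    simp only [VState.tick_clk]
    nlinarith

theorem wp_rowBasis {n r K : ℕ} (hK : 2 * K + 6 ≤ E.B) (hc : E.c = n + 1) (hcK : E.c < 2 ^ K)
    (hrn : r ≤ n) (hMK : 2 * n ≤ K) (hnK : 8 * n + 8 < 2 ^ K) (hi : ∀ a, E.inp a < 4)
    (v0 : h.var 0 = n) (v1 : h.var 1 = r) (a1 : h.arr 1 = []) (a2 : h.arr 2 = [])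
    (hQ : ∀ h' : VState, h'.arr = Function.update (Function.update h.arr 1
        (rowBasis n r E.inp).1) 2 (rowBasis n r E.inp).2 →
      (∀ y < 12, h'.var y = h.var y) →
      h'.clk ≤ h.clk + 800 * ((n + 1) * (n + 1) * (n + 1)) → Q h') :
    WP E rowsP Q h := by
  have hB : 64 * 2 ^ K ≤ 2 ^ E.B :=
    calc 64 * 2 ^ K = 2 ^ (K + 6) := by ring
      _ ≤ _ := Nat.pow_le_pow_right (by omega) (by omega)
  have hE0 : E.B ≠ 0 := by omega
  have hM : 2 ^ (2 * n) ≤ 2 ^ K := Nat.pow_le_pow_right (by omega) hMK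
  have eM : 2 ^ (2 * n) = 4 ^ n := by rw [pow_mul]; norm_num
  set row : ℕ → ℕ := fun i => digits 4 n fun j => E.inp (i * n + j) with hrow
  have hrowlt : ∀ i, row i < 2 ^ (2 * n) := fun i => by
    rw [eM]; exact digits_lt (fun _ => hi _) n
  unfold rowsP
  refine wp_seq (wp_assign (by simp) (wp_seq (wp_assign (by simp) ?_)))
  refine wp_for (fun i g => g.arr = Function.update (Function.update h.arr 1
      (((List.range i).map row).foldl (insN 1) ([], [])).1) 2
      (((List.range i).map row).foldl (insN 1) ([], [])).2 ∧
    (∀ y < 12, g.var y = h.var y) ∧ g.var 13 = i ∧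
    g.clk ≤ h.clk + 20 + (600 * ((n + 1) * (n + 1)) + 100) * i) (by omega) (k := r)
    (by simp [v1]) ?_ ?_ ?_
  · have u1 : Function.update h.arr 1 [] = h.arr := by rw [← a1, Function.update_eq_self]
    have u2 : Function.update h.arr 2 [] = h.arr := by rw [← a2, Function.update_eq_self]
    simp [u1, u2]
    intro y hy
    rw [if_neg (by omega), if_neg (by omega)]
  · rintro i hir g ⟨e1, e2, e3, e4⟩ h12 -
    refine wp_seq (wp_assign (by simp) (wp_seq (wp_assign (by simp; omega) (wp_seq
      (wp_assign (by simp) (wp_seq (wp_assign (by simp) (wp_seq ?_))))))))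
    refine wp_for (fun j u => u.arr = g.arr ∧ (∀ y < 12, u.var y = h.var y) ∧ u.var 12 = r - i ∧
      u.var 13 = i ∧ u.var 14 = 4 ^ j ∧ u.var 20 = (digits 4 j fun j => E.inp (i * n + j)) ∧
      u.var 15 = j ∧ u.clk ≤ g.clk + 30 + 50 * j)
      (by omega) (k := n) (by simp [e2, v0]) ?_ ?_ ?_
    · simp [h12, e3, digits_zero]
      intro y hy
      rw [if_neg (by omega), if_neg (by omega), if_neg (by omega), if_neg (by omega), e2 y hy]
    · rintro j hjn u ⟨f1, f2, f3, f4, f5, f6, f7, f8⟩ h16 -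
      have u0 : u.var 0 = n := by rw [f2 _ (by omega), v0]
      have hin : i * n + j < (n + 1) * (n + 1) := by nlinarith
      have hin' : i * n ≤ n * n := Nat.mul_le_mul_right _ (by omega)
      have hnn : (n + 1) * (n + 1) < 2 ^ E.B := by
        have := addr_lt (id := 0) (i := 0) hK hcK (by positivity) (by omega)
        simpa [addr, hc] using this
      have hnn' : (n + 1) * (n + 1) = n * n + 2 * n + 1 := by ring
      have d1 := digits_lt (q := 4) (b := fun j => E.inp (i * n + j)) (fun _ => hi _) j
      have h4 : 4 * 4 ^ j ≤ 4 ^ n := by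
        rw [← pow_succ']; exact Nat.pow_le_pow_right (by omega) hjn
      have b1 : E.inp (i * n + j) * 4 ^ j ≤ 4 * 4 ^ j := Nat.mul_le_mul_right _ (hi _).le
      refine wp_seq (wp_assign (by simp [f4, f5, f6, f7, u0, hc]; omega) (wp_seq
        (wp_assign (by simp [f5]; omega) (wp_assign (by simp [f7]; omega) ?_))))
      simp [f1, f3, f4, f5, f6, f7, u0, h16, digits_succ]
      refine ⟨?_, by ring, by omega⟩
      intro y hy
      rw [if_neg (by omega), if_neg (by omega), if_neg (by omega), if_neg (by omega), f2 y hy]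
    · rintro u ⟨f1, f2, f3, f4, f5, f6, f7, f8⟩ -
      have f6' : u.var 20 = row i := f6
      have hl := foldl_insN_length 1 ((List.range i).map row) ([], [])
      have hlt := foldl_insN_lt (D := 1) (c := 2 ^ (2 * n)) ((List.range i).map row)
        (by simp only [List.mem_map]; rintro _ ⟨j, -, rfl⟩; exact hrowlt j) ([], []) (by simp)
        (by simp)
      set b := ((List.range i).map row).foldl (insN 1) ([], []) with hb
      simp only [List.length_nil, List.length_map, List.length_range, zero_add] at hl
      have a1' : u.arr 1 = b.1 := by rw [f1, e1]; simp
      have a2' : u.arr 2 = b.2 := by rw [f1, e1]; simp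
      refine wp_seq (wp_assign (by simp; omega) (wp_seq (wp_assign (by simp; omega) (wp_seq
        (wp_ins (M := 2 * n) (L := n) (id := 1) (v := row i) (D := 1) (b := b) hK hcK hMK
          (by simp [f6']) (by simp) (by simp) (by simp [a1']) (by simp [a2']) (hrowlt i)
          (by omega) hlt.1 (by omega) (by omega) (by omega) ?_)))))
      intro g' l1 l2 l3
      simp at l1 l3
      have l13 : g'.var 13 = i := by rw [l2 _ (by omega)]; simpa using f4
      have l12 : g'.var 12 = r - i := by rw [l2 _ (by omega)]; simpa using f3
      refine wp_assign (by simp [l13]; omega) ?_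
      have hs : ((List.range (i + 1)).map row).foldl (insN 1) ([], []) = insN 1 b (row i) := by
        simp [List.range_succ, hb]
      simp only [VState.set_var, VState.set_arr, VState.set_clk, hs]
      simp [l13, l12]
      refine ⟨?_, ?_, ?_⟩
      · rw [l1, f1, e1]
        funext id
        simp only [Function.update_apply]
        split_ifs <;> rfl
      · intro y hy
        rw [if_neg (by omega), if_neg (by omega), l2 _ (by omega)]
        simp only [VState.set_var, VState.tick_var]
        rw [if_neg (by omega), if_neg (by omega), f2 y hy]
      · have w1 : 250 * (2 * n + 1) * (n + 1) ≤ 500 * ((n + 1) * (n + 1)) :=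
          (Nat.mul_le_mul_right (n + 1) (show 250 * (2 * n + 1) ≤ 500 * (n + 1) by omega)).trans
            (by rw [mul_assoc])
        have w2 : 1 * (n + 1) ≤ (n + 1) * (n + 1) := Nat.mul_le_mul_right _ (by omega)
        have w3 : (600 * ((n + 1) * (n + 1)) + 100) * (i + 1) =
          (600 * ((n + 1) * (n + 1)) + 100) * i + (600 * ((n + 1) * (n + 1)) + 100) := by ring
        rw [w3]
        omega
  · rintro g ⟨e1, e2, e3, e4⟩ -
    refine hQ _ e1 e2 ?_
    simp only [VState.tick_clk]
    have q1 : (600 * ((n + 1) * (n + 1)) + 100) * r ≤ (600 * ((n + 1) * (n + 1)) + 100) * n :=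
      Nat.mul_le_mul_left _ hrn
    nlinarith [Nat.zero_le (n * n * n), Nat.zero_le (n * n)]

end

/-- Half of the length of the window in which the search takes place; the other positions are
punctured. With `r / n` close to `1 - R`, this is about `(1 + R) / (3 + R) * n`. The size is chosen
so that at the Gilbert-Varshamov distance the number of operators of small weight on a half window,
and the expected number of candidates in a round, are about the same. -/
def halfWindow (n r : ℕ) : ℕ := (2 * n - r) * n / (4 * n - r)

theorem two_mul_halfWindow_le {n r : ℕ} (hr : r ≤ n) : 2 * halfWindow n r ≤ n := by
  unfold halfWindow
  rcases Nat.eq_zero_or_pos n with rfl | hn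
  · simp
  · have h1 : (2 * n - r) * n / (4 * n - r) * (4 * n - r) ≤ (2 * n - r) * n :=
      Nat.div_mul_le_self _ _
    by_contra hcon
    push Not at hcon
    have h2 : (n + 1) * (4 * n - r) ≤ 2 * ((2 * n - r) * n / (4 * n - r)) * (4 * n - r) :=
      Nat.mul_le_mul_right _ hcon
    obtain ⟨s, rfl⟩ := Nat.exists_eq_add_of_le hr
    have e1 : 4 * (r + s) - r = 3 * r + 4 * s := by omega
    have e2 : 2 * (r + s) - r = r + 2 * s := by omega
    rw [e1, e2] at h1 h2
    nlinarith

/-- The program of the punctured bipartition technique: it computes the table of columns, the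
window length and the basis of the stabilizer group, and then searches. -/
def distP : Prog :=
  .arith .add 2 1 3 ;; .const 3 1 ;; .arith .add 1 0 3 ;;
  powP 8 0 4 ;; powP 10 1 2 ;;
  assign 5 ((2 * .var 0 - .var 1) * .var 0 / (4 * .var 0 - .var 1)) ;;
  tableP ;; rowsP ;; searchP

theorem initState_mem_lt {r n : ℕ} (H : CheckMatrix r n) (a : ℕ) : (initState H).mem a < 4 := by
  simp only [initState]
  split_ifs with h
  · have h1 := ZMod.val_lt (H ⟨a / n, h.1⟩ ⟨a % n, h.2⟩).1
    have h2 := ZMod.val_lt (H ⟨a / n, h.1⟩ ⟨a % n, h.2⟩).2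
    omega
  · omega

theorem initState_mem_eq_zero {r n a : ℕ} (H : CheckMatrix r n) (hr : r ≤ n)
    (ha : (n + 1) * (n + 1) ≤ a) : (initState H).mem a = 0 := by
  simp only [initState]
  rw [dif_neg]
  rintro ⟨h1, h2⟩
  have hn : 0 < n := by omega
  rw [Nat.div_lt_iff_lt_mul hn] at h1
  have : r * n ≤ n * n := Nat.mul_le_mul_right _ hr
  nlinarith

theorem pow_bound (n : ℕ) : 3 + n * (n * n * (5 + 2 ^ n)) + 2 ^ n + 8 < 2 ^ (5 * n + 20) := by
  have h1 : n < 2 ^ n := Nat.lt_two_pow_self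
  have h2 : 1 ≤ 2 ^ n := Nat.one_le_two_pow
  have e : 2 ^ (5 * n + 20) = 2 ^ 20 * ((2 ^ n * (2 ^ n * 2 ^ n)) * (2 ^ n * 2 ^ n)) := by ring
  rw [e]
  generalize 2 ^ n = y at *
  have a1 : n * (n * n * (5 + y)) ≤ y * (y * y * (6 * y)) :=
    Nat.mul_le_mul h1.le (Nat.mul_le_mul (Nat.mul_le_mul h1.le h1.le) (by omega))
  have a2 : y * (y * y * (6 * y)) = 6 * ((y * (y * y)) * (y * 1)) := by ring
  have a3 : (y * (y * y)) * (y * 1) ≤ (y * (y * y)) * (y * y) :=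
    Nat.mul_le_mul_left _ (Nat.mul_le_mul_left _ h2)
  have a4 : y * 1 ≤ y * (y * y * (y * y)) :=
    Nat.mul_le_mul_left _ (Nat.succ_le_of_lt (by positivity))
  have a5 : y * (y * y * (y * y)) = (y * (y * y)) * (y * y) := by ring
  omega

theorem wp_distP {E : Env} {h₀ : VState} {n r K D X : ℕ} {G R : List ℕ} (hr : r ≤ n) (hn : 2 ≤ n)
    (hK : K = 5 * n + 20) (hEB : E.B = 10 * n + 46) (hEc : E.c = n + 1)
    (hinp : ∀ a, E.inp a < 4) (z0 : h₀.var 0 = n) (z1 : h₀.var 1 = r)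
    (z2 : ∀ x, 2 ≤ x → h₀.var x = 0) (ze : h₀.arr = fun _ => []) (zc : h₀.clk = 3)
    {w : ℕ} (hw : w = halfWindow n r)
    (hG : G = colTable n r E.inp) (hR : R = (rowBasis n r E.inp).1) (hX4 : X ≤ 4 ^ n)
    (hD : 0 < D) (hDn : D ≤ n)
    (hno : ∀ d < D, ∀ a x, ¬ Succ n w (4 ^ n) (2 ^ r) G R d a x)
    (hyes : ∃ a < n, ∃ x < 2 * w, Succ n w (4 ^ n) (2 ^ r) G R D (n - a) (2 * w - x))
    (hX1 : ∀ d ≤ D, ∀ a x, (sideN (prm n w (4 ^ n) (2 ^ r) d a x 0) G 0 w).length ≤ X)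
    (hX2 : ∀ d ≤ D, ∀ a x, (sideN (prm n w (4 ^ n) (2 ^ r) d a x 0) G w w).length ≤ X)
    (hX3 : ∀ d ≤ D, ∀ a x, (candN (prm n w (4 ^ n) (2 ^ r) d a x 0) G).length ≤ X) :
    WP E (powP 8 0 4 ;; powP 10 1 2 ;;
      assign 5 ((2 * .var 0 - .var 1) * .var 0 / (4 * .var 0 - .var 1)) ;;
      tableP ;; rowsP ;; searchP)
      (fun h' => h'.var 0 = D ∧ h'.clk ≤ 50000 * (n + 1) ^ 6 * (X + 1)) h₀ := by
  have hnK : 8 * n + 8 < 2 ^ K := by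
    have h1 : n < 2 ^ n := Nat.lt_two_pow_self
    have h2 : 2 ^ (n + 5) ≤ 2 ^ K := Nat.pow_le_pow_right (by omega) (by omega)
    have h3 : 2 ^ (n + 5) = 32 * 2 ^ n := by ring
    omega
  have hB : 64 * 2 ^ K ≤ 2 ^ E.B :=
    calc 64 * 2 ^ K = 2 ^ (K + 6) := by ring
      _ ≤ _ := Nat.pow_le_pow_right (by omega) (by omega)
  have hE0 : E.B ≠ 0 := by omega
  have h4n : 4 ^ n * 16 ≤ 2 ^ K := by
    have : 4 ^ n * 16 = 2 ^ (2 * n + 4) := by rw [pow_add, pow_mul]; norm_num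
    rw [this]; exact Nat.pow_le_pow_right (by omega) (by omega)
  have h2r : 2 ^ r * 2 ≤ 2 ^ K := by
    rw [← pow_succ]; exact Nat.pow_le_pow_right (by omega) (by omega)
  have hone : 1 < 2 ^ E.B := by omega
  refine wp_seq (wp_pow (m := n) (by omega) (by omega) hone (by omega) (by simp [z0])
    (by omega) (by omega) ?_)
  intro u₁ m₁ l₁ v₁ c₁
  refine wp_seq (wp_pow (m := r) (by omega) (by omega) hone (by omega)
    (by rw [l₁ _ (by omega) (by omega)]; simp [z1]) (by omega) (by omega) ?_)
  intro u₂ m₂ l₂ v₂ c₂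
  have l₂' : ∀ z, z ≠ 8 → z ≠ 10 → z ≠ 12 → u₂.var z = h₀.var z := fun z z1 z2 z3 => by
    rw [l₂ z z2 z3, l₁ z z1 z3]
  have u0 : u₂.var 0 = n := by rw [l₂' _ (by omega) (by omega) (by omega)]; simp [z0]
  have u1 : u₂.var 1 = r := by rw [l₂' _ (by omega) (by omega) (by omega)]; simp [z1]
  have hnn : (n + 1) * (n + 1) * 64 ≤ 2 ^ K * 2 ^ K := by
    have := Nat.mul_le_mul hnK.le hnK.le
    nlinarith
  have hKK : 64 * (2 ^ K * 2 ^ K) = 2 ^ E.B := by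
    rw [hEB, show 10 * n + 46 = 6 + K + K by omega, pow_add, pow_add]; ring
  have hmul : (2 * n - r) * n ≤ (2 * n) * n := Nat.mul_le_mul_right _ (by omega)
  have hdiv : (2 * n - r) * n / (4 * n - r) ≤ (2 * n - r) * n := Nat.div_le_self _ _
  have hn2 : 2 * n * n ≤ 2 * ((n + 1) * (n + 1)) := by nlinarith
  refine wp_seq (wp_assign ?_ (wp_seq ?_))
  · simp [u0, u1, -tsub_le_iff_right]; omega
  refine wp_table (n := n) (r := r) (K := K) (by omega) hEc (by omega) hr
    (by omega) hnK hinp (by simp [u0]) (by simp [u1]) ?_ (by simp [m₂, m₁, ze]) ?_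
  · simp; rw [l₂ 8 (by omega) (by omega), v₁]
  intro u₃ m₃ l₃ c₃
  simp [u0, u1] at m₃ c₃
  refine wp_seq (wp_rowBasis (n := n) (r := r) (K := K) (by omega) hEc (by omega) hr
    (by omega) hnK hinp (by rw [l₃ _ (by omega)]; simp [u0])
    (by rw [l₃ _ (by omega)]; simp [u1]) (by simp [m₃, m₂, m₁, ze])
    (by simp [m₃, m₂, m₁, ze]) ?_)
  intro u₄ m₄ l₄ c₄
  have hl := foldl_insN_length 1 ((List.range r).map fun i => digits 4 n fun j =>
    E.inp (i * n + j)) ([], [])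
  have hlt := foldl_insN_lt (D := 1) (c := 4 ^ n) ((List.range r).map fun i =>
      digits 4 n fun j => E.inp (i * n + j))
      (by simp only [List.mem_map]; rintro _ ⟨j, -, rfl⟩; exact digits_lt (fun _ => hinp _) n)
      ([], []) (by simp) (by simp)
  change (rowBasis n r E.inp).1.length ≤ _ ∧ _ at hl
  change (∀ v ∈ (rowBasis n r E.inp).1, _) ∧ _ at hlt
  rw [← hR] at hl hlt
  simp only [List.length_nil, List.length_map, List.length_range, zero_add] at hl
  have e2n : 4 ^ n ≤ 2 ^ (2 * n + r) := by
    rw [pow_add, pow_mul]; exact Nat.le_mul_of_pos_right _ (by positivity)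
  have v4 : ∀ y < 12, u₄.var y = if y = 5 then w else u₂.var y := by
    intro y hy
    rw [l₄ y hy, l₃ y hy]
    simp [u0, u1, hw, halfWindow]
  have set : Setup E n w (4 ^ n) (2 ^ r) K (2 * n + r) X D G R := by
    refine ⟨by omega, by omega, by omega, hnK, by omega, hn,
      (by rw [hw]; exact two_mul_halfWindow_le hr), by positivity, ?_, hDn, ?_, ?_, ?_, by omega, hX1, hX2, hX3⟩
    · rw [pow_add, pow_mul]; norm_num
    · rw [hK]
      refine lt_of_le_of_lt ?_ (pow_bound n)
      have : 2 ^ r ≤ 2 ^ n := Nat.pow_le_pow_right (by omega) hr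
      gcongr
    · rw [hG]; exact colTable_lt hinp
    · exact fun b hb => (hlt.1 b hb).trans_le e2n
  refine wp_search (n := n) (w := w) (P := 4 ^ n) (S := 2 ^ r) set ?_ ?_ ?_ ?_ ?_ ?_ ?_ ?_ ?_ hD
    hno hyes ?_
  · rw [v4 _ (by omega), if_neg (by omega), u0]
  · rw [v4 _ (by omega), if_neg (by omega), l₂' _ (by omega) (by omega) (by omega)]; simp [z2]
  · rw [v4 _ (by omega), if_pos rfl]
  · rw [v4 _ (by omega), if_neg (by omega), l₂' _ (by omega) (by omega) (by omega)]; simp [z2]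
  · rw [v4 _ (by omega), if_neg (by omega), l₂ _ (by omega) (by omega), v₁]
  · rw [v4 _ (by omega), if_neg (by omega), v₂]
  · rw [m₄, Function.update_of_ne (by omega), Function.update_of_ne (by omega), m₃,
      Function.update_self, hG]
  · rw [m₄, Function.update_of_ne (by omega), Function.update_self, hR]
  · intro id hid
    rw [m₄, Function.update_of_ne (by omega), Function.update_of_ne (by omega), m₃,
      Function.update_of_ne (by omega), m₂, m₁, ze]
  · rintro h' e0 ec
    refine ⟨e0, ?_⟩
    have hM : 2 * n + r + 1 ≤ 3 * (n + 1) := by omega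
    set q := (n + 1) ^ 6 * (X + 1) with hq
    have k1 : (2 * n + r + 1) * (X + 1) * (2 * n + 1) * (n + 1) ≤
        3 * (n + 1) * (X + 1) * (2 * (n + 1)) * (n + 1) := by gcongr; omega
    have k2 : 8000 * ((2 * n + r + 1) * (X + 1) * (2 * n + 1) * (n + 1)) * (n + 1) * (n + 1) *
        (n + 1) ≤ 48000 * q := by
      calc _ ≤ 8000 * (3 * (n + 1) * (X + 1) * (2 * (n + 1)) * (n + 1)) * (n + 1) * (n + 1) *
        (n + 1) := by gcongr
        _ = _ := by rw [hq]; ring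
    have k3 : ∀ j, j ≤ 6 → (n + 1) ^ j ≤ q := fun j hj =>
      (Nat.pow_le_pow_right (by omega) hj).trans (Nat.le_mul_of_pos_right _ (by omega))
    have j1 := k3 1 (by omega)
    have j2 := k3 2 (by omega)
    have j3 := k3 3 (by omega)
    have p1 : (n + 1) ^ 1 = n + 1 := pow_one _
    have p2 : (n + 1) ^ 2 = (n + 1) * (n + 1) := by ring
    have p3 : (n + 1) ^ 3 = (n + 1) * (n + 1) * (n + 1) := by ring
    rw [mul_assoc, ← hq]
    omega

/-- The program outputs the first target distance for which some round succeeds, at a cost that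
is controlled by the longest of the lists. -/
theorem exec_distP {r n : ℕ} (H : CheckMatrix r n) (hr : r ≤ n) (hn : 2 ≤ n) {D X : ℕ}
    {G R : List ℕ} (hG : G = colTable n r (initState H).mem)
    (hR : R = (rowBasis n r (initState H).mem).1) (hX4 : X ≤ 4 ^ n)
    (hD : 0 < D) (hDn : D ≤ n)
    (hno : ∀ d < D, ∀ a x, ¬ Succ n (halfWindow n r) (4 ^ n) (2 ^ r) G R d a x)
    (hyes : ∃ a < n, ∃ x < 2 * halfWindow n r,
      Succ n (halfWindow n r) (4 ^ n) (2 ^ r) G R D (n - a) (2 * halfWindow n r - x))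
    (hX1 : ∀ d ≤ D, ∀ a x, (sideN (prm n (halfWindow n r) (4 ^ n) (2 ^ r) d a x 0) G 0
      (halfWindow n r)).length ≤ X)
    (hX2 : ∀ d ≤ D, ∀ a x, (sideN (prm n (halfWindow n r) (4 ^ n) (2 ^ r) d a x 0) G
      (halfWindow n r) (halfWindow n r)).length ≤ X)
    (hX3 : ∀ d ≤ D, ∀ a x,
      (candN (prm n (halfWindow n r) (4 ^ n) (2 ^ r) d a x 0) G).length ≤ X) :
    ∃ t s, Exec distP (initState H) t s ∧ t ≤ 10 ^ 7 * (n + 1) ^ 7 * (X + 1) ∧ s.reg 0 = D := by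
  set w := halfWindow n r with hw
  set K := 5 * n + 20 with hK
  set E : Env := ⟨2 * K + 6, n + 1, (initState H).mem⟩ with hE
  have hEB : E.B = 10 * n + 46 := by simp [hE, hK]; omega
  have hnK : 8 * n + 8 < 2 ^ K := by
    have h1 : n < 2 ^ n := Nat.lt_two_pow_self
    have h2 : 2 ^ (n + 5) ≤ 2 ^ K := Nat.pow_le_pow_right (by omega) (by omega)
    have h3 : 2 ^ (n + 5) = 32 * 2 ^ n := by ring
    omega
  have hB : 64 * 2 ^ K ≤ 2 ^ E.B :=
    calc 64 * 2 ^ K = 2 ^ (K + 6) := by ring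
      _ ≤ _ := Nat.pow_le_pow_right (by omega) (by omega)
  have hE0 : E.B ≠ 0 := by omega
  have hinp : ∀ a, E.inp a < 4 := initState_mem_lt H
  set h₀ : VState := ⟨fun x => if x = 0 then n else if x = 1 then r else 0, fun _ => [], 3⟩ with hh
  -- the first three instructions lead from the initial state to a state of the abstract machine
  have b0 : Bnd E.B (initState H) := by
    refine ⟨fun x => ?_, fun a => (initState_mem_lt H a).trans (by omega)⟩
    simp only [initState]
    split_ifs <;> omega
  have b1 := b0.reg 2 (v := r) (by omega)
  have b2 := b1.reg 3 (v := 1) (by omega)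
  have b3 := b2.reg 1 (v := n + 1) (by omega)
  have g1 := Go.arith b0 .add 2 1 3
  have g2 := Go.const ⟨Function.update (initState H).reg 2 r, (initState H).mem⟩ 3 1
    (B := E.B) (by omega)
  have g3 := Go.arith b2 .add 1 0 3
  have i0 : (initState H).reg 0 = n := by simp [initState]
  have i1 : (initState H).reg 1 = r := by simp [initState]
  have i3 : (initState H).reg 3 = 0 := by simp [initState]
  simp [Op.eval, i0, i1, i3] at g1 g3
  have hrep : Rep E h₀ ⟨Function.update (Function.update (Function.update (initState H).reg 2 r) 3 1)
      1 (n + 1), (initState H).mem⟩ := by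
    refine ⟨fun x => ?_, by simp [hE], b3, fun a _ => rfl, fun id => ?_, fun id i => ?_⟩
    · simp only [Function.update_apply]
      rw [if_neg (by omega), if_neg (by omega)]
      simp only [initState, hh]
      split_ifs <;> omega
    · simpa [hh] using initState_mem_eq_zero H hr (le_addr (n + 1) id 0)
    · simpa [hh] using initState_mem_eq_zero H hr (le_addr (n + 1) id (i + 1))
  have key := wp_distP (E := E) (h₀ := h₀) (X := X) hr hn hK hEB rfl hinp (by simp [hh])
    (by simp [hh])
    (fun x hx => by simp only [hh]; rw [if_neg (by omega), if_neg (by omega)]) rfl rfl hw hG hR hX4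
    hD hDn hno hyes hX1 hX2 hX3
  obtain ⟨t, s', h', g, hrep', hc, hv, hcost⟩ := key _ hrep
  obtain ⟨T, hex, hT⟩ := g1.seq (g2.seq (g3.seq g))
  refine ⟨T, s', hex, hT.trans ?_, ?_⟩
  · have h3 : h₀.clk = 3 := rfl
    have e1 : 1 + 2 * E.B ≤ 200 * (n + 1) := by omega
    calc _ ≤ (50000 * (n + 1) ^ 6 * (X + 1)) * (200 * (n + 1)) :=
          Nat.mul_le_mul (by omega) e1
      _ = _ := by ring
  · have := hrep'.var 0
    rw [← hv, ← this]

section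

/-! ### Elimination on numbers as bit vectors -/

theorem xor_lt_iff {x b : ℕ} (hb : b ≠ 0) : x ^^^ b < x ↔ x.testBit (Nat.log2 b) = true := by
  have htop : b.testBit (Nat.log2 b) = true := Nat.testBit_log2 hb
  have hhigh : ∀ j, Nat.log2 b < j → b.testBit j = false := fun j hj =>
    Nat.testBit_lt_two_pow ((Nat.log2_lt hb).1 hj)
  constructor
  · intro h
    by_contra hc
    rw [Bool.not_eq_true] at hc
    have : x < x ^^^ b := Nat.lt_of_testBit (Nat.log2 b) hc (by simp [hc, htop])
      fun j hj => by simp [hhigh j hj]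
    omega
  · intro hc
    exact Nat.lt_of_testBit (Nat.log2 b) (by simp [hc, htop]) hc fun j hj => by simp [hhigh j hj]

theorem xor_lt_two_pow_iff (x y k : ℕ) : x ^^^ y < 2 ^ k ↔ x / 2 ^ k = y / 2 ^ k := by
  rw [← Nat.div_eq_zero_iff_lt (by positivity), Nat.xor_div_two_pow, Nat.xor_eq_zero_iff]

section Elimination
variable {V : Type*} [AddCommGroup V] {g : V → ℕ}

/-- An injective map to the natural numbers that turns addition into exclusive or. -/
structure Coding (g : V → ℕ) : Prop where
  inj : Function.Injective g
  add : ∀ x y, g (x + y) = g x ^^^ g y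

theorem Coding.zero (hg : Coding g) : g 0 = 0 := by
  have := hg.add 0 0
  rw [add_zero] at this
  simpa using this

theorem Coding.ne_zero (hg : Coding g) {x : V} (hx : x ≠ 0) : g x ≠ 0 := by
  rw [← hg.zero]; exact fun h => hx (hg.inj h)

/-- The counterpart of `redN` for vectors. -/
def redV (g : V → ℕ) (bs : List V) (x : V) : V :=
  bs.foldl (fun x b => if g x ^^^ g b < g x then x + b else x) x

theorem redV_append_singleton (g : V → ℕ) (bs : List V) (c x : V) :
    redV g (bs ++ [c]) x = if g (redV g bs x) ^^^ g c < g (redV g bs x)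
      then redV g bs x + c else redV g bs x := by
  unfold redV
  rw [List.foldl_append]
  rfl

theorem Coding.redV (hg : Coding g) (bs : List V) (x : V) :
    g (redV g bs x) = redN (bs.map g) (g x) := by
  unfold redN QDist.redV
  induction bs generalizing x with
  | nil => rfl
  | cons b bs ih =>
    simp only [List.map_cons, List.foldl_cons]
    rw [ih]
    congr 1
    split_ifs <;> simp [hg.add]

/-- The leading bit of each vector is at position `k` or above, and it does not occur in the later
vectors. -/
structure Piv (g : V → ℕ) (k : ℕ) (bs : List V) : Prop where
  le : ∀ b ∈ bs, 2 ^ k ≤ g b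
  pw : bs.Pairwise fun b b' => (g b').testBit (Nat.log2 (g b)) = false

theorem Piv.ne_zero {k : ℕ} {bs : List V} (hg : Coding g) (h : Piv g k bs) :
    ∀ b ∈ bs, b ≠ 0 := by
  rintro b hb rfl
  have := h.le 0 hb
  rw [hg.zero] at this
  have : 0 < 2 ^ k := by positivity
  omega

theorem redV_eq_self {bs : List V} (hg : Coding g) (hbs : ∀ b ∈ bs, b ≠ 0) {x : V}
    (hx : ∀ b ∈ bs, (g x).testBit (Nat.log2 (g b)) = false) : redV g bs x = x := by
  unfold redV
  induction bs with
  | nil => rfl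
  | cons b bs ih =>
    have hb := hg.ne_zero (hbs b (by simp))
    rw [List.foldl_cons, if_neg (by rw [xor_lt_iff hb, hx b (by simp)]; simp)]
    exact ih (fun c hc => hbs c (by simp [hc])) (fun c hc => hx c (by simp [hc]))

theorem redV_of_lt {k : ℕ} {bs : List V} (hg : Coding g) (h : Piv g k bs) {x : V}
    (hx : g x < 2 ^ k) : redV g bs x = x := by
  refine redV_eq_self hg (h.ne_zero hg) fun b hb => Nat.testBit_lt_two_pow (hx.trans_le ?_)
  refine Nat.pow_le_pow_right (by omega) ?_
  rw [Nat.le_log2 (hg.ne_zero (h.ne_zero hg b hb))]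
  exact h.le b hb

theorem testBit_redV {k : ℕ} {bs : List V} (hg : Coding g) (h : Piv g k bs) (x : V) :
    ∀ b ∈ bs, (g (redV g bs x)).testBit (Nat.log2 (g b)) = false := by
  induction bs using List.reverseRecOn generalizing x with
  | nil => simp
  | append_singleton bs c ih =>
    have hp := List.pairwise_append.1 h.pw
    have hbs : Piv g k bs := ⟨fun b hb => h.le b (by simp [hb]), hp.1⟩
    have hc := hg.ne_zero (h.ne_zero hg c (by simp))
    intro b hb
    rw [List.mem_append, List.mem_singleton] at hb
    rw [redV_append_singleton]
    simp only [xor_lt_iff hc]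
    rcases hb with hb | rfl
    · have h1 := ih hbs x b hb
      have h2 := hp.2.2 b hb c (by simp)
      split_ifs
      · simp [hg.add, h1, h2]
      · exact h1
    · split_ifs with h1
      · simp [hg.add, h1, Nat.testBit_log2 hc]
      · simpa using h1

/-- The counterpart of `extN` for vectors with a weight function. -/
def extV (wt : V → ℕ) (W : ℕ) (A : List V) (v : V) : List V :=
  A ++ (A.map (· + v)).filter fun y => decide (wt y ≤ W)

theorem Coding.extV (hg : Coding g) {wt : V → ℕ} {P : ℕ} (hwt : ∀ x, wt4 (g x % P) = wt x) (W : ℕ)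
    (A : List V) (v : V) : extN P W (A.map g) (g v) = (extV wt W A v).map g := by
  simp only [extN, QDist.extV, List.map_append, List.map_map]
  congr 1
  rw [List.filter_map, List.filter_map, List.map_map]
  have h1 : (fun x => g x ^^^ g v) = fun x => g (x + v) := by
    funext x; rw [hg.add]
  simp only [Function.comp_def, ← hg.add, hwt]

theorem Coding.foldl_extV (hg : Coding g) {wt : V → ℕ} {P : ℕ} (hwt : ∀ x, wt4 (g x % P) = wt x)
    (W : ℕ) (vs A : List V) :
    (vs.map g).foldl (extN P W) (A.map g) = (vs.foldl (QDist.extV wt W) A).map g := by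
  induction vs generalizing A with
  | nil => rfl
  | cons v vs ih => simp only [List.map_cons, List.foldl_cons]; rw [hg.extV hwt, ih]

variable [Module (ZMod 2) V]

theorem zmod_two_cases (c : ZMod 2) : c = 0 ∨ c = 1 := by revert c; decide

/-- The linear span of the members of a list. -/
abbrev lspan (L : List V) : Submodule (ZMod 2) V := Submodule.span (ZMod 2) {x | x ∈ L}

theorem lspan_nil : lspan ([] : List V) = ⊥ := by simp [lspan]

theorem lspan_append (L L' : List V) : lspan (L ++ L') = lspan L ⊔ lspan L' := by
  rw [lspan, lspan, lspan, ← Submodule.span_union]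
  congr 1
  ext x; simp

theorem lspan_singleton (v : V) : lspan [v] = Submodule.span (ZMod 2) {v} := by
  simp [lspan]

theorem mem_lspan {L : List V} {x : V} (h : x ∈ L) : x ∈ lspan L := Submodule.subset_span h

theorem mem_lspan_append_singleton {L : List V} {v x : V} :
    x ∈ lspan (L ++ [v]) ↔ x ∈ lspan L ∨ x + v ∈ lspan L := by
  rw [lspan_append, lspan_singleton, Submodule.mem_sup]
  constructor
  · rintro ⟨y, hy, z, hz, rfl⟩
    obtain ⟨c, rfl⟩ := Submodule.mem_span_singleton.1 hz
    obtain rfl | rfl : c = 0 ∨ c = 1 := zmod_two_cases c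
    · left; simpa using hy
    · right
      rwa [one_smul, add_assoc, ZModModule.add_self, add_zero]
  · rintro (h | h)
    · exact ⟨x, h, 0, zero_mem _, add_zero _⟩
    · exact ⟨x + v, h, v, Submodule.mem_span_singleton_self v, by
        rw [add_assoc, ZModModule.add_self, add_zero]⟩

/-- Every member of the list lies outside the span of the earlier ones. -/
def Indep (L : List V) : Prop := ∀ L₁ v L₂, L = L₁ ++ v :: L₂ → v ∉ lspan L₁

theorem Indep.append_singleton {L : List V} {v : V} :
    Indep (L ++ [v]) ↔ Indep L ∧ v ∉ lspan L := by
  constructor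
  · intro h
    exact ⟨fun L₁ u L₂ e => h L₁ u (L₂ ++ [v]) (by simp [e]), h L v [] rfl⟩
  · rintro ⟨h1, h2⟩ L₁ u L₂ e
    rcases List.eq_nil_or_concat L₂ with rfl | ⟨L₃, w, rfl⟩
    · obtain ⟨rfl, rfl⟩ : L = L₁ ∧ v = u := by simpa using List.append_inj' e rfl
      exact h2
    · have e' : L ++ [v] = (L₁ ++ u :: L₃) ++ [w] := by simpa using e
      obtain ⟨rfl, -⟩ := List.append_inj' e' rfl
      exact h1 L₁ u L₃ rfl

theorem redV_add_self_mem (g : V → ℕ) (bs : List V) (x : V) : redV g bs x + x ∈ lspan bs := by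
  unfold redV
  induction bs generalizing x with
  | nil => simp [ZModModule.add_self]
  | cons b bs ih =>
    rw [List.foldl_cons]
    have hle : lspan bs ≤ lspan (b :: bs) := Submodule.span_mono fun y hy => by
      simp only [Set.mem_ofPred_eq] at hy ⊢; exact List.mem_cons_of_mem _ hy
    split_ifs with h
    · have h1 := hle (ih (x + b))
      have h2 := add_mem h1 (mem_lspan (List.mem_cons_self (a := b) (l := bs)))
      rw [← add_assoc, add_assoc _ b b, ZModModule.add_self, add_zero] at h2
      exact h2
    · exact hle (ih x)

theorem redV_add (hg : Coding g) {bs : List V} (hbs : ∀ b ∈ bs, b ≠ 0) (x y : V) :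
    redV g bs (x + y) = redV g bs x + redV g bs y := by
  unfold redV
  induction bs generalizing x y with
  | nil => rfl
  | cons b bs ih =>
    simp only [List.foldl_cons]
    have hb := hg.ne_zero (hbs b (by simp))
    rw [← ih (fun c hc => hbs c (by simp [hc]))]
    congr 1
    simp only [xor_lt_iff hb, hg.add, Nat.testBit_xor]
    have hbb := ZModModule.add_self b
    rcases (g x).testBit (Nat.log2 (g b)) <;> rcases (g y).testBit (Nat.log2 (g b)) <;> simp
    · abel
    · abel
    · calc x + y = x + y + (b + b) := by rw [hbb, add_zero]
        _ = x + b + (y + b) := by abel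

theorem redV_mem_eq_zero {k : ℕ} {bs : List V} (hg : Coding g) (h : Piv g k bs) :
    ∀ b ∈ bs, redV g bs b = 0 := by
  induction bs using List.reverseRecOn with
  | nil => simp
  | append_singleton bs c ih =>
    have hp := List.pairwise_append.1 h.pw
    have hbs : Piv g k bs := ⟨fun b hb => h.le b (by simp [hb]), hp.1⟩
    have hc := hg.ne_zero (h.ne_zero hg c (by simp))
    intro b hb
    rw [List.mem_append, List.mem_singleton] at hb
    rw [redV_append_singleton]
    rcases hb with hb | rfl
    · rw [ih hbs b hb, hg.zero]; simp
    · rw [redV_eq_self hg (hbs.ne_zero hg) fun c hc => hp.2.2 c hc b (by simp),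
        if_pos (by rw [xor_lt_iff hc, Nat.testBit_log2 hc]), ZModModule.add_self]

theorem redV_eq_zero_iff {k : ℕ} {bs : List V} (hg : Coding g) (h : Piv g k bs) (x : V) :
    redV g bs x = 0 ↔ x ∈ lspan bs := by
  constructor
  · intro hx
    have := redV_add_self_mem g bs x
    rwa [hx, zero_add] at this
  · intro hx
    have hadd := redV_add hg (h.ne_zero hg)
    have h0 : redV g bs 0 = 0 := by
      have := hadd 0 0
      rw [add_zero] at this
      simpa using this
    induction hx using Submodule.span_induction with
    | mem y hy => exact redV_mem_eq_zero hg h y hy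
    | zero => exact h0
    | add y z _ _ hy hz => rw [hadd, hy, hz, add_zero]
    | smul c y _ hy =>
      obtain rfl | rfl : c = 0 ∨ c = 1 := zmod_two_cases c
      · simpa using h0
      · simpa using hy

/-- Insertion of independent vectors yields an echelon basis, and independent relations. -/
theorem foldl_insN_spec (hg : Coding g) (k : ℕ) (vs : List V) :
    ∃ bs ks : List V, (vs.map g).foldl (insN (2 ^ k)) ([], []) = (bs.map g, ks.map g) ∧
      Piv g k bs ∧ (∀ x ∈ ks, g x < 2 ^ k) ∧ lspan bs ⊔ lspan ks = lspan vs ∧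
      (Indep vs → Indep ks) := by
  induction vs using List.reverseRecOn with
  | nil =>
    refine ⟨[], [], rfl, ⟨by simp, by simp⟩, by simp, by simp, ?_⟩
    rintro - L₁ v L₂ e
    simp at e
  | append_singleton vs v ih =>
    obtain ⟨bs, ks, he, hp, hk, hs, hi⟩ := ih
    set u := redV g bs v with hu
    have hun : redN (bs.map g) (g v) = g u := (hg.redV bs v).symm
    have huv : u + v ∈ lspan bs := redV_add_self_mem g bs v
    -- inserting the reduced vector has the same effect on the span as inserting the vector
    have hspan : ∀ W : Submodule (ZMod 2) V, lspan bs ≤ W →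
        W ⊔ lspan [u] = W ⊔ lspan [v] := by
      intro W hW
      have a1 : v ∈ W ⊔ lspan [u] := by
        have : v = (u + v) + u := by rw [add_comm u v, add_assoc, ZModModule.add_self, add_zero]
        rw [this]
        exact add_mem (Submodule.mem_sup_left (hW huv))
          (Submodule.mem_sup_right (mem_lspan (by simp)))
      have a2 : u ∈ W ⊔ lspan [v] := by
        have : u = (u + v) + v := by rw [add_assoc, ZModModule.add_self, add_zero]
        rw [this]
        exact add_mem (Submodule.mem_sup_left (hW huv))
          (Submodule.mem_sup_right (mem_lspan (by simp)))
      refine le_antisymm (sup_le le_sup_left ?_) (sup_le le_sup_left ?_)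
      · rw [lspan_singleton u, Submodule.span_le]; simpa using a2
      · rw [lspan_singleton v, Submodule.span_le]; simpa using a1
    rw [List.map_append, List.foldl_append, he]
    simp only [List.map_cons, List.map_nil, List.foldl_cons, List.foldl_nil, insN, hun]
    split_ifs with hd
    · refine ⟨bs, ks ++ [u], by simp, hp, ?_, ?_, ?_⟩
      · intro x hx
        rw [List.mem_append, List.mem_singleton] at hx
        rcases hx with hx | rfl
        · exact hk x hx
        · exact (Nat.div_eq_zero_iff_lt (by positivity)).1 hd
      · rw [lspan_append, lspan_append, ← sup_assoc, hs, hspan _ (hs ▸ le_sup_left)]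
      · rw [Indep.append_singleton, Indep.append_singleton]
        rintro ⟨h1, h2⟩
        refine ⟨hi h1, fun hmem => h2 ?_⟩
        have h3 : u ∈ lspan vs := hs ▸ Submodule.mem_sup_right hmem
        have h4 : u + v ∈ lspan vs := hs ▸ Submodule.mem_sup_left huv
        have := add_mem h3 h4
        rwa [← add_assoc, ZModModule.add_self, zero_add] at this
    · refine ⟨bs ++ [u], ks, by simp, ⟨?_, ?_⟩, hk, ?_, ?_⟩
      · intro b hb
        rw [List.mem_append, List.mem_singleton] at hb
        rcases hb with hb | rfl
        · exact hp.le b hb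
        · rw [Nat.div_eq_zero_iff_lt (by positivity)] at hd
          omega
      · rw [List.pairwise_append]
        refine ⟨hp.pw, by simp, fun b hb c hc => ?_⟩
        rw [List.mem_singleton] at hc
        rw [hc]
        exact testBit_redV hg hp v b hb
      · rw [lspan_append, lspan_append, sup_right_comm, hs, hspan _ (hs ▸ le_sup_left)]
      · rw [Indep.append_singleton]
        exact fun h => hi h.1

theorem mem_foldl_extV {wt : V → ℕ} {W : ℕ} {vs A : List V} {y : V}
    (hy : y ∈ vs.foldl (extV wt W) A) :
    (∃ a ∈ A, y + a ∈ lspan vs) ∧ (y ∈ A ∨ wt y ≤ W) := by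
  induction vs using List.reverseRecOn generalizing y with
  | nil => exact ⟨⟨y, hy, by simp [ZModModule.add_self]⟩, .inl hy⟩
  | append_singleton vs v ih =>
    rw [List.foldl_append, List.foldl_cons, List.foldl_nil, extV, List.mem_append] at hy
    rcases hy with hy | hy
    · obtain ⟨⟨a, ha, h1⟩, h2⟩ := ih hy
      exact ⟨⟨a, ha, mem_lspan_append_singleton.2 (.inl h1)⟩, h2⟩
    · simp only [List.mem_filter, List.mem_map, decide_eq_true_eq] at hy
      obtain ⟨⟨z, hz, rfl⟩, hw⟩ := hy
      obtain ⟨⟨a, ha, h1⟩, -⟩ := ih hz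
      refine ⟨⟨a, ha, mem_lspan_append_singleton.2 (.inr ?_)⟩, .inr hw⟩
      have : z + v + a + v = z + a := by
        calc z + v + a + v = z + a + (v + v) := by abel
          _ = _ := by rw [ZModModule.add_self, add_zero]
      rwa [this]

/-- Without an effective bound on the weight, the whole cosets are generated. -/
theorem mem_foldl_extV_of_le {wt : V → ℕ} {W : ℕ} (hW : ∀ x, wt x ≤ W) {vs A : List V} {a y : V}
    (ha : a ∈ A) (hy : y + a ∈ lspan vs) : y ∈ vs.foldl (extV wt W) A := by
  induction vs using List.reverseRecOn generalizing y with
  | nil =>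
    rw [lspan_nil, Submodule.mem_bot] at hy
    have : y = a := by
      calc y = y + a + a := by rw [add_assoc, ZModModule.add_self, add_zero]
        _ = a := by rw [hy, zero_add]
    rwa [this]
  | append_singleton vs v ih =>
    rw [List.foldl_append, List.foldl_cons, List.foldl_nil, extV, List.mem_append]
    rcases mem_lspan_append_singleton.1 hy with h | h
    · exact .inl (ih h)
    · right
      simp only [List.mem_filter, List.mem_map, decide_eq_true_eq]
      refine ⟨⟨y + v, ih (by rwa [add_right_comm]), ?_⟩, hW _⟩
      rw [add_assoc, ZModModule.add_self, add_zero]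

theorem nodup_foldl_extV {wt : V → ℕ} {W : ℕ} {vs A : List V} (hA : A.Nodup) (hvs : Indep vs)
    (hAv : ∀ a ∈ A, ∀ a' ∈ A, a + a' ∈ lspan vs → a = a') :
    (vs.foldl (extV wt W) A).Nodup := by
  induction vs using List.reverseRecOn with
  | nil => exact hA
  | append_singleton vs v ih =>
    rw [Indep.append_singleton] at hvs
    have ih' := ih hvs.1 fun a ha a' ha' h =>
      hAv a ha a' ha' (mem_lspan_append_singleton.2 (.inl h))
    rw [List.foldl_append, List.foldl_cons, List.foldl_nil, extV, List.nodup_append']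
    refine ⟨ih', (ih'.map (add_left_injective v)).filter _, ?_⟩
    intro y hy hy'
    simp only [List.mem_filter, List.mem_map] at hy'
    obtain ⟨⟨z, hz, rfl⟩, -⟩ := hy'
    obtain ⟨⟨a, ha, h1⟩, -⟩ := mem_foldl_extV hy
    obtain ⟨⟨b, hb, h2⟩, -⟩ := mem_foldl_extV hz
    have h3 : z + v + a + (z + b) = a + b + v := by
      calc z + v + a + (z + b) = a + b + v + (z + z) := by abel
        _ = _ := by rw [ZModModule.add_self, add_zero]
    have h4 : a + b + v ∈ lspan vs := h3 ▸ add_mem h1 h2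
    have h5 := hAv a ha b hb (mem_lspan_append_singleton.2 (.inr h4))
    rw [h5, ZModModule.add_self, zero_add] at h4
    exact hvs.2 h4

end Elimination

end

section

section Matching
variable {V : Type*} [AddCommGroup V] {g : V → ℕ}

/-! ### Meet in the middle -/

/-- The counterpart of `matchN` for vectors. -/
def matchV (g : V → ℕ) (P : ℕ) (bs A B : List V) : List V :=
  B.flatMap fun y => ((A.map (redV g bs)).filter fun z =>
    decide (g z / P = g (redV g bs y) / P)).map (· + redV g bs y)

theorem Coding.matchV (hg : Coding g) (P : ℕ) (bs A B : List V) :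
    matchN P (bs.map g) (A.map g) (B.map g) = (QDist.matchV g P bs A B).map g := by
  simp only [matchN, QDist.matchV, bucketN, List.map_flatMap, List.flatMap_map, List.map_map]
  congr 1
  funext y
  rw [List.filter_map, List.filter_map, List.map_map, List.map_map]
  simp only [Function.comp_def, ← hg.redV, hg.add]

theorem mem_matchV (hg : Coding g) {k : ℕ} {bs A B : List V} {z : V} :
    z ∈ matchV g (2 ^ k) bs A B ↔
      ∃ x ∈ A, ∃ y ∈ B, z = redV g bs x + redV g bs y ∧ g z < 2 ^ k := by
  simp only [matchV, List.mem_flatMap, List.mem_map, List.mem_filter, decide_eq_true_eq]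
  constructor
  · rintro ⟨y, hy, _, ⟨⟨x, hx, rfl⟩, hk⟩, rfl⟩
    exact ⟨x, hx, y, hy, rfl, by rw [hg.add, xor_lt_two_pow_iff]; exact hk⟩
  · rintro ⟨x, hx, y, hy, rfl, hk⟩
    rw [hg.add, xor_lt_two_pow_iff] at hk
    exact ⟨y, hy, _, ⟨⟨x, hx, rfl⟩, hk⟩, rfl⟩

variable [Module (ZMod 2) V]

theorem Coding.lt_of_mem_lspan (hg : Coding g) {k : ℕ} {ks : List V}
    (hk : ∀ x ∈ ks, g x < 2 ^ k) {x : V} (hx : x ∈ lspan ks) : g x < 2 ^ k := by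
  have h0 : g 0 < 2 ^ k := by rw [hg.zero]; positivity
  induction hx using Submodule.span_induction with
  | mem y hy => exact hk y hy
  | zero => exact h0
  | add y z _ _ hy hz => rw [hg.add]; exact Nat.xor_lt_two_pow hy hz
  | smul c y _ hy =>
    obtain rfl | rfl := zmod_two_cases c
    · simpa using h0
    · simpa using hy

/-- Meet in the middle: the matches of the lists `A` and `B`, completed by the relations `ks`,
are the vectors with zero syndrome in `A + B + U`, each obtained once. -/
theorem foldl_extV_matchV (hg : Coding g) {k : ℕ} {bs ks A B : List V}
    {U₁ U₂ U : Submodule (ZMod 2) V} (hbs : Piv g k bs) (hks : ∀ x ∈ ks, g x < 2 ^ k)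
    (hU : lspan bs ⊔ lspan ks = U) (hind : Indep ks) (hA : A.Nodup) (hB : B.Nodup)
    (hA₁ : ∀ x ∈ A, x ∈ U₁) (hB₂ : ∀ y ∈ B, y ∈ U₂)
    (hdis : ∀ x ∈ U₁, ∀ y ∈ U₂, x + y ∈ U → x = 0 ∧ y = 0)
    {wt : V → ℕ} {W : ℕ} (hW : ∀ x, wt x ≤ W) :
    (ks.foldl (extV wt W) (matchV g (2 ^ k) bs A B)).Nodup ∧
    ∀ e, e ∈ ks.foldl (extV wt W) (matchV g (2 ^ k) bs A B) ↔
      g e < 2 ^ k ∧ ∃ x ∈ A, ∃ y ∈ B, e + x + y ∈ U := by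
  have hbU : lspan bs ≤ U := hU ▸ le_sup_left
  have hkU : lspan ks ≤ U := hU ▸ le_sup_right
  have hred : ∀ x, redV g bs x + x ∈ U := fun x => hbU (redV_add_self_mem g bs x)
  have hself := fun x : V => ZModModule.add_self x
  -- the parts of a match in `A` and in `B` are determined even modulo `U`
  have huniq : ∀ x ∈ A, ∀ y ∈ B, ∀ x' ∈ A, ∀ y' ∈ B,
      redV g bs x + redV g bs y + (redV g bs x' + redV g bs y') ∈ U → x = x' ∧ y = y' := by
    intro x hx y hy x' hx' y' hy' h
    have h1 := add_mem (add_mem (hred x) (hred x')) (add_mem (hred y) (hred y'))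
    have h2 := add_mem h h1
    have h3 : redV g bs x + redV g bs y + (redV g bs x' + redV g bs y') +
        (redV g bs x + x + (redV g bs x' + x') + (redV g bs y + y + (redV g bs y' + y'))) =
        (x + x') + (y + y') := by
      calc _ = (redV g bs x + redV g bs x) + (redV g bs y + redV g bs y) +
            ((redV g bs x' + redV g bs x') + (redV g bs y' + redV g bs y')) +
            ((x + x') + (y + y')) := by abel
        _ = _ := by simp only [hself, zero_add]
    rw [h3] at h2
    obtain ⟨h4, h5⟩ := hdis _ (add_mem (hA₁ x hx) (hA₁ x' hx')) _
      (add_mem (hB₂ y hy) (hB₂ y' hy')) h2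
    rw [← ZModModule.sub_eq_add, sub_eq_zero] at h4 h5
    exact ⟨h4, h5⟩
  have hmem0 : (0 : V) ∈ U := zero_mem _
  refine ⟨nodup_foldl_extV ?_ hind ?_, fun e => ⟨fun he => ?_, ?_⟩⟩
  · rw [matchV, List.nodup_flatMap]
    refine ⟨fun y hy => ((List.Nodup.filter _ ?_).map (add_left_injective _)), ?_⟩
    · refine List.Nodup.map_on (fun x hx x' hx' h => ?_) hA
      refine (huniq x hx y hy x' hx' y hy ?_).1
      rw [h, hself]; exact hmem0
    · refine hB.imp_of_mem fun {y y'} hy hy' hne => ?_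
      intro z hz hz'
      simp only [List.mem_map, List.mem_filter] at hz hz'
      obtain ⟨_, ⟨⟨x, hx, rfl⟩, -⟩, rfl⟩ := hz
      obtain ⟨_, ⟨⟨x', hx', rfl⟩, -⟩, h⟩ := hz'
      refine hne (huniq x hx y hy x' hx' y' hy' ?_).2
      rw [h, hself]; exact hmem0
  · intro a ha a' ha' h
    obtain ⟨x, hx, y, hy, rfl, -⟩ := (mem_matchV hg).1 ha
    obtain ⟨x', hx', y', hy', rfl, -⟩ := (mem_matchV hg).1 ha'
    obtain ⟨rfl, rfl⟩ := huniq x hx y hy x' hx' y' hy' (hkU h)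
    rfl
  · obtain ⟨⟨m, hm, h⟩, -⟩ := mem_foldl_extV he
    obtain ⟨x, hx, y, hy, rfl, hlt⟩ := (mem_matchV hg).1 hm
    refine ⟨?_, x, hx, y, hy, ?_⟩
    · have h1 := hg.lt_of_mem_lspan hks h
      rw [hg.add] at h1
      have h2 := Nat.xor_lt_two_pow h1 hlt
      rwa [Nat.xor_assoc, Nat.xor_self, Nat.xor_zero] at h2
    · have h1 := add_mem (hkU h) (add_mem (hred x) (hred y))
      have h2 : e + (redV g bs x + redV g bs y) + (redV g bs x + x + (redV g bs y + y)) =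
          e + x + y := by
        calc _ = (redV g bs x + redV g bs x) + (redV g bs y + redV g bs y) + (e + x + y) := by abel
          _ = _ := by rw [hself, hself]; simp
      rwa [h2] at h1
  · rintro ⟨hlt, x, hx, y, hy, hxy⟩
    rw [← hU, Submodule.mem_sup] at hxy
    obtain ⟨b, hb, κ, hκ, hsum⟩ := hxy
    have hadd := redV_add hg (hbs.ne_zero hg)
    have h1 : x + y + b = e + κ := by
      calc x + y + b = x + y + (b + κ) - κ := by abel
        _ = e - κ + (x + x) + (y + y) := by rw [hsum]; abel
        _ = e + κ := by simp only [hself, add_zero, ZModModule.sub_eq_add]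
    have hκlt := hg.lt_of_mem_lspan hks hκ
    have hlt' : g (e + κ) < 2 ^ k := by rw [hg.add]; exact Nat.xor_lt_two_pow hlt hκlt
    have h2 : redV g bs x + redV g bs y = e + κ := by
      rw [← hadd, ← redV_of_lt hg hbs hlt', ← h1, hadd (x + y) b,
        (redV_eq_zero_iff hg hbs b).2 hb, add_zero]
    refine mem_foldl_extV_of_le hW ((mem_matchV hg).2 ⟨x, hx, y, hy, h2.symm, hlt'⟩) ?_
    rwa [← add_assoc, hself, zero_add]

end Matching

end

section

/-! ### Pauli operators as numbers -/

theorem xor_add_mul_two_pow {k a b : ℕ} (x y : ℕ) (ha : a < 2 ^ k) (hb : b < 2 ^ k) :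
    (a + 2 ^ k * x) ^^^ (b + 2 ^ k * y) = (a ^^^ b) + 2 ^ k * (x ^^^ y) := by
  have hp : 0 < 2 ^ k := by positivity
  rw [← Nat.mod_add_div ((a + 2 ^ k * x) ^^^ (b + 2 ^ k * y)) (2 ^ k), Nat.xor_mod_two_pow,
    Nat.xor_div_two_pow, Nat.add_mul_mod_self_left, Nat.add_mul_mod_self_left,
    Nat.mod_eq_of_lt ha, Nat.mod_eq_of_lt hb, Nat.add_mul_div_left _ _ hp,
    Nat.add_mul_div_left _ _ hp, Nat.div_eq_of_lt ha, Nat.div_eq_of_lt hb, zero_add, zero_add]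

theorem digits_succ' (q m : ℕ) (b : ℕ → ℕ) :
    digits q (m + 1) b = b 0 + q * digits q m fun i => b (i + 1) := by
  simp only [digits, Finset.sum_range_succ', Finset.mul_sum, pow_zero, mul_one]
  rw [add_comm]
  congr 1
  exact Finset.sum_congr rfl fun i _ => by ring

theorem digits_xor {k : ℕ} (m : ℕ) {b b' : ℕ → ℕ} (hb : ∀ i, b i < 2 ^ k)
    (hb' : ∀ i, b' i < 2 ^ k) :
    digits (2 ^ k) m b ^^^ digits (2 ^ k) m b' = digits (2 ^ k) m fun i => b i ^^^ b' i := by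
  induction m generalizing b b' with
  | zero => simp [digits]
  | succ m ih =>
    rw [digits_succ', digits_succ', digits_succ', xor_add_mul_two_pow _ _ (hb 0) (hb' 0),
      ih (fun i => hb _) (fun i => hb' _)]

theorem digits_inj {q m : ℕ} {b b' : ℕ → ℕ} (hb : ∀ i, b i < q) (hb' : ∀ i, b' i < q)
    (h : digits q m b = digits q m b') : ∀ i < m, b i = b' i := by
  induction m generalizing b b' with
  | zero => simp
  | succ m ih =>
    rw [digits_succ', digits_succ'] at h
    have h0 : b 0 = b' 0 := by
      have := congrArg (· % q) h
      simpa [Nat.add_mul_mod_self_left, Nat.mod_eq_of_lt (hb 0), Nat.mod_eq_of_lt (hb' 0)] using this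
    have h1 : (digits q m fun i => b (i + 1)) = digits q m fun i => b' (i + 1) := by
      have hq : 0 < q := (Nat.zero_le _).trans_lt (hb 0)
      have := congrArg (· / q) h
      simpa [Nat.add_mul_div_left _ _ hq, Nat.div_eq_of_lt (hb 0), Nat.div_eq_of_lt (hb' 0)]
        using this
    intro i hi
    rcases i with _ | i
    · exact h0
    · exact ih (fun i => hb _) (fun i => hb' _) h1 i (by omega)

theorem wt4_digits (m : ℕ) {b : ℕ → ℕ} (hb : ∀ i, b i < 4) :
    wt4 (digits 4 m b) = ∑ i ∈ Finset.range m, if b i = 0 then 0 else 1 := by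
  induction m generalizing b with
  | zero => simp [digits, wt4_zero]
  | succ m ih =>
    rw [digits_succ', wt4_eq, Nat.add_mul_mod_self_left, Nat.mod_eq_of_lt (hb 0),
      Nat.add_mul_div_left _ _ (by omega), Nat.div_eq_of_lt (hb 0), zero_add,
      ih (fun i => hb _), Finset.sum_range_succ', add_comm]

theorem digits_eq_single {q m j c : ℕ} {b : ℕ → ℕ} (hj : j < m) (hbj : b j = c)
    (hb : ∀ i, i ≠ j → b i = 0) : digits q m b = c * q ^ j := by
  unfold digits
  rw [Finset.sum_eq_single j (fun i _ hi => by rw [hb i hi, zero_mul]), hbj]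
  intro h; simp at h; omega

theorem digits_congr {q m : ℕ} {b b' : ℕ → ℕ} (h : ∀ i < m, b i = b' i) :
    digits q m b = digits q m b' :=
  Finset.sum_congr rfl fun i hi => by rw [h i (Finset.mem_range.1 hi)]

/-- The number `u + 2 v` that stands for a symbol. -/
def sym (s : ZMod 2 × ZMod 2) : ℕ := s.1.val + 2 * s.2.val

theorem sym_lt (s : ZMod 2 × ZMod 2) : sym s < 2 ^ 2 := by revert s; decide

theorem sym_add (s s' : ZMod 2 × ZMod 2) : sym (s + s') = sym s ^^^ sym s' := by
  revert s s'; decide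

theorem sym_inj {s s' : ZMod 2 × ZMod 2} : sym s = sym s' → s = s' := by revert s s'; decide

theorem sym_eq_zero {s : ZMod 2 × ZMod 2} : sym s = 0 ↔ s = 0 := by revert s; decide

variable {r n : ℕ} (H : CheckMatrix r n)

/-- The base four number whose digits are the symbols of an operator. -/
def code (f : PauliVec n) : ℕ := digits (2 ^ 2) n fun j => if h : j < n then sym (f ⟨j, h⟩) else 0

/-- The binary number whose digits are the syndrome bits of an operator. -/
def syn (f : PauliVec n) : ℕ :=
  digits (2 ^ 1) r fun i => if h : i < r then (traceInner (H ⟨i, h⟩) f).val else 0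

/-- An operator together with its syndrome. -/
def tag (f : PauliVec n) : ℕ := code f + 2 ^ (2 * n) * syn H f

theorem code_lt (f : PauliVec n) : code f < 2 ^ (2 * n) := by
  rw [pow_mul]
  refine digits_lt (fun i => ?_) n
  split_ifs
  · exact sym_lt _
  · positivity

theorem code_add (f f' : PauliVec n) : code (f + f') = code f ^^^ code f' := by
  unfold code
  rw [digits_xor n (fun i => by split_ifs; exacts [sym_lt _, by positivity])
    (fun i => by split_ifs; exacts [sym_lt _, by positivity])]
  refine digits_congr fun i hi => ?_
  simp [hi, sym_add]

theorem traceInner_add (h f f' : PauliVec n) :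
    traceInner h (f + f') = traceInner h f + traceInner h f' := by
  simp only [traceInner, ← Finset.sum_add_distrib, Pi.add_apply, Prod.fst_add, Prod.snd_add]
  exact Finset.sum_congr rfl fun i _ => by ring

theorem traceInner_comm (f f' : PauliVec n) : traceInner f f' = traceInner f' f := by
  simp only [traceInner]
  exact Finset.sum_congr rfl fun i _ => by ring

theorem traceInner_smul (c : ZMod 2) (h f : PauliVec n) :
    traceInner h (c • f) = c * traceInner h f := by
  simp only [traceInner, Finset.mul_sum, Pi.smul_apply, Prod.smul_fst, Prod.smul_snd, smul_eq_mul]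
  exact Finset.sum_congr rfl fun i _ => by ring

theorem traceInner_self (f : PauliVec n) : traceInner f f = 0 := by
  simp only [traceInner]
  refine Finset.sum_eq_zero fun i _ => ?_
  rw [mul_comm, ZModModule.add_self]

theorem zmod_val_lt (c : ZMod 2) : c.val < 2 ^ 1 := by revert c; decide

theorem zmod_val_add (c c' : ZMod 2) : (c + c').val = c.val ^^^ c'.val := by revert c c'; decide

theorem syn_add (f f' : PauliVec n) : syn H (f + f') = syn H f ^^^ syn H f' := by
  unfold syn
  rw [digits_xor r (fun i => by split_ifs; exacts [zmod_val_lt _, by positivity])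
    (fun i => by split_ifs; exacts [zmod_val_lt _, by positivity])]
  refine digits_congr fun i hi => ?_
  simp [hi, traceInner_add, zmod_val_add]

theorem syn_eq_zero {f : PauliVec n} : syn H f = 0 ↔ ∀ i, traceInner (H i) f = 0 := by
  constructor
  · intro h i
    have h0 : syn H f = digits (2 ^ 1) r fun _ => 0 := by rw [h]; simp [digits]
    have := digits_inj (fun i => by split_ifs; exacts [zmod_val_lt _, by positivity])
      (fun i => by positivity) h0 i i.2
    simpa using this
  · intro h
    simp [syn, digits, h]

theorem coding_tag : Coding (tag H) where
  inj f f' h := by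
    have h1 := congrArg (· % 2 ^ (2 * n)) h
    simp only [tag, Nat.add_mul_mod_self_left, Nat.mod_eq_of_lt (code_lt _)] at h1
    have h2 := digits_inj (fun i => by split_ifs; exacts [sym_lt _, by positivity])
      (fun i => by split_ifs; exacts [sym_lt _, by positivity]) h1
    funext i
    have := h2 i i.2
    simp only [i.2, dif_pos] at this
    exact sym_inj this
  add f f' := by
    unfold tag
    rw [xor_add_mul_two_pow _ _ (code_lt _) (code_lt _), code_add, syn_add]

theorem tag_lt {f : PauliVec n} : tag H f < 2 ^ (2 * n) ↔ ∀ i, traceInner (H i) f = 0 := by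
  rw [← syn_eq_zero, tag]
  have hp : 0 < 2 ^ (2 * n) := by positivity
  have hc := code_lt f
  constructor
  · intro h
    by_contra h0
    have := Nat.le_mul_of_pos_right (2 ^ (2 * n)) (Nat.pos_of_ne_zero h0)
    omega
  · intro h; rw [h]; omega

theorem wt4_tag (f : PauliVec n) : wt4 (tag H f % 2 ^ (2 * n)) = hammingNorm f := by
  rw [tag, Nat.add_mul_mod_self_left, Nat.mod_eq_of_lt (code_lt _)]
  have := wt4_digits n (b := fun j => if h : j < n then sym (f ⟨j, h⟩) else 0)
    (fun i => by split_ifs; exacts [sym_lt _, by omega])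
  refine this.trans ?_
  rw [Finset.sum_range, hammingNorm, Finset.card_filter]
  refine Finset.sum_congr rfl fun i _ => ?_
  simp [sym_eq_zero]

theorem initState_mem (i : Fin r) (j : Fin n) : (initState H).mem (i * n + j) = sym (H i j) := by
  have hn : 0 < n := j.pos
  have h1 : (i * n + j : ℕ) / n = i := by
    rw [mul_comm, Nat.mul_add_div hn, Nat.div_eq_of_lt j.2, add_zero]
  have h2 : (i * n + j : ℕ) % n = j := by
    rw [mul_comm, Nat.mul_add_mod, Nat.mod_eq_of_lt j.2]
  simp only [initState]
  rw [dif_pos ⟨by rw [h1]; exact i.2, by rw [h2]; exact j.2⟩]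
  simp only [h1, h2, sym]

theorem traceInner_single (h : PauliVec n) (q : Fin n) (c : ZMod 2 × ZMod 2) :
    traceInner h (Pi.single q c) = (h q).1 * c.2 + (h q).2 * c.1 := by
  unfold traceInner
  rw [Finset.sum_eq_single q]
  · simp
  · intro i _ hi; simp [Pi.single_eq_of_ne hi]
  · simp

theorem sym_div_two (s : ZMod 2 × ZMod 2) : sym s / 2 = (s.1 * 0 + s.2 * 1).val := by
  revert s; decide

theorem sym_mod_two (s : ZMod 2 × ZMod 2) : sym s % 2 = (s.1 * 1 + s.2 * 0).val := by
  revert s; decide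

theorem code_single (q : Fin n) (c : ZMod 2 × ZMod 2) :
    code (Pi.single q c) = sym c * (2 ^ 2) ^ (q : ℕ) := by
  refine digits_eq_single q.2 (by simp) fun i hi => ?_
  split_ifs with h
  · rw [Pi.single_eq_of_ne (fun e => hi (by rw [← e]))]; simp [sym]
  · rfl

theorem colTable_eq : colTable n r (initState H).mem = (List.finRange n).flatMap fun q =>
    [tag H (Pi.single q (1, 0)), tag H (Pi.single q (0, 1))] := by
  have e : List.range n = (List.finRange n).map Fin.val := by simp
  have e4 : 4 ^ n = 2 ^ (2 * n) := by rw [pow_mul]; norm_num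
  unfold colTable
  rw [e, List.flatMap_map]
  congr 1
  funext q
  simp only [colPair, tag, code_single, syn, traceInner_single, e4]
  have s1 : sym (1, 0) = 1 := by decide
  have s2 : sym (0, 1) = 2 := by decide
  have hp : (2 ^ 2 : ℕ) = 4 := by norm_num
  have d1 : (digits 2 r fun i => (initState H).mem (i * n + q) / 2) = digits (2 ^ 1) r fun i =>
      if h : i < r then ((H ⟨i, h⟩ q).1 * 0 + (H ⟨i, h⟩ q).2 * 1).val else 0 :=
    digits_congr fun i hi => by
      have := initState_mem H ⟨i, hi⟩ q
      simp only at this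
      rw [dif_pos hi, ← sym_div_two, ← this]
  have d2 : (digits 2 r fun i => (initState H).mem (i * n + q) % 2) = digits (2 ^ 1) r fun i =>
      if h : i < r then ((H ⟨i, h⟩ q).1 * 1 + (H ⟨i, h⟩ q).2 * 0).val else 0 :=
    digits_congr fun i hi => by
      have := initState_mem H ⟨i, hi⟩ q
      simp only at this
      rw [dif_pos hi, ← sym_mod_two, ← this]
  rw [d1, d2, s1, s2, hp, one_mul]

theorem getD_flatMap_pair {α : Type*} (u v : α → ℕ) (l : List α) (i : ℕ) (hi : i < l.length) :
    (l.flatMap fun a => [u a, v a]).getD (2 * i) 0 = u l[i] ∧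
    (l.flatMap fun a => [u a, v a]).getD (2 * i + 1) 0 = v l[i] := by
  induction l generalizing i with
  | nil => simp at hi
  | cons a l ih =>
    rcases i with _ | i
    · simp
    · have := ih i (by simpa using hi)
      simp only [List.flatMap_cons, List.cons_append, List.nil_append, mul_add]
      simpa using this

/-- The single-qubit operators `Z` and `X` at the given positions. -/
def unitsAt (qs : List (Fin n)) : List (PauliVec n) :=
  qs.flatMap fun q => [Pi.single q (1, 0), Pi.single q (0, 1)]

theorem colsN_eq (qs : List (Fin n)) :
    colsN (colTable n r (initState H).mem) (qs.map Fin.val) = (unitsAt qs).map (tag H) := by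
  simp only [colsN, unitsAt, List.flatMap_map, List.map_flatMap, colTable_eq]
  congr 1
  funext q
  have := getD_flatMap_pair (fun q => tag H (Pi.single q (1, 0)))
    (fun q => tag H (Pi.single q (0, 1))) (List.finRange n) q (by simp)
  simp only [List.getElem_finRange, Fin.cast_mk, Fin.eta] at this
  rw [this.1, this.2]
  rfl

theorem rowBasis_eq (hH : ∀ i j, traceInner (H i) (H j) = 0) :
    rowBasis n r (initState H).mem = ((List.ofFn H).map (tag H)).foldl (insN 1) ([], []) := by
  unfold rowBasis
  congr 1
  have e : List.range r = (List.finRange r).map Fin.val := by simp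
  rw [e, List.map_map, List.ofFn_eq_map, List.map_map]
  refine List.map_congr_left fun i _ => ?_
  simp only [Function.comp, tag, (syn_eq_zero H).2 fun j => hH j i, mul_zero, add_zero, code]
  refine digits_congr fun j hj => ?_
  rw [dif_pos hj, ← initState_mem]

theorem unitsAt_append_singleton (qs : List (Fin n)) (q : Fin n) :
    unitsAt (qs ++ [q]) = unitsAt qs ++ [Pi.single q (1, 0)] ++ [Pi.single q (0, 1)] := by
  simp [unitsAt]

theorem mem_lspan_unitsAt {qs : List (Fin n)} {f : PauliVec n} :
    f ∈ lspan (unitsAt qs) ↔ ∀ q ∉ qs, f q = 0 := by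
  constructor
  · intro hf
    induction hf using Submodule.span_induction with
    | mem x hx =>
      simp only [unitsAt, List.mem_flatMap, List.mem_cons, List.not_mem_nil, or_false,
        Set.mem_ofPred_eq] at hx
      obtain ⟨p, hp, rfl | rfl⟩ := hx <;> intro q hq <;>
        exact Pi.single_eq_of_ne (fun e => hq (by rwa [e])) _
    | zero => simp
    | add x y _ _ hx hy => intro q hq; simp [hx q hq, hy q hq]
    | smul c x _ hx => intro q hq; simp [hx q hq]
  · intro hf
    have hfs : f = ∑ q, Pi.single q (f q) := (Finset.univ_sum_single f).symm
    rw [hfs]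
    refine Submodule.sum_mem _ fun q _ => ?_
    by_cases hq : q ∈ qs
    · have e : (Pi.single q (f q) : PauliVec n) =
          (f q).1 • (Pi.single q (1, 0) : PauliVec n) +
            (f q).2 • (Pi.single q (0, 1) : PauliVec n) := by
        rw [← Pi.single_smul, ← Pi.single_smul, ← Pi.single_add]
        simp
      rw [e]
      refine add_mem (Submodule.smul_mem _ _ (mem_lspan ?_))
        (Submodule.smul_mem _ _ (mem_lspan ?_)) <;>
      · simp only [unitsAt, List.mem_flatMap]
        exact ⟨q, hq, by simp⟩
    · rw [hf q hq]; simp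

theorem indep_unitsAt {qs : List (Fin n)} (hqs : qs.Nodup) : Indep (unitsAt qs) := by
  induction qs using List.reverseRecOn with
  | nil => intro L₁ v L₂ e; simp [unitsAt] at e
  | append_singleton qs q ih =>
    rw [List.nodup_append'] at hqs
    have hq : q ∉ qs := fun h => hqs.2.2 h (by simp)
    rw [unitsAt_append_singleton, Indep.append_singleton, Indep.append_singleton]
    refine ⟨⟨ih hqs.1, fun h => ?_⟩, fun h => ?_⟩
    · have := mem_lspan_unitsAt.1 h q hq
      simp at this
    · rcases mem_lspan_append_singleton.1 h with h | h <;>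
      · have := mem_lspan_unitsAt.1 h q hq
        simp at this

theorem hammingNorm_mono {f f' : PauliVec n} (h : ∀ i, f i = 0 → f' i = 0) :
    hammingNorm f' ≤ hammingNorm f := by
  unfold hammingNorm
  exact Finset.card_le_card fun i hi => by
    simp only [Finset.mem_filter, Finset.mem_univ, true_and, ne_eq] at hi ⊢
    exact fun h0 => hi (h i h0)

theorem mem_extV_of {V : Type*} [AddCommGroup V] {wt : V → ℕ} {W : ℕ} {A : List V} {v x : V}
    (h : x ∈ A) : x ∈ extV wt W A v := List.mem_append_left _ h

theorem add_mem_extV_of {V : Type*} [AddCommGroup V] {wt : V → ℕ} {W : ℕ} {A : List V} {v x : V}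
    (h : x ∈ A) (hw : wt (x + v) ≤ W) : x + v ∈ extV wt W A v :=
  List.mem_append_right _ (List.mem_filter.2 ⟨List.mem_map.2 ⟨x, h, rfl⟩, by simpa using hw⟩)

/-- Adding the single-qubit operators one by one generates all operators of bounded weight. -/
theorem mem_foldl_unitsAt {t : ℕ} {qs : List (Fin n)} {f : PauliVec n} :
    f ∈ (unitsAt qs).foldl (extV hammingNorm t) [0] ↔
      (∀ q ∉ qs, f q = 0) ∧ hammingNorm f ≤ t := by
  constructor
  · intro h
    obtain ⟨⟨a, ha, h1⟩, h2⟩ := mem_foldl_extV h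
    rw [List.mem_singleton] at ha h2
    subst ha
    rw [add_zero] at h1
    refine ⟨mem_lspan_unitsAt.1 h1, ?_⟩
    rcases h2 with rfl | h2
    · simp
    · exact h2
  · rintro ⟨h1, h2⟩
    induction qs using List.reverseRecOn generalizing f with
    | nil =>
      have : f = 0 := funext fun q => h1 q (by simp)
      simp [unitsAt, this]
    | append_singleton qs q ih =>
      rw [unitsAt_append_singleton, List.foldl_append, List.foldl_append]
      simp only [List.foldl_cons, List.foldl_nil]
      set f' : PauliVec n := Function.update f q 0 with hf'
      have hz : ∀ i, f i = 0 → f' i = 0 := fun i hi => by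
        by_cases hiq : i = q
        · subst hiq; simp [hf']
        · simp [hf', hiq, hi]
      have hmem : f' ∈ (unitsAt qs).foldl (extV hammingNorm t) [0] := by
        refine ih (fun i hi => ?_) ((hammingNorm_mono hz).trans h2)
        by_cases hiq : i = q
        · subst hiq; simp [hf']
        · rw [hf', Function.update_of_ne hiq]
          exact h1 i (by simp [hi, hiq])
      have hcase : f = f' ∨ f = f' + Pi.single q (1, 0) ∨ f = f' + Pi.single q (0, 1) ∨
          (f = f' + Pi.single q (1, 0) + Pi.single q (0, 1) ∧ f q ≠ 0) := by
        have hsplit : f = f' + Pi.single q (f q) := by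
          funext i
          by_cases hiq : i = q
          · subst hiq; simp [hf']
          · simp [hf', hiq]
        obtain ⟨u, v, hfq⟩ : ∃ u v, f q = (u, v) := ⟨_, _, rfl⟩
        rw [hfq] at hsplit ⊢
        obtain rfl | rfl := zmod_two_cases u <;> obtain rfl | rfl := zmod_two_cases v
        · left; rw [hsplit]; simp [hf']
        · right; right; left; exact hsplit
        · right; left; exact hsplit
        · right; right; right
          refine ⟨?_, by simp⟩
          rw [add_assoc, ← Pi.single_add]
          simpa using hsplit
      rcases hcase with h | h | h | ⟨h, hq0⟩
      · rw [h]; exact mem_extV_of (mem_extV_of hmem)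
      · rw [h]; exact mem_extV_of (add_mem_extV_of hmem (h ▸ h2))
      · rw [h]; exact add_mem_extV_of (mem_extV_of hmem) (h ▸ h2)
      · rw [h]
        refine add_mem_extV_of (add_mem_extV_of hmem ?_) (h ▸ h2)
        refine (hammingNorm_mono fun i hi => ?_).trans h2
        by_cases hiq : i = q
        · subst hiq; exact absurd hi hq0
        · simp [hf', hiq, hi]

theorem nodup_foldl_unitsAt {t : ℕ} {qs : List (Fin n)} (hqs : qs.Nodup) :
    ((unitsAt qs).foldl (extV hammingNorm t) [0]).Nodup :=
  nodup_foldl_extV (by simp) (indep_unitsAt hqs) (by simp)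

end

section

/-! ### The rounds of the search, in terms of operators -/

variable {r n : ℕ} (H : CheckMatrix r n)

/-- Position number `i` of the window of length `2 * w` that starts at `a` and is rotated
by `x`. -/
def winPos (hn : 0 < n) (w a x i : ℕ) : Fin n := ⟨(a + (x + i) % (2 * w)) % n, Nat.mod_lt _ hn⟩

/-- Position number `i` outside the window. -/
def outPos (hn : 0 < n) (w a i : ℕ) : Fin n := ⟨(a + (2 * w + i)) % n, Nat.mod_lt _ hn⟩

/-- The half of the window that starts with its position number `s`. -/
def halfWin (hn : 0 < n) (w a x s : ℕ) : Finset (Fin n) :=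
  (Finset.range w).image fun i => winPos hn w a x (s + i)

/-- The weight of an operator on a set of positions. -/
def wtOn (I : Finset (Fin n)) (f : PauliVec n) : ℕ := {i ∈ I | f i ≠ 0}.card

/-- The operators that commute with all generators. -/
def Commutes (f : PauliVec n) : Prop := ∀ i, traceInner (H i) f = 0

/-- The operators that are examined in a round: they commute with all generators and have weight at
most `t` on each half of the window, while their weight outside the window is arbitrary. -/
def Cand (hn : 0 < n) (w t a x : ℕ) (f : PauliVec n) : Prop :=
  Commutes H f ∧ wtOn (halfWin hn w a x 0) f ≤ t ∧ wtOn (halfWin hn w a x w) f ≤ t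

theorem positions_nodup (hn : 0 < n) {w : ℕ} (hw : 2 * w ≤ n) (a x : ℕ) :
    ((List.range w).map (winPos hn w a x) ++ (List.range w).map (fun i => winPos hn w a x (w + i)) ++
      (List.range (n - 2 * w)).map (outPos hn w a)).Nodup := by
  set σ : ℕ → ℕ := fun i => if i < 2 * w then (x + i) % (2 * w) else i with hσ
  have hσn : ∀ i < n, σ i < n := by
    intro i hi
    simp only [hσ]
    split_ifs with h
    · exact (Nat.mod_lt _ (by omega)).trans_le hw
    · exact hi
  have hinj : ∀ i < n, ∀ j < n, σ i = σ j → i = j := by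
    intro i _ j _ h
    simp only [hσ] at h
    split_ifs at h with h1 h2 h2
    · have : i ≡ j [MOD 2 * w] := Nat.ModEq.add_left_cancel' x h
      rwa [Nat.ModEq, Nat.mod_eq_of_lt h1, Nat.mod_eq_of_lt h2] at this
    · have := Nat.mod_lt (x + i) (show 0 < 2 * w by omega); omega
    · have := Nat.mod_lt (x + j) (show 0 < 2 * w by omega); omega
    · exact h
  have e : (List.range w).map (winPos hn w a x) ++
      (List.range w).map (fun i => winPos hn w a x (w + i)) ++
      (List.range (n - 2 * w)).map (outPos hn w a) =
      (List.range n).map fun i => (⟨(a + σ i) % n, Nat.mod_lt _ hn⟩ : Fin n) := by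
    have hsplit : List.range n = List.range (w + w + (n - 2 * w)) := by congr 1; omega
    rw [hsplit, List.range_add, List.range_add, List.map_append, List.map_append,
      List.map_map, List.map_map]
    congr 1
    · congr 1
      · refine List.map_congr_left fun i hi => ?_
        rw [List.mem_range] at hi
        simp [hσ, winPos, show i < 2 * w by omega]
      · refine List.map_congr_left fun i hi => ?_
        rw [List.mem_range] at hi
        simp [hσ, winPos, show w + i < 2 * w by omega]
    · refine List.map_congr_left fun i _ => ?_
      simp [hσ, outPos, show ¬ w + w + i < 2 * w by omega]
      congr 2; omega
  rw [e]
  refine List.Nodup.map_on (fun i hi j hj h => ?_) List.nodup_range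
  rw [List.mem_range] at hi hj
  rw [Fin.mk.injEq] at h
  have h1 : σ i ≡ σ j [MOD n] := Nat.ModEq.add_left_cancel' a h
  rw [Nat.ModEq, Nat.mod_eq_of_lt (hσn i hi), Nat.mod_eq_of_lt (hσn j hj)] at h1
  exact hinj i hi j hj h1

theorem mem_positions (hn : 0 < n) {w : ℕ} (hw : 2 * w ≤ n) (a x : ℕ) (q : Fin n) :
    q ∈ (List.range w).map (winPos hn w a x) ++
      (List.range w).map (fun i => winPos hn w a x (w + i)) ++
      (List.range (n - 2 * w)).map (outPos hn w a) := by
  have h := positions_nodup hn hw a x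
  set L := (List.range w).map (winPos hn w a x) ++
      (List.range w).map (fun i => winPos hn w a x (w + i)) ++
      (List.range (n - 2 * w)).map (outPos hn w a) with hL
  have hlen : L.length = n := by simp [hL]; omega
  have hc : L.toFinset.card = Fintype.card (Fin n) := by
    rw [List.toFinset_card_of_nodup h, hlen, Fintype.card_fin]
  have := Finset.eq_univ_of_card _ hc
  rw [← List.mem_toFinset, this]
  exact Finset.mem_univ _

/-- The restriction of an operator to a set of positions. -/
def restrict (I : Finset (Fin n)) (f : PauliVec n) : PauliVec n := fun i => if i ∈ I then f i else 0

theorem hammingNorm_restrict (I : Finset (Fin n)) (f : PauliVec n) :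
    hammingNorm (restrict I f) = wtOn I f := by
  unfold hammingNorm wtOn restrict
  congr 1
  ext i
  simp

theorem halfWin_eq (hn : 0 < n) (w a x s : ℕ) :
    halfWin hn w a x s = ((List.range w).map fun i => winPos hn w a x (s + i)).toFinset := by
  ext q
  simp [halfWin]

theorem halfWin_mod (hn : 0 < n) (w a x s : ℕ) :
    halfWin hn w a x s = halfWin hn w (a % n) (x % (2 * w)) s := by
  unfold halfWin winPos
  congr 1
  funext i
  simp only [Nat.mod_add_mod]

/-- The lists of a round are no longer than the corresponding sets of operators, and a round
succeeds iff one of its candidates is outside the stabilizer and has weight at most `d`. -/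
theorem round_spec (hH : ∀ i j, traceInner (H i) (H j) = 0) (hn : 0 < n) {w : ℕ} (hw : 2 * w ≤ n)
    (d a x : ℕ) {G R : List ℕ} (hG : G = colTable n r (initState H).mem)
    (hR : R = (rowBasis n r (initState H).mem).1) :
    ((sideN (prm n w (4 ^ n) (2 ^ r) d a x 0) G 0 w).length ≤
      Set.ncard {f : PauliVec n | (∀ q ∉ halfWin hn w a x 0, f q = 0) ∧
        hammingNorm f ≤ d * w / n + 1}) ∧
    ((sideN (prm n w (4 ^ n) (2 ^ r) d a x 0) G w w).length ≤
      Set.ncard {f : PauliVec n | (∀ q ∉ halfWin hn w a x w, f q = 0) ∧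
        hammingNorm f ≤ d * w / n + 1}) ∧
    ((candN (prm n w (4 ^ n) (2 ^ r) d a x 0) G).length ≤
      Set.ncard {f | Cand H hn w (d * w / n + 1) a x f}) ∧
    (Succ n w (4 ^ n) (2 ^ r) G R d a x ↔
      ∃ f, Cand H hn w (d * w / n + 1) a x f ∧ f ∉ Submodule.span (ZMod 2) (Set.range H) ∧
        hammingNorm f ≤ d) := by
  classical
  set t := d * w / n + 1 with ht
  set p := prm n w (4 ^ n) (2 ^ r) d a x 0 with hp
  have e4 : 4 ^ n = 2 ^ (2 * n) := by rw [pow_mul]; norm_num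
  have hg := coding_tag H
  have hwt := wt4_tag H
  have hnod := positions_nodup hn hw a x
  set L₁ := (List.range w).map (winPos hn w a x) with hL₁
  set L₂ := (List.range w).map (fun i => winPos hn w a x (w + i)) with hL₂
  set L₃ := (List.range (n - 2 * w)).map (outPos hn w a) with hL₃
  have hcov : ∀ q, q ∈ L₁ ++ L₂ ++ L₃ := mem_positions hn hw a x
  rw [List.nodup_append', List.nodup_append'] at hnod
  obtain ⟨⟨hn1, hn2, hd12⟩, hn3, hd3⟩ := hnod
  have hI₁ : ∀ q, q ∈ halfWin hn w a x 0 ↔ q ∈ L₁ := fun q => by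
    rw [halfWin_eq, List.mem_toFinset]; simp [hL₁]
  have hI₂ : ∀ q, q ∈ halfWin hn w a x w ↔ q ∈ L₂ := fun q => by
    rw [halfWin_eq, List.mem_toFinset]
  have c1 : colsN G ((List.range w).map fun i => p.pos (0 + i)) = (unitsAt L₁).map (tag H) := by
    rw [← colsN_eq, hG, hL₁, List.map_map]
    congr 1
    refine List.map_congr_left fun i _ => ?_
    simp [hp, prm, Params.pos, winPos]
  have c2 : colsN G ((List.range w).map fun i => p.pos (w + i)) = (unitsAt L₂).map (tag H) := by
    rw [← colsN_eq, hG, hL₂, List.map_map]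
    rfl
  have c3 : colsN G ((List.range (n - 2 * w)).map p.out) = (unitsAt L₃).map (tag H) := by
    rw [← colsN_eq, hG, hL₃, List.map_map]
    rfl
  set A := (unitsAt L₁).foldl (extV hammingNorm t) [0] with hA
  set B := (unitsAt L₂).foldl (extV hammingNorm t) [0] with hB
  have z0 : [0] = ([0] : List (PauliVec n)).map (tag H) := by simp [hg.zero]
  have hS1 : sideN p G 0 w = A.map (tag H) := by
    unfold sideN
    rw [c1, z0]
    exact hg.foldl_extV (fun x => by simpa [hp, prm, e4] using hwt x) t _ _
  have hS2 : sideN p G w w = B.map (tag H) := by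
    unfold sideN
    rw [c2, z0]
    exact hg.foldl_extV (fun x => by simpa [hp, prm, e4] using hwt x) t _ _
  obtain ⟨bs, ks, hbk, hpiv, hks, hsp, hind⟩ := foldl_insN_spec hg (2 * n) (unitsAt L₃)
  have hbase : baseN p G = (bs.map (tag H), ks.map (tag H)) := by
    rw [← hbk]
    unfold baseN
    change (colsN G ((List.range (n - 2 * w)).map p.out)).foldl (insN (4 ^ n)) _ = _
    rw [c3, e4]
  have hcand : candN p G = (ks.foldl (extV hammingNorm n)
      (matchV (tag H) (2 ^ (2 * n)) bs A B)).map (tag H) := by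
    unfold candN
    rw [hbase]
    change (ks.map (tag H)).foldl (extN (4 ^ n) n) (matchN (4 ^ n) (bs.map (tag H))
      (sideN p G 0 w) (sideN p G w w)) = _
    rw [hS1, hS2, e4, hg.matchV]
    exact hg.foldl_extV hwt n _ _
  have hAm : ∀ f, f ∈ A ↔ (∀ q ∉ L₁, f q = 0) ∧ hammingNorm f ≤ t := fun f => mem_foldl_unitsAt
  have hBm : ∀ f, f ∈ B ↔ (∀ q ∉ L₂, f q = 0) ∧ hammingNorm f ≤ t := fun f => mem_foldl_unitsAt
  have hAn : A.Nodup := nodup_foldl_unitsAt hn1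
  have hBn : B.Nodup := nodup_foldl_unitsAt hn2
  obtain ⟨hCn, hCm⟩ := foldl_extV_matchV hg (A := A) (B := B) (U₁ := lspan (unitsAt L₁))
    (U₂ := lspan (unitsAt L₂)) hpiv hks hsp (hind (indep_unitsAt hn3)) hAn hBn
    (fun x hx => mem_lspan_unitsAt.2 ((hAm x).1 hx).1)
    (fun x hx => mem_lspan_unitsAt.2 ((hBm x).1 hx).1)
    (by
      intro x hx y hy hxy
      rw [mem_lspan_unitsAt] at hx hy hxy
      refine ⟨funext fun q => ?_, funext fun q => ?_⟩
      · by_cases hq : q ∈ L₁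
        · have h1 := hxy q (fun h => hd3 (List.mem_append_left _ hq) h)
          have h2 := hy q (fun h => hd12 hq h)
          rwa [Pi.add_apply, h2, add_zero] at h1
        · exact hx q hq
      · by_cases hq : q ∈ L₂
        · have h1 := hxy q (fun h => hd3 (List.mem_append_right _ hq) h)
          have h2 := hx q (fun h => hd12 h hq)
          rwa [Pi.add_apply, h2, zero_add] at h1
        · exact hy q hq)
    (wt := hammingNorm) (W := n) (fun x => by
      simpa using hammingNorm_le_card_fintype (x := x))
  set C := ks.foldl (extV hammingNorm n) (matchV (tag H) (2 ^ (2 * n)) bs A B) with hC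
  have hCc : ∀ e, e ∈ C ↔ Cand H hn w t a x e := by
    intro e
    rw [hCm, tag_lt, Cand, ← hammingNorm_restrict, ← hammingNorm_restrict]
    refine and_congr_right fun _ => ?_
    constructor
    · rintro ⟨x', hx, y, hy, h⟩
      rw [mem_lspan_unitsAt] at h
      have hx' := (hAm x').1 hx
      have hy' := (hBm y).1 hy
      have e1 : restrict (halfWin hn w a x 0) e = x' := by
        funext q
        unfold restrict
        by_cases hq : q ∈ L₁
        · rw [if_pos ((hI₁ q).2 hq)]
          have h1 := h q (fun h => hd3 (List.mem_append_left _ hq) h)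
          have h2 := hy'.1 q (fun h => hd12 hq h)
          rwa [Pi.add_apply, Pi.add_apply, h2, add_zero, ← ZModModule.sub_eq_add, sub_eq_zero] at h1
        · rw [if_neg fun hh => hq ((hI₁ q).1 hh), hx'.1 q hq]
      have e2 : restrict (halfWin hn w a x w) e = y := by
        funext q
        unfold restrict
        by_cases hq : q ∈ L₂
        · rw [if_pos ((hI₂ q).2 hq)]
          have h1 := h q (fun h => hd3 (List.mem_append_right _ hq) h)
          have h2 := hx'.1 q (fun h => hd12 h hq)
          rwa [Pi.add_apply, Pi.add_apply, h2, add_zero, ← ZModModule.sub_eq_add, sub_eq_zero] at h1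
        · rw [if_neg fun hh => hq ((hI₂ q).1 hh), hy'.1 q hq]
      rw [e1, e2]
      exact ⟨hx'.2, hy'.2⟩
    · rintro ⟨h1, h2⟩
      refine ⟨_, (hAm _).2 ⟨fun q hq => ?_, h1⟩, _, (hBm _).2 ⟨fun q hq => ?_, h2⟩, ?_⟩
      · exact if_neg fun hh => hq ((hI₁ q).1 hh)
      · exact if_neg fun hh => hq ((hI₂ q).1 hh)
      · rw [mem_lspan_unitsAt]
        intro q hq
        have hq' := hcov q
        rw [List.mem_append, List.mem_append] at hq'
        simp only [Pi.add_apply, restrict, hI₁, hI₂]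
        rcases hq' with (hq' | hq') | hq'
        · rw [if_pos hq', if_neg fun h => hd12 hq' h, add_zero, ZModModule.add_self]
        · rw [if_neg fun h => hd12 h hq', if_pos hq', add_zero, ZModModule.add_self]
        · exact absurd hq' hq
  have hlen : ∀ (L : List (PauliVec n)) (s : Set (PauliVec n)), L.Nodup → (∀ f ∈ L, f ∈ s) →
      L.length ≤ s.ncard := by
    intro L s hL hs
    rw [← List.toFinset_card_of_nodup hL, ← Set.ncard_coe_finset]
    exact Set.ncard_le_ncard (fun f hf => hs f (by simpa using hf)) (Set.toFinite _)
  refine ⟨?_, ?_, ?_, ?_⟩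
  · rw [hS1, List.length_map]
    refine hlen A _ hAn fun f hf => ?_
    have := (hAm f).1 hf
    exact ⟨fun q hq => this.1 q fun h => hq ((hI₁ q).2 h), this.2⟩
  · rw [hS2, List.length_map]
    refine hlen B _ hBn fun f hf => ?_
    have := (hBm f).1 hf
    exact ⟨fun q hq => this.1 q fun h => hq ((hI₂ q).2 h), this.2⟩
  · rw [hcand, List.length_map]
    exact hlen C _ hCn fun f hf => (hCc f).1 hf
  · obtain ⟨rb, rk, hrb, hrp, hrk, hrs, -⟩ := foldl_insN_spec hg 0 (List.ofFn H)
    have hspan : lspan rb = Submodule.span (ZMod 2) (Set.range H) := by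
      have h1 : lspan rk = ⊥ := by
        rw [eq_bot_iff, Submodule.span_le]
        intro x hx
        have h2 := hrk x hx
        by_contra hne
        have := hg.ne_zero (x := x) (by simpa using hne)
        omega
      rw [h1, sup_bot_eq] at hrs
      rw [hrs, lspan, show {x | x ∈ List.ofFn H} = Set.range H from
        Set.ext fun x => List.mem_ofFn' H x]
    have hRe : R = rb.map (tag H) := by
      rw [hR, rowBasis_eq H hH]
      have := congrArg Prod.fst hrb
      simpa using this
    unfold Succ
    rw [List.any_eq_true]
    change (∃ y ∈ candN p G, goodN (4 ^ n) d R y = true) ↔ _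
    rw [hcand]
    simp only [List.mem_map, exists_exists_and_eq_and, goodN, Bool.and_eq_true, decide_eq_true_eq]
    refine exists_congr fun f => ?_
    rw [hCc, e4, hwt, hRe, ← hg.redV]
    refine and_congr_right fun _ => ?_
    rw [and_comm]
    refine and_congr_left fun _ => not_congr ?_
    rw [← hspan, ← redV_eq_zero_iff hg hrp]
    constructor
    · intro h
      by_contra h0
      exact hg.ne_zero h0 h
    · intro h; rw [h, hg.zero]

end

section

/-! ### Windows in which an operator is evenly distributed -/

/-- A discrete intermediate value theorem. -/
theorem exists_balanced {h : ℕ → ℕ} {W w s : ℕ} (hstep : ∀ x, h (x + 1) ≤ h x + 1)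
    (h0 : 2 * h s ≤ W + 1) (h1 : W ≤ 2 * h (s + w) + 1) :
    ∃ x, W ≤ 2 * h x + 1 ∧ 2 * h x ≤ W + 1 := by
  classical
  have hex : ∃ y, W ≤ 2 * h (s + y) + 1 := ⟨w, h1⟩
  refine ⟨s + Nat.find hex, Nat.find_spec hex, ?_⟩
  rcases Nat.eq_zero_or_pos (Nat.find hex) with h2 | h2
  · rw [h2]; exact h0
  · have h3 := Nat.find_min hex (m := Nat.find hex - 1) (by omega)
    have h4 := hstep (s + (Nat.find hex - 1))
    rw [show s + (Nat.find hex - 1) + 1 = s + Nat.find hex by omega] at h4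
    omega

variable {n : ℕ}

theorem wtOn_halfWin (hn : 0 < n) {w : ℕ} (hw : 2 * w ≤ n) (a x : ℕ) {s : ℕ} (hs : s + w ≤ 2 * w)
    (f : PauliVec n) : wtOn (halfWin hn w a x s) f =
      ∑ i ∈ Finset.range w, if f (winPos hn w a x (s + i)) = 0 then 0 else 1 := by
  unfold wtOn halfWin
  rw [Finset.card_filter, Finset.sum_image]
  · exact Finset.sum_congr rfl fun i _ => by simp
  · intro i hi j hj h
    simp only [Finset.coe_range, Set.mem_Iio] at hi hj
    simp only [winPos, Fin.mk.injEq] at h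
    have hw0 : 0 < 2 * w := by omega
    have h1 : (x + (s + i)) % (2 * w) ≡ (x + (s + j)) % (2 * w) [MOD n] :=
      Nat.ModEq.add_left_cancel' a h
    rw [Nat.ModEq, Nat.mod_eq_of_lt ((Nat.mod_lt _ hw0).trans_le hw),
      Nat.mod_eq_of_lt ((Nat.mod_lt _ hw0).trans_le hw)] at h1
    have h2 : s + i ≡ s + j [MOD 2 * w] := Nat.ModEq.add_left_cancel' x h1
    rw [Nat.ModEq, Nat.mod_eq_of_lt (by omega), Nat.mod_eq_of_lt (by omega)] at h2
    omega

theorem sum_shift (hn : 0 < n) (F : Fin n → ℕ) (j : ℕ) :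
    ∑ a ∈ Finset.range n, F ⟨(n - a + j) % n, Nat.mod_lt _ hn⟩ = ∑ i, F i := by
  rw [Finset.sum_range fun a => F ⟨(n - a + j) % n, Nat.mod_lt _ hn⟩]
  refine Fintype.sum_bijective (fun a : Fin n => (⟨(n - a + j) % n, Nat.mod_lt _ hn⟩ : Fin n)) ?_
    _ _ fun _ => rfl
  rw [Fintype.bijective_iff_injective_and_card]
  refine ⟨fun a b h => ?_, rfl⟩
  simp only [Fin.mk.injEq] at h
  have h1 : n - a ≡ n - b [MOD n] := Nat.ModEq.add_right_cancel' j h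
  have ha := a.2
  have hb := b.2
  have h2 : n - a + (a + b) ≡ n - b + (a + b) [MOD n] := h1.add_right _
  rw [show n - a + (a + b) = n + b by omega, show n - b + (a + b : ℕ) = n + a by omega] at h2
  have h3 : (b : ℕ) ≡ a [MOD n] := Nat.ModEq.add_left_cancel' n h2
  rw [Nat.ModEq, Nat.mod_eq_of_lt hb, Nat.mod_eq_of_lt ha] at h3
  exact Fin.ext h3.symm

/-- Some window contains at most the average weight, and some rotation of it splits this weight
evenly. -/
theorem exists_window (hn : 0 < n) {w : ℕ} (hw0 : 0 < w) (hw : 2 * w ≤ n) {d : ℕ} (f : PauliVec n)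
    (hf : hammingNorm f ≤ d) : ∃ a < n, ∃ x < 2 * w,
      wtOn (halfWin hn w (n - a) (2 * w - x) 0) f ≤ d * w / n + 1 ∧
      wtOn (halfWin hn w (n - a) (2 * w - x) w) f ≤ d * w / n + 1 := by
  set c : Fin n → ℕ := fun i => if f i = 0 then 0 else 1 with hc
  have hc1 : ∀ i, c i ≤ 1 := fun i => by simp only [hc]; split_ifs <;> omega
  have hsum : ∑ i, c i = hammingNorm f := by
    rw [hammingNorm, Finset.card_filter]
    exact Finset.sum_congr rfl fun i _ => by simp [hc]
  -- the window with the least weight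
  obtain ⟨a, ha, hle⟩ : ∃ a ∈ Finset.range n,
      (∑ j ∈ Finset.range (2 * w), c ⟨(n - a + j) % n, Nat.mod_lt _ hn⟩) * n ≤ 2 * w * d := by
    by_contra hcon
    push Not at hcon
    have h1 : ∑ a ∈ Finset.range n, 2 * w * d < ∑ a ∈ Finset.range n,
        (∑ j ∈ Finset.range (2 * w), c ⟨(n - a + j) % n, Nat.mod_lt _ hn⟩) * n :=
      Finset.sum_lt_sum_of_nonempty (by simpa using hn.ne') fun a ha => hcon a ha
    rw [Finset.sum_const, ← Finset.sum_mul, Finset.sum_comm] at h1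
    have h2 : ∑ j ∈ Finset.range (2 * w), ∑ a ∈ Finset.range n,
        c ⟨(n - a + j) % n, Nat.mod_lt _ hn⟩ = 2 * w * hammingNorm f := by
      rw [Finset.sum_congr rfl fun j _ => sum_shift hn c j, hsum]
      simp
    rw [h2] at h1
    simp only [Finset.card_range, smul_eq_mul] at h1
    have h3 : 2 * w * hammingNorm f * n ≤ n * (2 * w * d) := by
      calc _ ≤ 2 * w * d * n := Nat.mul_le_mul_right _ (Nat.mul_le_mul_left _ hf)
        _ = _ := by ring
    omega
  rw [Finset.mem_range] at ha
  set A := n - a with hA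
  set W := ∑ j ∈ Finset.range (2 * w), c ⟨(A + j) % n, Nat.mod_lt _ hn⟩ with hW
  set b : ℕ → ℕ := fun i => c ⟨(A + i % (2 * w)) % n, Nat.mod_lt _ hn⟩ with hb
  set h : ℕ → ℕ := fun x => ∑ i ∈ Finset.range w, b (x + i) with hh
  have hbper : ∀ i, b (i + 2 * w) = b i := fun i => by simp [hb]
  have hstep : ∀ x, h (x + 1) + b x = h x + b (x + w) := by
    intro x
    simp only [hh]
    have h1 := Finset.sum_range_succ (fun i => b (x + i)) w
    have h2 := Finset.sum_range_succ' (fun i => b (x + i)) w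
    have h3 : ∑ i ∈ Finset.range w, b (x + 1 + i) = ∑ i ∈ Finset.range w, b (x + (i + 1)) :=
      Finset.sum_congr rfl fun i _ => by congr 1; ring
    rw [add_zero] at h2
    omega
  have hstep' : ∀ x, h (x + 1) ≤ h x + 1 := fun x => by
    have := hstep x
    have := hc1 ⟨(A + (x + w) % (2 * w)) % n, Nat.mod_lt _ hn⟩
    change b (x + w) ≤ 1 at this
    omega
  have hhalf : ∀ x, h x + h (x + w) = W := by
    intro x
    induction x with
    | zero =>
      simp only [hh, zero_add, hW]
      rw [two_mul, Finset.sum_range_add]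
      congr 1 <;>
      · refine Finset.sum_congr rfl fun i hi => ?_
        rw [Finset.mem_range] at hi
        simp only [hb, Nat.mod_eq_of_lt (show i < 2 * w by omega),
          Nat.mod_eq_of_lt (show w + i < 2 * w by omega)]
    | succ x ih =>
      have h1 := hstep x
      have h2 := hstep (x + w)
      rw [show x + w + w = x + 2 * w by ring, hbper, show x + w + 1 = x + 1 + w by ring] at h2
      omega
  obtain ⟨y, hy1, hy2⟩ : ∃ y, W ≤ 2 * h y + 1 ∧ 2 * h y ≤ W + 1 := by
    have e0 := hhalf 0
    rw [zero_add] at e0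
    by_cases hc0 : 2 * h 0 ≤ W + 1
    · by_cases hc1 : W ≤ 2 * h (0 + w) + 1
      · exact exists_balanced hstep' hc0 hc1
      · rw [zero_add] at hc1
        exact ⟨0, by omega, hc0⟩
    · have e1 := hhalf w
      refine exists_balanced (s := w) (w := w) hstep' (by omega) (by omega)
  have hyw := hhalf y
  have hbound : ∀ m, 2 * m ≤ W + 1 → m ≤ d * w / n + 1 := by
    intro m hm
    have h1 : (2 * m) * n ≤ (W + 1) * n := Nat.mul_le_mul_right _ hm
    have h2 : (m - 1) ≤ d * w / n := by
      rw [Nat.le_div_iff_mul_le hn]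
      rcases Nat.eq_zero_or_pos m with rfl | hm0
      · simp
      · obtain ⟨m, rfl⟩ : ∃ k, m = k + 1 := ⟨m - 1, by omega⟩
        simp only [Nat.add_sub_cancel]
        have e : 2 * w * d = 2 * (d * w) := by ring
        rw [e] at hle
        nlinarith
    omega
  have hper : ∀ s, s + w ≤ 2 * w → ∀ x, wtOn (halfWin hn w A x s) f = h (x + s) := by
    intro s hs x
    rw [wtOn_halfWin hn hw A x hs]
    refine Finset.sum_congr rfl fun i _ => ?_
    simp only [hb, hc, winPos, add_assoc]
    congr
  have hmod : ∀ s, halfWin hn w A (2 * w - (2 * w - y % (2 * w)) % (2 * w)) s =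
      halfWin hn w A y s := by
    intro s
    have hlt := Nat.mod_lt y (show 0 < 2 * w by omega)
    rw [halfWin_mod, halfWin_mod hn w A y]
    congr 1
    rcases Nat.eq_zero_or_pos (y % (2 * w)) with h0 | h0
    · rw [h0]; simp
    · rw [Nat.mod_eq_of_lt (show 2 * w - y % (2 * w) < 2 * w by omega),
        show 2 * w - (2 * w - y % (2 * w)) = y % (2 * w) by omega, Nat.mod_mod]
  refine ⟨a, ha, (2 * w - y % (2 * w)) % (2 * w), Nat.mod_lt _ (by omega), ?_, ?_⟩
  · rw [hmod, hper 0 (by omega)]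
    exact hbound _ hy2
  · rw [hmod, hper w (by omega)]
    exact hbound _ (by omega)

/-! ### The cost of the program in terms of the code -/

theorem halfWindow_pos {n r : ℕ} (hr : r ≤ n) (hn : 3 ≤ n) : 0 < halfWindow n r := by
  unfold halfWindow
  refine Nat.div_pos ?_ (by omega)
  calc 4 * n - r ≤ (2 * n - r) * 3 := by omega
    _ ≤ _ := Nat.mul_le_mul_left _ hn

theorem card_pauliVec (n : ℕ) : Nat.card (PauliVec n) = 4 ^ n := by
  simp

/-- The number of operators of weight at most `t` on `m` given positions. -/
def ballSize (m t : ℕ) : ℕ := ∑ j ∈ Finset.range (t + 1), m.choose j * 3 ^ j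

theorem card_halfWin (hn : 0 < n) {w : ℕ} (hw : 2 * w ≤ n) (a x : ℕ) :
    (halfWin hn w a x 0).card = w ∧ (halfWin hn w a x w).card = w ∧
      Disjoint (halfWin hn w a x 0) (halfWin hn w a x w) := by
  have h := positions_nodup hn hw a x
  rw [List.nodup_append', List.nodup_append'] at h
  obtain ⟨⟨h1, h2, h3⟩, -, -⟩ := h
  have e : (fun i => winPos hn w a x (0 + i)) = winPos hn w a x := by funext i; simp
  rw [halfWin_eq, halfWin_eq, e, List.toFinset_card_of_nodup h1, List.toFinset_card_of_nodup h2]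
  refine ⟨by simp, by simp, ?_⟩
  rw [Finset.disjoint_left]
  intro q hq hq'
  exact h3 (List.mem_toFinset.1 hq) (List.mem_toFinset.1 hq')

/-- The operators are sorted by their support; those with a given support form a product set. -/
theorem ncard_supp_eq (I : Finset (Fin n)) (j : ℕ) :
    Set.ncard {f : PauliVec n | (∀ q ∉ I, f q = 0) ∧ hammingNorm f = j} =
      I.card.choose j * 3 ^ j := by
  classical
  have h1 : {f : PauliVec n | (∀ q ∉ I, f q = 0) ∧ hammingNorm f = j} =
      ((I.powersetCard j).biUnion fun J => Fintype.piFinset fun i =>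
        if i ∈ J then ({0}ᶜ : Finset (ZMod 2 × ZMod 2)) else {0} : Finset (PauliVec n)) := by
    ext f
    simp only [Finset.coe_biUnion, Set.mem_iUnion, Finset.mem_coe, Fintype.mem_piFinset,
      Finset.mem_powersetCard, Set.mem_ofPred_eq, exists_prop]
    constructor
    · rintro ⟨h1, h2⟩
      refine ⟨Finset.univ.filter fun i => f i ≠ 0, ⟨fun i hi => ?_, h2⟩, fun i => ?_⟩
      · by_contra hI
        simp at hi
        exact hi (h1 i hI)
      · by_cases hi : f i = 0 <;> simp [hi]
    · rintro ⟨J, ⟨hJ, hj⟩, hf⟩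
      have hJ' : ∀ i, f i ≠ 0 ↔ i ∈ J := fun i => by
        have := hf i
        split_ifs at this with h
        · simp at this; simp [h, this]
        · simp at this; simp [h, this]
      refine ⟨fun q hq => ?_, ?_⟩
      · by_contra hne
        exact hq (hJ ((hJ' q).1 hne))
      · rw [← hj, hammingNorm]
        congr 1
        ext i
        simp [hJ']
  rw [h1, Set.ncard_coe_finset, Finset.card_biUnion]
  · rw [Finset.sum_congr rfl (g := fun _ => 3 ^ j)]
    · simp
    · intro J hJ
      rw [Finset.mem_powersetCard] at hJ
      rw [Fintype.card_piFinset]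
      have : ∀ i, (if i ∈ J then ({0}ᶜ : Finset (ZMod 2 × ZMod 2)) else {0}).card =
          if i ∈ J then 3 else 1 := fun i => by
        split_ifs
        · rfl
        · rfl
      simp only [this]
      rw [Finset.prod_ite]
      simp [hJ.2]
  · intro J _ J' _ hne
    change Disjoint _ _
    rw [Finset.disjoint_left]
    intro f hf hf'
    apply hne
    ext i
    rw [Fintype.mem_piFinset] at hf hf'
    have h1 := hf i
    have h2 := hf' i
    split_ifs at h1 h2 with h3 h4 h4 <;> simp_all

theorem ncard_supp_le (I : Finset (Fin n)) (t : ℕ) :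
    Set.ncard {f : PauliVec n | (∀ q ∉ I, f q = 0) ∧ hammingNorm f ≤ t} = ballSize I.card t := by
  unfold ballSize
  induction t with
  | zero =>
    rw [Finset.sum_range_one, ← ncard_supp_eq]
    simp
  | succ t ih =>
    rw [Finset.sum_range_succ, ← ih, ← ncard_supp_eq, ← Set.ncard_union_eq]
    · congr 1
      ext f
      simp only [Set.mem_ofPred_eq, Set.mem_union]
      constructor
      · rintro ⟨h1, h2⟩
        rcases Nat.le_succ_iff.1 h2 with h | h
        · exact .inl ⟨h1, h⟩
        · exact .inr ⟨h1, h⟩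
      · rintro (⟨h1, h2⟩ | ⟨h1, h2⟩)
        · exact ⟨h1, h2.trans (Nat.le_succ _)⟩
        · exact ⟨h1, h2.le⟩
    · rw [Set.disjoint_left]
      rintro f ⟨_, h1⟩ ⟨_, h2⟩
      omega

/-- The program outputs the distance, at a cost that is controlled by the number of operators in a
half window and by the number of candidates. -/
theorem exec_distP_distance {r n : ℕ} (H : CheckMatrix r n)
    (hH : ∀ i j, traceInner (H i) (H j) = 0) (hr : r ≤ n) (hn : 3 ≤ n) (hD : 0 < distance H) {X : ℕ}
    (hX : ballSize (halfWindow n r) (distance H * halfWindow n r / n + 1) ≤ X)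
    (hC : ∀ a < n, ∀ x < 2 * halfWindow n r, Set.ncard {f | Cand H (show 0 < n by omega)
      (halfWindow n r) (distance H * halfWindow n r / n + 1) a x f} ≤ X) :
    ∃ t s, Exec distP (initState H) t s ∧ t ≤ 10 ^ 7 * (n + 1) ^ 7 * (X + 1) ∧
      s.reg 0 = distance H := by
  have hn0 : 0 < n := by omega
  set w := halfWindow n r with hwdef
  have hw := two_mul_halfWindow_le hr
  have hw0 := halfWindow_pos hr hn
  rw [← hwdef] at hw hw0
  set D := distance H with hDdef
  -- the least weight is attained
  have hne : {m | ∃ e : PauliVec n, (∀ i, traceInner (H i) e = 0) ∧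
      e ∉ Submodule.span (ZMod 2) (Set.range H) ∧ hammingNorm e = m}.Nonempty := by
    by_contra h
    rw [Set.not_nonempty_iff_eq_empty] at h
    rw [hDdef, distance, h, Nat.sInf_empty] at hD
    omega
  obtain ⟨e, he1, he2, he3⟩ := Nat.sInf_mem hne
  change hammingNorm e = D at he3
  have hDn : D ≤ n := by
    rw [← he3]; simpa using hammingNorm_le_card_fintype (x := e)
  have hspec := fun d a x => round_spec H hH hn0 hw d a x rfl rfl
  have hmono : ∀ d ≤ D, d * w / n + 1 ≤ D * w / n + 1 := fun d hd =>
    Nat.add_le_add_right (Nat.div_le_div_right (Nat.mul_le_mul_right _ hd)) 1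
  have hball : ∀ (I : Finset (Fin n)) d, d ≤ D → I.card = w →
      Set.ncard {f : PauliVec n | (∀ q ∉ I, f q = 0) ∧ hammingNorm f ≤ d * w / n + 1} ≤ X := by
    intro I d hd hI
    rw [ncard_supp_le, hI]
    refine le_trans (Finset.sum_le_sum_of_subset ?_) hX
    exact Finset.range_subset_range.2 (Nat.add_le_add_right (hmono d hd) 1)
  have hall : ∀ s : Set (PauliVec n), s.ncard ≤ 4 ^ n := fun s => by
    rw [← card_pauliVec, ← Set.ncard_univ]
    exact Set.ncard_le_ncard (Set.subset_univ _) (Set.toFinite _)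
  have hcand : ∀ d ≤ D, ∀ a x, Set.ncard {f | Cand H hn0 w (d * w / n + 1) a x f} ≤ X := by
    intro d hd a x
    refine le_trans ?_ (hC (a % n) (Nat.mod_lt _ hn0) (x % (2 * w)) (Nat.mod_lt _ (by omega)))
    refine Set.ncard_le_ncard (fun f hf => ?_) (Set.toFinite _)
    obtain ⟨h1, h2, h3⟩ := hf
    refine ⟨h1, ?_, ?_⟩
    · rw [← halfWin_mod]; exact h2.trans (hmono d hd)
    · rw [← halfWin_mod]; exact h3.trans (hmono d hd)
  have hX' : 10 ^ 7 * (n + 1) ^ 7 * (min X (4 ^ n) + 1) ≤ 10 ^ 7 * (n + 1) ^ 7 * (X + 1) :=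
    Nat.mul_le_mul_left _ (by omega)
  suffices h : ∃ t s, Exec distP (initState H) t s ∧
      t ≤ 10 ^ 7 * (n + 1) ^ 7 * (min X (4 ^ n) + 1) ∧ s.reg 0 = D by
    obtain ⟨t, s, h1, h2, h3⟩ := h
    exact ⟨t, s, h1, h2.trans hX', h3⟩
  refine exec_distP H hr (by omega) (D := D) (X := min X (4 ^ n))
    rfl rfl (min_le_right _ _) hD hDn ?_ ?_ ?_ ?_ ?_
  · intro d hd a x hs
    obtain ⟨f, hf, hf1, hf2⟩ := (hspec d a x).2.2.2.1 hs
    have : D ≤ hammingNorm f := Nat.sInf_le ⟨f, hf.1, hf1, rfl⟩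
    omega
  · obtain ⟨a, ha, x, hx, h1, h2⟩ := exists_window hn0 hw0 hw e he3.le
    exact ⟨a, ha, x, hx, (hspec D _ _).2.2.2.2 ⟨e, ⟨he1, h1, h2⟩, he2, he3.le⟩⟩
  · exact fun d hd a x => le_min ((hspec d a x).1.trans (hball _ d hd (card_halfWin hn0 hw a x).1))
      ((hspec d a x).1.trans (hall _))
  · exact fun d hd a x => le_min
      ((hspec d a x).2.1.trans (hball _ d hd (card_halfWin hn0 hw a x).2.1))
      ((hspec d a x).2.1.trans (hall _))
  · exact fun d hd a x => le_min ((hspec d a x).2.2.1.trans (hcand d hd a x))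
      ((hspec d a x).2.2.1.trans (hall _))

end

section

/-! ### Counting generators of stabilizer codes -/

variable {n : ℕ}

/-- The trace inner product as a bilinear form. -/
def sympForm (n : ℕ) : LinearMap.BilinForm (ZMod 2) (PauliVec n) :=
  LinearMap.mk₂ _ traceInner
    (fun e f g => by rw [traceInner_comm, traceInner_add, traceInner_comm g, traceInner_comm g])
    (fun c e f => by rw [traceInner_comm, traceInner_smul, traceInner_comm f]; rfl)
    traceInner_add (fun c e f => traceInner_smul c e f)

/-- The operators that commute with all operators of a subspace. -/
def perp (V : Submodule (ZMod 2) (PauliVec n)) : Submodule (ZMod 2) (PauliVec n) :=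
  (sympForm n).orthogonal V

theorem mem_perp {V : Submodule (ZMod 2) (PauliVec n)} {e : PauliVec n} :
    e ∈ perp V ↔ ∀ v ∈ V, traceInner v e = 0 := Iff.rfl

theorem finrank_perp (V : Submodule (ZMod 2) (PauliVec n)) :
    Module.finrank (ZMod 2) (perp V) = 2 * n - Module.finrank (ZMod 2) V := by
  have h : ∀ x : PauliVec n, (∀ y, traceInner x y = 0) → x = 0 := by
    intro x hx
    funext q
    have h1 := hx (Pi.single q (1, 0))
    have h2 := hx (Pi.single q (0, 1))
    rw [traceInner_single] at h1 h2
    simp only [mul_one, mul_zero, zero_add, add_zero] at h1 h2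
    exact Prod.ext h2 h1
  have hB : (sympForm n).Nondegenerate :=
    ⟨h, fun y hy => h y fun x => by rw [traceInner_comm]; exact hy x⟩
  rw [perp, LinearMap.BilinForm.finrank_orthogonal hB,
    Module.finrank_pi_fintype]
  simp [mul_comm]

theorem mem_sup_singleton {V : Submodule (ZMod 2) (PauliVec n)} {v x : PauliVec n} :
    x ∈ V ⊔ Submodule.span (ZMod 2) {v} ↔ x ∈ V ∨ x + v ∈ V := by
  rw [Submodule.mem_sup]
  constructor
  · rintro ⟨y, hy, z, hz, rfl⟩
    obtain ⟨a, rfl⟩ := Submodule.mem_span_singleton.1 hz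
    rcases zmod_two_cases a with rfl | rfl
    · left; simpa using hy
    · right; rwa [one_smul, add_assoc, ZModModule.add_self, add_zero]
  · rintro (h | h)
    · exact ⟨x, h, 0, Submodule.zero_mem _, add_zero x⟩
    · exact ⟨x + v, h, v, Submodule.mem_span_singleton_self v, by
        rw [add_assoc, ZModModule.add_self, add_zero]⟩

theorem mem_perp_sup {V : Submodule (ZMod 2) (PauliVec n)} {v x : PauliVec n} :
    x ∈ perp (V ⊔ Submodule.span (ZMod 2) {v}) ↔ x ∈ perp V ∧ traceInner v x = 0 := by
  simp only [mem_perp, mem_sup_singleton]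
  refine ⟨fun h => ⟨fun y hy => h y (.inl hy), h v (.inr ?_)⟩, fun ⟨h1, h2⟩ y hy => ?_⟩
  · rw [ZModModule.add_self]; exact V.zero_mem
  · rcases hy with hy | hy
    · exact h1 y hy
    · have := h1 _ hy
      rwa [traceInner_comm, traceInner_add, traceInner_comm x v, h2, add_zero,
        traceInner_comm] at this

theorem finrank_sup_singleton {V : Submodule (ZMod 2) (PauliVec n)} {v : PauliVec n} (hv : v ∉ V) :
    Module.finrank (ZMod 2) (V ⊔ Submodule.span (ZMod 2) {v} : Submodule _ _) =
      Module.finrank (ZMod 2) V + 1 := by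
  have hv0 : v ≠ 0 := fun h => hv (h ▸ V.zero_mem)
  have h1 := Submodule.finrank_sup_add_finrank_inf_eq V (Submodule.span (ZMod 2) {v})
  have h2 : V ⊓ Submodule.span (ZMod 2) {v} = ⊥ := by
    rw [eq_bot_iff]
    rintro x ⟨hx, hx'⟩
    obtain ⟨a, rfl⟩ := Submodule.mem_span_singleton.1 hx'
    rcases zmod_two_cases a with rfl | rfl
    · simp
    · exact absurd (by simpa using hx) hv
  rw [h2, finrank_bot, finrank_span_singleton hv0] at h1
  simpa using h1

theorem inf_perp_sup_singleton {V : Submodule (ZMod 2) (PauliVec n)} {v : PauliVec n}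
    (hv : v ∈ perp V) : (V ⊔ Submodule.span (ZMod 2) {v}) ⊓ perp (V ⊔ Submodule.span (ZMod 2) {v}) =
      (V ⊓ perp V) ⊔ Submodule.span (ZMod 2) {v} := by
  ext x
  simp only [Submodule.mem_inf, mem_perp_sup, mem_sup_singleton]
  have hvv := traceInner_self v
  constructor
  · rintro ⟨h1 | h1, h2, h3⟩
    · exact .inl ⟨h1, h2⟩
    · exact .inr ⟨h1, (perp V).add_mem h2 hv⟩
  · rintro (⟨h1, h2⟩ | ⟨h1, h2⟩)
    · exact ⟨.inl h1, h2, by rw [traceInner_comm]; exact hv x h1⟩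
    · have h3 : traceInner v (x + v) = 0 := by rw [traceInner_comm]; exact hv _ h1
      refine ⟨.inr h1, ?_, ?_⟩
      · have := (perp V).add_mem h2 hv
        rwa [add_assoc, ZModModule.add_self, add_zero] at this
      · rwa [traceInner_add, hvv, add_zero] at h3

/-- The number of operators in the complement of a subspace of dimension `m` that commute with all
its elements, when `ρ` is the dimension of the radical of the subspace. -/
def extCount (n m ρ : ℕ) : ℕ := 2 ^ (2 * n - m) - 2 ^ ρ

theorem ncard_perp_diff (V : Submodule (ZMod 2) (PauliVec n)) :
    Set.ncard {v | v ∈ perp V ∧ v ∉ V} = extCount n (Module.finrank (ZMod 2) V)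
      (Module.finrank (ZMod 2) (V ⊓ perp V : Submodule _ _)) := by
  have hc : ∀ W : Submodule (ZMod 2) (PauliVec n),
      Set.ncard (W : Set (PauliVec n)) = 2 ^ Module.finrank (ZMod 2) W := fun W => by
    rw [← Nat.card_coe_set_eq]
    have := Module.natCard_eq_pow_finrank (K := ZMod 2) (V := W)
    rwa [Nat.card_zmod] at this
  have h : {v | v ∈ perp V ∧ v ∉ V} =
      (perp V : Set (PauliVec n)) \ (V ⊓ perp V : Submodule _ _) := by
    ext v; simp +contextual
  rw [h, Set.ncard_sdiff (by simp) (Set.toFinite _), hc, hc, finrank_perp, extCount]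

/-- The lists of `r` commuting generators whose span is disjoint from `V` and commutes with `V`,
the generators being independent. -/
def good (r : ℕ) (V : Submodule (ZMod 2) (PauliVec n)) : Set (CheckMatrix r n) :=
  {H | (∀ c : Fin r → ZMod 2, ∑ i, c i • H i ∈ V → c = 0) ∧
    (∀ i j, traceInner (H i) (H j) = 0) ∧ ∀ i, H i ∈ perp V}

theorem cons_mem_good {r : ℕ} {V : Submodule (ZMod 2) (PauliVec n)} {v : PauliVec n}
    {H : CheckMatrix r n} : (Fin.cons v H : CheckMatrix (r + 1) n) ∈ good (r + 1) V ↔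
      (v ∈ perp V ∧ v ∉ V) ∧ H ∈ good r (V ⊔ Submodule.span (ZMod 2) {v}) := by
  unfold good
  simp only [Set.mem_ofPred_eq, mem_perp_sup, Fin.forall_fin_succ (n := r), Fin.cons_zero,
    Fin.cons_succ, Fin.sum_univ_succ, traceInner_self, true_and]
  constructor
  · rintro ⟨h1, ⟨h2, h3⟩, h4, h5⟩
    refine ⟨⟨h4, fun hv => ?_⟩, fun c hc => ?_, fun i j => (h3 i).2 j, fun i => ⟨h5 i, h2 i⟩⟩
    · have := congrFun (h1 (Fin.cons 1 0) (by simpa using hv)) 0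
      simp at this
    · rw [mem_sup_singleton] at hc
      obtain ⟨a, ha⟩ : ∃ a : ZMod 2, a • v + ∑ i, c i • H i ∈ V := by
        rcases hc with hc | hc
        · exact ⟨0, by simpa using hc⟩
        · exact ⟨1, by rwa [one_smul, add_comm]⟩
      have := h1 (Fin.cons a c) (by simpa using ha)
      funext i
      simpa using congrFun this i.succ
  · rintro ⟨⟨h1, h2⟩, h3, h4, h5⟩
    refine ⟨fun c hc => ?_, ⟨fun j => (h5 j).2, fun i => ⟨?_, h4 i⟩⟩, h1, fun i => (h5 i).1⟩
    · have h6 : (fun i => c (Fin.succ i)) = 0 := h3 _ (by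
        rw [mem_sup_singleton]
        rcases zmod_two_cases (c 0) with h | h
        · left; simpa [h] using hc
        · right; rw [h, one_smul, add_comm] at hc; exact hc)
      have h7 : c 0 = 0 := by
        rcases zmod_two_cases (c 0) with h | h
        · exact h
        · refine absurd ?_ h2
          have : ∀ i : Fin r, c i.succ = 0 := congrFun h6
          simpa [h, this] using hc
      funext i
      refine Fin.cases h7 (fun j => congrFun h6 j) i
    · rw [traceInner_comm]; exact (h5 i).2

theorem ncard_cons {r : ℕ} (P : CheckMatrix (r + 1) n → Prop) :
    Set.ncard {H | P H} = ∑ v, Set.ncard {H : CheckMatrix r n | P (Fin.cons v H)} := by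
  classical
  have h := Fintype.card_congr (((Fin.consEquiv fun _ : Fin (r + 1) => PauliVec n).subtypeEquiv
    (p := fun x => P (Fin.cons x.1 x.2)) (q := P) (fun _ => Iff.rfl)).symm.trans
      (Equiv.subtypeProdEquivSigmaSubtype fun v H => P (Fin.cons v H)))
  rw [Fintype.card_sigma] at h
  simp only [← Nat.card_coe_set_eq, Nat.card_eq_fintype_card]
  exact h

/-- The number of lists in `good r V`. -/
def goodCount (n r m ρ : ℕ) : ℕ := ∏ i ∈ Finset.range r, extCount n (m + i) (ρ + i)

theorem goodCount_succ (n r m ρ : ℕ) :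
    goodCount n (r + 1) m ρ = extCount n m ρ * goodCount n r (m + 1) (ρ + 1) := by
  unfold goodCount
  rw [Finset.prod_range_succ', mul_comm]
  congr 1
  exact Finset.prod_congr rfl fun i _ => by
    rw [show m + (i + 1) = m + 1 + i by ring, show ρ + (i + 1) = ρ + 1 + i by ring]

theorem finrank_radical_sup {V : Submodule (ZMod 2) (PauliVec n)} {v : PauliVec n}
    (hv : v ∈ perp V) (hV : v ∉ V) :
    Module.finrank (ZMod 2) ((V ⊔ Submodule.span (ZMod 2) {v}) ⊓
      perp (V ⊔ Submodule.span (ZMod 2) {v}) : Submodule _ _) =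
      Module.finrank (ZMod 2) (V ⊓ perp V : Submodule _ _) + 1 := by
  rw [inf_perp_sup_singleton hv, finrank_sup_singleton fun h => hV (Submodule.mem_inf.1 h).1]

/-- The first generator is any element of `perp V` outside `V`; the others are then counted with
the first one adjoined to `V`. -/
theorem ncard_good (r : ℕ) (V : Submodule (ZMod 2) (PauliVec n)) :
    (good r V).ncard = goodCount n r (Module.finrank (ZMod 2) V)
      (Module.finrank (ZMod 2) (V ⊓ perp V : Submodule _ _)) := by
  classical
  induction r generalizing V with
  | zero =>
    have : good 0 V = Set.univ := by
      ext H
      exact iff_of_true ⟨fun c _ => Subsingleton.elim c 0, fun i => i.elim0, fun i => i.elim0⟩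
        trivial
    rw [this, Set.ncard_univ]
    simp [goodCount]
  | succ r ih =>
    have h1 : good (r + 1) V = {H | H ∈ good (r + 1) V} := rfl
    rw [h1, ncard_cons, goodCount_succ, ← ncard_perp_diff, Set.ncard_eq_toFinset_card',
      ← smul_eq_mul, ← Finset.sum_const]
    simp only [Set.toFinset_ofPred, Finset.sum_filter]
    refine Finset.sum_congr rfl fun v _ => ?_
    simp only [cons_mem_good]
    split_ifs with h
    · simp only [h, true_and, not_false_eq_true]
      rw [← finrank_radical_sup h.1 h.2, ← finrank_sup_singleton h.2, ← ih]
      rfl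
    · simp [h]

/-- Any operator outside `V` is represented by a given nontrivial combination of the generators in
at most the expected number of cases. -/
theorem ncard_comb_le (r : ℕ) (V : Submodule (ZMod 2) (PauliVec n)) (c : Fin r → ZMod 2)
    (hc : c ≠ 0) (g : PauliVec n) (hg : g ∉ V) :
    Set.ncard {H | H ∈ good r V ∧ ∑ i, c i • H i = g} * extCount n (Module.finrank (ZMod 2) V)
      (Module.finrank (ZMod 2) (V ⊓ perp V : Submodule _ _)) ≤ goodCount n r
        (Module.finrank (ZMod 2) V) (Module.finrank (ZMod 2) (V ⊓ perp V : Submodule _ _)) := by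
  classical
  induction r generalizing V g with
  | zero => exact absurd (Subsingleton.elim _ _) hc
  | succ r ih =>
    rw [goodCount_succ, mul_comm]
    refine Nat.mul_le_mul_left _ ?_
    set m := Module.finrank (ZMod 2) V
    set ρ := Module.finrank (ZMod 2) (V ⊓ perp V : Submodule _ _)
    rcases Set.eq_empty_or_nonempty {H | H ∈ good (r + 1) V ∧ ∑ i, c i • H i = g} with h0 | ⟨H₀, hH₀, hg₀⟩
    · rw [h0]; simp
    have hgp : g ∈ perp V := hg₀ ▸ Submodule.sum_mem _ fun i _ => Submodule.smul_mem _ _ (hH₀.2.2 i)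
    rw [ncard_cons]
    simp only [cons_mem_good, Fin.sum_univ_succ, Fin.cons_zero, Fin.cons_succ]
    by_cases hc' : (fun i => c (Fin.succ i)) = 0
    · have hc0 : c 0 = 1 := by
        rcases zmod_two_cases (c 0) with h | h
        · exact absurd (funext fun i => Fin.cases h (fun j => congrFun hc' j) i) hc
        · exact h
      have hcs : ∀ i : Fin r, c i.succ = 0 := congrFun hc'
      rw [Finset.sum_eq_single g]
      · rw [← finrank_radical_sup hgp hg, ← finrank_sup_singleton hg, ← ncard_good]
        exact Set.ncard_le_ncard (fun H hH => hH.1.2) (Set.toFinite _)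
      · intro v _ hv
        simp [hc0, hcs, hv]
      · simp
    · have hzero : ∀ v, ¬ (v ∈ perp (V ⊔ Submodule.span (ZMod 2) {g}) ∧
          v ∉ V ⊔ Submodule.span (ZMod 2) {g}) → Set.ncard {H : CheckMatrix r n |
            ((v ∈ perp V ∧ v ∉ V) ∧ H ∈ good r (V ⊔ Submodule.span (ZMod 2) {v})) ∧
              c 0 • v + ∑ i, c (Fin.succ i) • H i = g} = 0 := by
        intro v h
        rw [Set.ncard_eq_zero]
        rw [Set.eq_empty_iff_forall_notMem]
        rintro H ⟨⟨⟨h1, h2⟩, h3, h4, h5⟩, h6⟩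
        apply h
        rw [mem_perp_sup, mem_sup_singleton, not_or]
        refine ⟨⟨h1, ?_⟩, h2, fun h7 => hc' (h3 _ ?_)⟩
        · rw [traceInner_comm, ← h6, traceInner_add, traceInner_smul, traceInner_self, mul_zero,
            zero_add]
          refine Finset.sum_induction _ (fun y => traceInner v y = 0)
            (fun a b ha hb => by rw [traceInner_add, ha, hb, add_zero]) (by simp [traceInner])
            fun i _ => by rw [traceInner_smul, (mem_perp_sup.1 (h5 i)).2, mul_zero]
        · rw [mem_sup_singleton]
          rw [← h6] at h7
          rcases zmod_two_cases (c 0) with h' | h'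
          · right; rw [h', zero_smul, zero_add, add_comm] at h7; exact h7
          · left; rwa [h', one_smul, ← add_assoc, ZModModule.add_self, zero_add] at h7
      have hterm : ∀ v, Set.ncard {H : CheckMatrix r n | ((v ∈ perp V ∧ v ∉ V) ∧
          H ∈ good r (V ⊔ Submodule.span (ZMod 2) {v})) ∧
            c 0 • v + ∑ i, c (Fin.succ i) • H i = g} * extCount n (m + 1) (ρ + 1) ≤
          if v ∈ perp (V ⊔ Submodule.span (ZMod 2) {g}) ∧ v ∉ V ⊔ Submodule.span (ZMod 2) {g} then
            goodCount n r (m + 1) (ρ + 1) else 0 := by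
        intro v
        split_ifs with h
        · simp only [mem_perp_sup, mem_sup_singleton, not_or] at h
          have h3 := ih (V ⊔ Submodule.span (ZMod 2) {v}) _ hc' (g + c 0 • v) (by
            rw [mem_sup_singleton, not_or]
            rcases zmod_two_cases (c 0) with h' | h'
            · simpa [h', add_comm g] using ⟨hg, h.2.2⟩
            · rw [h', one_smul, add_assoc, ZModModule.add_self, add_zero]
              exact ⟨by rw [add_comm]; exact h.2.2, hg⟩)
          rw [finrank_radical_sup h.1.1 h.2.1, finrank_sup_singleton h.2.1] at h3
          refine le_trans (Nat.mul_le_mul_right _ (Set.ncard_le_ncard ?_ (Set.toFinite _))) h3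
          rintro H ⟨⟨_, h4⟩, h5⟩
          refine ⟨h4, ?_⟩
          rw [← h5, add_comm, ← add_assoc, ZModModule.add_self, zero_add]
        · rw [hzero v h, zero_mul]
      rcases Nat.eq_zero_or_pos (extCount n (m + 1) (ρ + 1)) with hQ | hQ
      · -- there is no room for a first generator
        rw [Finset.sum_eq_zero]
        · exact Nat.zero_le _
        · intro v _
          have hcard := ncard_perp_diff (V ⊔ Submodule.span (ZMod 2) {g})
          rw [finrank_radical_sup hgp hg, finrank_sup_singleton hg, hQ, Set.ncard_eq_zero] at hcard
          exact hzero v fun h => (Set.eq_empty_iff_forall_notMem.1 hcard) v h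
      · refine Nat.le_of_mul_le_mul_right ?_ hQ
        rw [Finset.sum_mul]
        refine (Finset.sum_le_sum fun v _ => hterm v).trans ?_
        rw [← Finset.sum_filter, Finset.sum_const, smul_eq_mul, mul_comm]
        refine Nat.mul_le_mul_left _ ?_
        have hcard := ncard_perp_diff (V ⊔ Submodule.span (ZMod 2) {g})
        rw [finrank_radical_sup hgp hg, finrank_sup_singleton hg] at hcard
        rw [← hcard, Set.ncard_eq_toFinset_card', Set.toFinset_ofPred]

end

section

/-! ### Probabilities of commutation -/

section Commutation

variable {r n : ℕ}

/-- The logical operators: they commute with all generators but are not in the stabilizer. The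
distance of the code is their least weight. -/
def Logical (H : CheckMatrix r n) (f : PauliVec n) : Prop :=
  Commutes H f ∧ f ∉ Submodule.span (ZMod 2) (Set.range H)

theorem mem_span_range_iff (H : CheckMatrix r n) (f : PauliVec n) :
    f ∈ Submodule.span (ZMod 2) (Set.range H) ↔ ∃ c : Fin r → ZMod 2, ∑ i, c i • H i = f :=
  Submodule.mem_span_range_iff_exists_fun _

theorem good_bot {k : ℕ} : good (n - k) (⊥ : Submodule (ZMod 2) (PauliVec n)) =
    stabilizerCodes n k := by
  ext H
  simp only [good, stabilizerCodes, Set.mem_ofPred_eq, Fintype.linearIndependent_iff,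
    Submodule.mem_bot, mem_perp, funext_iff, Pi.zero_apply]
  refine and_congr_right fun _ => and_iff_left fun i v hv => ?_
  simp [funext hv, traceInner]

/-- Conditioning on the event that `e` is logical amounts to passing to the generators that are
`good` for the span of `e`. -/
theorem mem_good_span {H : CheckMatrix r n} {e : PauliVec n} (he : e ≠ 0) :
    H ∈ good r (Submodule.span (ZMod 2) {e}) ↔ H ∈ good r ⊥ ∧ Logical H e := by
  have hmem : ∀ x, x ∈ Submodule.span (ZMod 2) {e} ↔ x = 0 ∨ x = e := fun x => by
    have := mem_sup_singleton (V := ⊥) (v := e) (x := x)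
    rwa [bot_sup_eq, Submodule.mem_bot, Submodule.mem_bot, ← sub_eq_zero (b := e),
      ZModModule.sub_eq_add] at *
  simp only [good, Logical, Commutes, Set.mem_ofPred_eq, mem_perp, hmem, Submodule.mem_bot,
    forall_eq_or_imp, forall_eq, mem_span_range_iff, not_exists]
  have h0 : ∀ f : PauliVec n, traceInner 0 f = 0 := fun f => by simp [traceInner]
  constructor
  · rintro ⟨h1, h2, h3⟩
    refine ⟨⟨fun c hc => h1 c (.inl hc), h2, fun i => h0 _⟩, fun i => ?_, fun c hc => ?_⟩
    · rw [traceInner_comm]; exact (h3 i).2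
    · rw [h1 c (.inr hc)] at hc
      exact he (by simpa using hc.symm)
  · rintro ⟨⟨h1, h2, h3⟩, h4, h5⟩
    exact ⟨fun c hc => hc.elim (h1 c) fun h => absurd h (h5 c), h2,
      fun i => ⟨h0 _, by rw [traceInner_comm]; exact h4 i⟩⟩

theorem Logical.ne_zero {H : CheckMatrix r n} {f : PauliVec n} (h : Logical H f) : f ≠ 0 := by
  rintro rfl
  exact h.2 (Submodule.zero_mem _)

theorem extCount_diag_pos {i : ℕ} (hi : i < n) : 0 < extCount n i i :=
  Nat.sub_pos_of_lt (Nat.pow_lt_pow_right (by norm_num) (by omega))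

/-- A subspace of dimension at most one that commutes with itself. The zero space and the span of
one logical operator are treated together in this way. -/
def Small (V : Submodule (ZMod 2) (PauliVec n)) : Prop :=
  V ≤ perp V ∧ Module.finrank (ZMod 2) V ≤ 1

theorem small_bot : Small (⊥ : Submodule (ZMod 2) (PauliVec n)) := ⟨bot_le, by simp⟩

theorem small_span (e : PauliVec n) : Small (Submodule.span (ZMod 2) {e}) := by
  refine ⟨?_, ?_⟩
  · rw [Submodule.span_singleton_le_iff_mem, ← bot_sup_eq (Submodule.span (ZMod 2) {e}),
      mem_perp_sup]
    refine ⟨fun v hv => ?_, traceInner_self e⟩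
    rw [Submodule.mem_bot] at hv
    simp [hv]
  · exact (finrank_span_le_card _).trans (by simp)

theorem Small.ncard_good {V : Submodule (ZMod 2) (PauliVec n)} (hV : Small V) (r : ℕ) :
    (good r V).ncard = goodCount n r (Module.finrank (ZMod 2) V) (Module.finrank (ZMod 2) V) := by
  rw [QDist.ncard_good, inf_eq_left.2 hV.1]

theorem Small.ncard_le {V : Submodule (ZMod 2) (PauliVec n)} (hV : Small V) :
    Set.ncard (V : Set (PauliVec n)) ≤ 2 := by
  have := Module.natCard_eq_pow_finrank (K := ZMod 2) (V := V)
  rw [Nat.card_zmod] at this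
  rw [← Nat.card_coe_set_eq]
  exact this.le.trans (Nat.pow_le_pow_right (by norm_num) hV.2)

/-- Adjoining an operator divides the number of generators at least by `2 ^ r`. -/
theorem two_pow_mul_goodCount_le {m ρ : ℕ} (hr : r < n) (hm : m ≤ 1) :
    2 ^ r * goodCount n r (m + 1) ρ ≤ goodCount n r m m := by
  unfold goodCount
  calc _ = ∏ i ∈ Finset.range r, 2 * extCount n (m + 1 + i) (ρ + i) := by
        rw [Finset.prod_mul_distrib]; simp
    _ ≤ _ := Finset.prod_le_prod' fun i hi => by
        rw [Finset.mem_range] at hi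
        unfold extCount
        rw [Nat.mul_sub, ← pow_succ', ← pow_succ',
          show 2 * n - (m + 1 + i) + 1 = 2 * n - (m + i) by omega]
        exact Nat.sub_le_sub_left (Nat.pow_le_pow_right (by norm_num) (by omega)) _

/-- Given that an operator is logical, any other operator commutes with all generators with
probability about `2 ^ (-r)`. The same holds without the condition. -/
theorem Small.ncard_commutes_le {V : Submodule (ZMod 2) (PauliVec n)} (hV : Small V)
    (hr : r < n) (hn : 2 ≤ n) {f : PauliVec n} (hf : f ∉ V) :
    (Set.ncard {H | H ∈ good r V ∧ Commutes H f} : ℝ) ≤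
      (1 + 8 * (1 / 4) ^ (n - r)) / 2 ^ r * (good r V).ncard := by
  classical
  set m := Module.finrank (ZMod 2) V with hm
  set G := (good r V).ncard with hG
  set C := (Finset.univ.filter fun c : Fin r → ZMod 2 => c ≠ 0) ×ˢ
    (Finset.univ.filter fun v : PauliVec n => v ∈ V) with hC
  have hsub : {H | H ∈ good r V ∧ Commutes H f} ⊆ good r (V ⊔ Submodule.span (ZMod 2) {f}) ∪
      ⋃ p ∈ C, {H | H ∈ good r V ∧ ∑ i, p.1 i • H i = f + p.2} := by
    rintro H ⟨⟨h1, h2, h3⟩, h4⟩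
    by_cases h5 : ∃ c : Fin r → ZMod 2, c ≠ 0 ∧ ∑ i, c i • H i + f ∈ V
    · obtain ⟨c, hc, h6⟩ := h5
      refine .inr ?_
      simp only [Set.mem_iUnion, exists_prop]
      refine ⟨(c, ∑ i, c i • H i + f), by simp [hC, hc, h6], ⟨h1, h2, h3⟩, ?_⟩
      change _ = f + (_ + f)
      rw [add_left_comm, ZModModule.add_self, add_zero]
    · refine .inl ⟨fun c hc => ?_, h2, fun i => mem_perp_sup.2 ⟨h3 i, ?_⟩⟩
      · by_contra hc0
        rcases mem_sup_singleton.1 hc with h | h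
        · exact hc0 (h1 c h)
        · exact h5 ⟨c, hc0, h⟩
      · rw [traceInner_comm]; exact h4 i
  have hA : 2 ^ r * (good r (V ⊔ Submodule.span (ZMod 2) {f})).ncard ≤ G := by
    rw [hG, hV.ncard_good, QDist.ncard_good, finrank_sup_singleton hf]
    exact two_pow_mul_goodCount_le hr hV.2
  have hQ : 2 ^ (2 * n - m - 1) ≤ extCount n m m := by
    unfold extCount
    have h1 : 2 ^ (2 * n - m) = 2 * 2 ^ (2 * n - m - 1) := by
      rw [← pow_succ']; congr 1; have := hV.2; omega
    have h2 : 2 ^ m ≤ 2 ^ (2 * n - m - 1) :=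
      Nat.pow_le_pow_right (by norm_num) (by have := hV.2; omega)
    omega
  have hB : ∀ p ∈ C, Set.ncard {H | H ∈ good r V ∧ ∑ i, p.1 i • H i = f + p.2} *
      2 ^ (2 * n - m - 1) ≤ G := by
    intro p hp
    simp only [hC, Finset.mem_product, Finset.mem_filter, Finset.mem_univ, true_and] at hp
    refine (Nat.mul_le_mul_left _ hQ).trans ?_
    have h := ncard_comb_le r V p.1 hp.1 (f + p.2) fun h => hf (by
      simpa [add_assoc, ZModModule.add_self] using V.add_mem h hp.2)
    rwa [inf_eq_left.2 hV.1, ← hV.ncard_good] at h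
  have hCc : C.card ≤ 2 ^ r * 2 := by
    rw [hC, Finset.card_product]
    refine Nat.mul_le_mul ((Finset.card_le_univ _).trans (by simp)) ?_
    have := hV.ncard_le
    rw [Set.ncard_eq_toFinset_card'] at this
    convert this using 2
    ext; simp
  have hsum : Set.ncard {H | H ∈ good r V ∧ Commutes H f} ≤
      (good r (V ⊔ Submodule.span (ZMod 2) {f})).ncard +
        ∑ p ∈ C, Set.ncard {H | H ∈ good r V ∧ ∑ i, p.1 i • H i = f + p.2} :=
    (Set.ncard_le_ncard hsub (Set.toFinite _)).trans ((Set.ncard_union_le _ _).trans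
      (Nat.add_le_add_left (Finset.set_ncard_biUnion_le _ _) _))
  have hA' : ((good r (V ⊔ Submodule.span (ZMod 2) {f})).ncard : ℝ) ≤ G / 2 ^ r := by
    rw [le_div_iff₀ (by positivity), mul_comm]
    exact_mod_cast hA
  have hB' : ((∑ p ∈ C, Set.ncard {H | H ∈ good r V ∧ ∑ i, p.1 i • H i = f + p.2} : ℕ) : ℝ) ≤
      2 ^ r * 2 * (G / 2 ^ (2 * n - m - 1)) := by
    push_cast
    calc _ ≤ ∑ p ∈ C, (G : ℝ) / 2 ^ (2 * n - m - 1) := Finset.sum_le_sum fun p hp => by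
          rw [le_div_iff₀ (by positivity)]
          exact_mod_cast hB p hp
      _ = C.card * ((G : ℝ) / 2 ^ (2 * n - m - 1)) := by rw [Finset.sum_const, nsmul_eq_mul]
      _ ≤ _ := mul_le_mul_of_nonneg_right (by exact_mod_cast hCc) (by positivity)
  have hpow : (2 : ℝ) ^ r * 2 / 2 ^ (2 * n - m - 1) ≤ 8 * (1 / 4) ^ (n - r) / 2 ^ r := by
    rw [div_pow, one_pow, mul_one_div, div_div, div_le_div_iff₀ (by positivity) (by positivity)]
    have e1 : (2 : ℝ) ^ r * 2 * (4 ^ (n - r) * 2 ^ r) = 2 ^ (2 * n + 1) := by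
      rw [show (4 : ℝ) = 2 ^ 2 by norm_num, ← pow_mul, ← pow_succ, ← pow_add, ← pow_add]
      congr 1; omega
    have e2 : (8 : ℝ) * 2 ^ (2 * n - m - 1) = 2 ^ (2 * n - m - 1 + 3) := by ring
    rw [e1, e2]
    exact pow_le_pow_right₀ (by norm_num) (by have := hV.2; omega)
  calc (Set.ncard {H | H ∈ good r V ∧ Commutes H f} : ℝ)
      ≤ G / 2 ^ r + 2 ^ r * 2 * (G / 2 ^ (2 * n - m - 1)) := by
        refine le_trans (by exact_mod_cast hsum) (?_ : ((_ : ℕ) : ℝ) ≤ _)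
        push_cast at hB' ⊢
        exact add_le_add hA' hB'
    _ = (1 / 2 ^ r + 2 ^ r * 2 / 2 ^ (2 * n - m - 1)) * G := by ring
    _ ≤ (1 / 2 ^ r + 8 * (1 / 4) ^ (n - r) / 2 ^ r) * G :=
        mul_le_mul_of_nonneg_right (by linarith) (by positivity)
    _ = _ := by ring

theorem ncard_good_bot_pos (hr : r ≤ n) :
    0 < (good r (⊥ : Submodule (ZMod 2) (PauliVec n))).ncard := by
  rw [small_bot.ncard_good, finrank_bot]
  exact Finset.prod_pos fun i hi => by
    rw [zero_add]; exact extCount_diag_pos ((Finset.mem_range.1 hi).trans_le hr)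

/-- An operator is logical with probability about `2 ^ (-r)`. -/
theorem ncard_good_span (hr : r ≤ n) {e : PauliVec n} (he : e ≠ 0) :
    ((good r (Submodule.span (ZMod 2) {e})).ncard : ℝ) ≤
      (good r (⊥ : Submodule (ZMod 2) (PauliVec n))).ncard / 2 ^ r ∧
    (1 - (1 / 4) ^ (n - r)) / 2 ^ r * (good r (⊥ : Submodule (ZMod 2) (PauliVec n))).ncard ≤
      ((good r (Submodule.span (ZMod 2) {e})).ncard : ℝ) := by
  rw [small_bot.ncard_good, finrank_bot, (small_span e).ncard_good, finrank_span_singleton he]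
  have htel : goodCount n r 1 1 * extCount n 0 0 = goodCount n r 0 0 * extCount n r r := by
    unfold goodCount
    have h1 := Finset.prod_range_succ (fun i => extCount n (0 + i) (0 + i)) r
    have h2 := Finset.prod_range_succ' (fun i => extCount n (0 + i) (0 + i)) r
    simp only [zero_add] at h1 h2 ⊢
    simp only [add_comm 1, ← h2, h1]
  have e0 : (extCount n 0 0 : ℝ) = 4 ^ n - 1 := by
    unfold extCount
    rw [Nat.cast_sub (Nat.pow_le_pow_right (by norm_num) (Nat.zero_le _))]
    push_cast
    rw [Nat.sub_zero, pow_mul]; norm_num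
  have er : (2 : ℝ) ^ r * extCount n r r = 4 ^ n - 4 ^ r := by
    unfold extCount
    rw [Nat.cast_sub (Nat.pow_le_pow_right (by norm_num) (by omega))]
    push_cast
    rw [mul_sub, ← pow_add, ← pow_add, show r + (2 * n - r) = 2 * n by omega, ← two_mul, pow_mul,
      pow_mul]
    norm_num
  have h : (goodCount n r 1 1 : ℝ) * (4 ^ n - 1) * 2 ^ r = goodCount n r 0 0 * (4 ^ n - 4 ^ r) := by
    rw [← e0, ← er]
    have : (goodCount n r 1 1 : ℝ) * extCount n 0 0 = goodCount n r 0 0 * extCount n r r := by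
      exact_mod_cast htel
    rw [this]; ring
  have h0 : (0 : ℝ) ≤ goodCount n r 0 0 := Nat.cast_nonneg _
  have h1 : (0 : ℝ) ≤ goodCount n r 1 1 := Nat.cast_nonneg _
  have h4r : (1 : ℝ) ≤ 4 ^ r := one_le_pow₀ (by norm_num)
  have h2r : (0 : ℝ) < 2 ^ r := by positivity
  have hpos : (0 : ℝ) < 4 ^ n := by positivity
  constructor
  · rw [le_div_iff₀ h2r]
    rcases Nat.eq_zero_or_pos n with rfl | hn
    · obtain rfl : r = 0 := by omega
      simp [goodCount]
    · have h4n : (1 : ℝ) < 4 ^ n := one_lt_pow₀ (by norm_num) (by omega)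
      have h5 : (goodCount n r 1 1 : ℝ) * 2 ^ r * (4 ^ n - 1) ≤ goodCount n r 0 0 * (4 ^ n - 1) := by
        nlinarith
      exact le_of_mul_le_mul_right h5 (by linarith)
  · rw [div_mul_eq_mul_div, div_le_iff₀ h2r]
    have h6 : (1 - (1 / 4 : ℝ) ^ (n - r)) * 4 ^ n = 4 ^ n - 4 ^ r := by
      have : (4 : ℝ) ^ n = 4 ^ (n - r) * 4 ^ r := by rw [← pow_add]; congr 1; omega
      rw [sub_mul, one_mul, div_pow, one_pow, this]
      field_simp
    refine le_of_mul_le_mul_right ?_ hpos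
    have h7 : (1 - (1 / 4 : ℝ) ^ (n - r)) * goodCount n r 0 0 * 4 ^ n =
        goodCount n r 1 1 * (4 ^ n - 1) * 2 ^ r := by rw [h, ← h6]; ring
    rw [h7]
    nlinarith [mul_nonneg h1 h2r.le]

end Commutation

end

section

/-! ### First and second moments -/

section Moments

theorem sum_ncard_comm {α β : Type*} [Fintype α] [Fintype β] (A : Finset α) (B : Finset β)
    (R : α → β → Prop) :
    ∑ a ∈ A, Set.ncard {b | b ∈ B ∧ R a b} = ∑ b ∈ B, Set.ncard {a | a ∈ A ∧ R a b} := by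
  classical
  have h := Finset.sum_card_bipartiteAbove_eq_sum_card_bipartiteBelow R (s := A) (t := B)
  have h1 : ∀ a, Set.ncard {b | b ∈ B ∧ R a b} = (B.bipartiteAbove R a).card := fun a => by
    rw [Finset.bipartiteAbove, ← Set.ncard_coe_finset]; congr 1; ext; simp
  have h2 : ∀ b, Set.ncard {a | a ∈ A ∧ R a b} = (A.bipartiteBelow R b).card := fun b => by
    rw [Finset.bipartiteBelow, ← Set.ncard_coe_finset]; congr 1; ext; simp
  simp only [h1, h2, h]

/-- Markov's inequality for a random set. -/
theorem mul_ncard_many_le {α β : Type*} [Fintype α] [Fintype β] (A : Set α) (B : Set β)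
    (R : α → β → Prop) (X : ℕ) {p : ℝ}
    (hp : ∀ b ∈ B, (Set.ncard {a | a ∈ A ∧ R a b} : ℝ) ≤ p * A.ncard) :
    X * (Set.ncard {a | a ∈ A ∧ X ≤ Set.ncard {b | b ∈ B ∧ R a b}} : ℝ) ≤
      B.ncard * (p * A.ncard) := by
  classical
  have h := sum_ncard_comm A.toFinset B.toFinset R
  simp only [Set.mem_toFinset] at h
  have h1 : X * Set.ncard {a | a ∈ A ∧ X ≤ Set.ncard {b | b ∈ B ∧ R a b}} ≤
      ∑ a ∈ A.toFinset, Set.ncard {b | b ∈ B ∧ R a b} := by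
    have e : {a | a ∈ A ∧ X ≤ Set.ncard {b | b ∈ B ∧ R a b}} =
        (A.toFinset.filter fun a => X ≤ Set.ncard {b | b ∈ B ∧ R a b} : Finset α) := by
      ext; simp
    rw [e, Set.ncard_coe_finset, mul_comm, ← smul_eq_mul, ← Finset.sum_const]
    refine (Finset.sum_le_sum fun a ha => (Finset.mem_filter.1 ha).2).trans ?_
    exact Finset.sum_le_sum_of_subset (Finset.filter_subset _ _)
  calc _ ≤ ((∑ b ∈ B.toFinset, Set.ncard {a | a ∈ A ∧ R a b} : ℕ) : ℝ) := by
        rw [← h]; exact_mod_cast h1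
    _ ≤ ∑ b ∈ B.toFinset, p * A.ncard := by
        push_cast
        exact Finset.sum_le_sum fun b hb => hp b (Set.mem_toFinset.1 hb)
    _ = _ := by rw [Finset.sum_const, nsmul_eq_mul, Set.ncard_eq_toFinset_card' B]

variable {r n : ℕ}

theorem ncard_wtOn_le {I J : Finset (Fin n)} {w : ℕ} (hI : I.card = w) (hJ : J.card = w)
    (hd : Disjoint I J) (t : ℕ) : Set.ncard {f : PauliVec n | wtOn I f ≤ t ∧ wtOn J f ≤ t} ≤
      ballSize w t ^ 2 * 4 ^ (n - 2 * w) := by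
  classical
  set S : Finset (Fin n) → Set (PauliVec n) := fun I =>
    {f | (∀ q ∉ I, f q = 0) ∧ hammingNorm f ≤ t} with hS
  have hc : ∀ I, (S I).ncard = ballSize I.card t := fun I => ncard_supp_le I t
  have hres : ∀ I f, wtOn I f ≤ t → restrict I f ∈ S I := fun I f h =>
    ⟨fun q hq => by simp [restrict, hq], by rwa [hammingNorm_restrict]⟩
  have h1 := Set.ncard_le_ncard_of_injOn (s := {f : PauliVec n | wtOn I f ≤ t ∧ wtOn J f ≤ t})
    (t := (S I ×ˢ S J) ×ˢ (Set.univ : Set ({q // q ∉ I ∪ J} → ZMod 2 × ZMod 2)))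
    (fun f => ((restrict I f, restrict J f), fun q => f q))
    (fun f hf => ⟨⟨hres I f hf.1, hres J f hf.2⟩, trivial⟩)
    (fun f _ g _ h => by
      simp only [Prod.mk.injEq] at h
      funext q
      by_cases hq : q ∈ I
      · simpa [restrict, hq] using congrFun h.1.1 q
      by_cases hq' : q ∈ J
      · simpa [restrict, hq'] using congrFun h.1.2 q
      · exact congrFun h.2 ⟨q, by simp [hq, hq']⟩) (Set.toFinite _)
  rw [Set.ncard_prod, Set.ncard_prod, hc, hc, hI, hJ, Set.ncard_univ] at h1
  refine h1.trans (le_of_eq ?_)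
  rw [sq]
  congr 1
  rw [Nat.card_eq_fintype_card, Fintype.card_fun, Fintype.card_subtype_compl]
  rw [Fintype.card_coe, Finset.card_union_of_disjoint hd, hI, hJ]
  simp [two_mul]

/-- Few choices of the generators lead to many candidates in some window. -/
theorem ncard_many_cand_le (hn : 0 < n) {w : ℕ} (hw : 2 * w ≤ n)
    {V : Submodule (ZMod 2) (PauliVec n)} (hV : Small V) {p : ℝ}
    (hp : ∀ f ∉ V, (Set.ncard {H | H ∈ good r V ∧ Commutes H f} : ℝ) ≤ p * (good r V).ncard)
    (hp0 : 0 ≤ p) (t X : ℕ) :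
    X * (Set.ncard {H | H ∈ good r V ∧ ∃ a < n, ∃ x < 2 * w,
      X + 2 < Set.ncard {f | Cand H hn w t a x f}} : ℝ) ≤
      n ^ 2 * (ballSize w t ^ 2 * 4 ^ (n - 2 * w)) * (p * (good r V).ncard) := by
  classical
  set T : ℕ × ℕ → Set (PauliVec n) := fun q =>
    {f | f ∉ V ∧ wtOn (halfWin hn w q.1 q.2 0) f ≤ t ∧ wtOn (halfWin hn w q.1 q.2 w) f ≤ t} with hT
  set I := Finset.range n ×ˢ Finset.range (2 * w) with hI
  set bad : ℕ × ℕ → Set (CheckMatrix r n) := fun q =>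
    {H | H ∈ good r V ∧ X ≤ Set.ncard {f | f ∈ T q ∧ Commutes H f}} with hbad
  have h1 : ∀ q, (X * (bad q).ncard : ℝ) ≤
      (ballSize w t ^ 2 * 4 ^ (n - 2 * w)) * (p * (good r V).ncard) := by
    intro q
    refine (mul_ncard_many_le (good r V) (T q) Commutes X fun f hf => hp f hf.1).trans ?_
    refine mul_le_mul_of_nonneg_right ?_ (by positivity)
    obtain ⟨c1, c2, c3⟩ := card_halfWin hn hw q.1 q.2
    have h2 : (T q).ncard ≤ ballSize w t ^ 2 * 4 ^ (n - 2 * w) :=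
      (Set.ncard_le_ncard (fun f hf => hf.2) (Set.toFinite _)).trans (ncard_wtOn_le c1 c2 c3 t)
    exact_mod_cast h2
  have hsub : {H | H ∈ good r V ∧ ∃ a < n, ∃ x < 2 * w,
      X + 2 < Set.ncard {f | Cand H hn w t a x f}} ⊆ ⋃ q ∈ I, bad q := by
    rintro H ⟨hH, a, ha, x, hx, h⟩
    simp only [Set.mem_iUnion, exists_prop]
    refine ⟨(a, x), by simp [hI, ha, hx], hH, ?_⟩
    have h3 : {f | Cand H hn w t a x f} ⊆
        {f | f ∈ T (a, x) ∧ Commutes H f} ∪ (V : Set (PauliVec n)) := by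
      rintro f ⟨h4, h5, h6⟩
      by_cases hf : f ∈ V
      · exact .inr hf
      · exact .inl ⟨⟨hf, h5, h6⟩, h4⟩
    have h4 := (Set.ncard_le_ncard h3 (Set.toFinite _)).trans (Set.ncard_union_le _ _)
    have h5 := hV.ncard_le
    omega
  have h2 : ((⋃ q ∈ I, bad q).ncard : ℝ) ≤ ∑ q ∈ I, ((bad q).ncard : ℝ) := by
    exact_mod_cast Finset.set_ncard_biUnion_le I bad
  calc _ ≤ X * ∑ q ∈ I, ((bad q).ncard : ℝ) := by
        refine mul_le_mul_of_nonneg_left (le_trans ?_ h2) (Nat.cast_nonneg _)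
        exact_mod_cast Set.ncard_le_ncard hsub (Set.toFinite _)
    _ ≤ ∑ q ∈ I, (ballSize w t ^ 2 * 4 ^ (n - 2 * w)) * (p * (good r V).ncard) := by
        rw [Finset.mul_sum]; exact Finset.sum_le_sum fun q _ => h1 q
    _ = (n * (2 * w : ℕ)) * ((ballSize w t ^ 2 * 4 ^ (n - 2 * w)) * (p * (good r V).ncard)) := by
        rw [Finset.sum_const, hI]; simp
    _ ≤ (n * n) * ((ballSize w t ^ 2 * 4 ^ (n - 2 * w)) * (p * (good r V).ncard)) := by
        gcongr
    _ = _ := by ring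

/-! ### The distribution of the distance -/

theorem Logical.distance_le {H : CheckMatrix r n} {f : PauliVec n} (h : Logical H f) :
    distance H ≤ hammingNorm f := Nat.sInf_le ⟨f, h.1, h.2, rfl⟩

theorem exists_logical {H : CheckMatrix r n} (h : 0 < distance H) :
    ∃ f, Logical H f ∧ hammingNorm f = distance H := by
  have hne : {m | ∃ e : PauliVec n, (∀ i, traceInner (H i) e = 0) ∧
      e ∉ Submodule.span (ZMod 2) (Set.range H) ∧ hammingNorm e = m}.Nonempty := by
    by_contra hcon
    rw [Set.not_nonempty_iff_eq_empty] at hcon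
    rw [distance, hcon, Nat.sInf_empty] at h
    omega
  obtain ⟨e, h1, h2, h3⟩ := Nat.sInf_mem hne
  exact ⟨e, ⟨h1, h2⟩, h3⟩

theorem Logical.distance_pos {H : CheckMatrix r n} {f : PauliVec n} (h : Logical H f) :
    0 < distance H := by
  have hne : {m | ∃ e : PauliVec n, (∀ i, traceInner (H i) e = 0) ∧
      e ∉ Submodule.span (ZMod 2) (Set.range H) ∧ hammingNorm e = m}.Nonempty :=
    ⟨_, f, h.1, h.2, rfl⟩
  obtain ⟨e, h1, h2, h3⟩ := Nat.sInf_mem hne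
  change hammingNorm e = distance H at h3
  rw [← h3, hammingNorm_pos_iff]
  exact Logical.ne_zero ⟨h1, h2⟩

theorem ncard_ball (n D : ℕ) : Set.ncard {f : PauliVec n | hammingNorm f ≤ D} = ballSize n D := by
  have := ncard_supp_le (Finset.univ : Finset (Fin n)) D
  simpa using this

/-- The number of codes with a distance of at most `D`, by the first moment. -/
theorem ncard_distance_le (hr : r ≤ n) (D : ℕ) :
    (Set.ncard {H | H ∈ good r (⊥ : Submodule (ZMod 2) (PauliVec n)) ∧ 0 < distance H ∧
      distance H ≤ D} : ℝ) ≤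
      ballSize n D / 2 ^ r * (good r (⊥ : Submodule (ZMod 2) (PauliVec n))).ncard := by
  have h := mul_ncard_many_le (good r (⊥ : Submodule (ZMod 2) (PauliVec n)))
    {f | f ≠ 0 ∧ hammingNorm f ≤ D} Logical 1 (p := 1 / 2 ^ r) (by
      rintro f ⟨hf, -⟩
      have h1 := (ncard_good_span hr hf).1
      simp only [← mem_good_span hf]
      rw [one_div_mul_eq_div]
      exact h1)
  rw [Nat.cast_one, one_mul] at h
  refine le_trans ?_ (h.trans ?_)
  · norm_cast
    refine Set.ncard_le_ncard ?_ (Set.toFinite _)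
    rintro H ⟨h1, h2, h3⟩
    obtain ⟨f, hf, hf'⟩ := exists_logical h2
    refine ⟨h1, ?_⟩
    rw [Nat.one_le_iff_ne_zero, ← Nat.pos_iff_ne_zero, Set.ncard_pos]
    exact ⟨f, ⟨hf.ne_zero, hf'.trans_le h3⟩, hf⟩
  · have h2 : Set.ncard {f : PauliVec n | f ≠ 0 ∧ hammingNorm f ≤ D} ≤ ballSize n D := by
      rw [← ncard_ball]
      exact Set.ncard_le_ncard (fun f hf => hf.2) (Set.toFinite _)
    have h3 : (Set.ncard {f : PauliVec n | f ≠ 0 ∧ hammingNorm f ≤ D} : ℝ) ≤ ballSize n D := by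
      exact_mod_cast h2
    refine (mul_le_mul_of_nonneg_right h3 (by positivity)).trans (le_of_eq ?_)
    ring

/-- The mean number of logical operators of low weight, given that one of them is known. -/
theorem sum_logical_le (hr : r < n) (hn : 2 ≤ n) {e : PauliVec n}
    (W : Finset (PauliVec n)) (h0 : (0 : PauliVec n) ∉ W) :
    ∑ H ∈ (good r (Submodule.span (ZMod 2) {e})).toFinite.toFinset,
      (Set.ncard {f | f ∈ W ∧ Logical H f ∧ f ≠ e} : ℝ) ≤
      W.card * ((1 + 8 * (1 / 4) ^ (n - r)) / 2 ^ r *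
        (good r (Submodule.span (ZMod 2) {e})).ncard) := by
  have h := sum_ncard_comm (good r (Submodule.span (ZMod 2) {e})).toFinite.toFinset W
    (fun H f => Logical H f ∧ f ≠ e)
  have h' : ∑ H ∈ (good r (Submodule.span (ZMod 2) {e})).toFinite.toFinset,
      (Set.ncard {f | f ∈ W ∧ Logical H f ∧ f ≠ e} : ℝ) = ∑ f ∈ W,
      (Set.ncard {H | H ∈ (good r (Submodule.span (ZMod 2) {e})).toFinite.toFinset ∧
        Logical H f ∧ f ≠ e} : ℝ) := by exact_mod_cast h
  rw [h', ← nsmul_eq_mul, ← Finset.sum_const]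
  refine Finset.sum_le_sum fun f hf => ?_
  simp only [Set.Finite.mem_toFinset]
  by_cases hfe : f = e
  · simp only [hfe, ne_eq, not_true_eq_false, and_false, Set.ofPred_false, Set.ncard_empty,
      Nat.cast_zero]
    positivity
  · refine le_trans ?_ ((small_span e).ncard_commutes_le hr hn (f := f) ?_)
    · have h2 : {H | H ∈ good r (Submodule.span (ZMod 2) {e}) ∧ Logical H f ∧ f ≠ e} ⊆
          {H | H ∈ good r (Submodule.span (ZMod 2) {e}) ∧ Commutes H f} :=
        fun H hH => ⟨hH.1, hH.2.1.1⟩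
      exact_mod_cast Set.ncard_le_ncard h2 (Set.toFinite _)
    · rw [Submodule.mem_span_singleton]
      rintro ⟨a, rfl⟩
      rcases zmod_two_cases a with rfl | rfl
      · exact h0 (by simpa using hf)
      · exact hfe (one_smul _ _)

end Moments

end

section

section Distance

variable {r n : ℕ}

theorem ncard_good_span_eq {e f : PauliVec n} (he : e ≠ 0) (hf : f ≠ 0) (r : ℕ) :
    (good r (Submodule.span (ZMod 2) {e})).ncard = (good r (Submodule.span (ZMod 2) {f})).ncard := by
  rw [(small_span e).ncard_good, (small_span f).ncard_good, finrank_span_singleton he,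
    finrank_span_singleton hf]

/-- The second moment method: hardly any code is without logical operators of low weight, if the
expected number of these operators is large. -/
theorem ncard_no_logical_le (hr : r < n) (hn : 2 ≤ n) (W : Finset (PauliVec n))
    (h0 : (0 : PauliVec n) ∉ W) :
    (Set.ncard {H | H ∈ good r (⊥ : Submodule (ZMod 2) (PauliVec n)) ∧ ¬ ∃ f ∈ W, Logical H f} : ℝ) *
      W.card ≤ (2 ^ r + 9 * (1 / 4) ^ (n - r) * W.card) *
        (good r (⊥ : Submodule (ZMod 2) (PauliVec n))).ncard := by
  classical
  rcases W.eq_empty_or_nonempty with rfl | ⟨e₀, he₀⟩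
  · simp
  have hW0 : ∀ e ∈ W, e ≠ 0 := fun e he h => h0 (h ▸ he)
  set G := (good r (⊥ : Submodule (ZMod 2) (PauliVec n))).toFinite.toFinset with hG
  set M := ((good r (Submodule.span (ZMod 2) {e₀})).ncard : ℝ) with hM
  set M₀ := ((good r (⊥ : Submodule (ZMod 2) (PauliVec n))).ncard : ℝ) with hM₀
  set η : ℝ := (1 / 4) ^ (n - r) with hη
  set Q : ℝ := 2 ^ r with hQ
  set u := (W.card : ℝ) with hu
  have hMe : ∀ e ∈ W, ((good r (Submodule.span (ZMod 2) {e})).ncard : ℝ) = M := fun e he => by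
    rw [hM, ncard_good_span_eq (hW0 e he) (hW0 e₀ he₀)]
  obtain ⟨hM1, hM2⟩ := ncard_good_span hr.le (hW0 e₀ he₀)
  have hQ0 : 0 < Q := by positivity
  have hη0 : 0 < η := by positivity
  have hη1 : η ≤ 1 / 4 := by
    calc η ≤ (1 / 4) ^ 1 := pow_le_pow_of_le_one (by norm_num) (by norm_num) (by omega)
      _ = _ := pow_one _
  have hM₀0 : 0 < M₀ := Nat.cast_pos.2 (ncard_good_bot_pos hr.le)
  have hu0 : 0 < u := by
    rw [hu]; exact_mod_cast Finset.card_pos.2 ⟨e₀, he₀⟩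
  set Z : CheckMatrix r n → ℝ := fun H => Set.ncard {f | f ∈ W ∧ Logical H f} with hZ
  -- the first moment
  have h1 : ∑ H ∈ G, Z H = u * M := by
    have h := sum_ncard_comm G W (fun H f => Logical H f)
    have h' : ∑ H ∈ G, Z H = ∑ f ∈ W, (Set.ncard {H | H ∈ G ∧ Logical H f} : ℝ) := by
      simp only [hZ]
      exact_mod_cast h
    rw [h', hu, ← nsmul_eq_mul, ← Finset.sum_const]
    refine Finset.sum_congr rfl fun f hf => ?_
    rw [← hMe f hf]
    congr 2
    ext H
    rw [mem_good_span (hW0 f hf), Set.mem_ofPred_eq, hG, Set.Finite.mem_toFinset]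
  -- the second moment
  have h2 : ∑ H ∈ G, Z H ^ 2 ≤ u * (M + u * ((1 + 8 * η) / Q * M)) := by
    have hZsq : ∀ H, Z H ^ 2 = ∑ f ∈ W, if Logical H f then Z H else 0 := fun H => by
      rw [← Finset.sum_filter, Finset.sum_const, nsmul_eq_mul, sq]
      congr 1
      simp only [hZ]
      rw [← Set.ncard_coe_finset]
      congr 2
      ext f; simp
    simp only [hZsq]
    rw [Finset.sum_comm, hu, ← nsmul_eq_mul, ← Finset.sum_const]
    refine Finset.sum_le_sum fun e he => ?_
    rw [← Finset.sum_filter]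
    have hfil : G.filter (fun H => Logical H e) =
        (good r (Submodule.span (ZMod 2) {e})).toFinite.toFinset := by
      ext H
      rw [Finset.mem_filter, hG, Set.Finite.mem_toFinset, Set.Finite.mem_toFinset,
        mem_good_span (hW0 e he)]
    rw [hfil]
    have h3 := sum_logical_le hr hn (e := e) W h0
    rw [hMe e he] at h3
    have h4 : ∀ H, Z H ≤ 1 + (Set.ncard {f | f ∈ W ∧ Logical H f ∧ f ≠ e} : ℝ) := fun H => by
      have h5 : {f | f ∈ W ∧ Logical H f} ⊆ {e} ∪ {f | f ∈ W ∧ Logical H f ∧ f ≠ e} := by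
        rintro f ⟨hf, hf'⟩
        by_cases hfe : f = e
        · exact .inl hfe
        · exact .inr ⟨hf, hf', hfe⟩
      have h6 := (Set.ncard_le_ncard h5 (Set.toFinite _)).trans (Set.ncard_union_le _ _)
      rw [Set.ncard_singleton] at h6
      simp only [hZ]
      exact_mod_cast h6
    refine (Finset.sum_le_sum fun H _ => h4 H).trans ?_
    rw [Finset.sum_add_distrib, Finset.sum_const, nsmul_eq_mul, mul_one,
      ← Set.ncard_eq_toFinset_card, hMe e he]
    linarith
  set P := G.filter fun H => ∃ f ∈ W, Logical H f with hP
  have h3 : ∑ H ∈ P, Z H = u * M := by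
    rw [← h1]
    refine Finset.sum_subset (Finset.filter_subset _ _) fun H hH hHP => ?_
    simp only [hP, Finset.mem_filter, hH, true_and] at hHP
    simp only [hZ, Nat.cast_eq_zero]
    rw [Set.ncard_eq_zero, Set.eq_empty_iff_forall_notMem]
    rintro f ⟨hf, hf'⟩
    exact hHP ⟨f, hf, hf'⟩
  have h4 : ∑ H ∈ P, Z H ^ 2 ≤ u * (M + u * ((1 + 8 * η) / Q * M)) :=
    (Finset.sum_le_sum_of_subset_of_nonneg (Finset.filter_subset _ _)
      fun _ _ _ => sq_nonneg _).trans h2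
  have h5 := sq_sum_le_card_mul_sum_sq (s := P) (f := Z)
  rw [h3] at h5
  have h6 : (Set.ncard {H | H ∈ good r (⊥ : Submodule (ZMod 2) (PauliVec n)) ∧
      ¬ ∃ f ∈ W, Logical H f} : ℝ) = M₀ - P.card := by
    rw [eq_sub_iff_add_eq, hM₀, ← Nat.cast_add, Nat.cast_inj, ← Set.ncard_coe_finset P,
      ← Set.ncard_union_eq]
    · congr 1
      ext H
      simp only [hP, hG, Finset.coe_filter, Set.Finite.mem_toFinset, Set.mem_union,
        Set.mem_ofPred_eq]
      tauto
    · rw [Set.disjoint_left]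
      rintro H ⟨_, h⟩ h'
      exact h (Finset.mem_filter.1 h').2
  rw [h6]
  have hM0 : 0 < M := lt_of_lt_of_le (mul_pos (div_pos (by linarith) hQ0) hM₀0) hM2
  -- the Cauchy-Schwarz inequality after cancellation
  have h7 : u * M ≤ P.card * (1 + u * ((1 + 8 * η) / Q)) := by
    have : u * M * (u * M) ≤ P.card * (1 + u * ((1 + 8 * η) / Q)) * (u * M) := by
      calc _ = (u * M) ^ 2 := by ring
        _ ≤ P.card * (u * (M + u * ((1 + 8 * η) / Q * M))) :=
          h5.trans (mul_le_mul_of_nonneg_left h4 (Nat.cast_nonneg _))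
        _ = _ := by ring
    exact le_of_mul_le_mul_right this (mul_pos hu0 hM0)
  have h8 : u * (1 - η) * M₀ ≤ P.card * (Q + u * (1 + 8 * η)) := by
    have e1 : (P.card : ℝ) * (Q + u * (1 + 8 * η)) =
        P.card * (1 + u * ((1 + 8 * η) / Q)) * Q := by field_simp
    have e2 : (1 - η) / Q * M₀ * Q = (1 - η) * M₀ := by field_simp
    rw [e1]
    calc _ = u * ((1 - η) / Q * M₀ * Q) := by rw [e2]; ring
      _ ≤ u * (M * Q) := by gcongr
      _ = u * M * Q := by ring
      _ ≤ _ := mul_le_mul_of_nonneg_right h7 hQ0.le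
  have h9 : (P.card : ℝ) ≤ M₀ := by
    have : (0 : ℝ) ≤ M₀ - P.card := h6 ▸ Nat.cast_nonneg _
    linarith
  have h10 : (0 : ℝ) ≤ P.card := Nat.cast_nonneg _
  nlinarith [mul_nonneg hη0.le hu0.le, mul_nonneg (mul_nonneg hη0.le hu0.le) (sub_nonneg.2 h9),
    mul_nonneg hQ0.le h10]

/-- The transfer of a bound to the codes of a given distance: below the typical distance, a code
has hardly ever two logical operators of this weight. -/
theorem ncard_distance_eq_le (hr : r < n) (hn : 2 ≤ n) {d : ℕ} (hd : 0 < d)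
    {b : ℝ} {B : CheckMatrix r n → Prop} (hB : ∀ e : PauliVec n, e ≠ 0 →
      (Set.ncard {H | H ∈ good r (Submodule.span (ZMod 2) {e}) ∧ distance H = d ∧ B H} : ℝ) ≤
        b * (good r (Submodule.span (ZMod 2) {e})).ncard)
    (hsmall : ballSize n d * ((1 + 8 * (1 / 4) ^ (n - r)) / 2 ^ r : ℝ) ≤ 1 / 2) (hb : 0 ≤ b) :
    (Set.ncard {H | H ∈ good r (⊥ : Submodule (ZMod 2) (PauliVec n)) ∧ distance H = d ∧ B H} : ℝ) ≤
      2 * b * Set.ncard {H | H ∈ good r (⊥ : Submodule (ZMod 2) (PauliVec n)) ∧ distance H = d} ∧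
    (d ≤ n → 0 < Set.ncard {H | H ∈ good r (⊥ : Submodule (ZMod 2) (PauliVec n)) ∧
      distance H = d}) := by
  classical
  set W : Finset (PauliVec n) := Finset.univ.filter fun f => f ≠ 0 ∧ hammingNorm f ≤ d with hW
  set S : Finset (PauliVec n) := Finset.univ.filter fun f => hammingNorm f = d with hS
  have hS0 : ∀ e ∈ S, e ≠ 0 := fun e he h => by
    simp only [hS, Finset.mem_filter, Finset.mem_univ, true_and] at he
    rw [h, hammingNorm_zero] at he
    omega
  have hWc : (W.card : ℝ) ≤ ballSize n d := by
    rw [← ncard_ball, ← Set.ncard_coe_finset]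
    have h : (W : Set (PauliVec n)) ⊆ {f : PauliVec n | hammingNorm f ≤ d} := fun f hf => by
      simp only [hW, Finset.coe_filter, Finset.mem_univ, true_and] at hf
      exact hf.2
    exact_mod_cast Set.ncard_le_ncard h (Set.toFinite _)
  -- the codes in which `e` is the only logical operator of weight at most `d`
  set U : PauliVec n → Set (CheckMatrix r n) := fun e =>
    {H | H ∈ good r (Submodule.span (ZMod 2) {e}) ∧ ¬ ∃ f, f ∈ W ∧ Logical H f ∧ f ≠ e} with hU
  have hUc : ∀ e ∈ S, ((good r (Submodule.span (ZMod 2) {e})).ncard : ℝ) ≤ 2 * (U e).ncard := by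
    intro e he
    have h1 := sum_logical_le hr hn (e := e) W (by simp [hW])
    set Ge := (good r (Submodule.span (ZMod 2) {e})).toFinite.toFinset with hGe
    have h2 : ((Ge.filter fun H => ∃ f, f ∈ W ∧ Logical H f ∧ f ≠ e).card : ℝ) ≤
        ∑ H ∈ Ge, (Set.ncard {f | f ∈ W ∧ Logical H f ∧ f ≠ e} : ℝ) := by
      rw [Finset.card_filter, Nat.cast_sum]
      refine Finset.sum_le_sum fun H _ => ?_
      split_ifs with h
      · have : 0 < Set.ncard {f | f ∈ W ∧ Logical H f ∧ f ≠ e} := (Set.ncard_pos).2 h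
        exact_mod_cast this
      · simp
    have h3 : (U e).ncard + (Ge.filter fun H => ∃ f, f ∈ W ∧ Logical H f ∧ f ≠ e).card =
        (good r (Submodule.span (ZMod 2) {e})).ncard := by
      rw [← Set.ncard_coe_finset, ← Set.ncard_union_eq]
      · congr 1
        ext H
        simp only [hU, hGe, Finset.coe_filter, Set.Finite.mem_toFinset, Set.mem_union,
          Set.mem_ofPred_eq]
        tauto
      · rw [Set.disjoint_left]
        rintro H ⟨_, h⟩ h'
        exact h (Finset.mem_filter.1 h').2
    have h4 : ((U e).ncard : ℝ) + (Ge.filter fun H => ∃ f, f ∈ W ∧ Logical H f ∧ f ≠ e).card =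
        (good r (Submodule.span (ZMod 2) {e})).ncard := by exact_mod_cast h3
    have h5 : (W.card : ℝ) * ((1 + 8 * (1 / 4) ^ (n - r)) / 2 ^ r *
        (good r (Submodule.span (ZMod 2) {e})).ncard) ≤
        1 / 2 * (good r (Submodule.span (ZMod 2) {e})).ncard := by
      rw [← mul_assoc]
      refine mul_le_mul_of_nonneg_right (le_trans ?_ hsmall) (Nat.cast_nonneg _)
      exact mul_le_mul_of_nonneg_right hWc (by positivity)
    linarith
  have hUsub : ∀ e ∈ S, U e ⊆ {H | H ∈ good r ⊥ ∧ distance H = d} := by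
    rintro e he H ⟨h1, h2⟩
    obtain ⟨h3, h4⟩ := (mem_good_span (hS0 e he)).1 h1
    refine ⟨h3, ?_⟩
    simp only [hS, Finset.mem_filter, Finset.mem_univ, true_and] at he
    have h5 := h4.distance_le
    obtain ⟨f, hf, hf'⟩ := exists_logical h4.distance_pos
    by_cases hfe : f = e
    · rw [← hf', hfe, he]
    · exact absurd ⟨f, by simp [hW, hf.ne_zero, hf', ← he, h5], hf, hfe⟩ h2
  have hUdis : (S : Set (PauliVec n)).PairwiseDisjoint fun e => (U e).toFinite.toFinset := by
    intro e he e' he' hne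
    change Disjoint _ _
    rw [Finset.disjoint_left]
    intro H h1 h2
    rw [Set.Finite.mem_toFinset] at h1 h2
    have he1 := hS0 e he
    simp only [hS, Finset.coe_filter, Finset.mem_univ, true_and, Set.mem_ofPred_eq] at he
    exact h2.2 ⟨e, by simp [hW, he1, he], ((mem_good_span he1).1 h1.1).2, hne⟩
  have hlow : ∑ e ∈ S, (U e).ncard ≤
      Set.ncard {H : CheckMatrix r n | H ∈ good r ⊥ ∧ distance H = d} := by
    have h1 : ∑ e ∈ S, (U e).ncard = (S.biUnion fun e => (U e).toFinite.toFinset).card := by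
      rw [Finset.card_biUnion hUdis]
      exact Finset.sum_congr rfl fun e _ => Set.ncard_eq_toFinset_card _ _
    rw [h1, ← Set.ncard_coe_finset]
    refine Set.ncard_le_ncard ?_ (Set.toFinite _)
    intro H hH
    simp only [Finset.coe_biUnion, Set.mem_iUnion, Set.Finite.coe_toFinset, exists_prop] at hH
    obtain ⟨e, he, h⟩ := hH
    exact hUsub e he h
  have hup : Set.ncard {H : CheckMatrix r n | H ∈ good r ⊥ ∧ distance H = d ∧ B H} ≤
      ∑ e ∈ S, Set.ncard {H | H ∈ good r (Submodule.span (ZMod 2) {e}) ∧ distance H = d ∧ B H} := by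
    refine (Set.ncard_le_ncard ?_ (Set.toFinite _)).trans (Finset.set_ncard_biUnion_le _ _)
    rintro H ⟨h1, h2, h3⟩
    obtain ⟨e, he, he'⟩ := exists_logical (H := H) (by omega)
    simp only [Set.mem_iUnion, exists_prop]
    exact ⟨e, by simp [hS, he', h2], (mem_good_span he.ne_zero).2 ⟨h1, he⟩, h2, h3⟩
  constructor
  · calc _ ≤ ∑ e ∈ S, (Set.ncard {H | H ∈ good r (Submodule.span (ZMod 2) {e}) ∧
          distance H = d ∧ B H} : ℝ) := by exact_mod_cast hup
      _ ≤ ∑ e ∈ S, b * (2 * (U e).ncard) := Finset.sum_le_sum fun e he =>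
          (hB e (hS0 e he)).trans (mul_le_mul_of_nonneg_left (hUc e he) hb)
      _ = 2 * b * (∑ e ∈ S, (U e).ncard : ℕ) := by
          push_cast
          rw [Finset.mul_sum]
          exact Finset.sum_congr rfl fun e _ => by ring
      _ ≤ _ := mul_le_mul_of_nonneg_left (by exact_mod_cast hlow) (by positivity)
  · intro hdn
    have hSne : S.Nonempty := by
      rw [← Finset.card_pos, ← Set.ncard_coe_finset]
      have h := ncard_supp_eq (Finset.univ : Finset (Fin n)) d
      have e : (S : Set (PauliVec n)) = {f | (∀ q ∉ (Finset.univ : Finset (Fin n)), f q = 0) ∧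
          hammingNorm f = d} := by ext; simp [hS]
      rw [e, h]
      have := Nat.choose_pos hdn
      simp only [Finset.card_univ, Fintype.card_fin]
      positivity
    obtain ⟨e, he⟩ := hSne
    have h1 := hUc e he
    obtain ⟨-, h2⟩ := ncard_good_span hr.le (hS0 e he)
    have h3 : (0 : ℝ) < (good r (⊥ : Submodule (ZMod 2) (PauliVec n))).ncard := by
      exact_mod_cast ncard_good_bot_pos (n := n) hr.le
    have h4 : (1 / 4 : ℝ) ^ (n - r) < 1 := pow_lt_one₀ (by norm_num) (by norm_num) (by omega)
    have h5 : (0 : ℝ) < (U e).ncard := by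
      have := mul_pos (div_pos (sub_pos.2 h4) (by positivity : (0 : ℝ) < 2 ^ r)) h3
      linarith
    have h6 : (U e).ncard ≤ ∑ e ∈ S, (U e).ncard :=
      Finset.single_le_sum (f := fun e => (U e).ncard) (fun _ _ => Nat.zero_le _) he
    have h7 : 0 < (U e).ncard := by exact_mod_cast h5
    omega

end Distance

end

/-! ### Entropy and the volume of balls -/

section Entropy

open Real

/-- The logarithm of the ratio of the probabilities of a given Pauli error and of no error, with
the opposite sign, when the total error probability is `p`. -/
noncomputable def logRatio (p : ℝ) : ℝ := log (3 * (1 - p) / p)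

theorem qaryEntropy_four {p : ℝ} (h0 : 0 < p) (h1 : p < 1) :
    qaryEntropy 4 p = p * logRatio p - log (1 - p) := by
  have h2 : (0 : ℝ) < 1 - p := by linarith
  rw [qaryEntropy, binEntropy, logRatio, log_div (by positivity) h0.ne',
    log_mul (by norm_num) h2.ne', log_inv, log_inv]
  norm_num
  ring

theorem logRatio_nonneg {p : ℝ} (h0 : 0 < p) (h1 : p ≤ 3 / 4) : 0 ≤ logRatio p :=
  log_nonneg (by rw [le_div_iff₀ h0]; linarith)

theorem logRatio_pos {p : ℝ} (h0 : 0 < p) (h1 : p < 3 / 4) : 0 < logRatio p :=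
  log_pos (by rw [lt_div_iff₀ h0]; linarith)

/-- The Chernoff bound. -/
theorem ballSize_le_exp {p : ℝ} (h0 : 0 < p) (h1 : p ≤ 3 / 4) (m t : ℕ) :
    (ballSize m t : ℝ) ≤ exp (t * logRatio p - m * log (1 - p)) := by
  have h2 : (0 : ℝ) < 1 - p := by linarith
  set y := p / (3 * (1 - p)) with hy
  have hy0 : 0 < y := by positivity
  have hy1 : y ≤ 1 := by rw [hy, div_le_one (by positivity)]; linarith
  have e1 : exp (t * logRatio p - m * log (1 - p)) = (1 + 3 * y) ^ m / y ^ t := by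
    have h3 : 1 + 3 * y = (1 - p)⁻¹ := by rw [hy]; field_simp; ring
    have h4 : exp (logRatio p) = y⁻¹ := by
      rw [logRatio, exp_log (by positivity), hy, inv_div]
    rw [exp_sub, exp_nat_mul, exp_nat_mul, exp_log h2, h4, h3, inv_pow, inv_pow]
    field_simp
  rw [e1, le_div_iff₀ (by positivity)]
  have h3 : ∀ j ∈ Finset.range (t + 1), ((m.choose j * 3 ^ j : ℕ) : ℝ) * y ^ t ≤
      (3 * y) ^ j * 1 ^ (m - j) * m.choose j := by
    intro j hj
    have : y ^ t ≤ y ^ j :=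
      pow_le_pow_of_le_one hy0.le hy1 (by rw [Finset.mem_range] at hj; omega)
    push_cast
    rw [mul_pow, one_pow, mul_one]
    calc _ ≤ (m.choose j : ℝ) * 3 ^ j * y ^ j := by gcongr
      _ = _ := by ring
  unfold ballSize
  rw [Nat.cast_sum, Finset.sum_mul, add_comm 1 (3 * y), add_pow]
  refine (Finset.sum_le_sum h3).trans ?_
  calc _ ≤ ∑ j ∈ Finset.range (t + m + 1), (3 * y) ^ j * 1 ^ (m - j) * m.choose j :=
        Finset.sum_le_sum_of_subset_of_nonneg (Finset.range_subset_range.2 (by omega))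
          fun _ _ _ => by positivity
    _ = _ := (Finset.sum_subset (Finset.range_subset_range.2 (by omega)) fun j _ hj => by
        rw [Nat.choose_eq_zero_of_lt (by rw [Finset.mem_range] at hj; omega)]; simp).symm

/-- A lower bound by the weak law of large numbers. -/
theorem exp_le_ballSize {p ε : ℝ} (h0 : 0 < p) (h1 : p ≤ 3 / 4) (hε : 0 < ε) {n D : ℕ}
    (hn : 1 ≤ n * ε ^ 2) (hD : (p + ε) * n ≤ D) :
    exp (n * ((p - ε) * logRatio p - log (1 - p))) ≤ 2 * ballSize n D := by
  have h2 : (0 : ℝ) < 1 - p := by linarith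
  have hn0 : n ≠ 0 := by rintro rfl; norm_num at hn
  have hn1 : (0 : ℝ) < n := by exact_mod_cast Nat.pos_of_ne_zero hn0
  set b : ℕ → ℝ := fun j => n.choose j * p ^ j * (1 - p) ^ (n - j) with hb
  have hb0 : ∀ j, 0 ≤ b j := fun j => by positivity
  have hsum : ∑ j ∈ Finset.range (n + 1), b j = 1 := by
    have h := add_pow p (1 - p) n
    rw [add_sub_cancel, one_pow] at h
    rw [h]
    exact Finset.sum_congr rfl fun j _ => by simp only [hb]; ring
  have hvar : ∑ j ∈ Finset.range (n + 1), (p - j / n) ^ 2 * b j = p * (1 - p) / n := by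
    have h := bernstein.variance hn0 ⟨p, h0.le, by linarith⟩
    rw [Finset.sum_range]
    refine Eq.trans (Finset.sum_congr rfl fun j _ => ?_) h
    simp [hb, bernstein_apply, bernstein.z]
  set near := (Finset.range (n + 1)).filter fun j : ℕ => |p - j / n| ≤ ε with hnear
  have hfar : ∑ j ∈ (Finset.range (n + 1)).filter (fun j : ℕ => ¬ |p - j / n| ≤ ε), b j ≤ 1 / 2 := by
    have h3 : ε ^ 2 * ∑ j ∈ (Finset.range (n + 1)).filter (fun j : ℕ => ¬ |p - j / n| ≤ ε), b j ≤
        p * (1 - p) / n := by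
      rw [← hvar, Finset.mul_sum]
      refine (Finset.sum_le_sum fun j hj => ?_).trans (Finset.sum_le_sum_of_subset_of_nonneg
        (Finset.filter_subset _ _) fun j _ _ => mul_nonneg (sq_nonneg _) (hb0 j))
      refine mul_le_mul_of_nonneg_right ?_ (hb0 j)
      rw [Finset.mem_filter, not_le] at hj
      rw [← sq_abs (p - j / n)]
      exact pow_le_pow_left₀ hε.le hj.2.le 2
    have h4 : p * (1 - p) / n ≤ ε ^ 2 * (1 / 2) := by
      rw [div_le_iff₀ hn1]
      nlinarith [sq_nonneg (p - 1 / 2)]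
    exact le_of_mul_le_mul_left (h3.trans h4) (by positivity)
  have hnear1 : 1 / 2 ≤ ∑ j ∈ near, b j := by
    have := Finset.sum_filter_add_sum_filter_not (Finset.range (n + 1))
      (fun j : ℕ => |p - j / n| ≤ ε) b
    rw [hsum] at this
    linarith
  set E := exp (n * ((p - ε) * logRatio p - log (1 - p))) with hE
  have hterm : ∀ j ∈ near, E * b j ≤ ((n.choose j * 3 ^ j : ℕ) : ℝ) := by
    intro j hj
    rw [hnear, Finset.mem_filter, Finset.mem_range, abs_le] at hj
    obtain ⟨hjn, hj1, hj2⟩ := hj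
    have hj3 : (p - ε) * n ≤ j := by
      rw [← le_div_iff₀ hn1]; linarith
    have e1 : p ^ j * (1 - p) ^ (n - j) = 3 ^ j * exp (-(j * logRatio p - n * log (1 - p))) := by
      have h3 : exp (logRatio p) = 3 * (1 - p) / p := by rw [logRatio, exp_log (by positivity)]
      rw [neg_sub, exp_sub, exp_nat_mul, exp_nat_mul, exp_log h2, h3,
        show n = n - j + j by omega, Nat.add_sub_cancel, pow_add, div_pow, mul_pow]
      field_simp
    simp only [hb]
    rw [mul_assoc, e1, hE]
    push_cast
    calc _ = n.choose j * 3 ^ j * (exp (n * ((p - ε) * logRatio p - log (1 - p))) *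
          exp (-(j * logRatio p - n * log (1 - p)))) := by ring
      _ ≤ n.choose j * 3 ^ j * 1 := by
          refine mul_le_mul_of_nonneg_left ?_ (by positivity)
          rw [← exp_add, exp_le_one_iff]
          nlinarith [mul_le_mul_of_nonneg_right hj3 (logRatio_nonneg h0 h1)]
      _ = _ := mul_one _
  have hsub : near ⊆ Finset.range (D + 1) := by
    intro j hj
    rw [hnear, Finset.mem_filter, abs_le] at hj
    have h3 : (j : ℝ) / n ≤ p + ε := by linarith [hj.2.1]
    rw [div_le_iff₀ hn1] at h3
    have h4 : (j : ℝ) ≤ D := h3.trans hD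
    rw [Finset.mem_range]
    have : j ≤ D := by exact_mod_cast h4
    omega
  have h3 : E * ∑ j ∈ near, b j ≤ ballSize n D := by
    rw [Finset.mul_sum, ballSize, Nat.cast_sum]
    exact (Finset.sum_le_sum hterm).trans
      (Finset.sum_le_sum_of_subset_of_nonneg hsub fun _ _ _ => Nat.cast_nonneg _)
  nlinarith [exp_pos (n * ((p - ε) * logRatio p - log (1 - p)))]

theorem lt_three_quarters {δ : ℝ} (h1 : δ ≤ 1) (h : qaryEntropy 4 δ < log 2) : δ < 3 / 4 := by
  by_contra hcon
  rw [not_lt] at hcon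
  have h3 := (qaryEntropy_strictAntiOn (q := 4) (by norm_num)).antitoneOn
    (a := δ) (b := 1) ⟨by norm_num; linarith, h1⟩ ⟨by norm_num, le_rfl⟩ h1
  rw [qaryEntropy_one] at h3
  have h4 : log 2 < log 3 := log_lt_log (by norm_num) (by norm_num)
  norm_num at h3
  linarith

theorem qaryEntropy_lt {p q : ℝ} (hp : 0 ≤ p) (hpq : p < q) (hq : q ≤ 3 / 4) :
    qaryEntropy 4 p < qaryEntropy 4 q :=
  qaryEntropy_strictMonoOn (q := 4) (by norm_num) ⟨hp, by norm_num; linarith⟩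
    ⟨by linarith, by norm_num; linarith⟩ hpq

theorem entropy4_mul_log (δ : ℝ) : entropy4 δ * (2 * log 2) = qaryEntropy 4 δ := by
  have h : log 4 = 2 * log 2 := by
    rw [show (4 : ℝ) = 2 ^ 2 by norm_num, log_pow]; norm_num
  rw [entropy4, h]
  have : log 2 ≠ 0 := (log_pos (by norm_num)).ne'
  field_simp

/-- The Gilbert-Varshamov distance. -/
theorem exists_gv {R : ℝ} (h0 : 0 < R) (h1 : R < 1) : ∃ δ, 0 < δ ∧ δ ≤ 1 ∧
    R = 1 - 2 * entropy4 δ := by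
  have hl : 0 < log 2 := log_pos (by norm_num)
  have hv : (1 - R) * log 2 ∈ Set.Icc (qaryEntropy 4 0) (qaryEntropy 4 1) := by
    rw [qaryEntropy_zero, qaryEntropy_one]
    have h4 : log 2 < log 3 := log_lt_log (by norm_num) (by norm_num)
    norm_num
    constructor <;> nlinarith
  obtain ⟨δ, ⟨h2, h3⟩, h4⟩ := intermediate_value_Icc zero_le_one
    qaryEntropy_continuous.continuousOn hv
  refine ⟨δ, lt_of_le_of_ne h2 ?_, h3, ?_⟩
  · rintro rfl
    rw [qaryEntropy_zero] at h4
    nlinarith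
  · rw [← entropy4_mul_log] at h4
    nlinarith

theorem tendsto_pow_mul_exp {a : ℕ → ℝ} {a₀ : ℝ} (ha : Tendsto a atTop (𝓝 a₀)) (h0 : a₀ < 0)
    (c : ℕ) : Tendsto (fun n : ℕ => (n : ℝ) ^ c * exp (n * a n)) atTop (𝓝 0) := by
  have h1 : |exp (a₀ / 2)| < 1 := by
    rw [abs_of_pos (exp_pos _)]; rw [← exp_zero]; exact exp_lt_exp.2 (by linarith)
  refine tendsto_of_tendsto_of_tendsto_of_le_of_le' tendsto_const_nhds
    (tendsto_pow_const_mul_const_pow_of_abs_lt_one c h1)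
    (Eventually.of_forall fun n => by positivity) ?_
  filter_upwards [ha.eventually (gt_mem_nhds (show a₀ < a₀ / 2 by linarith))] with n hn
  rw [← exp_nat_mul]
  gcongr

end Entropy

section

/-! ### The cost on random codes -/

section Cost

open Real

variable {R : ℝ} {k : ℕ → ℕ}

theorem tendsto_checks (hR1 : R < 1) (hk : Tendsto (fun n => (k n : ℝ) / n) atTop (𝓝 R)) :
    Tendsto (fun n => ((n - k n : ℕ) : ℝ) / n) atTop (𝓝 (1 - R)) := by
  refine (tendsto_const_nhds.sub hk).congr' ?_
  filter_upwards [hk.eventually (gt_mem_nhds hR1), eventually_gt_atTop 0] with n hn hn0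
  have hn1 : (0 : ℝ) < n := by exact_mod_cast hn0
  rw [div_lt_one hn1, Nat.cast_lt] at hn
  rw [Nat.cast_sub hn.le, sub_div, div_self hn1.ne']

theorem eventually_lt_self (hR1 : R < 1) (hk : Tendsto (fun n => (k n : ℝ) / n) atTop (𝓝 R)) :
    ∀ᶠ n in atTop, k n < n := by
  filter_upwards [hk.eventually (gt_mem_nhds hR1), eventually_gt_atTop 0] with n hn hn0
  have hn1 : (0 : ℝ) < n := by exact_mod_cast hn0
  rwa [div_lt_one hn1, Nat.cast_lt] at hn

theorem tendsto_of_ratio (hR0 : 0 < R) (hk : Tendsto (fun n => (k n : ℝ) / n) atTop (𝓝 R)) :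
    Tendsto k atTop atTop := by
  have h : Tendsto (fun n => (k n : ℝ)) atTop atTop := by
    refine (hk.pos_mul_atTop hR0 tendsto_natCast_atTop_atTop).congr' ?_
    filter_upwards [eventually_gt_atTop 0] with n hn
    field_simp
  exact tendsto_natCast_atTop_iff.1 h

theorem tendsto_halfWindow (hR0 : 0 < R) {r : ℕ → ℕ}
    (hr : Tendsto (fun n => (r n : ℝ) / n) atTop (𝓝 (1 - R))) (hrn : ∀ᶠ n in atTop, r n ≤ n) :
    Tendsto (fun n => (halfWindow n (r n) : ℝ) / n) atTop (𝓝 ((1 + R) / (3 + R))) := by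
  have h1 : Tendsto (fun n => (2 - (r n : ℝ) / n) / (4 - (r n : ℝ) / n)) atTop
      (𝓝 ((1 + R) / (3 + R))) := by
    have := (tendsto_const_nhds (x := (2 : ℝ)).sub hr).div
      (tendsto_const_nhds (x := (4 : ℝ)).sub hr) (by linarith)
    rwa [show (2 : ℝ) - (1 - R) = 1 + R by ring, show (4 : ℝ) - (1 - R) = 3 + R by ring] at this
  have h2 : Tendsto (fun n => (2 - (r n : ℝ) / n) / (4 - (r n : ℝ) / n) - 1 / n) atTop
      (𝓝 ((1 + R) / (3 + R))) := by
    simpa using h1.sub tendsto_one_div_atTop_nhds_zero_nat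
  refine tendsto_of_tendsto_of_tendsto_of_le_of_le' h2 h1 ?_ ?_ <;>
  · filter_upwards [hrn, eventually_gt_atTop 0] with n hn hn0
    have hn1 : (0 : ℝ) < n := by exact_mod_cast hn0
    have e1 : ((2 * n - r n : ℕ) : ℝ) = 2 * n - r n := by
      rw [Nat.cast_sub (by omega)]; push_cast; ring
    have e2 : ((4 * n - r n : ℕ) : ℝ) = 4 * n - r n := by
      rw [Nat.cast_sub (by omega)]; push_cast; ring
    have hrn' : (r n : ℝ) ≤ n := by exact_mod_cast hn
    have hpos : (0 : ℝ) < 4 * n - r n := by linarith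
    have e3 : (2 - (r n : ℝ) / n) / (4 - (r n : ℝ) / n) = (2 * n - r n) / (4 * n - r n) := by
      have : (4 : ℝ) - r n / n = (4 * n - r n) / n := by field_simp
      have h' : (2 : ℝ) - r n / n = (2 * n - r n) / n := by field_simp
      rw [this, h']
      field_simp
    have h3 := Nat.div_add_mod ((2 * n - r n) * n) (4 * n - r n)
    have h4 := Nat.mod_lt ((2 * n - r n) * n) (show 0 < 4 * n - r n by omega)
    change (4 * n - r n) * halfWindow n (r n) + _ = _ at h3
    have h5 : (4 * n - r n : ℝ) * halfWindow n (r n) +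
        ((2 * n - r n) * n % (4 * n - r n) : ℕ) = (2 * n - r n) * n := by
      rw [← e1, ← e2]; exact_mod_cast h3
    have h6 : (((2 * n - r n) * n % (4 * n - r n) : ℕ) : ℝ) < 4 * n - r n := by
      rw [← e2]; exact_mod_cast h4
    have h7 : (0 : ℝ) ≤ ((2 * n - r n) * n % (4 * n - r n) : ℕ) := Nat.cast_nonneg _
    rw [e3]
    first
      | (rw [sub_le_iff_le_add, ← add_div, div_le_div_iff₀ hpos hn1]; nlinarith)
      | (rw [div_le_div_iff₀ hn1 hpos]; nlinarith)

/-- With a few exceptions, the cost of the program on a code whose distance does not exceed the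
target is as claimed. The exceptions are rare also under the condition that a given operator is
logical. The number of candidates in a window is balanced against the number of operators in its
halves: this is the choice of the window size. -/
theorem ncard_slow_le (hR0 : 0 < R) (hR1 : R < 1)
    (hk : Tendsto (fun n => (k n : ℝ) / n) atTop (𝓝 R)) {δ : ℝ} (hδ0 : 0 < δ) (hδ1 : δ < 3 / 4)
    (hδ : qaryEntropy 4 δ ≤ (1 - R) * log 2) {ε : ℝ} (hε : 0 < ε) :
    ∃ ε' > 0, ∃ b : ℕ → ℝ, Tendsto b atTop (𝓝 0) ∧ (∀ n, 0 ≤ b n) ∧ ∀ᶠ n in atTop,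
      ∀ V : Submodule (ZMod 2) (PauliVec n), Small V →
        (Set.ncard {H | H ∈ good (n - k n) V ∧ 0 < distance H ∧ (distance H : ℝ) ≤ (δ + ε') * n ∧
          ¬ FindsDistance distP H ((2 : ℝ) ^ ((exponentD R δ + ε) * n))} : ℝ) ≤
        b n * (good (n - k n) V).ncard := by
  set l := logRatio δ with hl
  set h := qaryEntropy 4 δ with hh
  have hhl : h = δ * l - log (1 - δ) := qaryEntropy_four hδ0 (by linarith)
  have hl0 : 0 ≤ l := logRatio_nonneg hδ0 hδ1.le
  have hlog2 : 0 < log 2 := log_pos (by norm_num)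
  set κ := (1 + R) / (3 + R) with hκ
  have hκ0 : 0 < κ := by positivity
  have hκ1 : κ * (3 + R) = 1 + R := by rw [hκ]; field_simp
  have hκ2 : κ ≤ 1 := by rw [hκ, div_le_one (by linarith)]; linarith
  set ε₁ := ε * log 2 / 5 with hε₁
  have hε₁0 : 0 < ε₁ := by positivity
  set ε' := ε₁ / (l + 1) with hε'
  have hε'0 : 0 < ε' := by positivity
  have hlε : l * ε' ≤ ε₁ := by
    rw [hε', mul_div_assoc', div_le_iff₀ (by linarith)]; nlinarith
  have hF : exponentD R δ * log 2 = κ * h := by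
    have := entropy4_mul_log δ
    rw [exponentD, hκ, hh, ← this]; ring
  set r : ℕ → ℕ := fun n => n - k n with hr
  set w : ℕ → ℕ := fun n => halfWindow n (r n) with hw
  set D : ℕ → ℕ := fun n => ⌊(δ + ε') * n⌋₊ with hD
  set t : ℕ → ℕ := fun n => D n * w n / n + 1 with ht
  have hrn : ∀ n, r n ≤ n := fun n => Nat.sub_le _ _
  have hrlim : Tendsto (fun n => (r n : ℝ) / n) atTop (𝓝 (1 - R)) := tendsto_checks hR1 hk
  have hwlim : Tendsto (fun n => (w n : ℝ) / n) atTop (𝓝 κ) :=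
    tendsto_halfWindow hR0 hrlim (Eventually.of_forall hrn)
  -- the volume of a half window
  set e : ℕ → ℝ := fun n => (w n : ℝ) / n * (h + l * ε') + l * (1 / n) with he
  have helim : Tendsto e atTop (𝓝 (κ * (h + l * ε'))) := by
    have := (hwlim.mul_const (h + l * ε')).add
      ((tendsto_one_div_atTop_nhds_zero_nat (𝕜 := ℝ)).const_mul l)
    rwa [mul_zero, add_zero] at this
  have hball : ∀ᶠ n in atTop, (ballSize (w n) (t n) : ℝ) ≤ exp (n * e n) := by
    filter_upwards [eventually_gt_atTop 0] with n hn0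
    have hn1 : (0 : ℝ) < n := by exact_mod_cast hn0
    refine (ballSize_le_exp hδ0 hδ1.le _ _).trans (exp_le_exp.2 ?_)
    have h1 : (t n : ℝ) ≤ (δ + ε') * w n + 1 := by
      have h2 : ((D n * w n / n : ℕ) : ℝ) ≤ (D n * w n : ℕ) / n := Nat.cast_div_le
      have h3 : (D n : ℝ) ≤ (δ + ε') * n := Nat.floor_le (by positivity)
      have h4 : ((D n * w n : ℕ) : ℝ) / n ≤ (δ + ε') * w n := by
        rw [div_le_iff₀ hn1]
        push_cast
        calc (D n : ℝ) * w n ≤ (δ + ε') * n * w n := by gcongr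
          _ = _ := by ring
      simp only [ht]
      push_cast
      linarith
    have h5 : n * e n = w n * (h + l * ε') + l := by simp only [he]; field_simp
    rw [h5, hhl]
    nlinarith [mul_le_mul_of_nonneg_right h1 hl0]
  set X : ℕ → ℕ := fun n => ⌈exp (n * (κ * h + 3 * ε₁))⌉₊ with hX
  -- the exponent of the probability of the exceptions
  set c : ℕ → ℝ := fun n => 2 * e n + (1 - 2 * ((w n : ℝ) / n)) * (2 * log 2) -
    (r n : ℝ) / n * log 2 - (κ * h + 3 * ε₁) with hc
  have hclim : Tendsto c atTop (𝓝 (2 * (κ * (h + l * ε')) + (1 - 2 * κ) * (2 * log 2) -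
      (1 - R) * log 2 - (κ * h + 3 * ε₁))) :=
    (((helim.const_mul 2).add ((tendsto_const_nhds.sub (hwlim.const_mul 2)).mul_const _)).sub
      (hrlim.mul_const _)).sub tendsto_const_nhds
  have hκε : κ * (l * ε') ≤ ε₁ :=
    (mul_le_mul hκ2 hlε (by positivity) zero_le_one).trans (one_mul _).le
  have hc0 : 2 * (κ * (h + l * ε')) + (1 - 2 * κ) * (2 * log 2) -
      (1 - R) * log 2 - (κ * h + 3 * ε₁) < 0 := by
    have h1 : κ * h ≤ κ * ((1 - R) * log 2) := mul_le_mul_of_nonneg_left hδ hκ0.le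
    have h2 : κ * ((1 - R) * log 2) + (1 - 2 * κ) * (2 * log 2) - (1 - R) * log 2 =
        (1 + R - κ * (3 + R)) * log 2 := by ring
    rw [hκ1, sub_self, zero_mul] at h2
    nlinarith
  refine ⟨ε', hε'0, fun n => 9 * (n ^ 2 * exp (n * c n)), ?_, fun n => by positivity, ?_⟩
  · simpa using (tendsto_pow_mul_exp hclim hc0 2).const_mul 9
  have hgrow : ∀ᶠ n : ℕ in atTop, 10 ^ 7 * 2 ^ 7 * 5 * ((n : ℝ) ^ 7 * exp (n * (-2 * ε₁))) < 1 := by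
    have h1 := (tendsto_pow_mul_exp (tendsto_const_nhds (x := -2 * ε₁)) (by linarith) 7).const_mul
      (10 ^ 7 * 2 ^ 7 * 5 : ℝ)
    rw [mul_zero] at h1
    exact h1.eventually (gt_mem_nhds one_pos)
  filter_upwards [hball, hgrow, eventually_lt_self hR1 hk,
    (tendsto_of_ratio hR0 hk).eventually_ge_atTop 1, eventually_ge_atTop 3,
    helim.eventually (gt_mem_nhds (show κ * (h + l * ε') < κ * h + 3 * ε₁ by linarith))]
    with n hball hgrow hkn hk1 hn3 hen V hV
  have hn0 : 0 < n := by omega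
  have hn1 : (0 : ℝ) < n := by exact_mod_cast hn0
  have hw2 : 2 * w n ≤ n := two_mul_halfWindow_le (hrn n)
  have hX0 : (0 : ℝ) < X n := lt_of_lt_of_le (exp_pos _) (Nat.le_ceil _)
  have hBX : ballSize (w n) (t n) ≤ X n + 2 := by
    have : (ballSize (w n) (t n) : ℝ) ≤ X n :=
      hball.trans ((exp_le_exp.2 (by nlinarith)).trans (Nat.le_ceil _))
    have : ballSize (w n) (t n) ≤ X n := by exact_mod_cast this
    omega
  set p : ℝ := (1 + 8 * (1 / 4) ^ (n - r n)) / 2 ^ r n with hp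
  have hp0 : 0 ≤ p := by positivity
  have hmany := ncard_many_cand_le hn0 hw2 hV (p := p)
    (fun f hf => hV.ncard_commutes_le (by simp only [hr]; omega) (by omega) hf) hp0 (t n) (X n)
  refine le_trans ?_ (le_trans ((le_div_iff₀' hX0).2 hmany) ?_)
  · refine Nat.cast_le.2 (Set.ncard_le_ncard ?_ (Set.toFinite _))
    rintro H ⟨hH, hd0, hd1, hslow⟩
    refine ⟨hH, ?_⟩
    by_contra hcon
    push Not at hcon
    apply hslow
    have hdD : distance H ≤ D n := Nat.le_floor hd1
    have htH : distance H * w n / n + 1 ≤ t n :=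
      Nat.add_le_add_right (Nat.div_le_div_right (Nat.mul_le_mul_right _ hdD)) 1
    obtain ⟨T, s, h1, h2, h3⟩ := exec_distP_distance H hH.2.1 (hrn n) hn3 hd0 (X := X n + 2)
      (le_trans (Finset.sum_le_sum_of_subset
        (Finset.range_subset_range.2 (Nat.add_le_add_right htH 1))) hBX)
      (fun a ha x hx => (Set.ncard_le_ncard (fun f hf =>
        (⟨hf.1, hf.2.1.trans htH, hf.2.2.trans htH⟩ : Cand H hn0 (w n) (t n) a x f))
          (Set.toFinite _)).trans (hcon a ha x hx))
    refine ⟨T, s, h1, ?_, h3⟩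
    have e1 : (2 : ℝ) ^ ((exponentD R δ + ε) * n) = exp (n * (κ * h + 5 * ε₁)) := by
      rw [rpow_def_of_pos (by norm_num), ← hF, hε₁]
      congr 1; ring
    have e2 : exp (n * (κ * h + 5 * ε₁)) * exp (n * (-2 * ε₁)) = exp (n * (κ * h + 3 * ε₁)) := by
      rw [← exp_add]; congr 1; ring
    have h4 : (X n : ℝ) + 3 ≤ 5 * exp (n * (κ * h + 3 * ε₁)) := by
      have h5 : (X n : ℝ) < exp (n * (κ * h + 3 * ε₁)) + 1 := Nat.ceil_lt_add_one (exp_pos _).le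
      have h6 : 1 ≤ exp (n * (κ * h + 3 * ε₁)) := by
        rw [one_le_exp_iff]
        have : 0 ≤ h := qaryEntropy_nonneg hδ0.le (by linarith)
        positivity
      linarith
    have h5 : ((n : ℝ) + 1) ^ 7 ≤ (2 * n) ^ 7 := by
      refine pow_le_pow_left₀ (by positivity) ?_ 7
      have : (1 : ℝ) ≤ n := by exact_mod_cast hn0
      linarith
    have h6 : (T : ℝ) ≤ 10 ^ 7 * ((n : ℝ) + 1) ^ 7 * (X n + 3) := by
      have : (T : ℝ) ≤ ((10 ^ 7 * (n + 1) ^ 7 * (X n + 2 + 1) : ℕ) : ℝ) := by exact_mod_cast h2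
      push_cast at this
      linarith
    rw [e1]
    calc (T : ℝ) ≤ 10 ^ 7 * ((n : ℝ) + 1) ^ 7 * (X n + 3) := h6
      _ ≤ 10 ^ 7 * (2 * n) ^ 7 * (5 * exp (n * (κ * h + 3 * ε₁))) := by gcongr
      _ = 10 ^ 7 * 2 ^ 7 * 5 * ((n : ℝ) ^ 7 * exp (n * (-2 * ε₁))) *
          exp (n * (κ * h + 5 * ε₁)) := by rw [← e2]; ring
      _ ≤ 1 * exp (n * (κ * h + 5 * ε₁)) := by gcongr
      _ = _ := one_mul _
  · rw [div_le_iff₀ hX0]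
    have hp9 : p ≤ 9 * exp (-(r n * log 2)) := by
      have h1 : (1 / 4 : ℝ) ^ (n - r n) ≤ 1 := pow_le_one₀ (by norm_num) (by norm_num)
      rw [exp_neg, exp_nat_mul, exp_log (by norm_num), hp, div_eq_mul_inv]
      gcongr
      linarith
    have h4 : (4 : ℝ) ^ (n - 2 * w n) = exp ((n - 2 * w n) * (2 * log 2)) := by
      have : ((n - 2 * w n : ℕ) : ℝ) = n - 2 * w n := by rw [Nat.cast_sub hw2]; push_cast; ring
      rw [← this, exp_nat_mul, two_mul (log 2), exp_add, exp_log (by norm_num)]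
      norm_num
    have h5 : exp (n * e n) ^ 2 * exp ((n - 2 * w n) * (2 * log 2)) * exp (-(r n * log 2)) =
        exp (n * c n) * exp (n * (κ * h + 3 * ε₁)) := by
      rw [sq, ← exp_add, ← exp_add, ← exp_add, ← exp_add]
      congr 1
      simp only [hc]
      field_simp
      ring
    have hG : (0 : ℝ) ≤ (good (r n) V).ncard := Nat.cast_nonneg _
    calc _ ≤ (n : ℝ) ^ 2 * (exp (n * e n) ^ 2 * exp ((n - 2 * w n) * (2 * log 2))) *
          (9 * exp (-(r n * log 2)) * (good (r n) V).ncard) := by rw [h4]; gcongr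
      _ = 9 * n ^ 2 * (good (r n) V).ncard * (exp (n * e n) ^ 2 *
          exp ((n - 2 * w n) * (2 * log 2)) * exp (-(r n * log 2))) := by ring
      _ = 9 * n ^ 2 * (good (r n) V).ncard * (exp (n * c n) * exp (n * (κ * h + 3 * ε₁))) := by
          rw [h5]
      _ ≤ 9 * n ^ 2 * (good (r n) V).ncard * (exp (n * c n) * X n) := by
          gcongr; exact Nat.le_ceil _
      _ = _ := by ring

end Cost

end

section

/-! ### The typical distance -/

section Typical

open Real

variable {R : ℝ} {k : ℕ → ℕ}

theorem FindsDistance.mono {P : Prog} {r n : ℕ} {H : CheckMatrix r n} {T T' : ℝ}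
    (h : FindsDistance P H T) (hT : T ≤ T') : FindsDistance P H T' := by
  obtain ⟨t, s, h1, h2, h3⟩ := h
  exact ⟨t, s, h1, h2.trans hT, h3⟩

theorem two_rpow_le {a b : ℝ} (h : a ≤ b) (n : ℕ) : (2 : ℝ) ^ (a * n) ≤ (2 : ℝ) ^ (b * n) :=
  rpow_le_rpow_of_exponent_le (by norm_num) (mul_le_mul_of_nonneg_right h (Nat.cast_nonneg n))

theorem tendsto_prob {α : ℕ → Type*} [∀ n, Finite (α n)] {E : ∀ n, Set (α n)}
    {A : ∀ n, α n → Prop} {b : ℕ → ℝ} (hb : Tendsto b atTop (𝓝 0))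
    (hE : ∀ᶠ n in atTop, 0 < (E n).ncard)
    (h : ∀ᶠ n in atTop, (Set.ncard {x | x ∈ E n ∧ ¬ A n x} : ℝ) ≤ b n * (E n).ncard) :
    Tendsto (fun n => prob (E n) (A n)) atTop (𝓝 1) := by
  refine tendsto_of_tendsto_of_tendsto_of_le_of_le'
    (by simpa using (tendsto_const_nhds (x := (1 : ℝ))).sub hb) tendsto_const_nhds ?_ ?_
  · filter_upwards [hE, h] with n hn h1
    have hn' : (0 : ℝ) < (E n).ncard := by exact_mod_cast hn
    rw [prob, le_div_iff₀ hn']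
    have h2 : Set.ncard {x | x ∈ E n ∧ A n x} + Set.ncard {x | x ∈ E n ∧ ¬ A n x} =
        (E n).ncard := by
      rw [← Set.ncard_union_eq]
      · congr 1
        ext x
        simp only [Set.mem_union, Set.mem_ofPred_eq]
        tauto
      · rw [Set.disjoint_left]
        rintro x ⟨_, h⟩ ⟨_, h'⟩
        exact h' h
    have h3 : (Set.ncard {x | x ∈ E n ∧ A n x} : ℝ) + Set.ncard {x | x ∈ E n ∧ ¬ A n x} =
        (E n).ncard := by exact_mod_cast h2
    linarith
  · refine Eventually.of_forall fun n => div_le_one_of_le₀ ?_ (Nat.cast_nonneg _)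
    have h2 : {x | x ∈ E n ∧ A n x} ⊆ E n := fun x hx => hx.1
    exact Nat.cast_le.2 (Set.ncard_le_ncard h2 (Set.toFinite _))

theorem exp_checks (r : ℕ) : (2 : ℝ) ^ r = exp (r * log 2) := by
  rw [exp_nat_mul, exp_log (by norm_num)]

/-- Below the Gilbert-Varshamov bound, the expected number of logical operators of low weight
vanishes. -/
theorem tendsto_ballSize_div (hR1 : R < 1) (hk : Tendsto (fun n => (k n : ℝ) / n) atTop (𝓝 R))
    {p β : ℝ} (h0 : 0 < p) (h1 : p < 3 / 4) {d : ℕ → ℕ}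
    (hd : Tendsto (fun n => (d n : ℝ) / n) atTop (𝓝 β))
    (h : β * logRatio p - log (1 - p) < (1 - R) * log 2) :
    Tendsto (fun n => (ballSize n (d n) : ℝ) / 2 ^ (n - k n)) atTop (𝓝 0) := by
  have h2 : Tendsto (fun n => (d n : ℝ) / n * logRatio p - log (1 - p) -
      ((n - k n : ℕ) : ℝ) / n * log 2) atTop
      (𝓝 (β * logRatio p - log (1 - p) - (1 - R) * log 2)) :=
    ((hd.mul_const _).sub tendsto_const_nhds).sub ((tendsto_checks hR1 hk).mul_const _)
  have h3 := tendsto_pow_mul_exp h2 (by linarith) 0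
  refine tendsto_of_tendsto_of_tendsto_of_le_of_le' tendsto_const_nhds h3
    (Eventually.of_forall fun n => by positivity) ?_
  filter_upwards [eventually_gt_atTop 0] with n hn
  have hn1 : (0 : ℝ) < n := by exact_mod_cast hn
  rw [exp_checks, div_le_iff₀ (exp_pos _), pow_zero, one_mul, ← exp_add]
  refine (ballSize_le_exp h0 h1.le _ _).trans (exp_le_exp.2 (le_of_eq ?_))
  field_simp
  ring

theorem tendsto_floor_mul_div {c : ℝ} (hc : 0 ≤ c) :
    Tendsto (fun n : ℕ => (⌊c * n⌋₊ : ℝ) / n) atTop (𝓝 c) :=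
  (tendsto_nat_floor_mul_div_atTop hc).comp tendsto_natCast_atTop_atTop

/-- Above the Gilbert-Varshamov bound, the expected number of logical operators of low weight
grows. -/
theorem tendsto_div_ballSize (hR1 : R < 1) (hk : Tendsto (fun n => (k n : ℝ) / n) atTop (𝓝 R))
    {δ ε : ℝ} (h0 : 0 < δ) (h1 : δ < 3 / 4) (hε : 0 < ε)
    (h : qaryEntropy 4 δ = (1 - R) * log 2) :
    Tendsto (fun n => (2 : ℝ) ^ (n - k n) / ballSize n ⌊(δ + ε) * n⌋₊) atTop (𝓝 0) := by
  set ε₁ := min ε (3 / 4 - δ) / 3 with hε₁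
  have hmin : 0 < min ε (3 / 4 - δ) := lt_min hε (by linarith)
  have hε₁0 : 0 < ε₁ := by positivity
  have hε₁1 : 3 * ε₁ ≤ ε := by rw [hε₁]; linarith [min_le_left ε (3 / 4 - δ)]
  have hε₁2 : 3 * ε₁ ≤ 3 / 4 - δ := by rw [hε₁]; linarith [min_le_right ε (3 / 4 - δ)]
  set p := δ + ε₁ with hp
  have hp0 : 0 < p := by positivity
  have hp1 : p ≤ 3 / 4 := by linarith
  have hgap : qaryEntropy 4 δ < qaryEntropy 4 p := qaryEntropy_lt h0.le (by linarith) hp1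
  have hl0 := logRatio_nonneg hp0 hp1
  set ε₂ := min ε₁ ((qaryEntropy 4 p - qaryEntropy 4 δ) / (2 * (logRatio p + 1))) with hε₂
  have hε₂0 : 0 < ε₂ := lt_min hε₁0 (div_pos (by linarith) (by linarith))
  have hε₂1 : ε₂ ≤ ε₁ := min_le_left _ _
  have hε₂2 : ε₂ * logRatio p < qaryEntropy 4 p - qaryEntropy 4 δ := by
    have h2 : ε₂ * (2 * (logRatio p + 1)) ≤ qaryEntropy 4 p - qaryEntropy 4 δ :=
      (le_div_iff₀ (by linarith)).1 (min_le_right _ _)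
    nlinarith [mul_nonneg hε₂0.le hl0]
  have h2 : Tendsto (fun n => ((n - k n : ℕ) : ℝ) / n * log 2 -
      ((p - ε₂) * logRatio p - log (1 - p))) atTop
      (𝓝 ((1 - R) * log 2 - ((p - ε₂) * logRatio p - log (1 - p)))) :=
    ((tendsto_checks hR1 hk).mul_const _).sub tendsto_const_nhds
  have h3 := (tendsto_pow_mul_exp h2 (by
    have := qaryEntropy_four hp0 (by linarith)
    rw [← h]
    linarith) 0).const_mul 2
  rw [mul_zero] at h3
  refine tendsto_of_tendsto_of_tendsto_of_le_of_le' tendsto_const_nhds h3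
    (Eventually.of_forall fun n => by positivity) ?_
  have hlarge : ∀ c : ℝ, 0 < c → ∀ᶠ n : ℕ in atTop, 1 ≤ (n : ℝ) * c := fun c hc =>
    (tendsto_natCast_atTop_atTop.atTop_mul_const hc).eventually_ge_atTop 1
  filter_upwards [hlarge _ hε₁0, hlarge _ (pow_pos hε₂0 2), eventually_gt_atTop 0] with n hn hn' hn0
  have hn1 : (0 : ℝ) < n := by exact_mod_cast hn0
  have h4 := exp_le_ballSize hp0 hp1 hε₂0 hn' (D := ⌊(δ + ε) * n⌋₊) (by
    have := Nat.lt_floor_add_one ((δ + ε) * (n : ℝ))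
    have h5 : (p + ε₂) * n + 1 ≤ (δ + ε) * n := by nlinarith
    linarith)
  have h5 : (0 : ℝ) < ballSize n ⌊(δ + ε) * n⌋₊ := by
    have := exp_pos (n * ((p - ε₂) * logRatio p - log (1 - p)))
    linarith
  rw [exp_checks, div_le_iff₀ h5, pow_zero, one_mul, mul_sub, exp_sub]
  have e1 : n * (((n - k n : ℕ) : ℝ) / n * log 2) = ((n - k n : ℕ) : ℝ) * log 2 := by field_simp
  rw [e1]
  calc exp (((n - k n : ℕ) : ℝ) * log 2) = 2 * (exp (((n - k n : ℕ) : ℝ) * log 2) /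
        exp (n * ((p - ε₂) * logRatio p - log (1 - p)))) *
          (exp (n * ((p - ε₂) * logRatio p - log (1 - p))) / 2) := by field_simp
    _ ≤ _ := by gcongr; linarith

/-- Random codes meet the Gilbert-Varshamov bound, and the program is fast on them. -/
theorem tendsto_prob_gv (hR0 : 0 < R) (hR1 : R < 1)
    (hk : Tendsto (fun n => (k n : ℝ) / n) atTop (𝓝 R)) {δ : ℝ} (hδ0 : 0 < δ) (hδ1 : δ ≤ 1)
    (hδ : R = 1 - 2 * entropy4 δ) {ε : ℝ} (hε : 0 < ε) :
    Tendsto (fun n => prob (stabilizerCodes n (k n)) fun H =>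
      |(distance H : ℝ) / n - δ| ≤ ε ∧
        FindsDistance distP H ((2 : ℝ) ^ ((exponentD R δ + ε) * n))) atTop (𝓝 1) := by
  have hlog2 : 0 < log 2 := log_pos (by norm_num)
  have hent : qaryEntropy 4 δ = (1 - R) * log 2 := by rw [← entropy4_mul_log, hδ]; ring
  have hδ2 : δ < 3 / 4 := lt_three_quarters hδ1 (by rw [hent]; nlinarith)
  obtain ⟨ε', hε', b, hb, hb0, hslow⟩ := ncard_slow_le hR0 hR1 hk hδ0 hδ2 hent.le hε
  set ε₂ := min ε' ε with hε₂
  have hε₂0 : 0 < ε₂ := lt_min hε' hε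
  set D : ℕ → ℕ := fun n => ⌊(δ + ε₂) * n⌋₊ with hD
  set D' : ℕ → ℕ := fun n => ⌊max (δ - ε) 0 * n⌋₊ with hD'
  have hup := tendsto_div_ballSize hR1 hk hδ0 hδ2 hε₂0 hent
  have hlow : Tendsto (fun n => (ballSize n (D' n) : ℝ) / 2 ^ (n - k n)) atTop (𝓝 0) := by
    refine tendsto_ballSize_div hR1 hk hδ0 hδ2 (tendsto_floor_mul_div (le_max_right _ _)) ?_
    rw [← hent, qaryEntropy_four hδ0 (by linarith)]
    have h1 : max (δ - ε) 0 < δ := max_lt (by linarith) hδ0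
    have := mul_lt_mul_of_pos_right h1 (logRatio_pos hδ0 hδ2)
    linarith
  have hquarter : Tendsto (fun n => 9 * (1 / 4 : ℝ) ^ (k n)) atTop (𝓝 0) := by
    simpa using ((tendsto_pow_atTop_nhds_zero_of_lt_one (by norm_num : (0 : ℝ) ≤ 1 / 4)
      (by norm_num)).comp (tendsto_of_ratio hR0 hk)).const_mul 9
  refine tendsto_prob (b := fun n => (2 * (2 ^ (n - k n) / ballSize n (D n)) +
    9 * (1 / 4 : ℝ) ^ (k n)) + ballSize n (D' n) / 2 ^ (n - k n) + b n) ?_ ?_ ?_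
  · simpa using (((hup.const_mul 2).add hquarter).add hlow).add hb
  · filter_upwards with n
    rw [← good_bot]
    exact ncard_good_bot_pos (Nat.sub_le _ _)
  filter_upwards [hslow, eventually_lt_self hR1 hk, (tendsto_of_ratio hR0 hk).eventually_ge_atTop 1,
    eventually_ge_atTop 2, hup.eventually (gt_mem_nhds (show (0 : ℝ) < 1 / 2 by norm_num))]
    with n hslow hkn hk1 hn2 hu
  have hn1 : (0 : ℝ) < n := by exact_mod_cast (by omega : 0 < n)
  rw [← good_bot]
  set r := n - k n with hr
  have hrn : n - r = k n := by omega
  set W : Finset (PauliVec n) := ((Set.toFinite {f : PauliVec n | hammingNorm f ≤ D n}).toFinset).erase 0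
    with hW
  have hWc : W.card = ballSize n (D n) - 1 := by
    rw [hW, Finset.card_erase_of_mem (by simp), ← Set.ncard_eq_toFinset_card, ncard_ball]
  have h2 := ncard_no_logical_le (show r < n by omega) hn2 W (by simp [hW])
  have h3 := ncard_distance_le (show r ≤ n by omega) (D' n)
  have h4 := hslow ⊥ small_bot
  set M : ℝ := ((good r (⊥ : Submodule (ZMod 2) (PauliVec n))).ncard : ℝ) with hM
  have hM0 : 0 ≤ M := Nat.cast_nonneg _
  have h2r : (1 : ℝ) ≤ 2 ^ r := one_le_pow₀ (by norm_num)
  have hball1 : 1 ≤ ballSize n (D n) := by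
    rw [ballSize, Finset.sum_range_succ']; simp
  have hball : 2 * (2 : ℝ) ^ r < ballSize n (D n) := by
    have hp : (0 : ℝ) < ballSize n (D n) := by exact_mod_cast hball1
    change (2 : ℝ) ^ r / ballSize n (D n) < 1 / 2 at hu
    rw [div_lt_iff₀ hp] at hu
    linarith
  have hWcr : (W.card : ℝ) = ballSize n (D n) - 1 := by
    rw [hWc, Nat.cast_sub hball1, Nat.cast_one]
  have hW0 : (0 : ℝ) < W.card := by rw [hWcr]; linarith
  have h5 : (Set.ncard {H | H ∈ good r (⊥ : Submodule (ZMod 2) (PauliVec n)) ∧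
      ¬ ∃ f ∈ W, Logical H f} : ℝ) ≤ (2 * (2 ^ r / ballSize n (D n)) + 9 * (1 / 4) ^ (k n)) * M := by
    rw [← le_div_iff₀ hW0, hrn] at h2
    refine h2.trans ?_
    rw [mul_div_right_comm]
    refine mul_le_mul_of_nonneg_right ?_ hM0
    rw [add_div, mul_div_assoc _ (W.card : ℝ), div_self hW0.ne', mul_one]
    refine add_le_add ?_ le_rfl
    rw [mul_div_assoc', div_le_div_iff₀ hW0 (by linarith), hWcr]
    nlinarith
  have hsub : {H | H ∈ good r (⊥ : Submodule (ZMod 2) (PauliVec n)) ∧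
      ¬ (|(distance H : ℝ) / n - δ| ≤ ε ∧
        FindsDistance distP H ((2 : ℝ) ^ ((exponentD R δ + ε) * n)))} ⊆
      ({H | H ∈ good r (⊥ : Submodule (ZMod 2) (PauliVec n)) ∧ ¬ ∃ f ∈ W, Logical H f} ∪
      {H | H ∈ good r (⊥ : Submodule (ZMod 2) (PauliVec n)) ∧ 0 < distance H ∧
        distance H ≤ D' n}) ∪
      {H | H ∈ good r (⊥ : Submodule (ZMod 2) (PauliVec n)) ∧ 0 < distance H ∧
        (distance H : ℝ) ≤ (δ + ε') * n ∧
        ¬ FindsDistance distP H ((2 : ℝ) ^ ((exponentD R δ + ε) * n))} := by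
    rintro H ⟨hH, hbad⟩
    by_cases hf : ∃ f ∈ W, Logical H f
    · obtain ⟨f, hfW, hf⟩ := hf
      have hpos := hf.distance_pos
      have hle : (distance H : ℝ) ≤ (δ + ε₂) * n := by
        have h6 : hammingNorm f ≤ D n := by
          rw [hW, Finset.mem_erase, Set.Finite.mem_toFinset] at hfW
          exact hfW.2
        have h7 : (distance H : ℝ) ≤ D n := by exact_mod_cast hf.distance_le.trans h6
        exact h7.trans (Nat.floor_le (by positivity))
      by_cases hlo : distance H ≤ D' n
      · exact .inl (.inr ⟨hH, hpos, hlo⟩)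
      · refine .inr ⟨hH, hpos, hle.trans ?_, fun hfind => hbad ⟨?_, hfind⟩⟩
        · have := min_le_left ε' ε
          gcongr
        · have h8 : (δ - ε) * n < distance H := by
            have h9 : max (δ - ε) 0 * n < D' n + 1 := Nat.lt_floor_add_one _
            have h10 : (D' n : ℝ) + 1 ≤ distance H := by exact_mod_cast (not_le.1 hlo)
            have h11 := mul_le_mul_of_nonneg_right (le_max_left (δ - ε) 0) hn1.le
            linarith
          have h12 : (δ + ε₂) * n ≤ (δ + ε) * n := by
            have := min_le_right ε' ε
            gcongr
          rw [abs_le]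
          constructor
          · have := (le_div_iff₀ hn1).2 h8.le
            linarith
          · have := (div_le_iff₀ hn1).2 (hle.trans h12)
            linarith
    · exact .inl (.inl ⟨hH, hf⟩)
  have h6 := ((Set.ncard_le_ncard hsub (Set.toFinite _)).trans (Set.ncard_union_le _ _)).trans
    (Nat.add_le_add_right (Set.ncard_union_le _ _) _)
  refine (Nat.cast_le (α := ℝ).2 h6).trans ?_
  rw [Nat.cast_add, Nat.cast_add]
  exact (add_le_add (add_le_add h5 h3) h4).trans (le_of_eq (by ring))

/-- Below the Gilbert-Varshamov bound, the program is fast on the codes of a given distance. -/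
theorem tendsto_prob_distance (hR0 : 0 < R) (hR1 : R < 1)
    (hk : Tendsto (fun n => (k n : ℝ) / n) atTop (𝓝 R)) {δ : ℝ} (hδ0 : 0 < δ) (hδ1 : δ ≤ 1)
    (hδ : R < 1 - 2 * entropy4 δ) {d : ℕ → ℕ}
    (hd : Tendsto (fun n => (d n : ℝ) / n) atTop (𝓝 δ)) {ε : ℝ} (hε : 0 < ε) :
    Tendsto (fun n => prob {H | H ∈ stabilizerCodes n (k n) ∧ distance H = d n} fun H =>
      FindsDistance distP H ((2 : ℝ) ^ ((exponentD R δ + ε) * n))) atTop (𝓝 1) := by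
  have hlog2 : 0 < log 2 := log_pos (by norm_num)
  have hent : qaryEntropy 4 δ < (1 - R) * log 2 := by rw [← entropy4_mul_log]; nlinarith
  have hδ2 : δ < 3 / 4 := lt_three_quarters hδ1 (by nlinarith)
  obtain ⟨ε', hε', b, hb, hb0, hslow⟩ := ncard_slow_le hR0 hR1 hk hδ0 hδ2 hent.le hε
  have hlow := tendsto_ballSize_div hR1 hk hδ0 hδ2 hd
    (by rwa [← qaryEntropy_four hδ0 (by linarith)])
  have hmain : ∀ᶠ n in atTop,
      (Set.ncard {H | H ∈ stabilizerCodes n (k n) ∧ distance H = d n ∧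
        ¬ FindsDistance distP H ((2 : ℝ) ^ ((exponentD R δ + ε) * n))} : ℝ) ≤
        2 * b n * Set.ncard {H | H ∈ stabilizerCodes n (k n) ∧ distance H = d n} ∧
      0 < Set.ncard {H | H ∈ stabilizerCodes n (k n) ∧ distance H = d n} := by
    filter_upwards [hslow, eventually_lt_self hR1 hk,
      (tendsto_of_ratio hR0 hk).eventually_ge_atTop 1, eventually_ge_atTop 2,
      hlow.eventually (gt_mem_nhds (show (0 : ℝ) < 1 / 18 by norm_num)),
      hd.eventually (gt_mem_nhds (show δ < δ + ε' by linarith)),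
      hd.eventually (gt_mem_nhds (show δ < 1 by linarith)), hd.eventually (lt_mem_nhds hδ0)]
      with n hslow hkn hk1 hn2 hball hd1 hd2 hd3
    have hn1 : (0 : ℝ) < n := by exact_mod_cast (by omega : 0 < n)
    rw [div_lt_iff₀ hn1] at hd1 hd2
    have hdn : d n ≤ n := by
      rw [one_mul] at hd2
      exact_mod_cast hd2.le
    have hdpos : 0 < d n := by
      by_contra hcon
      rw [Nat.eq_zero_of_not_pos hcon] at hd3
      simp at hd3
    have h := ncard_distance_eq_le (show n - k n < n by omega) hn2 hdpos (b := b n)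
      (B := fun H => ¬ FindsDistance distP H ((2 : ℝ) ^ ((exponentD R δ + ε) * n)))
      (fun e _ => by
        refine le_trans (Nat.cast_le.2 (Set.ncard_le_ncard ?_ (Set.toFinite _)))
          (hslow _ (small_span e))
        rintro H ⟨h1, h2, h3⟩
        exact ⟨h1, by omega, by rw [h2]; exact hd1.le, h3⟩)
      (by
        have h4 : (1 / 4 : ℝ) ^ (n - (n - k n)) ≤ 1 := pow_le_one₀ (by norm_num) (by norm_num)
        calc _ = ballSize n (d n) / 2 ^ (n - k n) * (1 + 8 * (1 / 4 : ℝ) ^ (n - (n - k n))) := by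
              ring
          _ ≤ 1 / 18 * 9 := by gcongr; linarith
          _ = _ := by norm_num) (hb0 n)
    rw [good_bot] at h
    exact And.intro h.1 (h.2 hdn)
  refine tendsto_prob (b := fun n => 2 * b n) (by simpa using hb.const_mul 2)
    (hmain.mono fun n hn => hn.2) (hmain.mono fun n hn => ?_)
  refine le_trans (le_of_eq ?_) hn.1
  simp only [Set.mem_ofPred_eq, and_assoc]

end Typical

end

end QDist

/-! ### The complexity exponents -/

theorem mainTheorem5 :
    ∃ P : QDist.Prog, ∀ R : ℝ, 0 < R → R < 1 →
      ∀ k : ℕ → ℕ, Tendsto (fun n => (k n : ℝ) / (n : ℝ)) atTop (𝓝 R) →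
      ∀ ε : ℝ, 0 < ε →
        -- a random code, in terms of its own relative distance
        Tendsto (fun n => QDist.prob (QDist.stabilizerCodes n (k n)) fun H =>
            QDist.FindsDistance P H
              ((2 : ℝ) ^ ((QDist.exponentD R ((QDist.distance H : ℝ) / n) + ε) * n)))
          atTop (𝓝 1) ∧
        -- a random code among those of a given relative distance below the GV bound
        (∀ δ : ℝ, 0 < δ → δ ≤ 1 → R < 1 - 2 * QDist.entropy4 δ →
          ∀ d : ℕ → ℕ, Tendsto (fun n => (d n : ℝ) / (n : ℝ)) atTop (𝓝 δ) →
            Tendsto (fun n =>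
                QDist.prob {H | H ∈ QDist.stabilizerCodes n (k n) ∧ QDist.distance H = d n}
                  fun H => QDist.FindsDistance P H
                    ((2 : ℝ) ^ ((QDist.exponentD R δ + ε) * n)))
              atTop (𝓝 1)) ∧
        -- on the GV bound
        (∀ δ : ℝ, 0 < δ → δ ≤ 1 → R = 1 - 2 * QDist.entropy4 δ →
          Tendsto (fun n => QDist.prob (QDist.stabilizerCodes n (k n)) fun H =>
              |(QDist.distance H : ℝ) / n - δ| ≤ ε ∧
              QDist.FindsDistance P H
                ((2 : ℝ) ^ (((1 - R ^ 2) / (3 + R) + ε) * n)))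
            atTop (𝓝 1)) := by
  refine ⟨QDist.distP, fun R hR0 hR1 k hk ε hε => ⟨?_, ?_, ?_⟩⟩
  · -- the distance is close to the Gilbert-Varshamov distance, where the exponent is continuous
    obtain ⟨δ, hδ0, hδ1, hδ⟩ := QDist.exists_gv hR0 hR1
    have hcont : Continuous (QDist.exponentD R) := by
      unfold QDist.exponentD QDist.entropy4
      exact continuous_const.mul (Real.qaryEntropy_continuous.div_const _)
    obtain ⟨ε₁, hε₁, hclose⟩ := Metric.continuous_iff.1 hcont δ (ε / 2) (by positivity)
    set ε₂ := min (ε₁ / 2) (ε / 2) with hε₂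
    have hε₂0 : 0 < ε₂ := lt_min (by positivity) (by positivity)
    have h := QDist.tendsto_prob_gv hR0 hR1 hk hδ0 hδ1 hδ hε₂0
    refine tendsto_of_tendsto_of_tendsto_of_le_of_le h tendsto_const_nhds (fun n => ?_) fun n => ?_
    · refine div_le_div_of_nonneg_right (Nat.cast_le.2 (Set.ncard_le_ncard ?_ (Set.toFinite _)))
        (Nat.cast_nonneg _)
      rintro H ⟨hH, h1, h2⟩
      refine ⟨hH, h2.mono (QDist.two_rpow_le ?_ n)⟩
      have h3 := hclose ((QDist.distance H : ℝ) / n) (by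
        rw [Real.dist_eq]
        exact lt_of_le_of_lt (h1.trans (min_le_left _ _)) (by linarith))
      rw [Real.dist_eq, abs_lt] at h3
      have := min_le_right (ε₁ / 2) (ε / 2)
      linarith [h3.1]
    · refine div_le_one_of_le₀ (Nat.cast_le.2 (Set.ncard_le_ncard ?_ (Set.toFinite _)))
        (Nat.cast_nonneg _)
      exact fun x hx => hx.1
  · exact fun δ hδ0 hδ1 hδ d hd => QDist.tendsto_prob_distance hR0 hR1 hk hδ0 hδ1 hδ hd hε
  · intro δ hδ0 hδ1 hδ
    have h : (1 - R ^ 2) / (3 + R) = QDist.exponentD R δ := by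
      have : QDist.entropy4 δ = (1 - R) / 2 := by linarith
      rw [QDist.exponentD, this]
      ring
    rw [h]
    exact QDist.tendsto_prob_gv hR0 hR1 hk hδ0 hδ1 hδ hε
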